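/- Let $\alpha,\beta$ be hermitian $2\times2$ matrices with $\alpha^2=\beta^2=I$, $\alpha\beta+\beta\alpha=0$, let $M,m,g\in\mathbb R$, and consider the Cauchy problem for the one-dimensional Dirac–Klein–Gordon system $$-i\beta\,\partial_t\psi+i\alpha\beta\,\partial_x\psi+M\psi=g\phi\psi,\qquad \partial_t^2\phi-\partial_x^2\phi+m^2\phi=\langle\beta\psi,\psi\rangle_{\mathbb C^2},$$ $$\psi(0)=\psi_0,\quad \phi(0)=\phi_0,\quad \partial_t\phi(0)=\phi_1,$$ for $\psi$ with values in $\mathbb C^2$ and $\phi$ real-valued (the equations being understood in the sense of distributions). Write $A=1-\partial_x^2$, $D=-i\partial_x$, $\langle\cdot\rangle=(1+|\cdot|^2)^{1/2}$, $$\psi_\pm=\pi_\pm(D)\psi,\quad \pi_\pm(\xi)=\tfrac12\Big(I\pm\tfrac{\xi}{|\xi|}\alpha\Big),\qquad \phi_\pm=\phi\pm iA^{-1/2}\partial_t\phi .$$ Let $X^{s,b}_\pm$ be the completion of the Schwartz space on $\mathbb R\times\mathbb R$ with respect to the norm $\|\langle\xi\rangle^s\langle\tau\pm|\xi|\rangle^b\,\tilde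 u(\xi,\tau)\|_{L^2_{\xi\tau}}$, where $\tilde u$ is the space-time Fourier transform ($\mathbb C^2$-valued $u$ for $\psi_\pm$, $\mathbb C$-valued $u$ for $\phi_\pm$), and let $X^{s,b}_\pm[0,T]$ consist of the restrictions of its elements to the time interval $[0,T]$. Theorem. Let $0<k<\frac12$. There is $\varepsilon_0>0$, depending only on $k$, such that for all $0<\varepsilon'<\varepsilon_0$ and all $\alpha,\beta,M,m,g$ as above the following holds. For all data $\psi_0\in L^2(\mathbb R)$, $\phi_0\in H^k(\mathbb R)$, $\phi_1\in H^{k-1}(\mathbb R)$ with $\phi_0,\phi_1$ real-valued, there is a solution $(\psi,\phi)$ that exists globally, i.e. for all $t\in[0,\infty)$: for every $T>0$, its restriction to $[0,T]$ is the unique solution of the Cauchy problem on $[0,T]$ with $$\psi_\pm\in X^{0,\frac12+\varepsilon'}_\pm[0,T],\qquad \phi_\pm\in X^{k,\frac12+\varepsilon'}_\pm[0,T],$$ $$\psi\in C^0([0,T],L^2(\mathbb R)),\quad \phi\in C^0([0,T],H^k(\mathbb R)),\quad \partial_t\phi\in C^0([0,T],H^{k-1}(\mathbb R)).$$ -/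

import Mathlib

open MeasureTheory FourierTransform TemperedDistribution
open scoped SchwartzMap ENNReal

noncomputable section

namespace DKG

/-- The spin space `ℂ²` with its Hermitian inner product. -/
abbrev Spinor : Type := EuclideanSpace ℂ (Fin 2)

/-- The charge class `L²(ℝ; ℂ²)`. -/
abbrev SpinorL2 : Type := Lp Spinor 2 (volume : Measure ℝ)

/-- Real-valued functions in `L²(ℝ)`. -/
abbrev RealL2 : Type := Lp ℝ 2 (volume : Measure ℝ)

/-- Space-time `ℝ²`; coordinate `0` is the space variable `x`, coordinate `1` is the time `t`
(on the Fourier side: `ξ` and `τ`). -/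
abbrev SpaceTime : Type := EuclideanSpace ℝ (Fin 2)

/-- A `2 × 2` matrix as an operator on the spin space. -/
abbrev op (γ : Matrix (Fin 2) (Fin 2) ℂ) : Spinor →L[ℂ] Spinor :=
  Matrix.toEuclideanCLM (n := Fin 2) (𝕜 := ℂ) γ

/-- A real `L²` function as a (complex-valued) tempered distribution. -/
def realDist (f : RealL2) : 𝓢'(ℝ, ℂ) :=
  Lp.toTemperedDistribution (Complex.ofRealCLM.compLp f)

/-- An `L²` spinor field as a tempered distribution. -/
def spinorDist (f : SpinorL2) : 𝓢'(ℝ, Spinor) :=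
  Lp.toTemperedDistribution f

/-- A tempered distribution is real if it takes real values on real test functions. -/
def IsReal (f : 𝓢'(ℝ, ℂ)) : Prop :=
  ∀ h : 𝓢(ℝ, ℂ), (∀ x, (h x).im = 0) → (f h).im = 0

/-- `f ∈ C⁰(S, H^s(ℝ))`: the Bessel potentials `⟨D⟩^s f(t)` of the `f(t)`, `t ∈ S`, are `L²`
functions depending continuously on `t` with respect to the `L²` norm. -/
def SobolevContinuousOn (s : ℝ) (f : ℝ → 𝓢'(ℝ, ℂ)) (S : Set ℝ) : Prop :=
  ∃ G : ℝ → Lp ℂ 2 (volume : Measure ℝ), ContinuousOn G S ∧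
    ∀ t ∈ S, besselPotential ℝ ℂ s (f t) = Lp.toTemperedDistribution (G t)

/-! ### The half wave decomposition -/

/-- Multiplication by the symbol `π_σ(ξ) = (I + σ (ξ / |ξ|) α) / 2`, for `σ = 1` and `σ = -1`
(the value at the single frequency `ξ = 0` plays no role). -/
def projSymbol (α : Matrix (Fin 2) (Fin 2) ℂ) (σ : ℝ) (g : ℝ → Spinor) : ℝ → Spinor :=
  fun ξ => (1 / 2 : ℂ) • (g ξ + ((σ * SignType.sign ξ : ℝ) : ℂ) • op α (g ξ))

theorem memLp_projSymbol (α : Matrix (Fin 2) (Fin 2) ℂ) (σ : ℝ) (g : SpinorL2) :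
    MemLp (projSymbol α σ g) 2 (volume : Measure ℝ) := by
  have hg : MemLp (g : ℝ → Spinor) 2 (volume : Measure ℝ) := Lp.memLp g
  have h1 : MemLp (fun ξ => op α (g ξ)) 2 (volume : Measure ℝ) := (op α).comp_memLp' hg
  have hs : Measurable fun ξ : ℝ => ((σ * SignType.sign ξ : ℝ) : ℂ) := by
    have : Measurable fun ξ : ℝ => ((SignType.sign ξ : SignType) : ℝ) := by
      have : (fun ξ : ℝ => ((SignType.sign ξ : SignType) : ℝ)) =
          fun ξ => if 0 < ξ then 1 else if ξ < 0 then -1 else 0 := by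
        funext ξ
        rw [sign_apply]
        split_ifs <;> simp
      rw [this]
      exact Measurable.ite measurableSet_Ioi measurable_const
        (Measurable.ite measurableSet_Iio measurable_const measurable_const)
    fun_prop
  have h2 : MemLp (fun ξ => ((σ * SignType.sign ξ : ℝ) : ℂ) • op α (g ξ)) 2
      (volume : Measure ℝ) := by
    refine MemLp.of_le_mul (c := |σ|) h1 (hs.aestronglyMeasurable.smul h1.1)
      (Filter.Eventually.of_forall fun ξ => ?_)
    rw [norm_smul]
    refine mul_le_mul_of_nonneg_right ?_ (norm_nonneg _)
    rw [Complex.norm_real, norm_mul, Real.norm_eq_abs]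
    refine mul_le_of_le_one_right (abs_nonneg _) ?_
    rcases lt_trichotomy ξ 0 with h | h | h <;> simp [h]
  exact (hg.add h2).const_smul (1 / 2 : ℂ)

/-- Multiplication by `π_σ(ξ)` on `L²`. -/
def projMul (α : Matrix (Fin 2) (Fin 2) ℂ) (σ : ℝ) (g : SpinorL2) : SpinorL2 :=
  (memLp_projSymbol α σ g).toLp (projSymbol α σ g)

/-- The projection `π_σ(D)` onto the positive (`σ = 1`) or negative (`σ = -1`) spectral subspace
of `-i α ∂ₓ`, on `L²(ℝ; ℂ²)`. -/
def proj (α : Matrix (Fin 2) (Fin 2) ℂ) (σ : ℝ) (f : SpinorL2) : SpinorL2 :=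
  (Lp.fourierTransformₗᵢ ℝ Spinor).symm (projMul α σ (Lp.fourierTransformₗᵢ ℝ Spinor f))

/-- The operator `A^{-1/2}` with `A = 1 - ∂ₓ²`, on tempered distributions. The frequency `ξ` of
Mathlib's Fourier transform (with kernel `e^{-2πixξ}`) corresponds to `-i∂ₓ = 2πξ`. -/
def invSqrtA : 𝓢'(ℝ, ℂ) →L[ℂ] 𝓢'(ℝ, ℂ) :=
  fourierMultiplierCLM ℂ fun ξ : ℝ => (((1 + (2 * Real.pi * ξ) ^ 2) ^ (-(1 / 2) : ℝ) : ℝ) : ℂ)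

/-- The half wave `φ_σ = φ + σ i A^{-1/2} φ_t`, for `σ = 1` and `σ = -1`. -/
def halfWave (σ : ℝ) (φ : RealL2) (φt : 𝓢'(ℝ, ℂ)) : 𝓢'(ℝ, ℂ) :=
  realDist φ + ((σ : ℂ) * Complex.I) • invSqrtA φt

/-! ### Bourgain - Klainerman - Machedon spaces -/

section Bourgain

variable {F : Type*} [NormedAddCommGroup F] [InnerProductSpace ℂ F] [CompleteSpace F]

/-- The weight `⟨ξ⟩^s ⟨τ + σ|ξ|⟩^b`, in angular frequencies. -/
def bourgainWeight (s b σ : ℝ) (p : SpaceTime) : ℝ :=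
  (1 + (2 * Real.pi * p 0) ^ 2) ^ (s / 2) *
    (1 + (2 * Real.pi * p 1 + σ * |2 * Real.pi * p 0|) ^ 2) ^ (b / 2)

/-- `u ∈ X^{s,b}_σ(ℝ × ℝ)` (for `σ = 1` and `σ = -1`): the space-time Fourier transform of `u` is
a function `G` with `⟨ξ⟩^s ⟨τ + σ|ξ|⟩^b G ∈ L²`. This is the completion of the Schwartz space
with respect to the norm `‖⟨ξ⟩^s ⟨τ + σ|ξ|⟩^b 𝓕u‖_{L²}`, realised inside `𝓢'`. -/
def MemBourgain (s b σ : ℝ) (u : 𝓢'(SpaceTime, F)) : Prop :=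
  ∃ G : SpaceTime → F,
    MemLp (fun p => bourgainWeight s b σ p • G p) 2 (volume : Measure SpaceTime) ∧
    ∀ h : 𝓢(SpaceTime, ℂ), 𝓕 u h = ∫ p, h p • G p

/-- The space-time distribution `u` coincides on the open strip `0 < t < T` with the time dependent
distribution `f`: for all test functions `h` supported in the strip, with time slices
`hs t = h(·, t)`, one has `u(h) = ∫₀ᵀ f(t)(h(·, t)) dt`. -/
def AgreesOnStrip (T : ℝ) (u : 𝓢'(SpaceTime, F)) (f : ℝ → 𝓢'(ℝ, F)) : Prop :=
  ∀ (h : 𝓢(SpaceTime, ℂ)) (hs : ℝ → 𝓢(ℝ, ℂ)),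
    (∀ t x, hs t x = h !₂[x, t]) →
    tsupport h ⊆ {p : SpaceTime | p 1 ∈ Set.Ioo 0 T} →
    u h = ∫ t in 0..T, f t (hs t)

/-- `f ∈ X^{s,b}_σ[0,T]`: the (weakly continuous) function `f` of time is the restriction to
`[0,T]` of an element of `X^{s,b}_σ`. -/
def MemBourgainOn (s b σ T : ℝ) (f : ℝ → 𝓢'(ℝ, F)) : Prop :=
  ∃ u : 𝓢'(SpaceTime, F), MemBourgain s b σ u ∧ AgreesOnStrip T u f

end Bourgain

/-! ### Solutions of the Cauchy problem -/

/-- `(ψ, φ)`, with `φt` the time derivative of `φ`, solves on `[0,T]` the Dirac - Klein - Gordon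
system
`-iβ ∂ₜψ + iαβ ∂ₓψ + Mψ = gφψ`,  `∂ₜ²φ - ∂ₓ²φ + m²φ = ⟨βψ,ψ⟩`
with data `ψ(0) = ψ₀`, `φ(0) = φ₀`, `∂ₜφ(0) = φ₁`, in the class
`ψ_± ∈ X^{0,1/2+ε}_±[0,T]`, `φ_± ∈ X^{k,1/2+ε}_±[0,T]`, `ψ ∈ C⁰([0,T], L²)`,
`φ ∈ C⁰([0,T], H^k)`, `∂ₜφ ∈ C⁰([0,T], H^{k-1})`.
The equations hold in the sense of distributions: tested with any Schwartz function `h` of `x`,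
at every time `t ∈ [0,T]`. -/
structure IsSolution (α β : Matrix (Fin 2) (Fin 2) ℂ) (M m g k ε : ℝ)
    (ψ₀ : SpinorL2) (φ₀ : RealL2) (φ₁ : 𝓢'(ℝ, ℂ)) (T : ℝ)
    (ψ : ℝ → SpinorL2) (φ : ℝ → RealL2) (φt : ℝ → 𝓢'(ℝ, ℂ)) : Prop where
  continuousOn_spinor : ContinuousOn ψ (Set.Icc 0 T)
  continuousOn_wave : SobolevContinuousOn k (fun t => realDist (φ t)) (Set.Icc 0 T)
  continuousOn_wave_deriv : SobolevContinuousOn (k - 1) φt (Set.Icc 0 T)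
  initial_spinor : ψ 0 = ψ₀
  initial_wave : φ 0 = φ₀
  initial_wave_deriv : φt 0 = φ₁
  dirac : ∀ h : 𝓢(ℝ, ℂ), ∀ t ∈ Set.Icc 0 T, ∃ d : Spinor,
    HasDerivWithinAt (fun s => spinorDist (ψ s) h) d (Set.Icc 0 T) t ∧
    -Complex.I • op β d
        + Complex.I • op (α * β) (TemperedDistribution.derivCLM Spinor (spinorDist (ψ t)) h)
        + (M : ℂ) • spinorDist (ψ t) h
      = (g : ℂ) • ∫ x : ℝ, h x • ((φ t x : ℂ) • ψ t x)
  wave_deriv : ∀ h : 𝓢(ℝ, ℂ), ∀ t ∈ Set.Icc 0 T,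
    HasDerivWithinAt (fun s => realDist (φ s) h) (φt t h) (Set.Icc 0 T) t
  klein_gordon : ∀ h : 𝓢(ℝ, ℂ), ∀ t ∈ Set.Icc 0 T, ∃ d : ℂ,
    HasDerivWithinAt (fun s => φt s h) d (Set.Icc 0 T) t ∧
    d - TemperedDistribution.derivCLM ℂ (TemperedDistribution.derivCLM ℂ (realDist (φ t))) h
        + (m : ℂ) ^ 2 * realDist (φ t) h
      = ∫ x : ℝ, h x * inner ℂ (op β (ψ t x)) (ψ t x)
  bourgain_spinor_pos :
    MemBourgainOn 0 (1 / 2 + ε) 1 T fun t => spinorDist (proj α 1 (ψ t))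
  bourgain_spinor_neg :
    MemBourgainOn 0 (1 / 2 + ε) (-1) T fun t => spinorDist (proj α (-1) (ψ t))
  bourgain_wave_pos : MemBourgainOn k (1 / 2 + ε) 1 T fun t => halfWave 1 (φ t) (φt t)
  bourgain_wave_neg : MemBourgainOn k (1 / 2 + ε) (-1) T fun t => halfWave (-1) (φ t) (φt t)

end DKG

end

noncomputable section

namespace DKG

open scoped Real
open ENNReal (HolderConjugate add_lt_top mul_lt_top ofNat_ne_top ofReal ofReal_add
  ofReal_le_ofReal ofReal_mul ofReal_ne_top ofReal_ofNat ofReal_pow ofReal_toReal rpow_mul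
  rpow_natCast toReal_mono toReal_nonneg)
open Complex (I I_im I_mul_I I_re I_sq add_im add_re coe_smul conjCLE conj_conj conj_im
  continuous_ofReal mul_im norm_I norm_real ofRealCLM ofRealCLM_apply ofReal_cos ofReal_neg
  ofReal_one ofReal_sub ofReal_zero re reCLM sub_im sub_re)
open ContinuousLinearMap (adjoint coeFn_compLp coeFn_compLpL coeFn_holder coe_restrictScalars'
  comp_apply le_opENorm lsmul mul mul_apply' norm_compLp_le)
open MeasureTheory.Lp (coeFn_add coeFn_smul coeFn_sub memLp toTemperedDistribution
  toTemperedDistribution_apply)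
open SchwartzMap (compSubConstCLM_apply derivCLM_apply fourierInv_coe)
open Real (continuous_fourierChar cos cos_neg dist_eq exp exp_add fourier_real_eq mul_rpow
  norm_eq_abs norm_of_nonneg pi_gt_three pi_pos rpow_add rpow_nonneg sin sqrt volume_Icc volume_Ioc)
open intervalIntegral (continuous_primitive integral_congr integral_hasDerivAt_right
  integral_interval_sub_left integral_mono_on integral_of_le)
open Function (uncurry)

local notation "vol" => (volume : Measure ℝ)
local notation "𝓛" => Spinor →L[ℂ] Spinor
local notation "ℱ" S => fun t => 𝓕 (S t : ℝ → ℂ)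
local notation "∂ₛ" => SchwartzMap.derivCLM ℂ ℂ

open Set Filter Topology

section Rep

variable {F : Type*} [NormedAddCommGroup F] [NormedSpace ℝ F]
  {p : ℝ≥0∞} [hp : Fact (1 ≤ p)]

theorem locallyIntegrable_lp (f : Lp F p vol) : LocallyIntegrable f volume :=
  (memLp f).locallyIntegrable hp.out

theorem intervalIntegrable_lp (f : Lp F p vol) (a b : ℝ) : IntervalIntegrable f volume a b :=
  ((locallyIntegrable_lp f).integrableOn_isCompact isCompact_uIcc).intervalIntegrable

/-- A jointly measurable representative of a curve of `L^p` functions. -/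
def rep (c : ℝ → Lp F p vol) (t x : ℝ) : F := deriv (fun y => ∫ z in 0..y, c t z) x

theorem rep_ae [CompleteSpace F] (c : ℝ → Lp F p vol) (t : ℝ) : rep c t =ᵐ[volume] c t := by
  filter_upwards [LocallyIntegrable.ae_hasDerivAt_integral (locallyIntegrable_lp (c t))] with x hx
  exact (hx 0).deriv

theorem norm_setIntegral_lp_le (f : Lp F p vol) (R : ℝ) (x y : ℝ) (hx : |x| ≤ R) (hy : |y| ≤ R) :
    ‖∫ z in x..y, f z‖ ≤ (volume (Ioc (-R) R) ^ (1 - 1 / p.toReal)).toReal * ‖f‖ := by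
  have hpt : 0 ≤ 1 - 1 / p.toReal := by
    rcases eq_or_ne p ∞ with rfl | h
    · simp
    · have : 1 ≤ p.toReal := by rw [← ENNReal.toReal_one]; exact toReal_mono h hp.out
      rw [sub_nonneg, div_le_one (by linarith)]; exact this
  have hfin : volume (Ioc (-R) R) ^ (1 - 1 / p.toReal) ≠ ∞ :=
    ENNReal.rpow_ne_top_of_nonneg hpt (by simp)
  have h1 : ‖∫ z in x..y, f z‖ₑ ≤ eLpNorm f 1 (volume.restrict (Ioc (-R) R)) := by
    calc ‖∫ z in x..y, f z‖ₑ = ‖∫ z in Set.uIoc x y, f z‖ₑ := by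
          rw [← ofReal_norm, ← ofReal_norm, intervalIntegral.norm_intervalIntegral_eq]
      _ ≤ ∫⁻ z in Set.uIoc x y, ‖f z‖ₑ := enorm_integral_le_lintegral_enorm _
      _ ≤ ∫⁻ z in Ioc (-R) R, ‖f z‖ₑ := by
          apply lintegral_mono_set
          intro z hz
          rw [Set.mem_uIoc] at hz
          have := abs_le.1 hx; have := abs_le.1 hy
          constructor <;> rcases hz with h | h <;> linarith
      _ = _ := by rw [eLpNorm_one_eq_lintegral_enorm]
  have h2 : eLpNorm f 1 (volume.restrict (Ioc (-R) R)) ≤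
      eLpNorm f p volume * volume (Ioc (-R) R) ^ (1 - 1 / p.toReal) := by
    refine (eLpNorm_le_eLpNorm_mul_rpow_measure_univ hp.out
      (by fun_prop)).trans ?_
    simp only [ENNReal.toReal_one, Measure.restrict_apply_univ, div_one]
    gcongr
    exact Measure.restrict_le_self
  have h3 := toReal_mono (ENNReal.mul_ne_top (Lp.eLpNorm_ne_top f) hfin) (h1.trans h2)
  rw [toReal_enorm, ENNReal.toReal_mul] at h3
  rw [Lp.norm_def, mul_comm]
  exact h3

theorem continuous_primitive_lp {c : ℝ → Lp F p vol} (hc : Continuous c) :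
    Continuous (uncurry fun t y => ∫ z in 0..y, c t z) := by
  rw [continuous_iff_continuousAt]
  rintro ⟨t, y⟩
  set R := |y| + 1
  set C := (volume (Ioc (-R) R) ^ (1 - 1 / p.toReal)).toReal
  have hcont : Continuous fun y => ∫ z in 0..y, c t z := continuous_primitive
      (fun a b => intervalIntegrable_lp (c t) _ _) 0
  have hlim : Tendsto (fun q : ℝ × ℝ => C * ‖c q.1 - c t‖ +
      ‖(∫ z in 0..q.2, c t z) - ∫ z in 0..y, c t z‖) (𝓝 (t, y)) (𝓝 0) := by
    have : Continuous (fun q : ℝ × ℝ => C * ‖c q.1 - c t‖ +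
      ‖(∫ z in 0..q.2, c t z) - ∫ z in 0..y, c t z‖) := by
      have h1 : Continuous fun q : ℝ × ℝ => ∫ z in 0..q.2, c t z := by fun_prop
      fun_prop
    simpa using this.tendsto (t, y)
  rw [ContinuousAt, tendsto_iff_norm_sub_tendsto_zero]
  refine squeeze_zero' (.of_forall fun _ => norm_nonneg _) ?_ hlim
  have hev : ∀ᶠ q : ℝ × ℝ in 𝓝 (t, y), |q.2| < R := by
    have : Continuous fun q : ℝ × ℝ => |q.2| := by fun_prop
    exact this.continuousAt.eventually (gt_mem_nhds (by simp [R]))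
  filter_upwards [hev] with q hq
  have hint : ∀ s : ℝ, IntervalIntegrable (c s) volume 0 q.2 := fun s =>
    intervalIntegrable_lp (c s) _ _
  have heq : ∫ z in 0..q.2, (c q.1 - c t : Lp F p volume) z
      = (∫ z in 0..q.2, c q.1 z) - ∫ z in 0..q.2, c t z := by
    rw [← intervalIntegral.integral_sub (hint _) (hint _)]
    apply intervalIntegral.integral_congr_ae
    filter_upwards [coeFn_sub (c q.1) (c t)] with z hz _
    rw [hz]; rfl
  have hb := norm_setIntegral_lp_le (c q.1 - c t) R 0 q.2 (by simp [R]; positivity) hq.le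
  rw [heq] at hb
  simp only [uncurry]
  calc _ = ‖((∫ z in 0..q.2, c q.1 z) - ∫ z in 0..q.2, c t z) +
        ((∫ z in 0..q.2, c t z) - ∫ z in 0..y, c t z)‖ := by congr 1; abel
    _ ≤ _ := (norm_add_le _ _).trans (by gcongr)

theorem stronglyMeasurable_rep [CompleteSpace F] {c : ℝ → Lp F p vol}
    (hc : Continuous c) : StronglyMeasurable (fun q : ℝ × ℝ => rep c q.1 q.2) :=
  stronglyMeasurable_deriv_with_param (continuous_primitive_lp hc)

end Rep

section Translate

variable {F : Type*} [NormedAddCommGroup F] {p : ℝ≥0∞}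

def shift (a : ℝ) (f : Lp F p vol) : Lp F p vol :=
  Lp.compMeasurePreserving (fun x => x + a) (measurePreserving_add_right volume a) f

theorem shift_ae (a : ℝ) (f : Lp F p vol) : shift a f =ᵐ[volume] fun x => f (x + a) :=
  Lp.coeFn_compMeasurePreserving f (measurePreserving_add_right volume a)

theorem norm_shift (a : ℝ) (f : Lp F p vol) : ‖shift a f‖ = ‖f‖ := Lp.norm_compMeasurePreserving f _

theorem ae_comp_add {P : ℝ → Prop} (h : ∀ᵐ x : ℝ, P x) (a : ℝ) : ∀ᵐ x : ℝ, P (x + a) :=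
  (measurePreserving_add_right volume a).quasiMeasurePreserving.ae h

theorem shift_shift (a b : ℝ) (f : Lp F p vol) : shift a (shift b f) = shift (a + b) f := by
  apply Lp.ext
  filter_upwards [shift_ae a (shift b f), ae_comp_add (shift_ae b f) a, shift_ae (a + b) f]
    with x h1 h2 h3
  rw [h1, h2, h3, add_assoc]

theorem shift_zero (f : Lp F p vol) : shift 0 f = f := by
  apply Lp.ext
  filter_upwards [shift_ae 0 f] with x h1
  rw [h1, add_zero]

theorem shift_add (a : ℝ) (f g : Lp F p vol) :
    shift a (f + g) = shift a f + shift a g := map_add _ f g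

theorem shift_sub (a : ℝ) (f g : Lp F p vol) :
    shift a (f - g) = shift a f - shift a g := map_sub _ f g

theorem continuous_shift [hp : Fact (1 ≤ p)] (hpt : p ≠ ∞) {X : Type*} [TopologicalSpace X] {a : X → ℝ}
    {f : X → Lp F p vol} (ha : Continuous a) (hf : Continuous f) :
    Continuous fun x => shift (a x) (f x) := by
  have hg : Continuous fun z : X => (⟨fun x => x + a z, by fun_prop⟩ : C(ℝ, ℝ)) := by
    refine ContinuousMap.continuous_of_continuous_uncurry _ ?_
    simp only [Function.uncurry_def, ContinuousMap.coe_mk]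
    fun_prop
  exact hf.compMeasurePreservingLp hg (fun z => measurePreserving_add_right volume (a z)) hpt

end Translate

theorem schwartz_weight_bound (h : 𝓢(ℝ, ℂ)) : ∃ K : ℝ, 0 ≤ K ∧ ∀ y : ℝ, ‖h y‖ ≤ K / (1 + y ^ 2) := by
  obtain ⟨C0, h0⟩ := h.decay 0 0
  obtain ⟨C2, h2⟩ := h.decay 2 0
  refine ⟨C0 + C2, ?_, fun y => ?_⟩
  · have a0 := h0.2 0
    have a2 := h2.2 0
    simp only [norm_iteratedFDeriv_zero] at a0 a2
    have := norm_nonneg (h 0)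
    nlinarith [norm_nonneg (0 : ℝ)]
  · have a0 := h0.2 y
    have a2 := h2.2 y
    simp only [norm_iteratedFDeriv_zero, pow_zero, one_mul, norm_eq_abs, sq_abs] at a0 a2
    rw [le_div_iff₀ (by positivity)]
    linarith

theorem schwartz_translate_taylor (h : 𝓢(ℝ, ℂ)) :
    ∃ K : ℝ, 0 ≤ K ∧ ∀ s x : ℝ, |s| ≤ 1 →
      ‖h (x - s) - h x + (s : ℂ) * ∂ₛ h x‖ ≤ K * s ^ 2 / (1 + x ^ 2) := by
  set h1 := ∂ₛ h with hh1
  set h2 := ∂ₛ h1 with hh2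
  obtain ⟨K, hK, hb⟩ := schwartz_weight_bound h2
  refine ⟨3 * K, by positivity, fun s x hs => ?_⟩
  have d0 : ∀ y, HasDerivAt h (h1 y) y := fun y => by simpa [hh1] using h.hasDerivAt y
  have d1 : ∀ y, HasDerivAt h1 (h2 y) y := fun y => by simpa [hh2] using h1.hasDerivAt y
  have hb2 : ∀ y, |y - x| ≤ 1 → ‖h2 y‖ ≤ 3 * K / (1 + x ^ 2) := fun y hy => by
    refine (hb y).trans ?_
    rw [div_le_div_iff₀ (by positivity) (by positivity)]
    have := abs_le.1 hy
    nlinarith [sq_nonneg (y - x - y), sq_nonneg (x + y), sq_nonneg (2 * y - x), mul_nonneg hK (sq_nonneg y),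
      mul_le_mul_of_nonneg_left (show x ^ 2 ≤ 2 * y ^ 2 + 2 by
        nlinarith [sq_nonneg (2 * y - x), sq_nonneg (x - 2 * y)]) hK]
  have hsub : ∀ σ ∈ uIcc 0 s, |σ| ≤ |s| := fun σ hσ => by
    have := abs_sub_left_of_mem_uIcc hσ
    simpa using this
  have e1 : ∀ σ ∈ uIcc (0 : ℝ) s, ‖h1 (x - σ) - h1 x‖ ≤ 3 * K / (1 + x ^ 2) * |s| := by
    intro σ hσ
    have hσ' := hsub σ hσ
    have := (convex_uIcc x (x - σ)).norm_image_sub_le_of_norm_hasDerivWithin_le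
      (f := h1) (f' := h2) (C := 3 * K / (1 + x ^ 2))
      (fun y _ => (d1 y).hasDerivWithinAt) (fun y hy => hb2 y ?_) left_mem_uIcc right_mem_uIcc
    · refine this.trans ?_
      gcongr
      rw [norm_eq_abs]
      simpa using hσ'
    · have := abs_sub_left_of_mem_uIcc hy
      have h3 : |x - σ - x| = |σ| := by simp
      rw [h3] at this
      linarith
  have e2 := (convex_uIcc (0 : ℝ) s).norm_image_sub_le_of_norm_hasDerivWithin_le
      (f := fun σ : ℝ => h (x - σ) + (σ : ℂ) * h1 x) (f' := fun σ => h1 x - h1 (x - σ))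
      (C := 3 * K / (1 + x ^ 2) * |s|) (fun σ _ => ?_) (fun σ hσ => by
        rw [norm_sub_rev]; exact e1 σ hσ) left_mem_uIcc right_mem_uIcc
  · simp only [sub_zero, ofReal_zero, zero_mul, add_zero, norm_eq_abs] at e2
    calc _ = ‖h (x - s) + (s : ℂ) * h1 x - h x‖ := by congr 1; ring
      _ ≤ _ := e2
      _ = _ := by rw [mul_assoc, abs_mul_abs_self]; ring
  · have A : HasDerivAt (fun σ : ℝ => h (x - σ)) (-h1 (x - σ)) σ := by
      have := (d0 (x - σ)).scomp σ ((hasDerivAt_id σ).const_sub x)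
      simpa [Function.comp_def] using this
    have B : HasDerivAt (fun σ : ℝ => (σ : ℂ) * h1 x) (h1 x) σ := by
      simpa using (ofRealCLM.hasDerivAt (x := σ)).mul_const (h1 x)
    have := A.add B
    rw [show -h1 (x - σ) + h1 x = h1 x - h1 (x - σ) by ring] at this
    exact this.hasDerivWithinAt

theorem memLp_inv_one_add_sq : MemLp (fun x : ℝ => (1 + x ^ 2)⁻¹) 2 volume := by
  have hm : AEStronglyMeasurable (fun x : ℝ => (1 + x ^ 2)⁻¹) volume := by fun_prop
  rw [memLp_two_iff_integrable_sq hm]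
  refine integrable_inv_one_add_sq.mono' (hm.pow 2) (.of_forall fun x => ?_)
  have : (1 + x ^ 2)⁻¹ ≤ 1 := inv_le_one_of_one_le₀ (by nlinarith [sq_nonneg x])
  have h0 : 0 ≤ (1 + x ^ 2)⁻¹ := by positivity
  rw [norm_eq_abs, abs_of_nonneg (by positivity)]
  nlinarith

theorem translate_toLp_quadratic (h : 𝓢(ℝ, ℂ)) : ∃ C : ℝ, 0 ≤ C ∧ ∀ s : ℝ, |s| ≤ 1 →
    ‖(h.compSubConstCLM ℂ s).toLp 2 volume - h.toLp 2 volume +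
      (s : ℂ) • (∂ₛ h).toLp 2 volume‖ ≤ C * s ^ 2 := by
  obtain ⟨K, hK, hb⟩ := schwartz_translate_taylor h
  set w := memLp_inv_one_add_sq.toLp
  refine ⟨K * ‖w‖, by positivity, fun s hs => ?_⟩
  have := Lp.norm_le_norm_of_ae_le (f := (h.compSubConstCLM ℂ s).toLp 2 volume - h.toLp 2 volume +
      (s : ℂ) • (∂ₛ h).toLp 2 volume) (g := (K * s ^ 2) • w) ?_
  · refine this.trans_eq ?_
    rw [norm_smul, norm_eq_abs, abs_of_nonneg (by positivity)]
    ring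
  · filter_upwards [coeFn_add ((h.compSubConstCLM ℂ s).toLp 2 volume - h.toLp 2 volume)
      ((s : ℂ) • (∂ₛ h).toLp 2 volume),
      coeFn_sub ((h.compSubConstCLM ℂ s).toLp 2 volume) (h.toLp 2 volume),
      coeFn_smul (s : ℂ) ((∂ₛ h).toLp 2 volume),
      (h.compSubConstCLM ℂ s).coeFn_toLp 2 volume, h.coeFn_toLp 2 volume,
      (∂ₛ h).coeFn_toLp 2 volume, coeFn_smul (K * s ^ 2) w,
      memLp_inv_one_add_sq.coeFn_toLp] with x h1 h2 h3 h4 h5 h6 h7 h8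
    rw [h1, Pi.add_apply, h2, Pi.sub_apply, h3, Pi.smul_apply, h4, h5, h6, h7, Pi.smul_apply, h8,
      smul_eq_mul, smul_eq_mul, norm_mul (K * s ^ 2)]
    refine (hb s x hs).trans ?_
    rw [norm_eq_abs, norm_eq_abs, abs_of_nonneg (by positivity : 0 ≤ K * s ^ 2),
      abs_of_nonneg (by positivity), div_eq_mul_inv]

section Pairing

variable {F : Type*} [NormedAddCommGroup F] [NormedSpace ℂ F] [CompleteSpace F]

def pairL2 : Lp ℂ 2 vol →L[ℂ] Lp F 2 vol →L[ℂ] F := (lsmul ℂ ℂ).lpPairing volume 2 2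

theorem pairL2_eq (h : Lp ℂ 2 vol) (f : Lp F 2 vol) : pairL2 h f = ∫ x, h x • f x := by
  simp [pairL2, ContinuousLinearMap.lpPairing_eq_integral]

theorem toTemperedDistribution_eq_pairL2 (f : Lp F 2 vol) (h : 𝓢(ℝ, ℂ)) :
    toTemperedDistribution f h = pairL2 (h.toLp 2 volume) f := by
  rw [toTemperedDistribution_apply, pairL2_eq]
  exact integral_congr_ae ((h.coeFn_toLp 2 volume).mono fun x hx => by simp only [hx])

theorem toTemperedDistribution_translate {p : ℝ≥0∞} [Fact (1 ≤ p)]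
    (f : Lp F p vol) (h : 𝓢(ℝ, ℂ)) (a : ℝ) :
    toTemperedDistribution f (h.compSubConstCLM ℂ a) = toTemperedDistribution (shift a f) h := by
  rw [toTemperedDistribution_apply, toTemperedDistribution_apply]
  rw [← integral_add_right_eq_self (fun x => (h.compSubConstCLM ℂ a) x • f x) a]
  apply integral_congr_ae
  filter_upwards [shift_ae a f] with x hx
  rw [hx, compSubConstCLM_apply, add_sub_cancel_right]

theorem continuous_toTemperedDistribution {p : ℝ≥0∞} [Fact (1 ≤ p)] {X : Type*}
    [TopologicalSpace X] {f : X → Lp F p vol} (hf : Continuous f) (h : 𝓢(ℝ, ℂ)) :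
    Continuous fun x => toTemperedDistribution (f x) h := by
  have h1 := (Lp.toTemperedDistributionCLM F vol p).continuous.comp hf
  exact (ContinuousEvalConst.continuous_eval_const h).comp h1

theorem hasDerivWithinAt_pairing_translate {u : ℝ → Lp F 2 vol}
    (hu : Continuous u) {S : Set ℝ} {c t : ℝ} {n : F} (h : 𝓢(ℝ, ℂ))
    (hd : HasDerivWithinAt (fun s => toTemperedDistribution (u s) (h.compSubConstCLM ℂ (c * t)))
      ((c : ℂ) • toTemperedDistribution (u t) (∂ₛ (h.compSubConstCLM ℂ (c * t))) + n) S t) :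
    HasDerivWithinAt (fun s => toTemperedDistribution (u s) (h.compSubConstCLM ℂ (c * s)))
      n S t := by
  set k := h.compSubConstCLM ℂ (c * t) with hk
  obtain ⟨C, hC, hq⟩ := translate_toLp_quadratic k
  have hks : ∀ s, h.compSubConstCLM ℂ (c * s) = k.compSubConstCLM ℂ (c * (s - t)) := fun s => by
    rw [hk, SchwartzMap.compSubConstCLM_comp]; congr 2; ring
  set D : ℝ → Lp ℂ 2 vol := fun s => (k.compSubConstCLM ℂ (c * (s - t))).toLp 2 volume - k.toLp 2 volume
  have d1 : HasDerivAt D (-(c : ℂ) • (∂ₛ k).toLp 2 volume) t := by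
    have hO : (fun s => D s + ((c * (s - t) : ℝ) : ℂ) • (∂ₛ k).toLp 2 volume)
        =O[𝓝 t] fun s => ‖s - t‖ ^ 2 := by
      refine Asymptotics.IsBigO.of_bound (C * c ^ 2) ?_
      have : Continuous fun s : ℝ => |c * (s - t)| := by fun_prop
      filter_upwards [this.continuousAt.eventually (gt_mem_nhds
        (show |c * (t - t)| < 1 by simp))] with s hs
      refine (hq _ hs.le).trans_eq ?_
      simp [mul_pow, mul_assoc]
    have h1 := ((((hasDerivAt_id t).sub_const t).const_mul c).ofReal_comp).smul_const
      ((∂ₛ k).toLp 2 volume)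
    exact (((hO.hasFDerivAt one_lt_two).hasDerivAt.sub h1).congr_deriv (by simp)).congr_of_eventuallyEq
      (.of_forall fun s => by simp)
  have hDt : D t = 0 := by simp [D, SchwartzMap.compSubConstCLM_zero]
  have e0 : ∀ s, toTemperedDistribution (u s) (h.compSubConstCLM ℂ (c * s)) =
      toTemperedDistribution (u s) k + pairL2 (D s) (u s - u t) + pairL2 (D s) (u t) := fun s => by
    rw [hks s, toTemperedDistribution_eq_pairL2, toTemperedDistribution_eq_pairL2]
    simp only [D, map_sub, _root_.sub_apply]
    abel
  have d3 : HasDerivAt (fun s => pairL2 (D s) (u t))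
      (pairL2 (-(c : ℂ) • (∂ₛ k).toLp 2 volume) (u t)) t :=
    (((pairL2 (F := F)).flip (u t)).restrictScalars ℝ).hasFDerivAt.comp_hasDerivAt t d1
  have d2 : HasDerivAt (fun s => pairL2 (D s) (u s - u t)) 0 t := by
    rw [hasDerivAt_iff_isLittleO]
    simp only [sub_self, map_zero, sub_zero, smul_zero]
    have hO1 : D =O[𝓝 t] fun s => s - t := by simpa [hDt] using d1.isBigO_sub
    have ho2 : (fun s => u s - u t) =o[𝓝 t] fun _ => (1 : ℝ) := by
      rw [Asymptotics.isLittleO_one_iff]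
      have : Continuous fun s => u s - u t := by fun_prop
      simpa using this.tendsto t
    have hb : (fun s => pairL2 (D s) (u s - u t)) =O[𝓝 t] fun s => ‖D s‖ * ‖u s - u t‖ := by
      refine Asymptotics.IsBigO.of_bound ‖pairL2 (F := F)‖ (.of_forall fun s => ?_)
      rw [norm_of_nonneg (by positivity), ← mul_assoc]
      exact (pairL2 (F := F)).le_opNorm₂ _ _
    refine hb.trans_isLittleO ?_
    simpa using hO1.norm_left.mul_isLittleO ho2.norm_left
  have := (hd.add d2.hasDerivWithinAt).add d3.hasDerivWithinAt
  refine (this.congr_of_eventuallyEq (.of_forall fun s => e0 s) (e0 t)).congr_deriv ?_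
  rw [toTemperedDistribution_eq_pairL2, map_smul, _root_.smul_apply, add_zero, neg_smul]
  abel

end Pairing

section Duhamel

variable {F : Type*} [NormedAddCommGroup F] [NormedSpace ℂ F] [CompleteSpace F]

theorem integrable_prod_smul_curve {p q : ℝ≥0∞} [Fact (1 ≤ p)] [hpq : HolderConjugate q p]
    {c : ℝ → Lp F p vol} (hc : Continuous c) {R : ℝ → ℝ → F}
    (hR : StronglyMeasurable fun z : ℝ × ℝ => R z.1 z.2) (hRc : ∀ t, R t =ᵐ[volume] c t)
    {h : ℝ → ℂ} (hh : MemLp h q volume) (a b : ℝ) :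
    Integrable (fun z : ℝ × ℝ => h z.2 • R z.1 z.2) ((volume.restrict (Ioc a b)).prod volume) := by
  refine ⟨(hh.1.comp_snd).smul (by fun_prop), ?_⟩
  obtain ⟨C, hC⟩ := isCompact_Icc.exists_bound_of_continuousOn (s := Icc a b) hc.continuousOn
  have hmeas : AEMeasurable (fun z : ℝ × ℝ => ‖h z.2 • R z.1 z.2‖ₑ)
      ((volume.restrict (Ioc a b)).prod volume) :=
    ((hh.1.comp_snd).smul (by fun_prop)).enorm
  rw [HasFiniteIntegral, lintegral_prod _ hmeas]
  have hbd : ∀ t ∈ Ioc a b, ∫⁻ y, ‖h y • R t y‖ₑ ≤ eLpNorm h q volume * ofReal C := by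
    intro t ht
    have h1 : eLpNorm (h • (c t : ℝ → F)) 1 volume ≤ eLpNorm h q volume * eLpNorm (c t) p volume :=
      eLpNorm_smul_le_mul_eLpNorm (by fun_prop) hh.1
    rw [eLpNorm_one_eq_lintegral_enorm] at h1
    calc ∫⁻ y, ‖h y • R t y‖ₑ = ∫⁻ y, ‖(h • (c t : ℝ → F)) y‖ₑ := by
          apply lintegral_congr_ae
          filter_upwards [hRc t] with y hy
          simp [hy]
      _ ≤ _ := h1
      _ ≤ _ := by
          gcongr
          have := hC t (Ioc_subset_Icc_self ht)
          rw [← ofReal_toReal (Lp.eLpNorm_ne_top (c t)), ← Lp.norm_def]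
          exact ofReal_le_ofReal this
  calc _ ≤ ∫⁻ t in Ioc a b, eLpNorm h q volume * ofReal C :=
        setLIntegral_mono' measurableSet_Ioc hbd
    _ < ∞ := by
        rw [setLIntegral_const]
        exact mul_lt_top (by finiteness) (by simp)

theorem locallyIntegrable_integral_curve {p q : ℝ≥0∞} [Fact (1 ≤ p)] [hpq : HolderConjugate q p]
    {c : ℝ → Lp F p vol} (hc : Continuous c) {R : ℝ → ℝ → F}
    (hR : StronglyMeasurable fun z : ℝ × ℝ => R z.1 z.2) (hRc : ∀ t, R t =ᵐ[volume] c t)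
    (a b : ℝ) : LocallyIntegrable (fun y => ∫ s in Ioc a b, R s y) volume := by
  rw [locallyIntegrable_iff]
  intro K hK
  have hm : MeasurableSet K := hK.measurableSet
  have hh : MemLp (K.indicator fun _ => (1 : ℂ)) q volume :=
    memLp_indicator_const q hm 1 (Or.inr hK.measure_lt_top.ne)
  have h1 := (integrable_prod_smul_curve hc hR hRc hh a b).integral_prod_right
  have : Integrable (K.indicator fun y => ∫ s in Ioc a b, R s y) volume := by
    refine h1.congr (.of_forall fun y => ?_)
    by_cases hy : y ∈ K <;> simp [hy]
  exact (integrable_indicator_iff hm).1 this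

theorem ae_integrable_slice_curve {p q : ℝ≥0∞} [Fact (1 ≤ p)] [hpq : HolderConjugate q p]
    {c : ℝ → Lp F p vol} (hc : Continuous c) {R : ℝ → ℝ → F}
    (hR : StronglyMeasurable fun z : ℝ × ℝ => R z.1 z.2) (hRc : ∀ t, R t =ᵐ[volume] c t)
    (a b : ℝ) : ∀ᵐ y : ℝ, IntegrableOn (fun s => R s y) (Ioc a b) volume := by
  have hk : ∀ n : ℕ, ∀ᵐ y : ℝ, y ∈ Icc (-(n : ℝ)) n → IntegrableOn (fun s => R s y) (Ioc a b) volume := by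
    intro n
    have hh : MemLp ((Icc (-(n : ℝ)) n).indicator fun _ => (1 : ℂ)) q volume :=
      memLp_indicator_const q measurableSet_Icc 1 (Or.inr isCompact_Icc.measure_lt_top.ne)
    have h1 := (integrable_prod_smul_curve hc hR hRc hh a b).prod_left_ae
    filter_upwards [h1] with y hy hyK
    simpa [IntegrableOn, indicator_of_mem hyK] using hy
  filter_upwards [ae_all_iff.2 hk] with y hy
  obtain ⟨n, hn⟩ := exists_nat_ge |y|
  exact hy n (abs_le.1 hn)

theorem shear_ae {c : ℝ → ℝ} {p : ℝ≥0∞} {F : Type*} [NormedAddCommGroup F]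
    {f : ℝ → Lp F p vol} {R : ℝ → ℝ → F} (hR : ∀ t, R t =ᵐ[volume] f t) (s : ℝ) :
    (fun y => R s (y + c s)) =ᵐ[volume] shift (c s) (f s) := by
  filter_upwards [shift_ae (c s) (f s), ae_comp_add (hR s) (c s)] with y h1 h2
  rw [h1, h2]

theorem stronglyMeasurable_shear {F : Type*} [TopologicalSpace F] {R : ℝ → ℝ → F} (c : ℝ)
    (hR : StronglyMeasurable fun z : ℝ × ℝ => R z.1 z.2) :
    StronglyMeasurable fun z : ℝ × ℝ => R z.1 (z.2 + c * z.1) :=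
  (by fun_prop)

theorem duhamel_ae {u b : ℝ → Lp F 2 vol} {a : ℝ → Lp F 1 vol}
    (hu : Continuous u) (ha : Continuous a) (hb : Continuous b) {T c : ℝ}
    (hw : ∀ h : 𝓢(ℝ, ℂ), ∀ t ∈ Icc 0 T, HasDerivWithinAt (fun s => toTemperedDistribution (u s) h)
        ((c : ℂ) • toTemperedDistribution (u t) (∂ₛ h)
          + (toTemperedDistribution (a t) h + toTemperedDistribution (b t) h)) (Icc 0 T) t)
    {U : ℝ → ℝ → F} (hUu : ∀ t, U t =ᵐ[volume] u t) {A B : ℝ → ℝ → F}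
    (hA : StronglyMeasurable fun z : ℝ × ℝ => A z.1 z.2) (hAa : ∀ t, A t =ᵐ[volume] a t)
    (hB : StronglyMeasurable fun z : ℝ × ℝ => B z.1 z.2) (hBb : ∀ t, B t =ᵐ[volume] b t)
    {t : ℝ} (ht : t ∈ Icc 0 T) :
    ∀ᵐ y : ℝ, U t (y + c * t) = U 0 y + ∫ s in Ioc 0 t, (A s (y + c * s) + B s (y + c * s)) := by
  have hA' := stronglyMeasurable_shear c hA
  have hB' := stronglyMeasurable_shear c hB
  have hAa' : ∀ s, (fun y => A s (y + c * s)) =ᵐ[volume] shift (c * s) (a s) :=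
    shear_ae (c := fun s => c * s) hAa
  have hBb' : ∀ s, (fun y => B s (y + c * s)) =ᵐ[volume] shift (c * s) (b s) :=
    shear_ae (c := fun s => c * s) hBb
  have ca : Continuous fun s => shift (c * s) (a s) :=
    continuous_shift ENNReal.one_ne_top (by fun_prop) ha
  have cb : Continuous fun s => shift (c * s) (b s) :=
    continuous_shift ofNat_ne_top (by fun_prop) hb
  have cu : Continuous fun s => shift (c * s) (u s) :=
    continuous_shift ofNat_ne_top (by fun_prop) hu
  have iA := ae_integrable_slice_curve (q := ∞) ca hA' hAa' 0 t
  have iB := ae_integrable_slice_curve (q := 2) cb hB' hBb' 0 t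
  have lA := locallyIntegrable_integral_curve (q := ∞) ca hA' hAa' 0 t
  have lB := locallyIntegrable_integral_curve (q := 2) cb hB' hBb' 0 t
  have hU0 := hUu 0
  have hUt : (fun y => U t (y + c * t)) =ᵐ[volume] shift (c * t) (u t) :=
    shear_ae (c := fun s => c * s) hUu t
  set G : ℝ → F := fun y => shift (c * t) (u t) y - u 0 y -
    ((∫ s in Ioc 0 t, A s (y + c * s)) + ∫ s in Ioc 0 t, B s (y + c * s)) with hG
  have lG : LocallyIntegrable G volume :=
    ((locallyIntegrable_lp _).sub (locallyIntegrable_lp _)).sub (lA.add lB)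
  have hzero : ∀ᵐ y : ℝ, G y = 0 := by
    apply ae_eq_zero_of_integral_contDiff_smul_eq_zero lG
    intro g gs gc
    have hg₁ : HasCompactSupport (ofRealCLM ∘ g) := gc.comp_left rfl
    have hg₂ : ContDiff ℝ ((⊤ : ℕ∞) : WithTop ℕ∞) (ofRealCLM ∘ g) := by fun_prop
    set h : 𝓢(ℝ, ℂ) := hg₁.toSchwartzMap hg₂ with hh
    have hhg : ∀ x, h x = (g x : ℂ) := fun x => rfl
    have hder : ∀ s ∈ Icc 0 T, HasDerivWithinAt
        (fun s => toTemperedDistribution (shift (c * s) (u s)) h)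
        (toTemperedDistribution (shift (c * s) (a s)) h +
          toTemperedDistribution (shift (c * s) (b s)) h) (Icc 0 T) s := by
      intro s hs
      have := hasDerivWithinAt_pairing_translate hu (c := c) h
        (hw (h.compSubConstCLM ℂ (c * s)) s hs)
      simpa only [toTemperedDistribution_translate] using this
    have cn : Continuous fun s => toTemperedDistribution (shift (c * s) (a s)) h +
          toTemperedDistribution (shift (c * s) (b s)) h :=
      (continuous_toTemperedDistribution ca h).add (continuous_toTemperedDistribution cb h)
    have hftc : ∫ s in 0..t, (toTemperedDistribution (shift (c * s) (a s)) h +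
          toTemperedDistribution (shift (c * s) (b s)) h) =
        toTemperedDistribution (shift (c * t) (u t)) h -
        toTemperedDistribution (shift (c * 0) (u 0)) h := by
      refine intervalIntegral.integral_eq_sub_of_hasDerivAt_of_le ht.1
        (continuous_toTemperedDistribution cu h).continuousOn (fun s hs => ?_)
        (cn.intervalIntegrable 0 t)
      exact (hder s ⟨hs.1.le, hs.2.le.trans ht.2⟩).hasDerivAt
        (Icc_mem_nhds hs.1 (hs.2.trans_le ht.2))
    have hmem1 : MemLp h ∞ volume := h.memLp_top
    have hmem2 : MemLp h 2 volume := h.memLp 2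
    have ia := integrable_prod_smul_curve ca hA' hAa' hmem1 0 t
    have ib := integrable_prod_smul_curve cb hB' hBb' hmem2 0 t
    have swap : ∀ {p : ℝ≥0∞} [Fact (1 ≤ p)] (d : ℝ → Lp F p vol) (R : ℝ → ℝ → F)
        (_ : ∀ s, R s =ᵐ[volume] d s) (_ : Integrable (fun z : ℝ × ℝ => h z.2 • R z.1 z.2)
        ((volume.restrict (Ioc 0 t)).prod volume)),
        ∫ s in Ioc 0 t, toTemperedDistribution (d s) h = ∫ y, h y • ∫ s in Ioc 0 t, R s y := by
      intro p _ d R hRd hi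
      calc ∫ s in Ioc 0 t, toTemperedDistribution (d s) h
          = ∫ s in Ioc 0 t, ∫ y, h y • R s y := by
            congr 1; ext s
            rw [toTemperedDistribution_apply]
            exact integral_congr_ae ((hRd s).mono fun y hy => by simp only [hy])
        _ = ∫ y, ∫ s in Ioc 0 t, h y • R s y := integral_integral_swap hi
        _ = _ := by
            congr 1; ext y
            rw [integral_smul]
    have sa := swap _ _ hAa' ia
    have sb := swap _ _ hBb' ib
    rw [integral_of_le ht.1, integral_add
      ((continuous_toTemperedDistribution ca h).integrableOn_Ioc)
      ((continuous_toTemperedDistribution cb h).integrableOn_Ioc), sa, sb, mul_zero, shift_zero,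
      toTemperedDistribution_apply, toTemperedDistribution_apply] at hftc
    have j1 : Integrable (fun y => h y • shift (c * t) (u t) y) volume := by
      exact memLp_one_iff_integrable.1 ((memLp (shift (c * t) (u t))).smul hmem2)
    have j2 : Integrable (fun y => h y • u 0 y) volume := by
      exact memLp_one_iff_integrable.1 ((memLp (u 0)).smul hmem2)
    have j3 : Integrable (fun y => h y • ∫ s in Ioc 0 t, A s (y + c * s)) volume := by
      have := ia.integral_prod_right
      simpa only [integral_smul] using this
    have j4 : Integrable (fun y => h y • ∫ s in Ioc 0 t, B s (y + c * s)) volume := by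
      have := ib.integral_prod_right
      simpa only [integral_smul] using this
    have : ∫ y, g y • G y = ∫ y, ((h y • shift (c * t) (u t) y - h y • u 0 y) -
        (h y • (∫ s in Ioc 0 t, A s (y + c * s)) + h y • ∫ s in Ioc 0 t, B s (y + c * s))) := by
      congr 1; ext y
      rw [hG, hhg, ← smul_add, ← smul_sub, ← smul_sub, coe_smul]
    rw [this]
    refine (integral_sub (j1.sub j2) (j3.add j4)).trans ?_
    refine (congrArg₂ _ (integral_sub j1 j2) (integral_add j3 j4)).trans ?_
    rw [hftc, sub_self]
  filter_upwards [hzero, hU0, hUt, iA, iB] with y hy h0 h1 h2 h3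
  rw [integral_add h2 h3, h0, h1]
  exact sub_eq_zero.1 (by rw [← hy, hG]; simp only; abel)

end Duhamel

section Characteristic

theorem lintegral_comp_affine (H : ℝ → ℝ≥0∞) (hH : Measurable H) (y : ℝ) {σ : ℝ}
    (hσ : σ = 1 ∨ σ = -1) (S : Set ℝ) : ∫⁻ s in S, H (y + 2 * σ * s) ≤ ∫⁻ x, H x := by
  have h0 : (2 * σ) ≠ 0 := by rcases hσ with rfl | rfl <;> norm_num
  calc ∫⁻ s in S, H (y + 2 * σ * s) ≤ ∫⁻ s, H (y + 2 * σ * s) := setLIntegral_le_lintegral _ _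
    _ = ∫⁻ x, H (y + x) ∂(Measure.map (fun s => 2 * σ * s) volume) := by
        rw [lintegral_map (by fun_prop) (by fun_prop)]
    _ = ofReal |(2 * σ)⁻¹| * ∫⁻ x, H (y + x) := by
        rw [Real.map_volume_mul_left h0, lintegral_smul_measure, smul_eq_mul]
    _ ≤ 1 * ∫⁻ x, H (y + x) := by
        gcongr
        rw [← ENNReal.ofReal_one]
        apply ofReal_le_ofReal
        rcases hσ with rfl | rfl <;> norm_num [abs_of_pos]
    _ = _ := by rw [one_mul, lintegral_add_left_eq_self H y]

theorem mul_le_sq_add_sq (x y : ℝ≥0∞) : x * y ≤ x ^ 2 + y ^ 2 := by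
  rcases le_total x y with h | h
  · exact (mul_le_mul_left h y).trans ((sq y).ge.trans le_add_self)
  · exact (mul_le_mul_right h x).trans ((sq x).ge.trans le_self_add)

theorem le_one_add_sq (x : ℝ≥0∞) : x ≤ 1 + x ^ 2 := by simpa using mul_le_sq_add_sq 1 x

theorem add_sq_le_four (x y : ℝ≥0∞) : (x + y) ^ 2 ≤ 4 * (x ^ 2 + y ^ 2) :=
  calc (x + y) ^ 2 = x ^ 2 + y ^ 2 + 2 * (x * y) := by ring
    _ ≤ x ^ 2 + y ^ 2 + 2 * (x ^ 2 + y ^ 2) := by gcongr; exact mul_le_sq_add_sq x y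
    _ = 3 * (x ^ 2 + y ^ 2) := by ring
    _ ≤ _ := by gcongr; norm_num

theorem add_three_sq_le (x y z : ℝ≥0∞) : (x + y + z) ^ 2 ≤ 16 * (x ^ 2 + y ^ 2 + z ^ 2) :=
  calc (x + y + z) ^ 2 ≤ 4 * (4 * (x ^ 2 + y ^ 2) + 4 * z ^ 2) :=
        (add_sq_le_four _ _).trans (by
          gcongr; exacts [add_sq_le_four _ _, le_mul_of_one_le_left' (by norm_num)])
    _ = _ := by ring

theorem lintegral_transversal_le {P Q : ℝ → ℝ≥0∞} (hP : Measurable P) (hQ : Measurable Q)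
    {σ : ℝ} (hσ : σ = 1 ∨ σ = -1) (S : Set ℝ) :
    ∫⁻ r in S, ∫⁻ x, P (x + σ * r) * Q (x - σ * r) ≤ (∫⁻ x, P x) * ∫⁻ x, Q x := by
  calc ∫⁻ r in S, ∫⁻ x, P (x + σ * r) * Q (x - σ * r)
      = ∫⁻ r in S, ∫⁻ x, P (x + 2 * σ * r) * Q x := by
        congr 1; ext r
        rw [← lintegral_add_right_eq_self (fun x => P (x + σ * r) * Q (x - σ * r)) (σ * r)]
        congr 1; ext x
        congr 2 <;> ring
    _ = ∫⁻ x, ∫⁻ r in S, P (x + 2 * σ * r) * Q x := by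
        rw [lintegral_lintegral_swap]
        fun_prop
    _ = ∫⁻ x, (∫⁻ r in S, P (x + 2 * σ * r)) * Q x := by
        congr 1; ext x
        rw [lintegral_mul_const _ (by fun_prop)]
    _ ≤ ∫⁻ x, (∫⁻ x, P x) * Q x := by
        exact lintegral_mono fun x => mul_le_mul' (lintegral_comp_affine P hP x hσ S) le_rfl
    _ = _ := lintegral_const_mul _ hQ

def charMajorant (T : ℝ) (c : ℝ≥0∞) (Φ a₀ : ℝ → ℝ → ℝ≥0∞) (a : ℝ → ℝ → ℝ → ℝ≥0∞) (σ y : ℝ) : ℝ≥0∞ :=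
  a₀ σ y + ∫⁻ s in Ioc 0 T, (Φ σ y + Φ (-σ) (y + 2 * σ * s) + c) * a (-σ) s (y + σ * s)

/-- Amplitudes `a σ` bounded by Duhamel majorants along characteristics. -/
structure CharSystem (T : ℝ) (N c : ℝ≥0∞) (Φ a₀ : ℝ → ℝ → ℝ≥0∞) (a : ℝ → ℝ → ℝ → ℝ≥0∞) :
    Prop where
  meas_pot : ∀ σ, Measurable (Φ σ)
  meas_data : ∀ σ, Measurable (a₀ σ)
  meas : ∀ σ, Measurable fun z : ℝ × ℝ => a σ z.1 z.2
  time_le : ofReal T ≤ N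
  const_le : c ≤ N
  pot_le : ∀ σ, ∫⁻ x, Φ σ x ^ 2 ≤ N
  data_le : ∀ σ, σ = 1 ∨ σ = -1 → ∫⁻ x, a₀ σ x ^ 2 ≤ N
  le : ∀ σ, σ = 1 ∨ σ = -1 → ∫⁻ t in Ioc 0 T, ∫⁻ x, a σ t x ^ 2 ≤ N
  ineq : ∀ σ, σ = 1 ∨ σ = -1 → ∀ᵐ t ∂(volume.restrict (Ioc 0 T)), ∀ᵐ y : ℝ,
    a σ t (y + σ * t) ≤ charMajorant T c Φ a₀ a σ y

def charConst₁ (N : ℝ≥0∞) : ℝ≥0∞ := 5 * N + 2 * N ^ 2 + N ^ 4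

def charConst₂ (N : ℝ≥0∞) : ℝ≥0∞ := 3 * N + N ^ 2 + 2 * N * charConst₁ N + 2 * N ^ 2 * charConst₁ N

def profileConst (N : ℝ≥0∞) : ℝ≥0∞ := 16 * (1 + charConst₁ N ^ 2 + charConst₂ N ^ 2)

def bilinConst (N : ℝ≥0∞) : ℝ≥0∞ := (N + N * N * profileConst N) * profileConst N

variable {T σ : ℝ} {N c : ℝ≥0∞} {Φ a₀ : ℝ → ℝ → ℝ≥0∞} {a : ℝ → ℝ → ℝ → ℝ≥0∞}

theorem sign_neg (hσ : σ = 1 ∨ σ = -1) : -σ = 1 ∨ -σ = -1 := by rcases hσ with rfl | rfl <;> simp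

namespace CharSystem

theorem measurable_majorant (h : CharSystem T N c Φ a₀ a) (σ : ℝ) :
    Measurable (charMajorant T c Φ a₀ a σ) := by
  have h1 := h.meas_pot
  have h2 := h.meas_data
  have h3 := h.meas
  unfold charMajorant
  fun_prop

theorem ae_le_majorant (h : CharSystem T N c Φ a₀ a) (hσ : σ = 1 ∨ σ = -1) :
    ∀ᵐ y : ℝ, ∀ᵐ s ∂(volume.restrict (Ioc 0 T)),
      a (-σ) s (y + σ * s) ≤ charMajorant T c Φ a₀ a (-σ) (y + 2 * σ * s) := by
  have h1 := h.measurable_majorant (-σ)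
  have h2 := h.meas
  rw [← Measure.ae_ae_comm (p := fun s y => a (-σ) s (y + σ * s) ≤
    charMajorant T c Φ a₀ a (-σ) (y + 2 * σ * s))]
  · filter_upwards [h.ineq (-σ) (sign_neg hσ)] with s hs
    filter_upwards [ae_comp_add hs (2 * σ * s)] with y hy
    convert hy using 2
    ring
  · exact measurableSet_le (by fun_prop) (by fun_prop)

theorem lintegral_sq_char_le (h : CharSystem T N c Φ a₀ a) (hσ : σ = 1 ∨ σ = -1) (y : ℝ) :
    ∫⁻ s in Ioc 0 T, ∫⁻ r in Ioc 0 T, a σ r (y + 2 * σ * s - σ * r) ^ 2 ≤ N := by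
  have h4 := h.meas
  rw [lintegral_lintegral_swap (by fun_prop)]
  refine (lintegral_mono fun r => ?_).trans (h.le σ hσ)
  refine (lintegral_mono fun s => le_of_eq ?_).trans
    (lintegral_comp_affine (fun x => a σ r x ^ 2) (by fun_prop) (y - σ * r) hσ (Ioc 0 T))
  congr 2; ring

theorem lintegral_pot_sq_le (h : CharSystem T N c Φ a₀ a) (τ : ℝ) (hσ : σ = 1 ∨ σ = -1) (y : ℝ) :
    ∫⁻ s in Ioc 0 T, Φ τ (y + 2 * σ * s) ^ 2 ≤ N :=
  (lintegral_comp_affine (fun x => Φ τ x ^ 2) ((h.meas_pot τ).pow_const 2) y hσ _).trans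
    (h.pot_le τ)

theorem lintegral_data_sq_le (h : CharSystem T N c Φ a₀ a) {τ : ℝ} (hτ : τ = 1 ∨ τ = -1)
    (hσ : σ = 1 ∨ σ = -1) (y : ℝ) : ∫⁻ s in Ioc 0 T, a₀ τ (y + 2 * σ * s) ^ 2 ≤ N :=
  (lintegral_comp_affine (fun x => a₀ τ x ^ 2) ((h.meas_data τ).pow_const 2) y hσ _).trans
    (h.data_le τ hτ)

theorem setLIntegral_const_le (h : CharSystem T N c Φ a₀ a) (k : ℝ≥0∞) :
    ∫⁻ _ in Ioc 0 T, k ≤ k * N := by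
  rw [setLIntegral_const, volume_Ioc, sub_zero]
  gcongr
  exact h.time_le

theorem ae_mass_le (h : CharSystem T N c Φ a₀ a) (hσ : σ = 1 ∨ σ = -1) :
    ∀ᵐ y : ℝ, ∫⁻ s in Ioc 0 T, a (-σ) s (y + σ * s) ≤ charConst₁ N := by
  have m1 := h.meas_pot
  have m2 := h.meas
  have m3 := h.meas_data
  filter_upwards [h.ae_le_majorant hσ] with y hy
  refine (lintegral_mono_ae hy).trans ?_
  have hb : ∀ s, charMajorant T c Φ a₀ a (-σ) (y + 2 * σ * s) ≤
      (1 + a₀ (-σ) (y + 2 * σ * s) ^ 2) + (Φ (-σ) (y + 2 * σ * s) ^ 2 * N + (N + N ^ 3 +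
        3 * ∫⁻ r in Ioc 0 T, a σ r (y + 2 * σ * s - σ * r) ^ 2)) := fun s => by
    rw [charMajorant]
    gcongr
    · exact le_one_add_sq _
    · calc ∫⁻ r in Ioc 0 T, (Φ (-σ) (y + 2 * σ * s) + Φ (- -σ) (y + 2 * σ * s + 2 * -σ * r) + c) *
              a (- -σ) r (y + 2 * σ * s + -σ * r)
          ≤ ∫⁻ r in Ioc 0 T, (Φ (-σ) (y + 2 * σ * s) ^ 2 + (Φ σ (y + 2 * σ * s + 2 * -σ * r) ^ 2 +
              (c ^ 2 + 3 * a σ r (y + 2 * σ * s - σ * r) ^ 2))) := by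
            gcongr with r
            rw [neg_neg, add_mul, add_mul,
              show y + 2 * σ * s + -σ * r = y + 2 * σ * s - σ * r by ring]
            calc _ ≤ _ := add_le_add (add_le_add (mul_le_sq_add_sq _ _) (mul_le_sq_add_sq _ _))
                    (mul_le_sq_add_sq _ _)
              _ = _ := by ring
        _ ≤ _ := by
            rw [lintegral_add_left (by fun_prop), lintegral_add_left (by fun_prop),
              lintegral_add_left (by fun_prop), lintegral_const_mul _ (by fun_prop), add_assoc N]
            gcongr
            · exact h.setLIntegral_const_le _
            · exact h.lintegral_pot_sq_le σ (sign_neg hσ) _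
            · refine (h.setLIntegral_const_le _).trans ?_
              rw [pow_succ N 2]
              gcongr
              exact h.const_le
  refine (lintegral_mono hb).trans ?_
  rw [lintegral_add_left (by fun_prop), lintegral_add_left (by fun_prop),
    lintegral_add_left (by fun_prop), lintegral_mul_const _ (by fun_prop),
    lintegral_add_left (by fun_prop), lintegral_const_mul _ (by fun_prop)]
  calc _ ≤ (1 * N + N) + (N * N + ((N + N ^ 3) * N + 3 * N)) := by
        gcongr
        · exact h.setLIntegral_const_le 1
        · exact h.lintegral_data_sq_le (sign_neg hσ) hσ y
        · exact h.lintegral_pot_sq_le _ hσ y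
        · exact h.setLIntegral_const_le _
        · exact h.lintegral_sq_char_le hσ y
    _ = charConst₁ N := by rw [charConst₁]; ring

theorem ae_majorant_le (h : CharSystem T N c Φ a₀ a) (hσ : σ = 1 ∨ σ = -1) :
    ∀ᵐ y : ℝ, charMajorant T c Φ a₀ a σ y ≤ a₀ σ y + charConst₁ N * Φ σ y + charConst₂ N := by
  have m1 := h.meas_pot
  have m2 := h.meas
  have m3 := h.meas_data
  have hmass : ∀ᵐ y : ℝ, ∀ᵐ s ∂(volume.restrict (Ioc 0 T)),
      ∫⁻ r in Ioc 0 T, a σ r (y + 2 * σ * s - σ * r) ≤ charConst₁ N := by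
    rw [← Measure.ae_ae_comm (p := fun s y =>
      ∫⁻ r in Ioc 0 T, a σ r (y + 2 * σ * s - σ * r) ≤ charConst₁ N)]
    · refine Eventually.of_forall fun s => ?_
      filter_upwards [ae_comp_add (h.ae_mass_le (sign_neg hσ)) (2 * σ * s)] with y hy
      simpa only [neg_neg, neg_mul, ← sub_eq_add_neg] using hy
    · exact measurableSet_le (by fun_prop) measurable_const
  filter_upwards [h.ae_le_majorant hσ, h.ae_mass_le hσ, hmass] with y hy hmy hms
  set K := charConst₁ N with hK
  have hpar : ∫⁻ s in Ioc 0 T, Φ (-σ) (y + 2 * σ * s) * a (-σ) s (y + σ * s) ≤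
      (2 * N + N ^ 2 + N) + (K * N + (N * K * (2 * N))) := by
    have hstep : ∀ᵐ s ∂(volume.restrict (Ioc 0 T)), Φ (-σ) (y + 2 * σ * s) * a (-σ) s (y + σ * s) ≤
        Φ (-σ) (y + 2 * σ * s) ^ 2 + a₀ (-σ) (y + 2 * σ * s) ^ 2 +
        (K * Φ (-σ) (y + 2 * σ * s) ^ 2 + (N * K * (1 + Φ (-σ) (y + 2 * σ * s) ^ 2))) +
        ∫⁻ r in Ioc 0 T, (Φ (-σ) (y + 2 * σ * s) ^ 2 * Φ σ (y + 2 * σ * s - 2 * σ * r) ^ 2 +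
          a σ r (y + 2 * σ * s - σ * r) ^ 2) := by
      filter_upwards [hy, hms] with s h1 h2
      set z := y + 2 * σ * s
      have hmaj : charMajorant T c Φ a₀ a (-σ) z ≤ a₀ (-σ) z + (Φ (-σ) z * K + N * K) +
          ∫⁻ r in Ioc 0 T, Φ σ (z - 2 * σ * r) * a σ r (z - σ * r) := by
        rw [charMajorant, add_assoc]
        gcongr
        calc _ = ∫⁻ r in Ioc 0 T, ((Φ (-σ) z + c) * a σ r (z - σ * r) +
                Φ σ (z - 2 * σ * r) * a σ r (z - σ * r)) := by
              congr 1; ext r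
              rw [neg_neg, show z + 2 * -σ * r = z - 2 * σ * r by ring,
                show z + -σ * r = z - σ * r by ring]
              ring
          _ ≤ _ := by
              rw [lintegral_add_left (by fun_prop), lintegral_const_mul _ (by fun_prop),
                ← add_mul]
              gcongr
              exact h.const_le
      calc Φ (-σ) z * a (-σ) s (y + σ * s) ≤ Φ (-σ) z * (a₀ (-σ) z + (Φ (-σ) z * K + N * K) +
          ∫⁻ r in Ioc 0 T, Φ σ (z - 2 * σ * r) * a σ r (z - σ * r)) := by
            gcongr
            exact h1.trans hmaj
        _ = Φ (-σ) z * a₀ (-σ) z + (K * Φ (-σ) z ^ 2 + N * K * Φ (-σ) z) +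
          ∫⁻ r in Ioc 0 T, (Φ (-σ) z * Φ σ (z - 2 * σ * r)) * a σ r (z - σ * r) := by
            rw [mul_add, mul_add, ← lintegral_const_mul _ (by fun_prop)]
            simp only [mul_assoc]
            ring_nf
        _ ≤ _ := by
            gcongr with r
            · exact mul_le_sq_add_sq _ _
            · exact le_one_add_sq _
            · refine (mul_le_sq_add_sq _ _).trans ?_
              rw [mul_pow]
    refine (lintegral_mono_ae hstep).trans ?_
    rw [lintegral_add_left (by fun_prop), lintegral_add_left (by fun_prop),
      lintegral_add_left (by fun_prop), lintegral_add_left (by fun_prop),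
      lintegral_const_mul _ (by fun_prop), lintegral_const_mul _ (by fun_prop),
      lintegral_add_left measurable_const]
    calc _ ≤ (N + N + (K * N + N * K * (1 * N + N))) + (N ^ 2 + N) := by
          gcongr
          · exact h.lintegral_pot_sq_le _ hσ y
          · exact h.lintegral_data_sq_le (sign_neg hσ) hσ y
          · exact h.lintegral_pot_sq_le _ hσ y
          · exact h.setLIntegral_const_le 1
          · exact h.lintegral_pot_sq_le _ hσ y
          · simp_rw [fun s => lintegral_add_left (μ := volume.restrict (Ioc 0 T))
              (f := fun r => Φ (-σ) (y + 2 * σ * s) ^ 2 * Φ σ (y + 2 * σ * s - 2 * σ * r) ^ 2)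
              (by fun_prop) fun r => a σ r (y + 2 * σ * s - σ * r) ^ 2]
            rw [lintegral_add_left (by fun_prop)]
            gcongr
            · rw [lintegral_lintegral_swap (by fun_prop)]
              calc _ ≤ ∫⁻ r in Ioc 0 T, ∫⁻ x, Φ (-σ) (x + σ * r) ^ 2 * Φ σ (x - σ * r) ^ 2 := by
                    refine lintegral_mono fun r => (lintegral_mono fun s => le_of_eq ?_).trans
                      (lintegral_comp_affine (fun x => Φ (-σ) (x + σ * r) ^ 2 *
                        Φ σ (x - σ * r) ^ 2) (by fun_prop) (y - σ * r) hσ (Ioc 0 T))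
                    congr 3 <;> ring
                _ ≤ _ := lintegral_transversal_le ((m1 (-σ)).pow_const 2) ((m1 σ).pow_const 2) hσ _
                _ ≤ N * N := by gcongr <;> exact h.pot_le _
                _ = N ^ 2 := (sq N).symm
            · exact h.lintegral_sq_char_le hσ y
      _ = _ := by ring
  rw [charMajorant]
  calc _ = a₀ σ y + ∫⁻ s in Ioc 0 T, ((Φ σ y + c) * a (-σ) s (y + σ * s) +
        Φ (-σ) (y + 2 * σ * s) * a (-σ) s (y + σ * s)) := by
        congr 2; ext s; ring
    _ ≤ a₀ σ y + ((Φ σ y + N) * K + ((2 * N + N ^ 2 + N) + (K * N + (N * K * (2 * N))))) := by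
        rw [lintegral_add_left (by fun_prop), lintegral_const_mul _ (by fun_prop)]
        gcongr
        exact h.const_le
    _ = _ := by rw [charConst₂, ← hK]; ring

theorem ae_le (h : CharSystem T N c Φ a₀ a) (hσ : σ = 1 ∨ σ = -1) :
    ∀ᵐ t ∂(volume.restrict (Ioc 0 T)), ∀ᵐ x : ℝ,
      a σ t x ≤ a₀ σ (x - σ * t) + charConst₁ N * Φ σ (x - σ * t) + charConst₂ N := by
  filter_upwards [h.ineq σ hσ] with t ht
  filter_upwards [ae_comp_add (ht.and (h.ae_majorant_le hσ)) (-(σ * t))] with x hx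
  have := hx.1.trans hx.2
  simpa only [neg_add_cancel_right, ← sub_eq_add_neg, sub_add_cancel] using this

theorem lintegral_weight_mul_le (h : CharSystem T N c Φ a₀ a) (hσ : σ = 1 ∨ σ = -1)
    {F : ℝ → ℝ → ℝ≥0∞} (hF : Measurable fun z : ℝ × ℝ => F z.1 z.2) {K : ℝ≥0∞}
    (h₀ : ∫⁻ t in Ioc 0 T, ∫⁻ x, F t x * a₀ σ (x - σ * t) ^ 2 ≤ K)
    (h₁ : ∫⁻ t in Ioc 0 T, ∫⁻ x, F t x * Φ σ (x - σ * t) ^ 2 ≤ K)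
    (h₂ : ∫⁻ t in Ioc 0 T, ∫⁻ x, F t x ≤ K) :
    ∫⁻ t in Ioc 0 T, ∫⁻ x, F t x * a σ t x ^ 2 ≤ K * profileConst N := by
  have m1 := h.meas_pot
  have m3 := h.meas_data
  calc _ ≤ ∫⁻ t in Ioc 0 T, ∫⁻ x, 16 * (F t x * a₀ σ (x - σ * t) ^ 2 +
        (charConst₁ N ^ 2 * (F t x * Φ σ (x - σ * t) ^ 2) + charConst₂ N ^ 2 * F t x)) := by
        apply lintegral_mono_ae
        filter_upwards [h.ae_le hσ] with t ht
        apply lintegral_mono_ae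
        filter_upwards [ht] with x hx
        refine (mul_le_mul_right ((pow_le_pow_left' hx 2).trans (add_three_sq_le _ _ _)) _).trans_eq ?_
        ring
    _ = 16 * ((∫⁻ t in Ioc 0 T, ∫⁻ x, F t x * a₀ σ (x - σ * t) ^ 2) +
        (charConst₁ N ^ 2 * (∫⁻ t in Ioc 0 T, ∫⁻ x, F t x * Φ σ (x - σ * t) ^ 2) +
        charConst₂ N ^ 2 * ∫⁻ t in Ioc 0 T, ∫⁻ x, F t x)) := by
        simp (discharger := fun_prop) only [lintegral_const_mul, lintegral_add_left]
        rw [lintegral_const_mul _ (by fun_prop), lintegral_add_left (by fun_prop),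
          lintegral_add_left (by fun_prop), lintegral_const_mul _ (by fun_prop),
          lintegral_const_mul _ (by fun_prop)]
    _ ≤ 16 * (K + (charConst₁ N ^ 2 * K + charConst₂ N ^ 2 * K)) := by gcongr
    _ = _ := by rw [profileConst]; ring

theorem lintegral_profile_mul_le (h : CharSystem T N c Φ a₀ a) (hσ : σ = 1 ∨ σ = -1)
    {P : ℝ → ℝ≥0∞} (hP : Measurable P) {K : ℝ≥0∞} (hK : ∫⁻ x, P x ^ 2 ≤ K) :
    ∫⁻ t in Ioc 0 T, ∫⁻ x, P (x + σ * t) ^ 2 * a σ t x ^ 2 ≤ K * N * profileConst N := by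
  refine h.lintegral_weight_mul_le hσ (F := fun t x => P (x + σ * t) ^ 2) (by fun_prop)
    ((lintegral_transversal_le (hP.pow_const 2) ((h.meas_data σ).pow_const 2) hσ _).trans ?_)
    ((lintegral_transversal_le (hP.pow_const 2) ((h.meas_pot σ).pow_const 2) hσ _).trans ?_) ?_
  · gcongr
    exact h.data_le σ hσ
  · gcongr
    exact h.pot_le σ
  · simp only [lintegral_add_right_eq_self (fun x => P x ^ 2)]
    exact (h.setLIntegral_const_le _).trans (by gcongr)

theorem lintegral_mul_le {c' : ℝ≥0∞} {Φ' a₀' : ℝ → ℝ → ℝ≥0∞} {a' : ℝ → ℝ → ℝ → ℝ≥0∞}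
    (h : CharSystem T N c Φ a₀ a) (h' : CharSystem T N c' Φ' a₀' a') (hσ : σ = 1 ∨ σ = -1) :
    ∫⁻ t in Ioc 0 T, ∫⁻ x, a σ t x ^ 2 * a' (-σ) t x ^ 2 ≤ bilinConst N := by
  refine h'.lintegral_weight_mul_le (sign_neg hσ) ((h.meas σ).pow_const 2) ?_ ?_
    ((h.le σ hσ).trans le_self_add)
  · refine le_trans ?_ ((h.lintegral_profile_mul_le hσ (h'.meas_data (-σ))
      (h'.data_le _ (sign_neg hσ))).trans le_add_self)
    simp only [mul_comm (a σ _ _ ^ 2), neg_mul, sub_neg_eq_add, le_refl]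
  · refine le_trans ?_ ((h.lintegral_profile_mul_le hσ (h'.meas_pot (-σ))
      (h'.pot_le _)).trans le_add_self)
    simp only [mul_comm (a σ _ _ ^ 2), neg_mul, sub_neg_eq_add, le_refl]

end CharSystem

theorem profileConst_lt_top (hN : N < ∞) : profileConst N < ∞ := by
  have h1 : charConst₁ N < ∞ := by unfold charConst₁; finiteness
  have h2 : charConst₂ N < ∞ := by unfold charConst₂; finiteness
  unfold profileConst
  finiteness

theorem bilinConst_lt_top (hN : N < ∞) : bilinConst N < ∞ := by
  have := profileConst_lt_top hN
  unfold bilinConst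
  finiteness

end Characteristic

section Energy

variable {E : Type*} [NormedAddCommGroup E] [InnerProductSpace ℂ E] [CompleteSpace E]

local notation "⟪" x ", " y "⟫" => inner ℂ x y

theorem enorm_re_le (z : ℂ) : ‖z.re‖ₑ ≤ ‖z‖ₑ := enorm_le_iff_norm_le.2 (Complex.abs_re_le_norm z)

theorem enorm_inner_le (x y : E) : ‖⟪x, y⟫‖ₑ ≤ ‖x‖ₑ * ‖y‖ₑ := by
  simp_rw [← ofReal_norm, ← ofReal_mul (norm_nonneg _)]
  exact ofReal_le_ofReal (norm_inner_le_norm _ _)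

theorem enorm_re_inner_le (x y : E) : ‖re ⟪x, y⟫‖ₑ ≤ ‖x‖ₑ * ‖y‖ₑ :=
  (enorm_re_le _).trans (enorm_inner_le _ _)

theorem normSq_add_integral {n : ℝ → E} {t : ℝ} (ht : 0 ≤ t) (hn : IntegrableOn n (Ioc 0 t))
    (u : E) : ‖u + ∫ s in Ioc 0 t, n s‖ ^ 2 =
      ‖u‖ ^ 2 + 2 * ∫ s in Ioc 0 t, re ⟪u + ∫ r in Ioc 0 s, n r, n s⟫ := by
  let _ := InnerProductSpace.rclikeToReal ℂ E
  have hi : IntervalIntegrable n volume 0 t := (intervalIntegrable_iff_integrableOn_Ioc_of_le ht).2 hn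
  set f : ℝ → E := fun s => u + ∫ r in 0..s, n r
  obtain ⟨C, hC⟩ := isCompact_uIcc.exists_bound_of_continuousOn (f := f)
    (continuousOn_const.add (intervalIntegral.continuousOn_primitive_interval' hi left_mem_uIcc))
  have hac : AbsolutelyContinuousOnInterval (fun s => ‖f s‖ ^ 2) 0 t := by
    refine squeeze_zero' (.of_forall fun _ => Finset.sum_nonneg fun _ _ => dist_nonneg) ?_
      ((hi.norm.absolutelyContinuousOnInterval_intervalIntegral left_mem_uIcc).const_mul (2 * C))
    filter_upwards [mem_inf_of_right (mem_principal_self _)] with I hI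
    refine Finset.sum_le_sum fun i h => ?_
    obtain ⟨h1, h2⟩ := hI.1 i h
    have hs : ∀ {x}, x ∈ uIcc 0 t → IntervalIntegrable n volume 0 x := fun hx =>
      hi.mono_set (uIcc_subset_uIcc_left hx)
    have h3 : f (I.2 i).1 - f (I.2 i).2 = ∫ r in (I.2 i).2..(I.2 i).1, n r := by
      rw [add_sub_add_left_eq_sub, integral_interval_sub_left (hs h1) (hs h2)]
    rw [dist_eq, dist_eq, ← mul_sub, integral_interval_sub_left
      (hs h1).norm (hs h2).norm, sq_sub_sq, abs_mul, abs_mul]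
    refine mul_le_mul ?_ ?_ (abs_nonneg _) (abs_nonneg _)
    · rw [abs_of_nonneg (by positivity)]
      exact le_trans (by linarith [hC _ h1, hC _ h2]) (le_abs_self _)
    · exact (abs_norm_sub_norm_le _ _).trans
        (h3 ▸ intervalIntegral.norm_integral_le_abs_integral_norm)
  have h1 := hac.integral_deriv_eq_sub
  have h2 : ∫ s in 0..t, deriv (fun s => ‖f s‖ ^ 2) s =
      ∫ s in 0..t, 2 * re ⟪u + ∫ r in Ioc 0 s, n r, n s⟫ := by
    apply intervalIntegral.integral_congr_ae
    filter_upwards [hi.ae_hasDerivAt_integral] with s hs h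
    rw [uIoc_of_le ht] at h
    rw [← integral_of_le h.1.le]
    exact ((hs (Ioc_subset_Icc_self.trans Icc_subset_uIcc h) 0 left_mem_uIcc).const_add
      u).norm_sq.deriv
  rw [h2, intervalIntegral.integral_const_mul, integral_of_le ht] at h1
  simp only [f, integral_of_le ht, intervalIntegral.integral_same, add_zero] at h1
  linarith

theorem integral_normSq_transport {U N : ℝ → ℝ → E}
    (hU : StronglyMeasurable fun z : ℝ × ℝ => U z.1 z.2)
    (hN : StronglyMeasurable fun z : ℝ × ℝ => N z.1 z.2) {T σ : ℝ}
    (hd : ∀ t ∈ Icc 0 T, ∀ᵐ y, U t (y + σ * t) = U 0 y + ∫ s in Ioc 0 t, N s (y + σ * s))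
    (hi : ∀ᵐ y : ℝ, IntegrableOn (fun s => N s (y + σ * s)) (Ioc 0 T))
    (h0 : MemLp (U 0) 2 volume)
    (hfin : ∫⁻ t in Ioc 0 T, ∫⁻ x, ‖U t x‖ₑ * ‖N t x‖ₑ < ∞) {t : ℝ} (ht : t ∈ Icc 0 T) :
    ∫ x, ‖U t x‖ ^ 2 = (∫ x, ‖U 0 x‖ ^ 2) + 2 * ∫ s in Ioc 0 t, ∫ x, re ⟪U s x, N s x⟫ := by
  have hU' := stronglyMeasurable_shear σ hU
  have hN' := stronglyMeasurable_shear σ hN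
  have hsub : Ioc 0 t ⊆ Ioc 0 T := Ioc_subset_Ioc_right ht.2
  have hpm : StronglyMeasurable fun z : ℝ × ℝ => ∫ s in Ioc 0 z.1, N s (z.2 + σ * s) := by
    have : (fun z : ℝ × ℝ => ∫ s in Ioc 0 z.1, N s (z.2 + σ * s)) = fun z : ℝ × ℝ => ∫ s,
        {w : (ℝ × ℝ) × ℝ | 0 < w.2 ∧ w.2 ≤ w.1.1}.indicator (fun w => N w.2 (w.1.2 + σ * w.2)) (z, s) := by
      ext z
      rw [← integral_indicator measurableSet_Ioc]
      rfl
    rw [this]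
    refine StronglyMeasurable.integral_prod_right' ?_
    refine StronglyMeasurable.indicator ?_ ?_
    · exact hN.comp_measurable (g := fun w : (ℝ × ℝ) × ℝ => (w.2, w.1.2 + σ * w.2)) (by fun_prop)
    · exact (measurableSet_lt measurable_const measurable_snd).inter
        (measurableSet_le measurable_snd (measurable_fst.comp measurable_fst))
  have hae : ∀ᵐ y : ℝ, ∀ᵐ s ∂(volume.restrict (Ioc 0 t)),
      U s (y + σ * s) = U 0 y + ∫ r in Ioc 0 s, N r (y + σ * r) := by
    have h1 : ∀ᵐ s ∂(volume.restrict (Ioc 0 t)), ∀ᵐ y : ℝ,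
      U s (y + σ * s) = U 0 y + ∫ r in Ioc 0 s, N r (y + σ * r) := by
      filter_upwards [ae_restrict_mem measurableSet_Ioc] with s hs
      exact hd s ⟨hs.1.le, hs.2.trans ht.2⟩
    refine (Measure.ae_ae_comm ?_).1 h1
    refine StronglyMeasurable.measurableSet_eq_fun hU' ?_
    exact (hU.comp_measurable (g := fun z : ℝ × ℝ => ((0 : ℝ), z.2)) (by fun_prop)).add hpm
  have hmre : StronglyMeasurable fun z : ℝ × ℝ => re ⟪U z.1 z.2, N z.1 z.2⟫ :=
    Complex.continuous_re.comp_stronglyMeasurable (hU.inner hN)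
  have hmre' := stronglyMeasurable_shear (R := fun s x => re ⟪U s x, N s x⟫) σ hmre
  have hint : Integrable (fun z : ℝ × ℝ => re ⟪U z.1 (z.2 + σ * z.1), N z.1 (z.2 + σ * z.1)⟫)
      ((volume.restrict (Ioc 0 t)).prod volume) := by
    refine ⟨hmre'.aestronglyMeasurable, ?_⟩
    rw [HasFiniteIntegral, lintegral_prod _ hmre'.aestronglyMeasurable.enorm]
    refine lt_of_le_of_lt ?_ hfin
    refine (lintegral_mono_set hsub).trans' (lintegral_mono fun s => ?_)
    rw [← lintegral_add_right_eq_self (fun x => ‖U s x‖ₑ * ‖N s x‖ₑ) (σ * s)]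
    exact lintegral_mono fun y => enorm_re_inner_le _ _
  have key : ∀ᵐ y : ℝ, ‖U t (y + σ * t)‖ ^ 2 = ‖U 0 y‖ ^ 2 +
      2 * ∫ s in Ioc 0 t, re ⟪U s (y + σ * s), N s (y + σ * s)⟫ := by
    filter_upwards [hae, hi, hd t ht] with y h1 h2 h3
    rw [h3, normSq_add_integral ht.1 (h2.mono_set hsub)]
    congr 2
    exact integral_congr_ae (h1.mono fun s hs => by simp only [hs])
  rw [← integral_add_right_eq_self (fun x => ‖U t x‖ ^ 2) (σ * t), integral_congr_ae key,
    integral_add (h0.integrable_norm_pow (by norm_num)) ((hint.integral_prod_right).const_mul 2), integral_const_mul,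
    ← integral_integral_swap (f := fun s y => re ⟪U s (y + σ * s), N s (y + σ * s)⟫) hint]
  congr 2
  congr 1; ext s
  exact integral_add_right_eq_self (fun x => re ⟪U s x, N s x⟫) (σ * s)

end Energy

section Matrices

local notation "⟪" x ", " y "⟫" => inner ℂ x y

structure DiracPair (A B : 𝓛) : Prop where
  symm_left : ∀ x y, ⟪A x, y⟫ = ⟪x, A y⟫
  symm_right : ∀ x y, ⟪B x, y⟫ = ⟪x, B y⟫
  sq_left : ∀ x, A (A x) = x
  sq_right : ∀ x, B (B x) = x
  anticomm : ∀ x, A (B x) = -B (A x)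

theorem diracPair_op {α β : Matrix (Fin 2) (Fin 2) ℂ} (hα : α.IsHermitian) (hβ : β.IsHermitian)
    (hαα : α * α = 1) (hββ : β * β = 1) (hαβ : α * β + β * α = 0) :
    DiracPair (op α) (op β) := by
  have sym : ∀ γ : Matrix (Fin 2) (Fin 2) ℂ, γ.IsHermitian → ∀ x y, ⟪op γ x, y⟫ = ⟪x, op γ y⟫ := by
    intro γ hγ x y
    have h1 : star (op γ) = op γ := by
      rw [op, ← map_star]
      congr 1
    have h2 : adjoint (op γ) = op γ := h1
    rw [← ContinuousLinearMap.adjoint_inner_right, h2]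
  have mul : ∀ (γ δ : Matrix (Fin 2) (Fin 2) ℂ) (x : Spinor), op γ (op δ x) = op (γ * δ) x := by simp
  refine ⟨sym α hα, sym β hβ, fun x => ?_, fun x => ?_, fun x => ?_⟩
  · rw [mul, hαα, op, map_one]; rfl
  · rw [mul, hββ, op, map_one]; rfl
  · rw [mul, mul, eq_neg_iff_add_eq_zero]
    have : op (α * β) x + op (β * α) x = op (α * β + β * α) x := by rw [op, op, op, map_add]; rfl
    rw [this, hαβ, op, map_zero]; rfl

def half (A : 𝓛) (σ : ℝ) : 𝓛 := (1 / 2 : ℂ) • (ContinuousLinearMap.id ℂ Spinor + (σ : ℂ) • A)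

variable {A B : 𝓛}

theorem half_apply (A : 𝓛) (σ : ℝ) (x : Spinor) :
    half A σ x = (1 / 2 : ℂ) • (x + (σ : ℂ) • A x) := rfl

theorem half_add_half_neg (A : 𝓛) (σ : ℝ) (x : Spinor) : half A σ x + half A (-σ) x = x := by
  simp only [half_apply, ofReal_neg]
  module

namespace DiracPair

theorem left_half (h : DiracPair A B) {σ : ℝ} (hσ : σ = 1 ∨ σ = -1) (x : Spinor) :
    A (half A σ x) = (σ : ℂ) • half A σ x := by
  rw [half_apply, map_smul, map_add, map_smul, h.sq_left]
  rcases hσ with rfl | rfl <;> simp <;> module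

theorem half_left (h : DiracPair A B) {σ : ℝ} (hσ : σ = 1 ∨ σ = -1) (x : Spinor) :
    half A σ (A x) = (σ : ℂ) • half A σ x := by
  rw [← h.left_half hσ, half_apply, half_apply, map_smul, map_add, map_smul]

theorem half_right (h : DiracPair A B) (σ : ℝ) (x : Spinor) :
    half A σ (B x) = B (half A (-σ) x) := by
  rw [half_apply, half_apply, map_smul, map_add, map_smul, h.anticomm]
  simp

theorem half_symm (h : DiracPair A B) (σ : ℝ) (x y : Spinor) : ⟪half A σ x, y⟫ = ⟪x, half A σ y⟫ := by
  rw [half_apply, half_apply, inner_smul_left, inner_smul_right, inner_add_left, inner_add_right,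
    inner_smul_left, inner_smul_right, h.symm_left]
  simp only [one_div, map_inv₀, map_ofNat, Complex.conj_ofReal]

theorem half_half (h : DiracPair A B) {σ : ℝ} (hσ : σ = 1 ∨ σ = -1) (x : Spinor) :
    half A σ (half A σ x) = half A σ x := by
  rw [half_apply A σ (half A σ x), h.left_half hσ]
  rcases hσ with rfl | rfl <;> simp <;> module

theorem inner_half_add (h : DiracPair A B) {σ : ℝ} (hσ : σ = 1 ∨ σ = -1) (x y : Spinor) :
    ⟪half A σ x, half A σ y⟫ + ⟪half A (-σ) x, half A (-σ) y⟫ = ⟪x, y⟫ := by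
  rw [h.half_symm, h.half_symm, h.half_half hσ, h.half_half (sign_neg hσ), ← inner_add_right,
    half_add_half_neg]

theorem normSq_half_add (h : DiracPair A B) {σ : ℝ} (hσ : σ = 1 ∨ σ = -1) (x : Spinor) :
    ‖half A σ x‖ ^ 2 + ‖half A (-σ) x‖ ^ 2 = ‖x‖ ^ 2 := by
  have := congrArg re (h.inner_half_add hσ x x)
  rw [add_re] at this
  rwa [← inner_self_eq_norm_sq (𝕜 := ℂ), ← inner_self_eq_norm_sq (𝕜 := ℂ), ← inner_self_eq_norm_sq (𝕜 := ℂ)]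

theorem norm_half_le (h : DiracPair A B) {σ : ℝ} (hσ : σ = 1 ∨ σ = -1) (x : Spinor) :
    ‖half A σ x‖ ≤ ‖x‖ := by
  have := h.normSq_half_add hσ x
  exact le_of_sq_le_sq (by nlinarith [sq_nonneg ‖half A (-σ) x‖]) (norm_nonneg x)

theorem norm_right (h : DiracPair A B) (x : Spinor) : ‖B x‖ = ‖x‖ := by
  have h1 : ⟪B x, B x⟫ = ⟪x, x⟫ := by rw [h.symm_right, h.sq_right]
  rw [@norm_eq_sqrt_re_inner ℂ, @norm_eq_sqrt_re_inner ℂ _ _ _ _ x, h1]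

theorem inner_right_im (h : DiracPair A B) (x : Spinor) : ⟪x, B x⟫.im = 0 := by
  have h1 : (starRingEnd ℂ) ⟪x, B x⟫ = ⟪x, B x⟫ := by rw [inner_conj_symm, h.symm_right]
  exact Complex.conj_eq_iff_im.1 h1

end DiracPair

end Matrices

section WeakDirac

local notation "⟪" x ", " y "⟫" => inner ℂ x y

theorem toTemperedDistribution_compLp {p : ℝ≥0∞} [Fact (1 ≤ p)] (K : 𝓛)
    (f : Lp Spinor p vol) (h : 𝓢(ℝ, ℂ)) :
    toTemperedDistribution (K.compLpL p volume f) h = K (toTemperedDistribution f h) := by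
  rw [toTemperedDistribution_apply, toTemperedDistribution_apply,
    ← ContinuousLinearMap.integral_comp_comm]
  · apply integral_congr_ae
    filter_upwards [coeFn_compLpL (p := p) (μ := volume) K f] with x hx
    rw [hx, map_smul]
  · have := (lsmul ℂ ℂ (E := Spinor)).memLp_of_bilin 1
      (p := ENNReal.conjExponent p) (h.memLp (ENNReal.conjExponent p) volume) (memLp f)
    exact memLp_one_iff_integrable.1 this

def smulL1 (q : RealL2) (ψ : SpinorL2) : Lp Spinor 1 vol :=
  (lsmul ℂ ℂ (E := Spinor)).holderL volume 2 2 1 (ofRealCLM.compLpL 2 volume q) ψ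

theorem smulL1_ae (q : RealL2) (ψ : SpinorL2) : smulL1 q ψ =ᵐ[volume] fun x => (q x : ℂ) • ψ x := by
  filter_upwards [coeFn_holder (r := 1) (lsmul ℂ ℂ (E := Spinor)) (ofRealCLM.compLpL 2 volume q) ψ,
    coeFn_compLpL (p := 2) (μ := volume) ofRealCLM q] with x h1 h2
  rw [smulL1, ContinuousLinearMap.holderL_apply_apply, h1, h2]
  rfl

theorem continuous_smulL1 {q : ℝ → RealL2} {ψ : ℝ → SpinorL2} (hq : Continuous q)
    (hψ : Continuous ψ) : Continuous fun t => smulL1 (q t) (ψ t) :=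
  (((lsmul ℂ ℂ (E := Spinor)).holderL volume 2 2 1).continuous.comp
    ((ofRealCLM.compLpL 2 volume).continuous.comp hq)).clm_apply hψ

/-- `ψ` solves the Dirac equation with potential `q` weakly on `[0, T]`. -/
structure WeakDirac (A B : 𝓛) (M T : ℝ) (q : ℝ → RealL2) (ψ : ℝ → SpinorL2) :
    Prop where
  cont : Continuous ψ
  cont_pot : Continuous q
  eq : ∀ h : 𝓢(ℝ, ℂ), ∀ t ∈ Icc 0 T, HasDerivWithinAt (fun s => spinorDist (ψ s) h)
    (A (spinorDist (ψ t) (∂ₛ h)) - (I * M) • B (spinorDist (ψ t) h)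
      - I • B (toTemperedDistribution (smulL1 (q t) (ψ t)) h)) (Icc 0 T) t

def comp (A : 𝓛) (ψ : ℝ → SpinorL2) (σ t x : ℝ) : Spinor := half A σ (rep ψ t x)

def source (A B : 𝓛) (M : ℝ) (q : ℝ → RealL2) (ψ : ℝ → SpinorL2) (σ t x : ℝ) : Spinor :=
  (-(I * ((M + rep q t x : ℝ) : ℂ))) • half A σ (B (rep ψ t x))

variable {A B : 𝓛} {M T : ℝ} {q : ℝ → RealL2} {ψ : ℝ → SpinorL2}

theorem stronglyMeasurable_comp (A : 𝓛) (hψ : Continuous ψ) (σ : ℝ) :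
    StronglyMeasurable fun z : ℝ × ℝ => comp A ψ σ z.1 z.2 :=
  (half A σ).continuous.comp_stronglyMeasurable (stronglyMeasurable_rep hψ)

theorem stronglyMeasurable_source (A B : 𝓛) (M : ℝ) (hq : Continuous q)
    (hψ : Continuous ψ) (σ : ℝ) :
    StronglyMeasurable fun z : ℝ × ℝ => source A B M q ψ σ z.1 z.2 := by
  have h1 := stronglyMeasurable_rep hq
  have h2 := stronglyMeasurable_rep hψ
  have h3 : StronglyMeasurable fun z : ℝ × ℝ => (-(I * ((M + rep q z.1 z.2 : ℝ) : ℂ))) :=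
    (show Continuous fun r : ℝ => (-(I * ((M + r : ℝ) : ℂ))) by fun_prop).comp_stronglyMeasurable h1
  exact h3.smul ((half A σ ∘L B).continuous.comp_stronglyMeasurable h2)

theorem memLp_comp (A : 𝓛) (ψ : ℝ → SpinorL2) (σ t : ℝ) : MemLp (comp A ψ σ t) 2 volume :=
  (half A σ).comp_memLp' ((memLp_congr_ae (rep_ae ψ t)).2 (memLp (ψ t)))

theorem enorm_neg_I_mul (r : ℝ) : ‖-(I * (r : ℂ))‖ₑ = ‖r‖ₑ := by
  rw [← enorm_norm, ← enorm_norm r]; simp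

theorem enorm_source (hD : DiracPair A B) (σ t x : ℝ) :
    ‖source A B M q ψ σ t x‖ₑ = ‖M + rep q t x‖ₑ * ‖comp A ψ (-σ) t x‖ₑ := by
  rw [source, comp, hD.half_right, enorm_smul, enorm_neg_I_mul, ← enorm_norm (B _), hD.norm_right,
    enorm_norm]

theorem source_eq (A B : 𝓛) (M : ℝ) (q : ℝ → RealL2) (ψ : ℝ → SpinorL2)
    (σ t x : ℝ) : source A B M q ψ σ t x =
      ((-I) • (half A σ ∘L B)) (((rep q t x : ℝ) : ℂ) • rep ψ t x) +
      ((-(I * M)) • (half A σ ∘L B)) (rep ψ t x) := by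
  simp only [source, _root_.smul_apply, comp_apply, map_smul, smul_smul, ← add_smul]
  congr 1
  push_cast
  ring

theorem forcing_ae (L : 𝓛) (q : ℝ → RealL2) (ψ : ℝ → SpinorL2) (t : ℝ) :
    (fun x => L (((rep q t x : ℝ) : ℂ) • rep ψ t x)) =ᵐ[volume]
      L.compLpL 1 volume (smulL1 (q t) (ψ t)) := by
  filter_upwards [coeFn_compLpL (p := 1) (μ := volume) L
    (smulL1 (q t) (ψ t)), smulL1_ae (q t) (ψ t), rep_ae q t, rep_ae ψ t] with x h1 h2 h3 h4
  rw [h1, h2, h3, h4]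

theorem compLpL_rep_ae (L : 𝓛) (ψ : ℝ → SpinorL2) (t : ℝ) :
    (fun x => L (rep ψ t x)) =ᵐ[volume] L.compLpL 2 volume (ψ t) := by
  filter_upwards [coeFn_compLpL (p := 2) (μ := volume) L (ψ t), rep_ae ψ t] with x h1 h4
  rw [h1, h4]

theorem stronglyMeasurable_forcing (L : 𝓛) (hq : Continuous q) (hψ : Continuous ψ) :
    StronglyMeasurable fun z : ℝ × ℝ => L (((rep q z.1 z.2 : ℝ) : ℂ) • rep ψ z.1 z.2) :=
  L.continuous.comp_stronglyMeasurable ((continuous_ofReal.comp_stronglyMeasurable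
    (stronglyMeasurable_rep hq)).smul (stronglyMeasurable_rep hψ))

theorem stronglyMeasurable_clm_rep (L : 𝓛) (hψ : Continuous ψ) :
    StronglyMeasurable fun z : ℝ × ℝ => L (rep ψ z.1 z.2) :=
  L.continuous.comp_stronglyMeasurable (stronglyMeasurable_rep hψ)

namespace WeakDirac

theorem integrableOn_source (h : WeakDirac A B M T q ψ) (σ : ℝ) :
    ∀ᵐ y : ℝ, IntegrableOn (fun s => source A B M q ψ σ s (y + σ * s)) (Ioc 0 T) := by
  set L₁ := (-I) • (half A σ ∘L B) with hL₁
  set L₂ := (-(I * M)) • (half A σ ∘L B) with hL₂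
  have c1 : Continuous fun t => L₁.compLpL 1 volume (smulL1 (q t) (ψ t)) :=
    (L₁.compLpL 1 volume).continuous.comp (continuous_smulL1 h.cont_pot h.cont)
  have c2 : Continuous fun t => L₂.compLpL 2 volume (ψ t) :=
    (L₂.compLpL 2 volume).continuous.comp h.cont
  have m1 := stronglyMeasurable_shear (R := fun s x => L₁ (((rep q s x : ℝ) : ℂ) • rep ψ s x)) σ
    (stronglyMeasurable_forcing L₁ h.cont_pot h.cont)
  have m2 := stronglyMeasurable_shear (R := fun s x => L₂ (rep ψ s x)) σ
    (stronglyMeasurable_clm_rep L₂ h.cont)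
  have i1 := ae_integrable_slice_curve (q := ∞)
    (continuous_shift ENNReal.one_ne_top (a := fun s => σ * s) (by fun_prop) c1) m1
    (shear_ae (c := fun s => σ * s) (forcing_ae L₁ q ψ)) 0 T
  have i2 := ae_integrable_slice_curve (q := 2)
    (continuous_shift ofNat_ne_top (a := fun s => σ * s) (by fun_prop) c2) m2
    (shear_ae (c := fun s => σ * s) (compLpL_rep_ae L₂ ψ)) 0 T
  filter_upwards [i1, i2] with y h1 h2
  simp_rw [source_eq]
  exact h1.add h2

theorem duhamel (h : WeakDirac A B M T q ψ) (hD : DiracPair A B) {σ : ℝ} (hσ : σ = 1 ∨ σ = -1)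
    {t : ℝ} (ht : t ∈ Icc 0 T) : ∀ᵐ y : ℝ, comp A ψ σ t (y + σ * t) =
      comp A ψ σ 0 y + ∫ s in Ioc 0 t, source A B M q ψ σ s (y + σ * s) := by
  set L₁ := (-I) • (half A σ ∘L B) with hL₁
  set L₂ := (-(I * M)) • (half A σ ∘L B) with hL₂
  have c1 : Continuous fun t => L₁.compLpL 1 volume (smulL1 (q t) (ψ t)) :=
    (L₁.compLpL 1 volume).continuous.comp (continuous_smulL1 h.cont_pot h.cont)
  have c2 : Continuous fun t => L₂.compLpL 2 volume (ψ t) :=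
    (L₂.compLpL 2 volume).continuous.comp h.cont
  have c3 : Continuous fun t => (half A σ).compLpL 2 volume (ψ t) :=
    ((half A σ).compLpL 2 volume).continuous.comp h.cont
  have hw : ∀ g : 𝓢(ℝ, ℂ), ∀ t ∈ Icc 0 T,
      HasDerivWithinAt (fun s => toTemperedDistribution ((half A σ).compLpL 2 volume (ψ s)) g)
        ((σ : ℂ) • toTemperedDistribution ((half A σ).compLpL 2 volume (ψ t))
            (∂ₛ g)
          + (toTemperedDistribution (L₁.compLpL 1 volume (smulL1 (q t) (ψ t))) g +
            toTemperedDistribution (L₂.compLpL 2 volume (ψ t)) g)) (Icc 0 T) t := by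
    intro g t ht
    have h1 := ((half A σ).restrictScalars ℝ).hasFDerivAt.comp_hasDerivWithinAt t (h.eq g t ht)
    simp only [toTemperedDistribution_compLp]
    refine h1.congr_deriv ?_
    rw [coe_restrictScalars', map_sub, map_sub, hD.half_left hσ, map_smul,
      map_smul, hL₁, hL₂]
    simp only [_root_.smul_apply, comp_apply, spinorDist, neg_smul]
    abel
  have := duhamel_ae c3 c1 c2 hw (compLpL_rep_ae (half A σ) ψ)
    (stronglyMeasurable_forcing L₁ h.cont_pot h.cont) (forcing_ae L₁ q ψ)
    (stronglyMeasurable_clm_rep L₂ h.cont) (compLpL_rep_ae L₂ ψ) ht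
  filter_upwards [this] with y hy
  simp_rw [source_eq]
  exact hy

end WeakDirac

end WeakDirac

section Stability

local notation "⟪" x ", " y "⟫" => inner ℂ x y

theorem lintegral_mul_le_sqrt {X : Type*} [MeasurableSpace X] (μ : Measure X) {f g : X → ℝ≥0∞}
    (hf : AEMeasurable f μ) (hg : AEMeasurable g μ) :
    ∫⁻ x, f x * g x ∂μ ≤ (∫⁻ x, f x ^ 2 ∂μ) ^ (1 / 2 : ℝ) * (∫⁻ x, g x ^ 2 ∂μ) ^ (1 / 2 : ℝ) := by
  have := ENNReal.lintegral_mul_le_Lp_mul_Lq μ Real.HolderConjugate.two_two hf hg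
  simpa using this

theorem enorm_sq_lp {F X : Type*} [NormedAddCommGroup F] [MeasurableSpace X] {μ : Measure X}
    (f : Lp F 2 μ) : ‖f‖ₑ ^ 2 = ∫⁻ x, ‖f x‖ₑ ^ 2 ∂μ := by
  have := eLpNorm_nnreal_pow_eq_lintegral (f := f) (μ := μ) (p := 2) (by norm_num)
  rw [Lp.enorm_def]
  simpa using this

/-- `D` is bounded by right- and left-travelling profiles plus `η`. -/
structure TravelBound (T : ℝ) (D : ℝ → ℝ → ℝ) (P : ℝ → ℝ → ℝ≥0∞) (η : ℝ → ℝ≥0∞) : Prop where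
  meas : ∀ σ, Measurable (P σ)
  meas_time : Measurable η
  le : ∀ t ∈ Icc 0 T, ∀ᵐ x, ‖D t x‖ₑ ≤ P 1 (x - t) + P (-1) (x + t) + η t

def profileNorm (P : ℝ → ℝ → ℝ≥0∞) : ℝ≥0∞ :=
  (∫⁻ x, P 1 x ^ 2) ^ (1 / 2 : ℝ) + (∫⁻ x, P (-1) x ^ 2) ^ (1 / 2 : ℝ)

theorem TravelBound.le_sign {T : ℝ} {D : ℝ → ℝ → ℝ} {P : ℝ → ℝ → ℝ≥0∞} {η : ℝ → ℝ≥0∞}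
    (h : TravelBound T D P η) {σ : ℝ} (hσ : σ = 1 ∨ σ = -1) {t : ℝ} (ht : t ∈ Icc 0 T) :
    ∀ᵐ x, ‖D t x‖ₑ ≤ P σ (x - σ * t) + P (-σ) (x + σ * t) + η t := by
  filter_upwards [h.le t ht] with x hx
  rcases hσ with rfl | rfl
  · simpa using hx
  · rw [neg_neg, add_comm (P (-1) _)]
    simpa [← sub_eq_add_neg] using hx

theorem lintegral_profile_mul_le_sqrt {T : ℝ} {N : ℝ≥0∞} (hT : ofReal T ≤ N)
    {P : ℝ → ℝ≥0∞} (hP : Measurable P) (c : ℝ) {f : ℝ → ℝ → ℝ≥0∞}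
    (hf : Measurable fun z : ℝ × ℝ => f z.1 z.2) {K : ℝ≥0∞}
    (hK : ∫⁻ s in Ioc 0 T, ∫⁻ x, f s x ^ 2 ≤ K) :
    ∫⁻ s in Ioc 0 T, ∫⁻ x, P (x + c * s) * f s x ≤
      (∫⁻ x, P x ^ 2) ^ (1 / 2 : ℝ) * (N ^ (1 / 2 : ℝ) * K ^ (1 / 2 : ℝ)) := by
  have m1 : Measurable fun z : ℝ × ℝ => P (z.2 + c * z.1) := hP.comp (by fun_prop)
  have h1 := lintegral_mul_le_sqrt ((volume.restrict (Ioc 0 T)).prod volume)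
    m1.aemeasurable hf.aemeasurable
  rw [lintegral_prod _ (m1.fun_mul hf).aemeasurable, lintegral_prod _ (m1.pow_const 2).aemeasurable,
    lintegral_prod _ (hf.pow_const 2).aemeasurable] at h1
  refine h1.trans ?_
  rw [← mul_assoc, ← ENNReal.mul_rpow_of_nonneg (∫⁻ x, P x ^ 2) N (by norm_num : (0 : ℝ) ≤ 1 / 2)]
  gcongr
  calc ∫⁻ s in Ioc 0 T, ∫⁻ x, P (x + c * s) ^ 2 = ∫⁻ _ in Ioc 0 T, ∫⁻ x, P x ^ 2 := by
        congr 1; ext s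
        exact lintegral_add_right_eq_self (fun x => P x ^ 2) (c * s)
    _ = (∫⁻ x, P x ^ 2) * ofReal T := by rw [setLIntegral_const, volume_Ioc, sub_zero]
    _ ≤ _ := by gcongr

theorem TravelBound.lintegral_mul_le {T : ℝ} {D : ℝ → ℝ → ℝ} {P : ℝ → ℝ → ℝ≥0∞} {η : ℝ → ℝ≥0∞}
    (h : TravelBound T D P η) {N : ℝ≥0∞} (hT : ofReal T ≤ N)
    {f : ℝ → ℝ → ℝ≥0∞} (hf : Measurable fun z : ℝ × ℝ => f z.1 z.2) {K : ℝ≥0∞}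
    (hK : ∫⁻ s in Ioc 0 T, ∫⁻ x, f s x ^ 2 ≤ K) {t : ℝ} (ht : t ∈ Icc 0 T) :
    ∫⁻ s in Ioc 0 t, ∫⁻ x, ‖D s x‖ₑ * f s x ≤ profileNorm P * (N ^ (1 / 2 : ℝ) * K ^ (1 / 2 : ℝ)) +
        ∫⁻ s in Ioc 0 t, η s * ∫⁻ x, f s x := by
  have m := h.meas
  have hsub : Ioc 0 t ⊆ Ioc 0 T := Ioc_subset_Ioc_right ht.2
  calc ∫⁻ s in Ioc 0 t, ∫⁻ x, ‖D s x‖ₑ * f s x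
      ≤ ∫⁻ s in Ioc 0 t, ((∫⁻ x, P 1 (x + (-1) * s) * f s x) + (∫⁻ x, P (-1) (x + 1 * s) * f s x)
          + η s * ∫⁻ x, f s x) := by
        refine setLIntegral_mono_ae' measurableSet_Ioc (.of_forall fun s hs => ?_)
        rw [← lintegral_const_mul _ (by fun_prop), ← lintegral_add_left (by fun_prop),
          ← lintegral_add_left (by fun_prop)]
        apply lintegral_mono_ae
        filter_upwards [h.le s ⟨hs.1.le, hs.2.trans ht.2⟩] with x hx
        rw [← add_mul, ← add_mul]
        gcongr
        simpa [← sub_eq_add_neg] using hx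
    _ = (∫⁻ s in Ioc 0 t, ∫⁻ x, P 1 (x + (-1) * s) * f s x) +
          (∫⁻ s in Ioc 0 t, ∫⁻ x, P (-1) (x + 1 * s) * f s x) +
          ∫⁻ s in Ioc 0 t, η s * ∫⁻ x, f s x := by
        rw [lintegral_add_left (by fun_prop), lintegral_add_left (by fun_prop)]
    _ ≤ _ := by
        rw [profileNorm, add_mul]
        gcongr <;> refine (lintegral_mono_set hsub).trans ?_
        · exact lintegral_profile_mul_le_sqrt hT (h.meas 1) (-1) hf hK
        · exact lintegral_profile_mul_le_sqrt hT (h.meas (-1)) 1 hf hK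

variable {A B : 𝓛} {M T : ℝ} {q q' : ℝ → RealL2} {ψ ψ' : ℝ → SpinorL2}

theorem lintegral_comp_sq_le (hD : DiracPair A B) {σ : ℝ} (hσ : σ = 1 ∨ σ = -1) (t : ℝ) :
    ∫⁻ x, ‖comp A ψ σ t x‖ₑ ^ 2 ≤ ‖ψ t‖ₑ ^ 2 := by
  rw [enorm_sq_lp]
  apply lintegral_mono_ae
  filter_upwards [rep_ae ψ t] with x hx
  rw [comp, hx]
  gcongr
  exact enorm_le_iff_norm_le.2 (hD.norm_half_le hσ _)

namespace WeakDirac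

theorem ae_pot_le (h : WeakDirac A B M T q ψ) {Φ : ℝ → ℝ → ℝ≥0∞} {c : ℝ≥0∞}
    (hb : TravelBound T (fun t x => M + q t x) Φ fun _ => c) {σ : ℝ} (hσ : σ = 1 ∨ σ = -1) :
    ∀ᵐ y : ℝ, ∀ᵐ s ∂(volume.restrict (Ioc 0 T)), ‖M + rep q s (y + σ * s)‖ₑ ≤
      Φ σ y + Φ (-σ) (y + 2 * σ * s) + c := by
  have mq : Measurable fun z : ℝ × ℝ => ‖M + rep q z.1 (z.2 + σ * z.1)‖ₑ := by
    have m1 := stronglyMeasurable_shear σ (stronglyMeasurable_rep h.cont_pot)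
    fun_prop
  refine (Measure.ae_ae_comm (p := fun s y => ‖M + rep q s (y + σ * s)‖ₑ ≤
    Φ σ y + Φ (-σ) (y + 2 * σ * s) + c) ?_).1 ?_
  · refine measurableSet_le mq ?_
    have m := hb.meas
    fun_prop
  · filter_upwards [ae_restrict_mem measurableSet_Ioc] with s hs
    have h2 := ae_comp_add ((hb.le_sign hσ (t := s) ⟨hs.1.le, hs.2⟩).and (rep_ae q s)) (σ * s)
    filter_upwards [h2] with y hy
    rw [hy.2]
    convert hy.1 using 4 <;> ring

theorem charSystem (h : WeakDirac A B M T q ψ) (hD : DiracPair A B) {Φ : ℝ → ℝ → ℝ≥0∞}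
    {c N : ℝ≥0∞} (hb : TravelBound T (fun t x => M + q t x) Φ fun _ => c)
    (hT : ofReal T ≤ N) (hc : c ≤ N) (hΦ : ∀ σ, ∫⁻ x, Φ σ x ^ 2 ≤ N)
    (h0 : ‖ψ 0‖ₑ ^ 2 ≤ N) (hN : ∫⁻ t in Ioc 0 T, ‖ψ t‖ₑ ^ 2 ≤ N) :
    CharSystem T N c Φ (fun σ y => ‖comp A ψ σ 0 y‖ₑ) (fun σ t x => ‖comp A ψ σ t x‖ₑ) where
  meas_pot := hb.meas
  meas_data σ := by
    have := (stronglyMeasurable_comp A h.cont σ).comp_measurable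
      (g := fun y : ℝ => ((0 : ℝ), y)) (by fun_prop)
    exact this.enorm
  meas σ := (stronglyMeasurable_comp A h.cont σ).enorm
  time_le := hT
  const_le := hc
  pot_le := hΦ
  data_le σ hσ := (lintegral_comp_sq_le hD hσ 0).trans h0
  le σ hσ := (lintegral_mono fun t => lintegral_comp_sq_le hD hσ t).trans hN
  ineq σ hσ := by
    filter_upwards [ae_restrict_mem measurableSet_Ioc] with t ht
    filter_upwards [h.ae_pot_le hb hσ, h.duhamel hD hσ (t := t) ⟨ht.1.le, ht.2⟩] with y hy hd
    rw [hd, charMajorant]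
    refine (enorm_add_le _ _).trans ?_
    gcongr
    calc _ ≤ ∫⁻ s in Ioc 0 t, ‖source A B M q ψ σ s (y + σ * s)‖ₑ :=
          enorm_integral_le_lintegral_enorm _
      _ ≤ ∫⁻ s in Ioc 0 T, ‖source A B M q ψ σ s (y + σ * s)‖ₑ :=
          lintegral_mono_set (Ioc_subset_Ioc_right ht.2)
      _ ≤ _ := by
          apply lintegral_mono_ae
          filter_upwards [hy] with s hs
          rw [enorm_source hD]
          gcongr

end WeakDirac

end Stability

section Stability

local notation "⟪" x ", " y "⟫" => inner ℂ x y

structure BoundedDirac (A B : 𝓛) (M T : ℝ) (N c : ℝ≥0∞) (Φ : ℝ → ℝ → ℝ≥0∞)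
    (q : ℝ → RealL2) (ψ : ℝ → SpinorL2) : Prop extends WeakDirac A B M T q ψ where
  bound : TravelBound T (fun t x => M + q t x) Φ fun _ => c
  time_le : ofReal T ≤ N
  const_le : c ≤ N
  pot_le : ∀ σ, ∫⁻ x, Φ σ x ^ 2 ≤ N
  data_le : ‖ψ 0‖ₑ ^ 2 ≤ N
  le : ∫⁻ t in Ioc 0 T, ‖ψ t‖ₑ ^ 2 ≤ N

def stabConst (N : ℝ≥0∞) : ℝ≥0∞ := 4 * (N ^ (1 / 2 : ℝ) * (8 * bilinConst N) ^ (1 / 2 : ℝ))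

theorem stabConst_lt_top {N : ℝ≥0∞} (hN : N < ∞) : stabConst N < ∞ := by
  have := bilinConst_lt_top hN
  unfold stabConst
  finiteness

variable {A B : 𝓛} {M T : ℝ} {q q' : ℝ → RealL2} {ψ ψ' : ℝ → SpinorL2}
  {N c c' : ℝ≥0∞} {Φ Φ' : ℝ → ℝ → ℝ≥0∞}

theorem lintegral_add_mul_add_lt_top {a a' b b' : ℝ → ℝ → ℝ≥0∞} {S : Set ℝ}
    (ha : Measurable fun z : ℝ × ℝ => a z.1 z.2) (ha' : Measurable fun z : ℝ × ℝ => a' z.1 z.2)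
    (hb : Measurable fun z : ℝ × ℝ => b z.1 z.2) (hb' : Measurable fun z : ℝ × ℝ => b' z.1 z.2)
    (h₁ : ∫⁻ s in S, ∫⁻ x, a s x * b s x < ∞) (h₂ : ∫⁻ s in S, ∫⁻ x, a' s x * b s x < ∞)
    (h₃ : ∫⁻ s in S, ∫⁻ x, a s x * b' s x < ∞) (h₄ : ∫⁻ s in S, ∫⁻ x, a' s x * b' s x < ∞) :
    ∫⁻ s in S, ∫⁻ x, (a s x + a' s x) * (b s x + b' s x) < ∞ := by
  simp_rw [add_mul, mul_add]
  simp (discharger := fun_prop) only [lintegral_add_left]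
  rw [lintegral_add_left (by fun_prop), lintegral_add_left (by fun_prop),
    lintegral_add_left (by fun_prop)]
  finiteness

attribute [local irreducible] comp source rep

namespace BoundedDirac

theorem char (h : BoundedDirac A B M T N c Φ q ψ) (hD : DiracPair A B) :
    CharSystem T N c Φ (fun σ y => ‖comp A ψ σ 0 y‖ₑ) (fun σ t x => ‖comp A ψ σ t x‖ₑ) :=
  h.toWeakDirac.charSystem hD h.bound h.time_le h.const_le h.pot_le h.data_le h.le

theorem lintegral_pot_mul_lt_top (h : BoundedDirac A B M T N c Φ q ψ) (hN : N < ∞)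
    {f g : ℝ → ℝ → ℝ≥0∞}
    (hf : Measurable fun z : ℝ × ℝ => f z.1 z.2) (hg : Measurable fun z : ℝ × ℝ => g z.1 z.2)
    (hT0 : 0 ≤ T)
    (hf2 : ∫⁻ s in Ioc 0 T, ∫⁻ x, f s x ^ 2 < ∞) (hg2 : ∫⁻ s in Ioc 0 T, ∫⁻ x, g s x ^ 2 < ∞)
    (hfg : ∫⁻ s in Ioc 0 T, ∫⁻ x, f s x ^ 2 * g s x ^ 2 < ∞) :
    ∫⁻ s in Ioc 0 T, ∫⁻ x, ‖M + rep q s x‖ₑ * (f s x * g s x) < ∞ := by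
  have hb : TravelBound T (fun t x => M + rep q t x) Φ fun _ => c :=
    ⟨h.bound.meas, h.bound.meas_time, fun t ht => by
      filter_upwards [h.bound.le t ht, rep_ae q t] with x h1 h2
      rwa [h2]⟩
  refine (hb.lintegral_mul_le h.time_le (hf.fun_mul hg) (by simp_rw [mul_pow]; exact le_rfl)
    (right_mem_Icc.2 hT0)).trans_lt (add_lt_top.2 ⟨?_, ?_⟩)
  · have := fun σ => (h.pot_le σ).trans_lt hN
    unfold profileNorm
    finiteness [this 1, this (-1)]
  · calc ∫⁻ s in Ioc 0 T, c * ∫⁻ x, f s x * g s x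
        ≤ ∫⁻ s in Ioc 0 T, c * ((∫⁻ x, f s x ^ 2) + ∫⁻ x, g s x ^ 2) := by
          refine lintegral_mono fun s => mul_le_mul_right ?_ c
          rw [← lintegral_add_left (by fun_prop)]
          exact lintegral_mono fun x => mul_le_sq_add_sq _ _
      _ = c * ((∫⁻ s in Ioc 0 T, ∫⁻ x, f s x ^ 2) + ∫⁻ s in Ioc 0 T, ∫⁻ x, g s x ^ 2) := by
          rw [lintegral_const_mul _ (by fun_prop), lintegral_add_left (by fun_prop)]
      _ < ∞ := by finiteness [h.const_le.trans_lt hN]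

theorem lintegral_comp_mul_source_lt_top (h : BoundedDirac A B M T N c Φ q ψ)
    (h' : BoundedDirac A B M T N c' Φ' q' ψ') (hD : DiracPair A B) (hN : N < ∞) (hT0 : 0 ≤ T)
    {σ : ℝ} (hσ : σ = 1 ∨ σ = -1) :
    ∫⁻ s in Ioc 0 T, ∫⁻ x, ‖comp A ψ' σ s x‖ₑ * ‖source A B M q ψ σ s x‖ₑ < ∞ := by
  have := h.lintegral_pot_mul_lt_top hN (f := fun s x => ‖comp A ψ' σ s x‖ₑ)
    (g := fun s x => ‖comp A ψ (-σ) s x‖ₑ)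
    (stronglyMeasurable_comp A h'.cont σ).enorm (stronglyMeasurable_comp A h.cont (-σ)).enorm
    hT0 (((h'.char hD).le σ hσ).trans_lt hN) (((h.char hD).le (-σ) (sign_neg hσ)).trans_lt hN)
    (((h'.char hD).lintegral_mul_le (h.char hD) hσ).trans_lt (bilinConst_lt_top hN))
  refine lt_of_le_of_lt (lintegral_mono fun s => lintegral_mono fun x => le_of_eq ?_) this
  rw [enorm_source hD]
  ring

theorem enorm_sub_sq_le_lintegral (h : BoundedDirac A B M T N c Φ q ψ)
    (h' : BoundedDirac A B M T N c' Φ' q' ψ') (hD : DiracPair A B) (hN : N < ∞)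
    {t : ℝ} (ht : t ∈ Icc 0 T) : ‖ψ t - ψ' t‖ₑ ^ 2 ≤ ‖ψ 0 - ψ' 0‖ₑ ^ 2 +
      2 * ∫⁻ s in Ioc 0 t, ∫⁻ x, ‖rep q s x - rep q' s x‖ₑ *
        (‖comp A ψ 1 s x - comp A ψ' 1 s x‖ₑ * ‖comp A ψ' (-1) s x‖ₑ +
         ‖comp A ψ (-1) s x - comp A ψ' (-1) s x‖ₑ * ‖comp A ψ' 1 s x‖ₑ) := by
  have hT0 : 0 ≤ T := ht.1.trans ht.2
  have hsub : Ioc 0 t ⊆ Ioc 0 T := Ioc_subset_Ioc_right ht.2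
  set U : ℝ → ℝ → ℝ → Spinor := fun σ s x => comp A ψ σ s x - comp A ψ' σ s x with hU
  set S : ℝ → ℝ → ℝ → Spinor := fun σ s x => source A B M q ψ σ s x - source A B M q' ψ' σ s x with hS
  have mU : ∀ σ, StronglyMeasurable fun z : ℝ × ℝ => U σ z.1 z.2 := fun σ =>
    (stronglyMeasurable_comp A h.cont σ).sub (stronglyMeasurable_comp A h'.cont σ)
  have mS : ∀ σ, StronglyMeasurable fun z : ℝ × ℝ => S σ z.1 z.2 := fun σ =>
    (stronglyMeasurable_source A B M h.cont_pot h.cont σ).sub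
      (stronglyMeasurable_source A B M h'.cont_pot h'.cont σ)
  have hfin : ∀ σ, σ = 1 ∨ σ = -1 → ∫⁻ s in Ioc 0 T, ∫⁻ x, ‖U σ s x‖ₑ * ‖S σ s x‖ₑ < ∞ := by
    intro σ hσ
    have mc := (stronglyMeasurable_comp A h.cont σ).enorm
    have mc' := (stronglyMeasurable_comp A h'.cont σ).enorm
    have ms := (stronglyMeasurable_source A B M h.cont_pot h.cont σ).enorm
    have ms' := (stronglyMeasurable_source A B M h'.cont_pot h'.cont σ).enorm
    exact (lintegral_mono fun s => lintegral_mono fun x => mul_le_mul' enorm_sub_le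
      enorm_sub_le).trans_lt (lintegral_add_mul_add_lt_top mc mc' ms ms'
        (h.lintegral_comp_mul_source_lt_top h hD hN hT0 hσ)
        (h.lintegral_comp_mul_source_lt_top h' hD hN hT0 hσ)
        (h'.lintegral_comp_mul_source_lt_top h hD hN hT0 hσ)
        (h'.lintegral_comp_mul_source_lt_top h' hD hN hT0 hσ))
  have hen : ∀ σ, σ = 1 ∨ σ = -1 → ∫ x, ‖U σ t x‖ ^ 2 = (∫ x, ‖U σ 0 x‖ ^ 2) +
      2 * ∫ s in Ioc 0 t, ∫ x, re ⟪U σ s x, S σ s x⟫ := by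
    intro σ hσ
    have hi : ∀ᵐ y : ℝ, IntegrableOn (fun s => S σ s (y + σ * s)) (Ioc 0 T) := by
      filter_upwards [h.integrableOn_source σ, h'.integrableOn_source σ] with y h1 h2
      exact h1.sub h2
    refine integral_normSq_transport (mU σ) (mS σ) (fun t ht => ?_) hi
      ((memLp_comp A ψ σ 0).sub (memLp_comp A ψ' σ 0)) (hfin σ hσ) ht
    filter_upwards [h.duhamel hD hσ ht, h'.duhamel hD hσ ht, h.integrableOn_source σ,
      h'.integrableOn_source σ] with y h1 h2 h3 h4
    have hsub : Ioc 0 t ⊆ Ioc 0 T := Ioc_subset_Ioc_right ht.2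
    simp only [hU, hS]
    rw [h1, h2, integral_sub (h3.mono_set hsub) (h4.mono_set hsub)]
    abel
  have hF : ∀ σ, σ = 1 ∨ σ = -1 → Integrable (fun z : ℝ × ℝ => re ⟪U σ z.1 z.2, S σ z.1 z.2⟫)
      ((volume.restrict (Ioc 0 t)).prod volume) := by
    intro σ hσ
    have mm : StronglyMeasurable fun z : ℝ × ℝ => re ⟪U σ z.1 z.2, S σ z.1 z.2⟫ :=
      Complex.continuous_re.comp_stronglyMeasurable ((mU σ).inner (mS σ))
    refine ⟨mm.aestronglyMeasurable, ?_⟩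
    rw [HasFiniteIntegral, lintegral_prod _ mm.aestronglyMeasurable.enorm]
    refine lt_of_le_of_lt ?_ (hfin σ hσ)
    exact (lintegral_mono_set hsub).trans'
      (lintegral_mono fun s => lintegral_mono fun y => enorm_re_inner_le _ _)
  have hnorm : ∀ s, ∫ x, ‖U 1 s x‖ ^ 2 + ‖U (-1) s x‖ ^ 2 = ‖ψ s - ψ' s‖ ^ 2 := by
    intro s
    have h1 := @inner_self_eq_norm_sq ℂ SpinorL2 _ _ _ (ψ s - ψ' s)
    rw [L2.inner_def] at h1
    rw [← h1, ← integral_re (L2.integrable_inner _ _)]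
    apply integral_congr_ae
    filter_upwards [rep_ae ψ s, rep_ae ψ' s, coeFn_sub (ψ s) (ψ' s)] with x h2 h3 h4
    rw [inner_self_eq_norm_sq (𝕜 := ℂ), h4, Pi.sub_apply, ← hD.normSq_half_add (Or.inl rfl) (ψ s x - ψ' s x), hU]
    simp only [comp, h2, h3, map_sub]
  have i0 : ∀ σ s, Integrable (fun x => ‖U σ s x‖ ^ 2) volume := fun σ s =>
    ((memLp_comp A ψ σ s).sub (memLp_comp A ψ' σ s)).integrable_norm_pow (by norm_num)
  have hsum : ‖ψ t - ψ' t‖ ^ 2 = ‖ψ 0 - ψ' 0‖ ^ 2 + 2 * ∫ z, (re ⟪U 1 z.1 z.2, S 1 z.1 z.2⟫ +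
      re ⟪U (-1) z.1 z.2, S (-1) z.1 z.2⟫) ∂((volume.restrict (Ioc 0 t)).prod volume) := by
    have p1 := hF 1 (Or.inl rfl)
    have p2 := hF (-1) (Or.inr rfl)
    rw [← hnorm, ← hnorm, integral_add (i0 _ _) (i0 _ _), integral_add (i0 _ _) (i0 _ _),
      hen 1 (Or.inl rfl), hen (-1) (Or.inr rfl), integral_add p1 p2, integral_prod _ p1,
      integral_prod _ p2]
    ring
  have hpt : ∀ s x, re ⟪U 1 s x, S 1 s x⟫ + re ⟪U (-1) s x, S (-1) s x⟫ =
      re (-(I * ((rep q s x - rep q' s x : ℝ) : ℂ)) * (⟪U 1 s x, half A 1 (B (rep ψ' s x))⟫ +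
        ⟪U (-1) s x, half A (-1) (B (rep ψ' s x))⟫)) := by
    intro s x
    set w := rep ψ s x - rep ψ' s x with hw
    set v := rep ψ' s x with hv
    have e1 : ∀ σ, U σ s x = half A σ w := fun σ => by simp only [hU, comp, hw, hv, map_sub]
    have e2 : ∀ σ, S σ s x = (-(I * ((M + rep q s x : ℝ) : ℂ))) • half A σ (B w) +
        (-(I * ((rep q s x - rep q' s x : ℝ) : ℂ))) • half A σ (B v) := by
      intro σ
      simp only [hS, source, hw, map_sub]
      push_cast
      module
    have e3 := hD.inner_half_add (Or.inl rfl) w (B w)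
    simp only [e1, e2, inner_add_right, inner_smul_right]
    rw [← add_re]
    have e4 : (-(I * ((M + rep q s x : ℝ) : ℂ)) * ⟪half A 1 w, half A 1 (B w)⟫ +
        -(I * ((M + rep q s x : ℝ) : ℂ)) * ⟪half A (-1) w, half A (-1) (B w)⟫).re = 0 := by
      rw [← mul_add, e3]
      simp [hD.inner_right_im w]
    rw [← sub_eq_zero, ← sub_re, ← e4]
    congr 1
    ring
  have hG : ∀ s x, ‖re ⟪U 1 s x, S 1 s x⟫ + re ⟪U (-1) s x, S (-1) s x⟫‖ₑ ≤
      ‖rep q s x - rep q' s x‖ₑ * (‖U 1 s x‖ₑ * ‖comp A ψ' (-1) s x‖ₑ + ‖U (-1) s x‖ₑ * ‖comp A ψ' 1 s x‖ₑ) := by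
    intro s x
    rw [hpt]
    have hb : ∀ σ, ‖half A σ (B (rep ψ' s x))‖ₑ = ‖comp A ψ' (-σ) s x‖ₑ := fun σ => by
      rw [comp, hD.half_right, ← enorm_norm, hD.norm_right, enorm_norm]
    refine (enorm_re_le _).trans ?_
    rw [enorm_mul, enorm_neg_I_mul, ← hb 1, ← neg_neg (1 : ℝ), ← hb (-1), neg_neg]
    gcongr
    exact (enorm_add_le _ _).trans (add_le_add (enorm_inner_le _ _) (enorm_inner_le _ _))
  have hq := stronglyMeasurable_rep h.cont_pot
  have hq' := stronglyMeasurable_rep h'.cont_pot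
  calc ‖ψ t - ψ' t‖ₑ ^ 2 = ofReal (‖ψ t - ψ' t‖ ^ 2) := by
        rw [ofReal_pow (norm_nonneg _), ofReal_norm]
    _ ≤ ofReal (‖ψ 0 - ψ' 0‖ ^ 2) + ofReal (2 * ∫ z, (re ⟪U 1 z.1 z.2, S 1 z.1 z.2⟫ +
      re ⟪U (-1) z.1 z.2, S (-1) z.1 z.2⟫) ∂((volume.restrict (Ioc 0 t)).prod volume)) := by
        rw [hsum]
        exact ENNReal.ofReal_add_le
    _ ≤ _ := by
        rw [ofReal_pow (norm_nonneg _), ofReal_norm, ofReal_mul (by norm_num), ofReal_ofNat]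
        gcongr
        have mc := fun σ => (stronglyMeasurable_comp A h'.cont σ).measurable
        have m1 := hq.measurable
        have m2 := hq'.measurable
        have m3 := fun σ => (mU σ).measurable
        rw [← lintegral_prod (fun z : ℝ × ℝ => ‖rep q z.1 z.2 - rep q' z.1 z.2‖ₑ *
          (‖U 1 z.1 z.2‖ₑ * ‖comp A ψ' (-1) z.1 z.2‖ₑ + ‖U (-1) z.1 z.2‖ₑ * ‖comp A ψ' 1 z.1 z.2‖ₑ))
          (by fun_prop)]
        refine (Real.ofReal_le_enorm _).trans ((enorm_integral_le_lintegral_enorm _).trans ?_)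
        exact lintegral_mono fun z => hG z.1 z.2

end BoundedDirac

end Stability

section Stability

variable {A B : 𝓛} {M T : ℝ} {q q' : ℝ → RealL2} {ψ ψ' : ℝ → SpinorL2}
  {N c c' : ℝ≥0∞} {Φ Φ' : ℝ → ℝ → ℝ≥0∞}

theorem smulL1_zero (q : RealL2) : smulL1 q 0 = 0 := by rw [smulL1, map_zero]

theorem weakDirac_zero (hq : Continuous q) : WeakDirac A B M T q fun _ => 0 where
  cont := continuous_const
  cont_pot := hq
  eq g t _ := by
    have h1 : ∀ g, spinorDist 0 g = 0 := fun g => by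
      rw [spinorDist, toTemperedDistribution_eq_pairL2, map_zero]
    have h2 : toTemperedDistribution (0 : Lp Spinor 1 vol) g = 0 := by
      rw [← Lp.toTemperedDistributionCLM_apply, map_zero]; rfl
    simp only [h1, smulL1_zero, h2, map_zero, smul_zero, sub_zero]
    exact hasDerivWithinAt_const _ _ _

attribute [local irreducible] comp source rep

namespace BoundedDirac

theorem zero (h : BoundedDirac A B M T N c Φ q ψ) : BoundedDirac A B M T N c Φ q fun _ => 0 where
  toWeakDirac := weakDirac_zero h.cont_pot
  bound := h.bound
  time_le := h.time_le
  const_le := h.const_le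
  pot_le := h.pot_le
  data_le := by simp
  le := by simp

theorem norm_le (h : BoundedDirac A B M T N c Φ q ψ) (hD : DiracPair A B) (hN : N < ∞)
    {t : ℝ} (ht : t ∈ Icc 0 T) : ‖ψ t‖ ≤ ‖ψ 0‖ := by
  have h1 := h.enorm_sub_sq_le_lintegral h.zero hD hN ht
  simp only [sub_self, enorm_zero, zero_mul, lintegral_zero, mul_zero, add_zero, sub_zero] at h1
  rw [← enorm_le_iff_norm_le]
  exact le_of_not_gt fun h2 => absurd h1 (not_le.2 (by gcongr))

theorem enorm_sub_sq_le (h : BoundedDirac A B M T N c Φ q ψ)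
    (h' : BoundedDirac A B M T N c' Φ' q' ψ') (hD : DiracPair A B) (hN : N < ∞)
    {P : ℝ → ℝ → ℝ≥0∞} {η : ℝ → ℝ≥0∞} (hδ : TravelBound T (fun t x => q t x - q' t x) P η)
    {t : ℝ} (ht : t ∈ Icc 0 T) : ‖ψ t - ψ' t‖ₑ ^ 2 ≤ ‖ψ 0 - ψ' 0‖ₑ ^ 2 +
      profileNorm P * stabConst N +
      4 * ∫⁻ s in Ioc 0 t, η s * (‖ψ s - ψ' s‖ₑ * ‖ψ' s‖ₑ) := by
  refine (h.enorm_sub_sq_le_lintegral h' hD hN ht).trans ?_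
  rw [add_assoc]
  gcongr
  have hb : TravelBound T (fun t x => rep q t x - rep q' t x) P η :=
    ⟨hδ.meas, hδ.meas_time, fun t ht => by
      filter_upwards [hδ.le t ht, rep_ae q t, rep_ae q' t] with x h1 h2 h3
      rwa [h2, h3]⟩
  have mc := fun σ => (stronglyMeasurable_comp A h.cont σ).measurable
  have mc' := fun σ => (stronglyMeasurable_comp A h'.cont σ).measurable
  have m1 := (stronglyMeasurable_rep h.cont_pot).measurable
  have m2 := (stronglyMeasurable_rep h'.cont_pot).measurable
  have key : ∀ σ, σ = 1 ∨ σ = -1 → ∫⁻ s in Ioc 0 t, ∫⁻ x, ‖rep q s x - rep q' s x‖ₑ *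
      (‖comp A ψ σ s x - comp A ψ' σ s x‖ₑ * ‖comp A ψ' (-σ) s x‖ₑ) ≤
      profileNorm P * (N ^ (1 / 2 : ℝ) * (8 * bilinConst N) ^ (1 / 2 : ℝ)) +
      ∫⁻ s in Ioc 0 t, η s * (‖ψ s - ψ' s‖ₑ * ‖ψ' s‖ₑ) := by
    intro σ hσ
    have hK : ∫⁻ s in Ioc 0 T, ∫⁻ x, (‖comp A ψ σ s x - comp A ψ' σ s x‖ₑ *
        ‖comp A ψ' (-σ) s x‖ₑ) ^ 2 ≤ 8 * bilinConst N := by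
      have b1 := (h.char hD).lintegral_mul_le (h'.char hD) hσ
      have b2 := (h'.char hD).lintegral_mul_le (h'.char hD) hσ
      calc _ ≤ ∫⁻ s in Ioc 0 T, ∫⁻ x, 4 * (‖comp A ψ σ s x‖ₑ ^ 2 * ‖comp A ψ' (-σ) s x‖ₑ ^ 2 +
              ‖comp A ψ' σ s x‖ₑ ^ 2 * ‖comp A ψ' (-σ) s x‖ₑ ^ 2) := by
            gcongr with s x
            rw [mul_pow, ← add_mul, ← mul_assoc]
            gcongr
            exact (pow_le_pow_left' enorm_sub_le 2).trans (add_sq_le_four _ _)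
        _ ≤ 4 * (bilinConst N + bilinConst N) := by
            simp_rw [fun s => lintegral_const_mul (μ := volume) 4 (f := fun x =>
              ‖comp A ψ σ s x‖ₑ ^ 2 * ‖comp A ψ' (-σ) s x‖ₑ ^ 2 +
              ‖comp A ψ' σ s x‖ₑ ^ 2 * ‖comp A ψ' (-σ) s x‖ₑ ^ 2) (by fun_prop),
              fun s => lintegral_add_left (μ := volume) (f := fun x =>
              ‖comp A ψ σ s x‖ₑ ^ 2 * ‖comp A ψ' (-σ) s x‖ₑ ^ 2) (by fun_prop)]
            rw [lintegral_const_mul _ (by fun_prop), lintegral_add_left (by fun_prop)]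
            gcongr
        _ = _ := by ring
    refine (hb.lintegral_mul_le h.time_le (f := fun s x => ‖comp A ψ σ s x - comp A ψ' σ s x‖ₑ *
      ‖comp A ψ' (-σ) s x‖ₑ) (by fun_prop) hK ht).trans ?_
    gcongr with s
    refine (lintegral_mul_le_sqrt volume (by fun_prop) (by fun_prop)).trans ?_
    have sq : ∀ {x y : ℝ≥0∞}, x ≤ y ^ 2 → x ^ (1 / 2 : ℝ) ≤ y := fun {x y} hxy => by
      rwa [one_div, ENNReal.rpow_inv_le_iff two_pos, ENNReal.rpow_two]
    gcongr
    · apply sq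
      rw [enorm_sq_lp]
      apply lintegral_mono_ae
      filter_upwards [rep_ae ψ s, rep_ae ψ' s, coeFn_sub (ψ s) (ψ' s)] with x h2 h3 h4
      rw [h4, Pi.sub_apply, comp, comp, h2, h3, ← map_sub]
      gcongr
      exact enorm_le_iff_norm_le.2 (hD.norm_half_le hσ _)
    · exact sq (lintegral_comp_sq_le hD (sign_neg hσ) s)
  have k1 := key 1 (Or.inl rfl)
  have k2 := key (-1) (Or.inr rfl)
  rw [neg_neg] at k2
  simp_rw [mul_add, fun s => lintegral_add_left (μ := volume) (f := fun x =>
    ‖rep q s x - rep q' s x‖ₑ * (‖comp A ψ 1 s x - comp A ψ' 1 s x‖ₑ * ‖comp A ψ' (-1) s x‖ₑ))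
    (by fun_prop)]
  rw [lintegral_add_left (by fun_prop), stabConst, mul_add]
  refine (add_le_add (mul_le_mul_right k1 2) (mul_le_mul_right k2 2)).trans (le_of_eq ?_)
  ring

theorem norm_sub_sq_le (h : BoundedDirac A B M T N c Φ q ψ)
    (h' : BoundedDirac A B M T N c' Φ' q' ψ') (hD : DiracPair A B) (hN : N < ∞)
    {P : ℝ → ℝ → ℝ≥0∞} {e : ℝ → ℝ} (he : Continuous e) (he0 : ∀ s, 0 ≤ e s)
    (hδ : TravelBound T (fun t x => q t x - q' t x) P fun s => ofReal (e s))
    {δ R : ℝ} (hP : profileNorm P * stabConst N ≤ ofReal (δ ^ 2)) (hR : 0 ≤ R)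
    (hψ' : ∀ s ∈ Icc 0 T, ‖ψ' s‖ ≤ R) (h0 : ψ 0 = ψ' 0)
    {t : ℝ} (ht : t ∈ Icc 0 T) :
    ‖ψ t - ψ' t‖ ^ 2 ≤ δ ^ 2 + 4 * R * ∫ s in 0..t, e s * ‖ψ s - ψ' s‖ := by
  have hc : Continuous fun s => e s * ‖ψ s - ψ' s‖ := he.mul (h.cont.sub h'.cont).norm
  have hnn : 0 ≤ ∫ s in 0..t, e s * ‖ψ s - ψ' s‖ :=
    intervalIntegral.integral_nonneg ht.1 fun s _ => mul_nonneg (he0 s) (norm_nonneg _)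
  have h1 := h.enorm_sub_sq_le h' hD hN hδ ht
  have h2 : ∫⁻ s in Ioc 0 t, ofReal (e s) * (‖ψ s - ψ' s‖ₑ * ‖ψ' s‖ₑ) ≤
      ofReal (R * ∫ s in 0..t, e s * ‖ψ s - ψ' s‖) := by
    rw [integral_of_le ht.1, ← integral_const_mul, ofReal_integral_eq_lintegral_ofReal]
    · refine setLIntegral_mono' measurableSet_Ioc fun s hs => ?_
      rw [← ofReal_norm, ← ofReal_norm, ← ofReal_mul (norm_nonneg _), ← ofReal_mul (he0 s)]
      apply ofReal_le_ofReal
      have := hψ' s ⟨hs.1.le, hs.2.trans ht.2⟩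
      calc e s * (‖ψ s - ψ' s‖ * ‖ψ' s‖) ≤ e s * (‖ψ s - ψ' s‖ * R) := by
            gcongr; exact he0 s
        _ = _ := by ring
    · exact ((hc.const_mul R).integrableOn_Icc (a := 0) (b := t)).mono_set Ioc_subset_Icc_self
    · exact Eventually.of_forall fun s => mul_nonneg hR (mul_nonneg (he0 s) (norm_nonneg _))
  have h3 : ofReal (‖ψ t - ψ' t‖ ^ 2) ≤
      ofReal (δ ^ 2 + 4 * R * ∫ s in 0..t, e s * ‖ψ s - ψ' s‖) := by
    rw [ofReal_pow (norm_nonneg _), ofReal_norm, ofReal_add (sq_nonneg _)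
      (by positivity), mul_assoc, ofReal_mul (by norm_num), ofReal_ofNat]
    refine h1.trans ?_
    rw [h0, sub_self, enorm_zero, zero_pow two_ne_zero, zero_add]
    gcongr
  exact (ENNReal.ofReal_le_ofReal_iff (by positivity)).1 h3

end BoundedDirac

theorem integral_le_exp {d : ℝ → ℝ} (hd : Continuous d) {l D : ℝ} (hl : 0 < l) (hD : 0 ≤ D)
    (h : ∀ s ∈ Icc 0 T, d s ≤ D * exp (l * s)) {t : ℝ} (ht : t ∈ Icc 0 T) :
    ∫ s in 0..t, d s ≤ D / l * exp (l * t) := by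
  calc ∫ s in 0..t, d s ≤ ∫ s in 0..t, D * exp (l * s) := by
        refine integral_mono_on ht.1 (hd.intervalIntegrable _ _)
          ((by fun_prop : Continuous fun s => D * exp (l * s)).intervalIntegrable _ _)
          fun s hs => h s ⟨hs.1, hs.2.trans ht.2⟩
    _ = D * ((exp (l * t) - 1) / l) := by
        rw [intervalIntegral.integral_const_mul]
        congr 1
        rw [intervalIntegral.integral_comp_mul_left exp hl.ne', integral_exp]
        simp [div_eq_inv_mul]
    _ ≤ D * (exp (l * t) / l) := by gcongr; linarith
    _ = _ := by ring

theorem le_exp_of_sq_le_integral {d e : ℝ → ℝ} (hd : Continuous d) (he : Continuous e)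
    (hd0 : ∀ t, 0 ≤ d t) {l δ C E : ℝ} (hl : 0 < l) (hδ : 0 ≤ δ) (hC : 0 ≤ C) (hE0 : 0 ≤ E)
    (h : ∀ t ∈ Icc 0 T, d t ^ 2 ≤ δ ^ 2 + C * ∫ s in 0..t, e s * d s)
    (hE : ∀ s ∈ Icc 0 T, e s ≤ E * exp (l * s)) :
    ∀ t ∈ Icc 0 T, d t ≤ (δ + C * E / (2 * l)) * exp (l * t) := by
  intro t ht
  have hne : (Icc 0 T).Nonempty := ⟨t, ht⟩
  obtain ⟨r, hr, hmax⟩ := isCompact_Icc.exists_isMaxOn hne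
    (f := fun t => d t * exp (-(l * t))) (by fun_prop)
  set m := d r * exp (-(l * r)) with hm
  have hdm : ∀ s ∈ Icc 0 T, d s ≤ m * exp (l * s) := by
    intro s hs
    have := hmax hs
    simp only [mem_ofPred_eq] at this
    calc d s = d s * exp (-(l * s)) * exp (l * s) := by
          rw [mul_assoc, ← exp_add]; simp
      _ ≤ _ := by gcongr
  have hm0 : 0 ≤ m := mul_nonneg (hd0 r) (Real.exp_nonneg _)
  have hint : ∫ s in 0..r, e s * d s ≤ E * m / (2 * l) * exp (2 * (l * r)) := by
    rw [← mul_assoc 2]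
    refine integral_le_exp (l := 2 * l) (D := E * m) (he.fun_mul hd) (by positivity) (by positivity)
      (fun s hs => ?_) hr
    calc e s * d s ≤ (E * exp (l * s)) * (m * exp (l * s)) :=
          mul_le_mul (hE s hs) (hdm s hs) (hd0 s) (by positivity)
      _ = E * m * exp (2 * l * s) := by rw [show 2 * l * s = l * s + l * s by ring, exp_add]; ring
  have hsq : m ^ 2 ≤ δ ^ 2 + C * E / (2 * l) * m := by
    have h1 := h r hr
    have h2 : exp (2 * (l * r)) * exp (-(l * r)) ^ 2 = 1 := by
      rw [← Real.exp_nat_mul, ← exp_add]; simp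
    have h3 : exp (-(l * r)) ^ 2 ≤ 1 := by
      refine pow_le_one₀ (Real.exp_nonneg _) (Real.exp_le_one_iff.2 ?_)
      have := mul_nonneg hl.le hr.1
      linarith
    calc m ^ 2 = d r ^ 2 * exp (-(l * r)) ^ 2 := by rw [hm, mul_pow]
      _ ≤ (δ ^ 2 + C * (E * m / (2 * l) * exp (2 * (l * r)))) * exp (-(l * r)) ^ 2 := by
          gcongr
          exact h1.trans (by gcongr)
      _ = δ ^ 2 * exp (-(l * r)) ^ 2 + C * E / (2 * l) * m *
          (exp (2 * (l * r)) * exp (-(l * r)) ^ 2) := by ring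
      _ ≤ δ ^ 2 * 1 + C * E / (2 * l) * m * 1 := by rw [h2]; gcongr
      _ = _ := by ring
  have ha : 0 ≤ C * E / (2 * l) := by positivity
  have hmle : m ≤ δ + C * E / (2 * l) := by
    by_contra! hlt
    nlinarith
  exact (hdm t ht).trans (by gcongr)

end Stability

section Volterra

def clip (T t : ℝ) : ℝ := max 0 (min t T)

theorem continuous_clip (T : ℝ) : Continuous (clip T) := by unfold clip; fun_prop

theorem clip_mem {T : ℝ} (hT : 0 ≤ T) (t : ℝ) : clip T t ∈ Icc 0 T :=
  ⟨le_max_left _ _, max_le hT (min_le_right _ _)⟩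

theorem clip_of_mem {T t : ℝ} (ht : t ∈ Icc 0 T) : clip T t = t := by
  rw [clip, min_eq_left ht.2, max_eq_right ht.1]

variable {H : Type*} [NormedAddCommGroup H] [NormedSpace ℝ H] [CompleteSpace H]

theorem exists_hasDerivWithinAt_of_lipschitz {L : ℝ → H → H} {K : ℝ} (hK : 0 ≤ K)
    (hL : ∀ u : ℝ → H, Continuous u → Continuous fun s => L s (u s))
    (hlip : ∀ s x y, ‖L s x - L s y‖ ≤ K * ‖x - y‖) (x₀ : H) {T : ℝ} (hT : 0 ≤ T) :
    ∃ u : ℝ → H, Continuous u ∧ u 0 = x₀ ∧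
      ∀ t ∈ Icc 0 T, HasDerivWithinAt u (L t (u t)) (Icc 0 T) t := by
  let p : ℕ → ℝ → H := fun n => Nat.rec (fun _ => x₀)
    (fun _ f t => x₀ + ∫ s in 0..clip T t, L s (f s)) n
  have p1 : ∀ n t, p (n + 1) t = x₀ + ∫ s in 0..clip T t, L s (p n s) := fun n t => rfl
  have pc : ∀ n, Continuous (p n) := by
    intro n
    induction n with
    | zero => fun_prop
    | succ n ih =>
      have h1 := continuous_primitive (μ := volume)
        (fun a b => (hL _ ih).intervalIntegrable a b) 0
      exact continuous_const.add (h1.comp (continuous_clip T))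
  obtain ⟨C, hC⟩ := isCompact_Icc.exists_bound_of_continuousOn (s := Icc 0 T)
    (hL (fun _ => x₀) continuous_const).continuousOn
  have hC0 : 0 ≤ C := (norm_nonneg _).trans (hC 0 ⟨le_rfl, hT⟩)
  have hstep : ∀ n t, ‖p (n + 1) t - p n t‖ ≤ C * T * ((K * clip T t) ^ n / n.factorial) := by
    intro n
    induction n with
    | zero =>
      intro t
      have : p (0 + 1) t - p 0 t = ∫ s in 0..clip T t, L s x₀ := by
        rw [p1]; exact add_sub_cancel_left _ _
      rw [this]
      have h1 := clip_mem hT t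
      refine (intervalIntegral.norm_integral_le_of_norm_le_const (C := C) fun s hs => ?_).trans ?_
      · rw [uIoc_of_le h1.1] at hs
        exact hC s ⟨hs.1.le, hs.2.trans h1.2⟩
      · rw [sub_zero, abs_of_nonneg h1.1]
        simp only [pow_zero, Nat.factorial_zero, Nat.cast_one, div_one, mul_one]
        exact mul_le_mul_of_nonneg_left h1.2 hC0
    | succ n ih =>
      intro t
      have h1 := clip_mem hT t
      have e : p (n + 1 + 1) t - p (n + 1) t =
          ∫ s in 0..clip T t, (L s (p (n + 1) s) - L s (p n s)) := by
        rw [p1 (n + 1), p1 n, add_sub_add_left_eq_sub]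
        exact (intervalIntegral.integral_sub ((hL _ (pc (n + 1))).intervalIntegrable _ _)
          ((hL _ (pc n)).intervalIntegrable _ _)).symm
      rw [e]
      have hcont : Continuous fun s : ℝ => K * (C * T * ((K * s) ^ n / n.factorial)) := by fun_prop
      refine (intervalIntegral.norm_integral_le_of_norm_le h1.1
        (g := fun s => K * (C * T * ((K * s) ^ n / n.factorial))) (.of_forall fun s hs => ?_)
        (hcont.intervalIntegrable _ _)).trans ?_
      · have h2 := ih s
        rw [clip_of_mem ⟨hs.1.le, hs.2.trans h1.2⟩] at h2
        exact (hlip _ _ _).trans (mul_le_mul_of_nonneg_left h2 hK)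
      · apply le_of_eq
        have : (fun s : ℝ => K * (C * T * ((K * s) ^ n / n.factorial))) =
            fun s => (K ^ (n + 1) * (C * T) / n.factorial) * s ^ n := by
          ext s; rw [mul_pow]; ring
        rw [this, intervalIntegral.integral_const_mul, integral_pow, Nat.factorial_succ, mul_pow]
        push_cast
        have : (n.factorial : ℝ) ≠ 0 := by positivity
        field_simp
        ring
  set d : ℕ → ℝ := fun n => C * T * ((K * T) ^ n / n.factorial) with hd
  have hds : Summable d := (Real.summable_pow_div_factorial (K * T)).mul_left (C * T)
  have hdist : ∀ t n, dist (p n t) (p n.succ t) ≤ d n := by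
    intro t n
    rw [dist_comm, dist_eq_norm]
    refine (hstep n t).trans ?_
    have := clip_mem hT t
    exact mul_le_mul_of_nonneg_left (div_le_div_of_nonneg_right (pow_le_pow_left₀
      (mul_nonneg hK this.1) (mul_le_mul_of_nonneg_left this.2 hK) n) (by positivity))
      (mul_nonneg hC0 hT)
  have hex : ∀ t, ∃ a, Tendsto (fun n => p n t) atTop (𝓝 a) := fun t =>
    cauchySeq_tendsto_of_complete (cauchySeq_of_dist_le_of_summable d (hdist t) hds)
  choose u hu using hex
  have hr : ∀ t n, dist (p n t) (u t) ≤ ∑' m, d (n + m) := fun t n =>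
    dist_le_tsum_of_dist_le_of_tendsto d (hdist t) hds (hu t) n
  have hr0 : Tendsto (fun n => ∑' m, d (n + m)) atTop (𝓝 0) := by
    have := tendsto_sum_nat_add d
    simpa only [add_comm] using this
  have hunif : TendstoUniformly p u atTop := by
    rw [Metric.tendstoUniformly_iff]
    intro ε hε
    filter_upwards [hr0.eventually (gt_mem_nhds hε)] with n hn t
    rw [dist_comm]
    exact (hr t n).trans_lt hn
  have uc : Continuous u := hunif.continuous (Eventually.of_forall pc).frequently
  have hint : ∀ t, u t = x₀ + ∫ s in 0..clip T t, L s (u s) := by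
    intro t
    refine tendsto_nhds_unique ((tendsto_add_atTop_iff_nat 1).2 (hu t)) ?_
    simp only [p1]
    refine tendsto_const_nhds.add ?_
    rw [tendsto_iff_norm_sub_tendsto_zero]
    have h1 := clip_mem hT t
    refine squeeze_zero (g := fun n => K * (∑' m, d (n + m)) * |clip T t - 0|) (fun n => norm_nonneg _)
      (fun n => ?_) ?_
    · rw [← intervalIntegral.integral_sub
          ((hL _ (pc _)).intervalIntegrable _ _) ((hL _ uc).intervalIntegrable _ _)]
      refine intervalIntegral.norm_integral_le_of_norm_le_const fun s _ => ?_
      refine (hlip _ _ _).trans (mul_le_mul_of_nonneg_left ?_ hK)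
      rw [← dist_eq_norm]; exact hr s n
    · simpa using (hr0.const_mul K).mul_const |clip T t - 0|
  refine ⟨u, uc, ?_, fun t ht => ?_⟩
  · rw [hint, clip_of_mem ⟨le_rfl, hT⟩]; simp
  · have h1 : HasDerivAt (fun t => x₀ + ∫ s in 0..t, L s (u s)) (L t (u t)) t :=
      (integral_hasDerivAt_right ((hL _ uc).intervalIntegrable _ _)
        ((hL _ uc).stronglyMeasurableAtFilter _ _) (hL _ uc).continuousAt).const_add x₀
    refine h1.hasDerivWithinAt.congr (fun s hs => ?_) ?_
    · rw [hint, clip_of_mem hs]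
    · rw [hint, clip_of_mem ht]

end Volterra

section Clamp

def clamp (K r : ℝ) : ℝ := max (min r K) (-K)

theorem abs_clamp_le (K r : ℝ) : |clamp K r| ≤ |K| := by
  rw [clamp]
  rcases le_total 0 K with h | h
  · rw [abs_of_nonneg h, abs_le]
    exact ⟨le_max_right _ _, max_le (min_le_right _ _) (by linarith)⟩
  · rw [max_eq_right ((min_le_right _ _).trans (by linarith)), abs_neg]

theorem abs_clamp_sub_le (K r s : ℝ) : |clamp K r - clamp K s| ≤ |r - s| := by
  refine (abs_max_sub_max_le_abs _ _ _).trans ?_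
  simpa using abs_min_sub_min_le_max r K s K

theorem continuous_clamp (K : ℝ) : Continuous (clamp K) := by unfold clamp; fun_prop

theorem clamp_of_abs_le {K r : ℝ} (h : |r| ≤ K) : clamp K r = r := by
  rw [abs_le] at h
  rw [clamp, min_eq_left h.2, max_eq_left h.1]

theorem clamp_zero {K : ℝ} (hK : 0 ≤ K) : clamp K 0 = 0 := clamp_of_abs_le (by simpa using hK)

theorem memLp_clamp_smul (K : ℝ) (q : RealL2) (f : SpinorL2) :
    MemLp (fun x => (clamp K (q x) : ℂ) • f x) 2 vol := by
  refine MemLp.of_le_mul (c := |K|) (memLp f) ?_ (.of_forall fun x => ?_)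
  · exact ((continuous_ofReal.comp (continuous_clamp K)).comp_aestronglyMeasurable
      (by fun_prop)).smul (by fun_prop)
  · rw [norm_smul, norm_real]
    exact mul_le_mul_of_nonneg_right (abs_clamp_le K _) (norm_nonneg _)

def mulClamp (K : ℝ) (q : RealL2) (f : SpinorL2) : SpinorL2 := (memLp_clamp_smul K q f).toLp _

theorem mulClamp_ae (K : ℝ) (q : RealL2) (f : SpinorL2) :
    mulClamp K q f =ᵐ[volume] fun x => (clamp K (q x) : ℂ) • f x :=
  (memLp_clamp_smul K q f).coeFn_toLp

theorem mulClamp_sub (K : ℝ) (q : RealL2) (f g : SpinorL2) :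
    mulClamp K q (f - g) = mulClamp K q f - mulClamp K q g := by
  apply Lp.ext
  filter_upwards [mulClamp_ae K q (f - g), mulClamp_ae K q f, mulClamp_ae K q g,
    coeFn_sub f g, coeFn_sub (mulClamp K q f) (mulClamp K q g)] with x h1 h2 h3 h4 h5
  rw [h1, h5, Pi.sub_apply, h2, h3, h4, Pi.sub_apply, smul_sub]

theorem norm_mulClamp_le (K : ℝ) (q : RealL2) (f : SpinorL2) : ‖mulClamp K q f‖ ≤ |K| * ‖f‖ := by
  refine Lp.norm_le_mul_norm_of_ae_le_mul ?_
  filter_upwards [mulClamp_ae K q f] with x hx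
  rw [hx, norm_smul, norm_real]
  exact mul_le_mul_of_nonneg_right (abs_clamp_le K _) (norm_nonneg _)

theorem continuous_mulClamp (K : ℝ) {q : ℝ → RealL2} {f : ℝ → SpinorL2} (hq : Continuous q)
    (hf : Continuous f) : Continuous fun t => mulClamp K (q t) (f t) := by
  rw [continuous_iff_continuousAt]
  intro t₀
  rw [ContinuousAt, Metric.tendsto_nhds]
  intro ε hε
  set δ : ℝ := ε / (4 * (2 * |K| + 1)) with hδ
  have hδ0 : 0 < δ := by positivity
  obtain ⟨g, hg, hgm⟩ := (memLp (f t₀)).exists_boundedContinuous_eLpNorm_sub_le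
    ofNat_ne_top (ε := ofReal δ) (by simpa using hδ0)
  set G : SpinorL2 := hgm.toLp g with hG
  have hfG : ‖f t₀ - G‖ ≤ δ := by
    have h1 : eLpNorm (⇑(f t₀ - G)) 2 volume ≤ ofReal δ := by
      refine (eLpNorm_congr_ae ?_).trans_le hg
      filter_upwards [coeFn_sub (f t₀) G, hgm.coeFn_toLp] with x h1 h2
      rw [h1, Pi.sub_apply, Pi.sub_apply, h2]
    rw [Lp.norm_def]
    exact ENNReal.toReal_le_of_le_ofReal hδ0.le h1
  have hG2 : ∀ t, ‖mulClamp K (q t) G - mulClamp K (q t₀) G‖ ≤ ‖g‖ * ‖q t - q t₀‖ := by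
    intro t
    refine Lp.norm_le_mul_norm_of_ae_le_mul ?_
    filter_upwards [mulClamp_ae K (q t) G, mulClamp_ae K (q t₀) G, hgm.coeFn_toLp,
      coeFn_sub (mulClamp K (q t) G) (mulClamp K (q t₀) G), coeFn_sub (q t) (q t₀)]
      with x h1 h2 h3 h4 h5
    rw [h4, h5, Pi.sub_apply, Pi.sub_apply, h1, h2, ← sub_smul, norm_smul, h3, mul_comm,
      ← ofReal_sub, norm_real]
    exact mul_le_mul (g.norm_coe_le_norm x) (abs_clamp_sub_le K _ _) (norm_nonneg _) (norm_nonneg _)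
  have h1 : Tendsto (fun t => |K| * ‖f t - f t₀‖ + ‖g‖ * ‖q t - q t₀‖) (𝓝 t₀) (𝓝 0) := by
    have : Continuous fun t => |K| * ‖f t - f t₀‖ + ‖g‖ * ‖q t - q t₀‖ := by fun_prop
    simpa using this.tendsto t₀
  filter_upwards [h1.eventually (gt_mem_nhds (half_pos hε))] with t ht
  rw [dist_eq_norm]
  have e : mulClamp K (q t) (f t) - mulClamp K (q t₀) (f t₀) =
      mulClamp K (q t) (f t - f t₀) + mulClamp K (q t) (f t₀ - G) +
      (mulClamp K (q t) G - mulClamp K (q t₀) G) - mulClamp K (q t₀) (f t₀ - G) := by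
    simp only [mulClamp_sub]; abel
  have h2 := norm_mulClamp_le K (q t) (f t - f t₀)
  have h3 := norm_mulClamp_le K (q t) (f t₀ - G)
  have h4 := norm_mulClamp_le K (q t₀) (f t₀ - G)
  have h5 : |K| * ‖f t₀ - G‖ ≤ ε / 8 := by
    calc |K| * ‖f t₀ - G‖ ≤ |K| * δ := by gcongr
      _ ≤ (|K| + 1 / 2) * δ := by gcongr; linarith
      _ = ε / 8 := by rw [hδ]; field_simp; ring
  rw [e]
  have h6 := norm_sub_le (mulClamp K (q t) (f t - f t₀) + mulClamp K (q t) (f t₀ - G) +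
      (mulClamp K (q t) G - mulClamp K (q t₀) G)) (mulClamp K (q t₀) (f t₀ - G))
  have h7 := norm_add₃_le (a := mulClamp K (q t) (f t - f t₀)) (b := mulClamp K (q t) (f t₀ - G))
    (c := mulClamp K (q t) G - mulClamp K (q t₀) G)
  linarith [hG2 t]

end Clamp

section FreeDirac

variable {A B : 𝓛}

theorem shift_compLpL {p : ℝ≥0∞} [Fact (1 ≤ p)] (L : 𝓛) (a : ℝ) (f : Lp Spinor p vol) :
    shift a (L.compLpL p volume f) = L.compLpL p volume (shift a f) := by
  apply Lp.ext
  filter_upwards [shift_ae a (L.compLpL p volume f), ae_comp_add (L.coeFn_compLpL f) a,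
    L.coeFn_compLpL (shift a f), shift_ae a f] with x h1 h2 h3 h4
  rw [h1, h2, h3, h4]

def propagator (A : 𝓛) (t : ℝ) (f : SpinorL2) : SpinorL2 :=
  (half A 1).compLpL 2 volume (shift (-t) f) + (half A (-1)).compLpL 2 volume (shift t f)

theorem propagator_sub (A : 𝓛) (t : ℝ) (f g : SpinorL2) :
    propagator A t (f - g) = propagator A t f - propagator A t g := by
  simp only [propagator, shift_sub, map_sub]; abel

theorem continuous_propagator (A : 𝓛) {a : ℝ → ℝ} (ha : Continuous a)
    {f : ℝ → SpinorL2} (hf : Continuous f) : Continuous fun t => propagator A (a t) (f t) :=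
  (((half A 1).compLpL 2 volume).continuous.comp (continuous_shift ofNat_ne_top ha.neg hf)).add
  (((half A (-1)).compLpL 2 volume).continuous.comp (continuous_shift ofNat_ne_top ha hf))

theorem norm_propagator_le (A : 𝓛) (t : ℝ) (f : SpinorL2) :
    ‖propagator A t f‖ ≤ (‖half A 1‖ + ‖half A (-1)‖) * ‖f‖ := by
  rw [propagator, add_mul]
  refine (norm_add_le _ _).trans (add_le_add ?_ ?_)
  · refine (norm_compLp_le _ _).trans_eq ?_
    rw [norm_shift]
  · refine (norm_compLp_le _ _).trans_eq ?_
    rw [norm_shift]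

theorem compLpL_compLpL_ae (L L' : 𝓛) (f : SpinorL2) :
    L.compLpL 2 volume (L'.compLpL 2 volume f) =ᵐ[volume] fun x => L (L' (f x)) := by
  filter_upwards [L.coeFn_compLpL (L'.compLpL 2 volume f), L'.coeFn_compLpL f] with x h1 h2
  rw [h1, h2]

theorem propagator_propagator_neg (hD : DiracPair A B) (t : ℝ) (f : SpinorL2) :
    propagator A t (propagator A (-t) f) = f := by
  have h0 : ∀ x, half A 1 (half A (-1) x) = 0 := fun x => by
    have := half_add_half_neg A 1 (half A (-1) x)
    rw [hD.half_half (Or.inr rfl)] at this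
    simpa using this
  have h0' : ∀ x, half A (-1) (half A 1 x) = 0 := fun x => by
    have := half_add_half_neg A 1 (half A 1 x)
    rw [hD.half_half (Or.inl rfl)] at this
    simpa using this
  simp only [propagator, shift_add, shift_compLpL, shift_shift, neg_neg, map_add]
  rw [neg_add_cancel, add_neg_cancel, shift_zero]
  apply Lp.ext
  filter_upwards [coeFn_add ((half A 1).compLpL 2 volume ((half A 1).compLpL 2 volume f) +
      (half A 1).compLpL 2 volume ((half A (-1)).compLpL 2 volume (shift (-t + -t) f)))
      ((half A (-1)).compLpL 2 volume ((half A 1).compLpL 2 volume (shift (t + t) f)) +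
      (half A (-1)).compLpL 2 volume ((half A (-1)).compLpL 2 volume f)),
    coeFn_add ((half A 1).compLpL 2 volume ((half A 1).compLpL 2 volume f))
      ((half A 1).compLpL 2 volume ((half A (-1)).compLpL 2 volume (shift (-t + -t) f))),
    coeFn_add ((half A (-1)).compLpL 2 volume ((half A 1).compLpL 2 volume (shift (t + t) f)))
      ((half A (-1)).compLpL 2 volume ((half A (-1)).compLpL 2 volume f)),
    compLpL_compLpL_ae (half A 1) (half A 1) f,
    compLpL_compLpL_ae (half A 1) (half A (-1)) (shift (-t + -t) f),
    compLpL_compLpL_ae (half A (-1)) (half A 1) (shift (t + t) f),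
    compLpL_compLpL_ae (half A (-1)) (half A (-1)) f] with x h1 h2 h3 h4 h5 h6 h7
  rw [h1, Pi.add_apply, h2, h3, Pi.add_apply, Pi.add_apply, h4, h5, h6, h7, h0, h0',
    hD.half_half (Or.inl rfl), hD.half_half (Or.inr rfl), add_zero, zero_add]
  exact half_add_half_neg A 1 (f x)

theorem derivCLM_compSubConstCLM (h : 𝓢(ℝ, ℂ)) (a : ℝ) : ∂ₛ (h.compSubConstCLM ℂ a) =
      (∂ₛ h).compSubConstCLM ℂ a := by
  ext x
  rw [derivCLM_apply, compSubConstCLM_apply, derivCLM_apply]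
  exact deriv_comp_sub_const h a x

theorem exists_weakDirac (hD : DiracPair A B) (M : ℝ) {q : ℝ → RealL2} (hq : Continuous q) {K : ℝ}
    (hK : ∀ t, ∀ᵐ x, |q t x| ≤ K) (ψ₀ : SpinorL2) {T : ℝ} (hT : 0 ≤ T) :
    ∃ ψ : ℝ → SpinorL2, WeakDirac A B M T q ψ ∧ ψ 0 = ψ₀ := by
  set L₁ := (-(I * M)) • B with hL₁
  set L₂ := (-I) • B with hL₂
  set F : ℝ → SpinorL2 → SpinorL2 := fun t f =>
    L₁.compLpL 2 volume f + L₂.compLpL 2 volume (mulClamp K (q t) f) with hF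
  have hFsub : ∀ t f g, F t (f - g) = F t f - F t g := fun t f g => by
    simp only [hF, mulClamp_sub, map_sub]; abel
  have hFn : ∀ t f, ‖F t f‖ ≤ (‖L₁‖ + ‖L₂‖ * |K|) * ‖f‖ := fun t f => by
    simp only [hF]
    rw [add_mul]
    refine (norm_add_le _ _).trans (add_le_add (norm_compLp_le _ _) ?_)
    refine (norm_compLp_le _ _).trans ?_
    rw [mul_assoc]
    exact mul_le_mul_of_nonneg_left (norm_mulClamp_le _ _ _) (norm_nonneg _)
  have hFc : ∀ u : ℝ → SpinorL2, Continuous u → Continuous fun t => F t (u t) := fun u hu =>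
    ((L₁.compLpL 2 volume).continuous.comp hu).add
      ((L₂.compLpL 2 volume).continuous.comp (continuous_mulClamp K hq hu))
  set κ := ‖half A 1‖ + ‖half A (-1)‖ with hκ
  obtain ⟨Ψ, hΨ, hΨ0, hΨd⟩ := exists_hasDerivWithinAt_of_lipschitz
    (L := fun t f => propagator A (-t) (F t (propagator A t f)))
    (K := κ * ((‖L₁‖ + ‖L₂‖ * |K|) * κ)) (by positivity)
    (fun u hu => continuous_propagator A continuous_neg (hFc _ (continuous_propagator A continuous_id hu)))
    (fun t f g => by
      rw [← propagator_sub, ← hFsub, ← propagator_sub]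
      calc _ ≤ κ * ‖F t (propagator A t (f - g))‖ := norm_propagator_le _ _ _
        _ ≤ κ * ((‖L₁‖ + ‖L₂‖ * |K|) * ‖propagator A t (f - g)‖) := by gcongr; exact hFn _ _
        _ ≤ κ * ((‖L₁‖ + ‖L₂‖ * |K|) * (κ * ‖f - g‖)) := by gcongr; exact norm_propagator_le _ _ _
        _ = _ := by ring)
    ψ₀ hT
  refine ⟨fun t => propagator A t (Ψ t), ⟨continuous_propagator A continuous_id hΨ, hq, ?_⟩, ?_⟩
  · intro h t ht
    set ψ := propagator A t (Ψ t) with hψ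
    set Ψ' := propagator A (-t) (F t ψ) with hΨ'
    have hd : ∀ g : 𝓢(ℝ, ℂ), HasDerivWithinAt (fun s => toTemperedDistribution (Ψ s) g)
        (toTemperedDistribution Ψ' g) (Icc 0 T) t := by
      intro g
      simp only [toTemperedDistribution_eq_pairL2]
      exact ((pairL2 (F := Spinor) (g.toLp 2 volume)).restrictScalars ℝ).hasFDerivAt.comp_hasDerivWithinAt t
        (hΨd t ht)
    have key : ∀ σ : ℝ, HasDerivWithinAt
        (fun s => toTemperedDistribution (shift (σ * s) (Ψ s)) h)
        (toTemperedDistribution (shift (σ * t) Ψ') h -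
          (σ : ℂ) • toTemperedDistribution (shift (σ * t) (Ψ t)) (∂ₛ h))
        (Icc 0 T) t := by
      intro σ
      have := hasDerivWithinAt_pairing_translate hΨ (c := σ) h
        (n := toTemperedDistribution (shift (σ * t) Ψ') h -
          (σ : ℂ) • toTemperedDistribution (shift (σ * t) (Ψ t)) (∂ₛ h))
        ((hd (h.compSubConstCLM ℂ (σ * t))).congr_deriv (by
          rw [derivCLM_compSubConstCLM, toTemperedDistribution_translate,
            toTemperedDistribution_translate]
          abel))
      simpa only [toTemperedDistribution_translate] using this
    have e1 : ∀ s f g, toTemperedDistribution (propagator A s f) g =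
        half A 1 (toTemperedDistribution (shift (-1 * s) f) g) +
        half A (-1) (toTemperedDistribution (shift (1 * s) f) g) := by
      intro s f g
      rw [propagator, toTemperedDistribution_eq_pairL2, map_add, ← toTemperedDistribution_eq_pairL2,
        ← toTemperedDistribution_eq_pairL2, toTemperedDistribution_compLp,
        toTemperedDistribution_compLp, neg_one_mul, one_mul]
    have d1 := ((half A 1).restrictScalars ℝ).hasFDerivAt.comp_hasDerivWithinAt t (key (-1))
    have d2 := ((half A (-1)).restrictScalars ℝ).hasFDerivAt.comp_hasDerivWithinAt t (key 1)
    have d3 := d1.add d2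
    simp only [spinorDist]
    refine (d3.congr_of_eventuallyEq (.of_forall fun s => e1 s (Ψ s) h) (e1 t (Ψ t) h)).congr_deriv ?_
    have hFt : toTemperedDistribution (F t ψ) h = -((I * M) • B (toTemperedDistribution ψ h)) -
        I • B (toTemperedDistribution (smulL1 (q t) ψ) h) := by
      have e2 : toTemperedDistribution (mulClamp K (q t) ψ) h =
          toTemperedDistribution (smulL1 (q t) ψ) h := by
        rw [toTemperedDistribution_apply, toTemperedDistribution_apply]
        apply integral_congr_ae
        filter_upwards [mulClamp_ae K (q t) ψ, smulL1_ae (q t) ψ, hK t] with x h1 h2 h3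
        rw [h1, h2, clamp_of_abs_le h3]
      simp only [hF]
      rw [toTemperedDistribution_eq_pairL2, map_add, ← toTemperedDistribution_eq_pairL2,
        ← toTemperedDistribution_eq_pairL2, toTemperedDistribution_compLp,
        toTemperedDistribution_compLp, e2, hL₁, hL₂, _root_.smul_apply, _root_.smul_apply,
        neg_smul, neg_smul]
      abel
    have e4 := e1 t Ψ' h
    rw [hΨ', propagator_propagator_neg hD, hFt] at e4
    have e5 : ∀ X Y Z : Spinor, X - Y - Z = X + (-Y - Z) := fun X Y Z => by abel
    rw [e5, e4, ← hΨ', hψ, e1 t (Ψ t)]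
    simp only [coe_restrictScalars', map_sub, map_smul, map_add,
      hD.left_half (Or.inl rfl), hD.left_half (Or.inr rfl)]
    push_cast
    module
  · change propagator A 0 (Ψ 0) = ψ₀
    rw [hΨ0, propagator]
    simp only [neg_zero, shift_zero]
    apply Lp.ext
    filter_upwards [coeFn_add ((half A 1).compLpL 2 volume ψ₀) ((half A (-1)).compLpL 2 volume ψ₀),
      (half A 1).coeFn_compLpL ψ₀, (half A (-1)).coeFn_compLpL ψ₀] with x h1 h2 h3
    rw [h1, Pi.add_apply, h2, h3, half_add_half_neg]

end FreeDirac

def jap (s ξ : ℝ) : ℝ := (1 + ξ ^ 2) ^ (s / 2)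

theorem jap_pos (s ξ : ℝ) : 0 < jap s ξ := Real.rpow_pos_of_pos (by positivity) _

theorem jap_mul (s r ξ : ℝ) : jap s ξ * jap r ξ = jap (s + r) ξ := by
  rw [jap, jap, jap, ← rpow_add (by positivity), add_div]

theorem jap_zero (ξ : ℝ) : jap 0 ξ = 1 := by simp [jap]

theorem jap_two (ξ : ℝ) : jap 2 ξ = 1 + ξ ^ 2 := by simp [jap]

theorem jap_neg_mul (s ξ : ℝ) : jap (-s) ξ * jap s ξ = 1 := by
  rw [jap_mul, neg_add_cancel, jap_zero]

theorem jap_mono {s r : ℝ} (h : s ≤ r) (ξ : ℝ) : jap s ξ ≤ jap r ξ :=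
  Real.rpow_le_rpow_of_exponent_le (by nlinarith [sq_nonneg ξ]) (by linarith)

theorem one_le_jap {s : ℝ} (h : 0 ≤ s) (ξ : ℝ) : 1 ≤ jap s ξ :=
  (jap_zero ξ).symm.le.trans (jap_mono h ξ)

theorem abs_le_jap_one (ξ : ℝ) : |ξ| ≤ jap 1 ξ := by
  rw [jap, ← Real.sqrt_eq_rpow, ← Real.sqrt_sq_eq_abs]
  exact Real.sqrt_le_sqrt (by linarith)

theorem continuous_jap (s : ℝ) : Continuous (jap s) :=
  Continuous.rpow_const (by fun_prop) fun ξ => Or.inl (by positivity)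

theorem hasTemperateGrowth_jap (s : ℝ) :
    Function.HasTemperateGrowth fun ξ : ℝ => (jap s ξ : ℂ) := by
  have h := Function.hasTemperateGrowth_one_add_norm_sq_rpow ℝ (s / 2)
  have h2 : (fun ξ : ℝ => jap s ξ) = fun ξ : ℝ => (1 + ‖ξ‖ ^ 2) ^ (s / 2) := by
    funext ξ
    simp [jap]
  rw [← h2] at h
  exact ofRealCLM.hasTemperateGrowth.comp h

theorem memLp_jap {s : ℝ} (hs : s < -(1 / 2)) : MemLp (jap s) 2 volume := by
  have h1 : Integrable fun ξ : ℝ => (1 + ‖ξ‖ ^ 2) ^ (-(-(2 * s)) / 2) :=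
    integrable_rpow_neg_one_add_norm_sq (by simp; linarith)
  rw [memLp_two_iff_integrable_sq (continuous_jap s).aestronglyMeasurable]
  refine h1.congr (.of_forall fun ξ => ?_)
  simp only [jap, norm_eq_abs, sq_abs]
  rw [← Real.rpow_natCast ((1 + ξ ^ 2) ^ (s / 2)) 2, ← Real.rpow_mul (by positivity)]
  simp

theorem integrable_jap {s : ℝ} (hs : s < -1) : Integrable (jap s) volume := by
  have h1 : Integrable fun ξ : ℝ => (1 + ‖ξ‖ ^ 2) ^ (-(-s) / 2) :=
    integrable_rpow_neg_one_add_norm_sq (by simp; linarith)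
  refine h1.congr (.of_forall fun ξ => ?_)
  simp only [jap, norm_eq_abs, sq_abs, neg_neg]

section SobRep

variable {F : Type*} [NormedAddCommGroup F] [InnerProductSpace ℂ F] [CompleteSpace F]

def japMul (s : ℝ) (h : 𝓢(ℝ, ℂ)) : 𝓢(ℝ, ℂ) :=
  SchwartzMap.smulLeftCLM ℂ (fun ξ : ℝ => (jap s ξ : ℂ)) h

theorem japMul_apply (s : ℝ) (h : 𝓢(ℝ, ℂ)) (ξ : ℝ) : japMul s h ξ = jap s ξ * h ξ := by
  rw [japMul, SchwartzMap.smulLeftCLM_apply_apply (hasTemperateGrowth_jap s), smul_eq_mul]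

theorem besselPotential_apply_apply (s : ℝ) (u : 𝓢'(ℝ, F)) (h : 𝓢(ℝ, ℂ)) :
    besselPotential ℝ F s u h = u (𝓕 (japMul s (𝓕⁻ h))) := by
  rw [besselPotential, fourierMultiplierCLM_apply_apply, japMul]
  congr 4
  funext ξ
  simp [jap]

theorem integrable_schwartz_smul {s : ℝ} {a : ℝ → F}
    (ha : MemLp (fun ξ => (jap s ξ : ℂ) • a ξ) 2 volume) (h : 𝓢(ℝ, ℂ)) :
    Integrable fun ξ => h ξ • a ξ := by
  have h1 : MemLp (japMul (-s) h) 2 volume := (japMul (-s) h).memLp 2 volume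
  have h2 := memLp_one_iff_integrable.1 (MemLp.smul (r := 1) ha h1)
  refine h2.congr (.of_forall fun ξ => ?_)
  simp only [Pi.smul_apply', japMul_apply, smul_smul]
  congr 1
  rw [mul_right_comm, ← Complex.ofReal_mul, jap_neg_mul, ofReal_one, one_mul]

/-- `u` is the inverse Fourier transform of `a`, with `a` in weighted `L²`. -/
structure SobRep (s : ℝ) (u : 𝓢'(ℝ, F)) (a : ℝ → F) : Prop where
  memLp : MemLp (fun ξ => (jap s ξ : ℂ) • a ξ) 2 volume
  eq : ∀ h : 𝓢(ℝ, ℂ), u h = ∫ ξ, (𝓕⁻ h) ξ • a ξ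

theorem sobRep_toTemperedDistribution (f : Lp F 2 vol) :
    SobRep 0 (toTemperedDistribution f) (𝓕 f : Lp F 2 vol) := by
  refine ⟨by simpa [jap_zero] using memLp _, fun h => ?_⟩
  have h1 := Lp.fourier_toTemperedDistribution_eq f
  have h2 : (toTemperedDistribution f) h = 𝓕 (toTemperedDistribution f) (𝓕⁻ h) := by
    rw [TemperedDistribution.fourier_apply, FourierTransform.fourier_fourierInv_eq]
  rw [h2, h1, toTemperedDistribution_apply]

theorem sobRep_fourierInv {a : ℝ → F} (ha : MemLp a 2 volume) :
    SobRep 0 (toTemperedDistribution (𝓕⁻ (ha.toLp a) : Lp F 2 vol)) a := by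
  have h1 := sobRep_toTemperedDistribution (𝓕⁻ (ha.toLp a) : Lp F 2 vol)
  rw [FourierTransform.fourier_fourierInv_eq] at h1
  refine ⟨by simpa [jap_zero] using ha, fun h => ?_⟩
  rw [h1.eq h]
  exact integral_congr_ae (ha.coeFn_toLp.mono fun ξ hξ => by simp only [hξ])

variable {s r : ℝ} {u v : 𝓢'(ℝ, F)} {a b : ℝ → F}

theorem SobRep.integrable (hu : SobRep s u a) (h : 𝓢(ℝ, ℂ)) : Integrable fun ξ => h ξ • a ξ :=
  integrable_schwartz_smul hu.memLp h

theorem SobRep.besselPotential (hu : SobRep s u a) (r : ℝ) :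
    SobRep (s - r) (besselPotential ℝ F r u) (fun ξ => (jap r ξ : ℂ) • a ξ) := by
  refine ⟨?_, fun h => ?_⟩
  · refine hu.memLp.ae_eq (.of_forall fun ξ => ?_)
    simp only [smul_smul, ← Complex.ofReal_mul, jap_mul, sub_add_cancel]
  · rw [besselPotential_apply_apply, hu.eq, FourierTransform.fourierInv_fourier_eq]
    refine integral_congr_ae (.of_forall fun ξ => ?_)
    simp only [japMul_apply, smul_smul, mul_comm]

theorem SobRep.unique (hu : SobRep s u a) (hv : SobRep r v a) : u = v := by
  ext h
  rw [hu.eq, hv.eq]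

theorem SobRep.congr (hu : SobRep s u a) (hab : a =ᵐ[volume] b) : SobRep s u b := by
  refine ⟨hu.memLp.ae_eq ?_, fun h => ?_⟩
  · filter_upwards [hab] with ξ hξ
    rw [hξ]
  · rw [hu.eq]
    exact integral_congr_ae (hab.mono fun ξ hξ => by simp only [hξ])

theorem SobRep.mono (hu : SobRep s u a) (hr : r ≤ s) : SobRep r u a := by
  refine ⟨?_, hu.eq⟩
  have h1 : (fun ξ => (jap r ξ : ℂ) • a ξ) =
      fun ξ => (jap (r - s) ξ : ℂ) • ((jap s ξ : ℂ) • a ξ) := by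
    funext ξ
    rw [smul_smul, ← Complex.ofReal_mul, jap_mul, sub_add_cancel]
  rw [h1]
  refine hu.memLp.of_le ?_ (.of_forall fun ξ => ?_)
  · exact (continuous_ofReal.comp (continuous_jap _)).aestronglyMeasurable.smul hu.memLp.1
  · rw [norm_smul, norm_real, norm_of_nonneg (jap_pos _ _).le]
    refine mul_le_of_le_one_left (norm_nonneg _) ?_
    rw [← jap_zero ξ]
    exact jap_mono (by linarith) ξ

theorem exists_sobRep {a : ℝ → F} (ha : MemLp (fun ξ => (jap s ξ : ℂ) • a ξ) 2 volume) :
    ∃ u : 𝓢'(ℝ, F), SobRep s u a := by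
  have h1 := (sobRep_fourierInv ha).besselPotential (-s)
  refine ⟨_, SobRep.congr (a := _) (by simpa using h1) (.of_forall fun ξ => ?_)⟩
  simp only [smul_smul, ← Complex.ofReal_mul, jap_neg_mul, ofReal_one, one_smul]

theorem exists_sobRep_of_memSobolev (hu : MemSobolev s 2 u) : ∃ a : ℝ → F, SobRep s u a := by
  obtain ⟨f, hf⟩ := hu
  have h1 := (sobRep_toTemperedDistribution f).besselPotential (-s)
  rw [(besselPotential_neg_apply_eq_iff s _ u).2 hf] at h1
  exact ⟨_, by simpa using h1⟩

theorem SobRep.besselPotential_eq (hu : SobRep s u a) :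
    TemperedDistribution.besselPotential ℝ F s u = toTemperedDistribution
      (𝓕⁻ (hu.memLp.toLp _) : Lp F 2 vol) :=
  (hu.besselPotential s).unique (sobRep_fourierInv hu.memLp)

theorem toTemperedDistribution_injective {p : ℝ≥0∞} [Fact (1 ≤ p)] {f g : Lp F p vol}
    (h : toTemperedDistribution f = toTemperedDistribution g) : f = g := by
  have h1 := Lp.ker_toTemperedDistributionCLM_eq_bot (F := F) (μ := vol) (p := p)
  rw [LinearMap.ker_eq_bot] at h1
  exact h1 h

theorem SobRep.ae_eq (hu : SobRep s u a) (hv : SobRep s u b) : a =ᵐ[volume] b := by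
  have h1 := hu.besselPotential_eq.symm.trans hv.besselPotential_eq
  have h2 := toTemperedDistribution_injective h1
  have h3 := congrArg (fun f : Lp F 2 vol => 𝓕 f) h2
  simp only [FourierTransform.fourier_fourierInv_eq] at h3
  have h4 := (MemLp.toLp_eq_toLp_iff hu.memLp hv.memLp).1 h3
  filter_upwards [h4] with ξ hξ
  have h5 : (jap s ξ : ℂ) ≠ 0 := by exact_mod_cast (jap_pos s ξ).ne'
  exact smul_right_injective F h5 hξ

end SobRep

theorem continuous_toLp_of_dominated {F : Type*} [NormedAddCommGroup F] {w : ℝ → ℝ → F}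
    {Γ : ℝ → ℝ} (hΓ : MemLp Γ 2 volume) (hm : ∀ t, AEStronglyMeasurable (w t) volume)
    (hc : ∀ᵐ ξ, Continuous fun t => w t ξ) (hw : ∀ t, ∀ᵐ ξ, ‖w t ξ‖ ≤ Γ ξ)
    (hL : ∀ t, MemLp (w t) 2 volume) :
    Continuous fun t => ((hL t).toLp (w t) : Lp F 2 vol) := by
  rw [continuous_iff_continuousAt]
  intro t₀
  rw [ContinuousAt, Lp.tendsto_Lp_iff_tendsto_eLpNorm']
  have h1 : ∀ t, eLpNorm (⇑((hL t).toLp (w t)) - ⇑((hL t₀).toLp (w t₀))) 2 volume =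
      (∫⁻ ξ, ‖w t ξ - w t₀ ξ‖ₑ ^ 2) ^ (1 / 2 : ℝ) := by
    intro t
    rw [eLpNorm_eq_lintegral_rpow_enorm_toReal (by norm_num) (by norm_num)]
    simp only [ENNReal.toReal_ofNat, one_div]
    congr 1
    apply lintegral_congr_ae
    filter_upwards [(hL t).coeFn_toLp, (hL t₀).coeFn_toLp] with ξ h2 h3
    rw [Pi.sub_apply, h2, h3]
    exact_mod_cast rpow_natCast _ 2
  simp_rw [h1]
  have h2 : Tendsto (fun t => ∫⁻ ξ, ‖w t ξ - w t₀ ξ‖ₑ ^ 2) (𝓝 t₀) (𝓝 (∫⁻ _ξ : ℝ, 0)) := by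
    refine tendsto_lintegral_filter_of_dominated_convergence' (fun ξ => (2 * ‖Γ ξ‖ₑ) ^ 2)
      (.of_forall fun t => (by fun_prop))
      (.of_forall fun t => ?_) ?_ ?_
    · filter_upwards [hw t, hw t₀] with ξ h3 h4
      gcongr
      have e : ∀ {y : F}, ‖y‖ ≤ Γ ξ → ‖y‖ₑ ≤ ‖Γ ξ‖ₑ := fun hy =>
        enorm_le_iff_norm_le.2 (hy.trans (le_abs_self _))
      calc ‖w t ξ - w t₀ ξ‖ₑ ≤ ‖w t ξ‖ₑ + ‖w t₀ ξ‖ₑ := enorm_sub_le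
        _ ≤ 2 * ‖Γ ξ‖ₑ := by rw [two_mul]; exact add_le_add (e h3) (e h4)
    · have h3 : ∫⁻ ξ, ‖Γ ξ‖ₑ ^ 2 ≠ ∞ := by
        have := hΓ.eLpNorm_lt_top
        rw [eLpNorm_lt_top_iff_lintegral_rpow_enorm_lt_top (by norm_num) (by norm_num)] at this
        simpa using this.ne
      simp_rw [mul_pow]
      rw [lintegral_const_mul' _ _ (by norm_num)]
      finiteness
    · filter_upwards [hc] with ξ h3
      have h4 : Tendsto (fun t => ‖w t ξ - w t₀ ξ‖ₑ ^ 2) (𝓝 t₀) (𝓝 (‖w t₀ ξ - w t₀ ξ‖ₑ ^ 2)) :=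
        ((ENNReal.continuous_pow 2).comp (h3.sub continuous_const).enorm).tendsto t₀
      simpa using h4
  rw [lintegral_zero] at h2
  have h3 := h2.ennrpow_const (1 / 2 : ℝ)
  simpa using h3

section KleinGordonODE

def freq (m ξ : ℝ) : ℝ := sqrt (m ^ 2 + (2 * π * ξ) ^ 2)

theorem freq_nonneg (m ξ : ℝ) : 0 ≤ freq m ξ := Real.sqrt_nonneg _

theorem freq_sq (m ξ : ℝ) : freq m ξ ^ 2 = m ^ 2 + (2 * π * ξ) ^ 2 := Real.sq_sqrt (by positivity)

theorem continuous_freq (m : ℝ) : Continuous (freq m) := by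
  unfold freq
  fun_prop

theorem freq_zero_left (ξ : ℝ) : freq 0 ξ = |2 * π * ξ| := by simp [freq, Real.sqrt_sq_eq_abs]

theorem freq_zero_le (m ξ : ℝ) : freq 0 ξ ≤ freq m ξ :=
  Real.sqrt_le_sqrt (by nlinarith [sq_nonneg m])

theorem abs_le_freq (m ξ : ℝ) : |ξ| ≤ freq m ξ := by
  refine le_trans ?_ (freq_zero_le m ξ)
  rw [freq_zero_left, abs_mul, abs_of_pos (by positivity : (0 : ℝ) < 2 * π)]
  nlinarith [abs_nonneg ξ, pi_gt_three]

theorem freq_le (m ξ : ℝ) : freq m ξ ≤ (|m| + 2 * π) * jap 1 ξ := by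
  have h0 : freq m ξ ≤ |m| + 2 * π * |ξ| := by
    rw [freq, Real.sqrt_le_left (by positivity)]
    have h3 := mul_nonneg (abs_nonneg m) (mul_nonneg pi_pos.le (abs_nonneg ξ))
    have h4 : (2 * π * |ξ|) ^ 2 = (2 * π * ξ) ^ 2 := by rw [mul_pow, sq_abs, ← mul_pow]
    nlinarith [sq_abs m]
  have h1 := abs_le_jap_one ξ
  have h2 : 1 ≤ jap 1 ξ := one_le_jap (by norm_num) ξ
  nlinarith [abs_nonneg m, pi_pos]

/-- `sin (t ω) / ω`, extended to `ω = 0`. -/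
def sn (ω t : ℝ) : ℝ := ∫ s in 0..t, cos (s * ω)

theorem sn_zero_right (ω : ℝ) : sn ω 0 = 0 := by simp [sn]

theorem hasDerivAt_sn (ω t : ℝ) : HasDerivAt (sn ω) (cos (t * ω)) t := integral_hasDerivAt_right
    ((by fun_prop : Continuous fun s : ℝ => cos (s * ω)).intervalIntegrable _ _)
    ((by fun_prop : Continuous fun s : ℝ => cos (s * ω)).stronglyMeasurableAtFilter _ _)
    (by fun_prop)

theorem continuous_sn : Continuous fun p : ℝ × ℝ => sn p.1 p.2 :=
  intervalIntegral.continuous_parametric_intervalIntegral_of_continuous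
    (f := fun (p : ℝ × ℝ) s => cos (s * p.1)) (by fun_prop) continuous_snd

theorem sn_zero_left (t : ℝ) : sn 0 t = t := by simp [sn]

theorem mul_sn (ω t : ℝ) : ω * sn ω t = sin (t * ω) := by
  have h1 : ∀ t, HasDerivAt (fun t => ω * sn ω t - sin (t * ω)) 0 t := fun t => by
    have := ((hasDerivAt_sn ω t).const_mul ω).sub
      ((Real.hasDerivAt_sin (t * ω)).comp t ((hasDerivAt_id t).mul_const ω))
    refine this.congr_deriv ?_
    ring
  have h2 := is_const_of_deriv_eq_zero (fun t => (h1 t).differentiableAt) (fun t => (h1 t).deriv)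
    t 0
  simp only [sn_zero_right, mul_zero, zero_mul, Real.sin_zero, sub_zero] at h2
  linarith

theorem sn_eq_div {ω : ℝ} (hω : ω ≠ 0) (t : ℝ) : sn ω t = sin (t * ω) / ω := by
  rw [eq_div_iff hω, mul_comm, mul_sn]

theorem abs_sn_le (ω t : ℝ) : |sn ω t| ≤ |t| := by
  have := intervalIntegral.norm_integral_le_of_norm_le_const (a := 0) (b := t) (C := 1)
    (f := fun s => cos (s * ω)) fun s _ => Real.abs_cos_le_one _
  simpa [sn] using this

theorem mul_abs_sn_le {ω : ℝ} (hω : 0 ≤ ω) (t : ℝ) : ω * |sn ω t| ≤ 1 := by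
  rw [← abs_of_nonneg hω, abs_of_nonneg hω, ← abs_of_nonneg hω, ← abs_mul, abs_of_nonneg hω, mul_sn]
  exact Real.abs_sin_le_one _

theorem sn_sub (ω t s : ℝ) :
    sn ω (t - s) = sn ω t * cos (s * ω) - cos (t * ω) * sn ω s := by
  by_cases hω : ω = 0
  · simp [hω, sn_zero_left]
  · rw [sn_eq_div hω, sn_eq_div hω, sn_eq_div hω, sub_mul, Real.sin_sub]
    field_simp

theorem jap_one_le (ξ : ℝ) : jap 1 ξ ≤ 1 + |ξ| := by
  rw [jap, ← Real.sqrt_eq_rpow, Real.sqrt_le_left (by positivity)]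
  nlinarith [sq_abs ξ, abs_nonneg ξ]

theorem abs_sn_mul_jap_le (m ξ t : ℝ) : |sn (freq m ξ) t| * jap 1 ξ ≤ |t| + 1 := by
  have h1 := jap_one_le ξ
  have h2 := abs_sn_le (freq m ξ) t
  have h3 := mul_abs_sn_le (freq_nonneg m ξ) t
  have h4 := abs_le_freq m ξ
  have h5 := abs_nonneg (sn (freq m ξ) t)
  calc |sn (freq m ξ) t| * jap 1 ξ ≤ |sn (freq m ξ) t| * (1 + |ξ|) := by gcongr
    _ ≤ |sn (freq m ξ) t| * (1 + freq m ξ) := by gcongr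
    _ ≤ |t| + 1 := by linarith

theorem abs_sn_le_jap (m ξ t : ℝ) : |sn (freq m ξ) t| ≤ (|t| + 1) * jap (-1) ξ := by
  have h1 := abs_sn_mul_jap_le m ξ t
  have h2 := jap_neg_mul 1 ξ
  have h3 := jap_pos (-1) ξ
  calc |sn (freq m ξ) t| = (|sn (freq m ξ) t| * jap 1 ξ) * jap (-1) ξ := by
        rw [mul_assoc, mul_comm (jap 1 ξ), h2, mul_one]
    _ ≤ _ := by gcongr

theorem freq_sub_freq_zero_mul_le (m ξ : ℝ) : (freq m ξ - freq 0 ξ) * freq 0 ξ ≤ m ^ 2 := by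
  have h1 := freq_sq m ξ
  have h2 := freq_sq 0 ξ
  have h3 := freq_zero_le m ξ
  have h4 := freq_nonneg 0 ξ
  nlinarith

theorem freq_sub_freq_zero_le (m ξ : ℝ) : freq m ξ - freq 0 ξ ≤ |m| := by
  have h1 := freq_sq m ξ
  have h2 := freq_sq 0 ξ
  have h4 := freq_nonneg 0 ξ
  have h5 : freq m ξ ≤ |m| + freq 0 ξ := by
    refine abs_le_of_sq_le_sq' ?_ (by positivity) |>.2
    nlinarith [sq_abs m, abs_nonneg m, mul_nonneg (abs_nonneg m) h4]
  linarith

theorem abs_cos_sub_cos_le (m ξ t : ℝ) :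
    |cos (t * freq m ξ) - cos (t * freq 0 ξ)| ≤ |t| * (|m| + m ^ 2) * jap (-1) ξ := by
  have h1 : |cos (t * freq m ξ) - cos (t * freq 0 ξ)| ≤
      |t| * (freq m ξ - freq 0 ξ) := by
    have h2 := Real.abs_cos_sub_cos_le (t * freq m ξ) (t * freq 0 ξ)
    rwa [← mul_sub, abs_mul, abs_of_nonneg (sub_nonneg.2 (freq_zero_le m ξ))] at h2
  refine h1.trans ?_
  rw [mul_assoc]
  refine mul_le_mul_of_nonneg_left ?_ (abs_nonneg t)
  have h3 := jap_neg_mul 1 ξ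
  have h4 : jap 1 ξ ≤ 1 + freq 0 ξ := by
    linarith [abs_le_freq 0 ξ, jap_one_le ξ]
  have h5 : (freq m ξ - freq 0 ξ) * jap 1 ξ ≤ |m| + m ^ 2 := by
    have h7 := freq_sub_freq_zero_mul_le m ξ
    have h8 := freq_sub_freq_zero_le m ξ
    have h9 := sub_nonneg.2 (freq_zero_le m ξ)
    nlinarith
  calc freq m ξ - freq 0 ξ = ((freq m ξ - freq 0 ξ) * jap 1 ξ) * jap (-1) ξ := by
        rw [mul_assoc, mul_comm (jap 1 ξ), h3, mul_one]
    _ ≤ _ := mul_le_mul_of_nonneg_right h5 (jap_pos _ _).le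

theorem abs_sn_sub_sn_le (m ξ t : ℝ) :
    |sn (freq m ξ) t - sn (freq 0 ξ) t| ≤ 2 * |t| * (1 + m ^ 2) * jap (-2) ξ := by
  set ω := freq m ξ with hω
  set r := freq 0 ξ with hr
  have hr0 : 0 ≤ r := freq_nonneg 0 ξ
  have hrω : r ≤ ω := freq_zero_le m ξ
  have hd : (ω - r) * r ≤ m ^ 2 := freq_sub_freq_zero_mul_le m ξ
  have h1 : |sn ω t - sn r t| ≤ 2 * |t| := by
    have := abs_sub (sn ω t) (sn r t)
    linarith [abs_sn_le ω t, abs_sn_le r t]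
  have h2 : |sn ω t - sn r t| * r ^ 2 ≤ 2 * |t| * m ^ 2 := by
    have e1 : ω * (sn ω t - sn r t) = (sin (t * ω) - sin (t * r)) - (ω - r) * sn r t := by
      rw [← mul_sn, ← mul_sn]
      ring
    have e2 : ω * |sn ω t - sn r t| ≤ 2 * |t| * (ω - r) := by
      rw [← abs_of_nonneg (hr0.trans hrω), abs_of_nonneg (hr0.trans hrω)]
      calc ω * |sn ω t - sn r t| = |ω * (sn ω t - sn r t)| := by
            rw [abs_mul, abs_of_nonneg (hr0.trans hrω)]
        _ ≤ |sin (t * ω) - sin (t * r)| + |(ω - r) * sn r t| := by rw [e1]; exact abs_sub _ _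
        _ ≤ |t * ω - t * r| + (ω - r) * |t| := by
            refine add_le_add (Real.abs_sin_sub_sin_le _ _) ?_
            rw [abs_mul, abs_of_nonneg (sub_nonneg.2 hrω)]
            exact mul_le_mul_of_nonneg_left (abs_sn_le r t) (sub_nonneg.2 hrω)
        _ = 2 * |t| * (ω - r) := by rw [← mul_sub, abs_mul, abs_of_nonneg (sub_nonneg.2 hrω)]; ring
    have e3 := abs_nonneg (sn ω t - sn r t)
    calc |sn ω t - sn r t| * r ^ 2 ≤ (ω * |sn ω t - sn r t|) * r := by
          have := mul_nonneg (mul_nonneg (sub_nonneg.2 hrω) e3) hr0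
          nlinarith
      _ ≤ (2 * |t| * (ω - r)) * r := by gcongr
      _ ≤ _ := by nlinarith [abs_nonneg t]
  have h3 : ξ ^ 2 ≤ r ^ 2 := by
    rw [← sq_abs ξ]
    exact pow_le_pow_left₀ (abs_nonneg _) (abs_le_freq 0 ξ) 2
  have h4 : |sn ω t - sn r t| * jap 2 ξ ≤ 2 * |t| * (1 + m ^ 2) := by
    rw [jap_two]
    nlinarith [abs_nonneg (sn ω t - sn r t)]
  have h5 := jap_neg_mul 2 ξ
  calc |sn ω t - sn r t| = (|sn ω t - sn r t| * jap 2 ξ) * jap (-2) ξ := by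
        rw [mul_assoc, mul_comm (jap 2 ξ), h5, mul_one]
    _ ≤ _ := mul_le_mul_of_nonneg_right h4 (jap_pos _ _).le

/-- Duhamel formula for the Fourier transform of a Klein-Gordon solution. -/
def kgW (m : ℝ) (a₀ a₁ : ℝ → ℂ) (s : ℝ → ℝ → ℂ) (t ξ : ℝ) : ℂ :=
  cos (t * freq m ξ) * (a₀ ξ - ∫ τ in 0..t, sn (freq m ξ) τ * s τ ξ) +
    sn (freq m ξ) t * (a₁ ξ + ∫ τ in 0..t, cos (τ * freq m ξ) * s τ ξ)

def kgWt (m : ℝ) (a₀ a₁ : ℝ → ℂ) (s : ℝ → ℝ → ℂ) (t ξ : ℝ) : ℂ :=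
  -((freq m ξ ^ 2 * sn (freq m ξ) t : ℝ) : ℂ) *
      (a₀ ξ - ∫ τ in 0..t, sn (freq m ξ) τ * s τ ξ) +
    cos (t * freq m ξ) * (a₁ ξ + ∫ τ in 0..t, cos (τ * freq m ξ) * s τ ξ)

variable {m : ℝ} {a₀ a₁ : ℝ → ℂ} {s s' : ℝ → ℝ → ℂ}

theorem kgW_zero (m : ℝ) (a₀ a₁ : ℝ → ℂ) (s : ℝ → ℝ → ℂ) : kgW m a₀ a₁ s 0 = a₀ := by
  funext ξ
  simp [kgW, sn_zero_right]

theorem kgWt_zero (m : ℝ) (a₀ a₁ : ℝ → ℂ) (s : ℝ → ℝ → ℂ) : kgWt m a₀ a₁ s 0 = a₁ := by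
  funext ξ
  simp [kgWt, sn_zero_right]

theorem continuous_sn_freq (m : ℝ) : Continuous fun p : ℝ × ℝ => sn (freq m p.2) p.1 :=
  continuous_sn.comp (((continuous_freq m).comp continuous_snd).prodMk continuous_fst)

theorem continuous_cos_freq (m : ℝ) : Continuous fun p : ℝ × ℝ => cos (p.1 * freq m p.2) :=
  Real.continuous_cos.comp (continuous_fst.mul ((continuous_freq m).comp continuous_snd))

theorem continuous_sn_source (hs : Continuous fun p : ℝ × ℝ => s p.1 p.2) :
    Continuous fun p : ℝ × ℝ => (sn (freq m p.2) p.1 : ℂ) * s p.1 p.2 :=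
  (continuous_ofReal.comp (continuous_sn_freq m)).mul hs

theorem continuous_cos_source (hs : Continuous fun p : ℝ × ℝ => s p.1 p.2) :
    Continuous fun p : ℝ × ℝ => (cos (p.1 * freq m p.2) : ℂ) * s p.1 p.2 :=
  (continuous_ofReal.comp (continuous_cos_freq m)).mul hs

theorem hasDerivAt_integral_slice {F : ℝ → ℝ → ℂ} (hF : Continuous fun p : ℝ × ℝ => F p.1 p.2)
    (t ξ : ℝ) : HasDerivAt (fun t => ∫ τ in 0..t, F τ ξ) (F t ξ) t := by
  have h1 : Continuous fun τ => F τ ξ := by fun_prop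
  exact integral_hasDerivAt_right (h1.intervalIntegrable _ _)
    (h1.stronglyMeasurableAtFilter _ _) h1.continuousAt

theorem hasDerivAt_cos_freq (ω t : ℝ) :
    HasDerivAt (fun t : ℝ => (cos (t * ω) : ℂ)) (-((ω ^ 2 * sn ω t : ℝ) : ℂ)) t := by
  have h1 := (Real.hasDerivAt_cos (t * ω)).comp t ((hasDerivAt_id t).mul_const ω)
  refine h1.ofReal_comp.congr_deriv ?_
  rw [sq, mul_assoc, mul_sn, ← ofReal_neg]
  congr 1
  ring

theorem hasDerivAt_kgW (hs : Continuous fun p : ℝ × ℝ => s p.1 p.2) (t ξ : ℝ) :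
    HasDerivAt (fun t => kgW m a₀ a₁ s t ξ) (kgWt m a₀ a₁ s t ξ) t := by
  have h1 := hasDerivAt_cos_freq (freq m ξ) t
  have h2 := (hasDerivAt_integral_slice
    (F := fun τ ξ => (sn (freq m ξ) τ : ℂ) * s τ ξ) (continuous_sn_source hs) t ξ).const_sub (a₀ ξ)
  have h3 := (hasDerivAt_sn (freq m ξ) t).ofReal_comp
  have h4 := (hasDerivAt_integral_slice (F := fun τ ξ => (cos (τ * freq m ξ) : ℂ) * s τ ξ)
      (continuous_cos_source hs) t ξ).const_add (a₁ ξ)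
  refine ((h1.mul h2).add (h3.mul h4)).congr_deriv ?_
  rw [kgWt]
  ring

theorem hasDerivAt_kgWt (hs : Continuous fun p : ℝ × ℝ => s p.1 p.2) (t ξ : ℝ) :
    HasDerivAt (fun t => kgWt m a₀ a₁ s t ξ)
      (-((freq m ξ ^ 2 : ℝ) : ℂ) * kgW m a₀ a₁ s t ξ + s t ξ) t := by
  have h1 := hasDerivAt_cos_freq (freq m ξ) t
  have h2 := (hasDerivAt_integral_slice
    (F := fun τ ξ => (sn (freq m ξ) τ : ℂ) * s τ ξ) (continuous_sn_source hs) t ξ).const_sub (a₀ ξ)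
  have h3 := (((hasDerivAt_sn (freq m ξ) t).const_mul (freq m ξ ^ 2)).ofReal_comp).fun_neg
  have h4 := (hasDerivAt_integral_slice (F := fun τ ξ => (cos (τ * freq m ξ) : ℂ) * s τ ξ)
      (continuous_cos_source hs) t ξ).const_add (a₁ ξ)
  refine ((h3.mul h2).add (h1.mul h4)).congr_deriv ?_
  have h5 : (freq m ξ ^ 2 * sn (freq m ξ) t) * sn (freq m ξ) t + cos (t * freq m ξ) *
      cos (t * freq m ξ) = 1 := by
    have := mul_sn (freq m ξ) t
    have h6 := Real.sin_sq_add_cos_sq (t * freq m ξ)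
    rw [← this] at h6
    linarith
  have h6 := congrArg (fun r : ℝ => (r : ℂ)) h5
  simp only [Complex.ofReal_add, Complex.ofReal_mul, ofReal_one, Complex.ofReal_pow] at h6
  rw [kgW]
  simp only [Complex.ofReal_mul, Complex.ofReal_pow]
  linear_combination (s t ξ) * h6

theorem kgW_sub_kgW (hs : Continuous fun p : ℝ × ℝ => s p.1 p.2)
    (hs' : Continuous fun p : ℝ × ℝ => s' p.1 p.2) (t ξ : ℝ) :
    kgW m a₀ a₁ s t ξ - kgW m a₀ a₁ s' t ξ =
      ∫ τ in 0..t, sn (freq m ξ) (t - τ) * (s τ ξ - s' τ ξ) := by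
  have slice : ∀ {F : ℝ → ℝ → ℂ}, Continuous (fun p : ℝ × ℝ => F p.1 p.2) →
      IntervalIntegrable (fun τ => F τ ξ) volume 0 t := fun {F} hF =>
    (by fun_prop : Continuous fun τ => F τ ξ).intervalIntegrable _ _
  have i1 := slice (F := fun τ ξ => (sn (freq m ξ) τ : ℂ) * s τ ξ) (continuous_sn_source hs)
  have i2 := slice (F := fun τ ξ => (sn (freq m ξ) τ : ℂ) * s' τ ξ) (continuous_sn_source hs')
  have i3 := slice (F := fun τ ξ => (cos (τ * freq m ξ) : ℂ) * s τ ξ) (continuous_cos_source hs)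
  have i4 := slice (F := fun τ ξ => (cos (τ * freq m ξ) : ℂ) * s' τ ξ) (continuous_cos_source hs')
  have e : ∀ τ, (sn (freq m ξ) (t - τ) : ℂ) * (s τ ξ - s' τ ξ) =
      (sn (freq m ξ) t : ℂ) * ((cos (τ * freq m ξ) : ℂ) * s τ ξ -
        (cos (τ * freq m ξ) : ℂ) * s' τ ξ) -
      (cos (t * freq m ξ) : ℂ) * ((sn (freq m ξ) τ : ℂ) * s τ ξ -
        (sn (freq m ξ) τ : ℂ) * s' τ ξ) := by
    intro τ
    rw [sn_sub]
    simp only [Complex.ofReal_mul, ofReal_sub]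
    ring
  simp_rw [e]
  rw [intervalIntegral.integral_sub ((i3.sub i4).const_mul _) ((i1.sub i2).const_mul _),
    intervalIntegral.integral_const_mul, intervalIntegral.integral_const_mul,
    intervalIntegral.integral_sub i3 i4, intervalIntegral.integral_sub i1 i2, kgW, kgW]
  ring

end KleinGordonODE

section KleinGordonWeak

structure KGData (k B : ℝ) (a₀ a₁ : ℝ → ℂ) (s : ℝ → ℝ → ℂ) : Prop where
  lt : k < 1 / 2
  memLp₀ : MemLp (fun ξ => (jap k ξ : ℂ) • a₀ ξ) 2 volume
  memLp₁ : MemLp (fun ξ => (jap (k - 1) ξ : ℂ) • a₁ ξ) 2 volume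
  cont : Continuous fun p : ℝ × ℝ => s p.1 p.2
  bound : ∀ t ξ, ‖s t ξ‖ ≤ B

def kgMajorant (k B : ℝ) (a₀ a₁ : ℝ → ℂ) (T ξ : ℝ) : ℝ :=
  ‖(jap k ξ : ℂ) • a₀ ξ‖ + (T + 1) * ‖(jap (k - 1) ξ : ℂ) • a₁ ξ‖ +
    2 * T * (T + 1) * B * jap (k - 1) ξ

def kgMajorantT (m k B : ℝ) (a₀ a₁ : ℝ → ℂ) (T ξ : ℝ) : ℝ :=
  (|m| + 2 * π) * (‖(jap k ξ : ℂ) • a₀ ξ‖ + T * (T + 1) * B * jap (k - 1) ξ) +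
    (‖(jap (k - 1) ξ : ℂ) • a₁ ξ‖ + T * B * jap (k - 1) ξ)

theorem aestronglyMeasurable_of_jap_smul {r : ℝ} {a : ℝ → ℂ}
    (ha : AEStronglyMeasurable (fun ξ => (jap r ξ : ℂ) • a ξ) volume) :
    AEStronglyMeasurable a volume := by
  have h1 : AEStronglyMeasurable (fun ξ => (jap (-r) ξ : ℂ)) volume :=
    (continuous_ofReal.comp (continuous_jap _)).aestronglyMeasurable
  refine (h1.smul ha).congr (.of_forall fun ξ => ?_)
  simp only [Pi.smul_apply', smul_smul, ← Complex.ofReal_mul, jap_neg_mul, ofReal_one, one_smul]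

theorem norm_jap_smul (r ξ : ℝ) (z : ℂ) : ‖(jap r ξ : ℂ) • z‖ = jap r ξ * ‖z‖ := by
  rw [norm_smul, norm_real, norm_of_nonneg (jap_pos _ _).le]

variable {m k B : ℝ} {a₀ a₁ : ℝ → ℂ} {s : ℝ → ℝ → ℂ}

theorem KGData.nonneg (hd : KGData k B a₀ a₁ s) : 0 ≤ B := (norm_nonneg _).trans (hd.bound 0 0)

theorem KGData.memLp_majorant (hd : KGData k B a₀ a₁ s) (T : ℝ) :
    MemLp (kgMajorant k B a₀ a₁ T) 2 volume :=
  (hd.memLp₀.norm.add (hd.memLp₁.norm.const_mul (T + 1))).add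
    ((memLp_jap (by linarith [hd.lt])).const_mul (2 * T * (T + 1) * B))

theorem KGData.memLp_majorantT (hd : KGData k B a₀ a₁ s) (m T : ℝ) :
    MemLp (kgMajorantT m k B a₀ a₁ T) 2 volume :=
  have h1 : MemLp (jap (k - 1)) 2 volume := memLp_jap (by linarith [hd.lt])
  ((hd.memLp₀.norm.add (h1.const_mul (T * (T + 1) * B))).const_mul (|m| + 2 * π)).add
    (hd.memLp₁.norm.add (h1.const_mul (T * B)))

theorem norm_integral_slice_le {f : ℝ → ℂ} {K t T : ℝ} (hK : 0 ≤ K) (ht : |t| ≤ T)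
    (hf : ∀ τ, |τ| ≤ T → ‖f τ‖ ≤ K) : ‖∫ τ in 0..t, f τ‖ ≤ K * T := by
  refine (intervalIntegral.norm_integral_le_of_norm_le_const (C := K) fun τ hτ => ?_).trans ?_
  · refine hf τ (le_trans ?_ ht)
    rcases Set.mem_uIoc.1 hτ with h | h
    · rw [abs_of_pos h.1, abs_of_pos (h.1.trans_le h.2)]
      exact h.2
    · rw [abs_of_nonpos h.2, abs_of_nonpos (h.1.le.trans h.2)]
      linarith [h.1]
  · rw [sub_zero]
    exact mul_le_mul_of_nonneg_left ht hK

theorem KGData.norm_sn_integral_le (hd : KGData k B a₀ a₁ s) {t T : ℝ} (ht : |t| ≤ T) (ξ : ℝ) :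
    ‖∫ τ in 0..t, sn (freq m ξ) τ * s τ ξ‖ ≤ (T + 1) * jap (-1) ξ * B * T := by
  have hT : 0 ≤ T := (abs_nonneg t).trans ht
  have hj := jap_pos (-1) ξ
  refine norm_integral_slice_le (mul_nonneg (by positivity) hd.nonneg) ht fun τ hτ => ?_
  rw [norm_mul, norm_real, norm_eq_abs]
  have h1 := abs_sn_le_jap m ξ τ
  have h2 : (|τ| + 1) * jap (-1) ξ ≤ (T + 1) * jap (-1) ξ := by gcongr
  exact mul_le_mul (h1.trans h2) (hd.bound τ ξ) (norm_nonneg _) (by positivity)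

theorem KGData.norm_cos_integral_le (hd : KGData k B a₀ a₁ s) {t T : ℝ} (ht : |t| ≤ T) (ξ : ℝ) :
    ‖∫ τ in 0..t, cos (τ * freq m ξ) * s τ ξ‖ ≤ B * T := by
  refine norm_integral_slice_le hd.nonneg ht fun τ hτ => ?_
  rw [norm_mul, norm_real, norm_eq_abs]
  exact (mul_le_of_le_one_left (norm_nonneg _) (Real.abs_cos_le_one _)).trans (hd.bound τ ξ)

theorem jap_sub_one (k ξ : ℝ) : jap k ξ * jap (-1) ξ = jap (k - 1) ξ := by
  rw [jap_mul, sub_eq_add_neg]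

theorem KGData.norm_kgW_le (hd : KGData k B a₀ a₁ s) {t T : ℝ} (ht : |t| ≤ T) (ξ : ℝ) :
    ‖(jap k ξ : ℂ) • kgW m a₀ a₁ s t ξ‖ ≤ kgMajorant k B a₀ a₁ T ξ := by
  have hT : 0 ≤ T := (abs_nonneg t).trans ht
  have hB := hd.nonneg
  have h1 := hd.norm_sn_integral_le (m := m) ht ξ
  have h2 := hd.norm_cos_integral_le (m := m) ht ξ
  have h3 : |sn (freq m ξ) t| ≤ (T + 1) * jap (-1) ξ :=
    (abs_sn_le_jap m ξ t).trans (by gcongr; exact (jap_pos _ _).le)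
  have hj := jap_pos (-1) ξ
  have hk := jap_pos k ξ
  have h4 : ‖kgW m a₀ a₁ s t ξ‖ ≤ (‖a₀ ξ‖ + (T + 1) * jap (-1) ξ * B * T) +
      ((T + 1) * jap (-1) ξ) * (‖a₁ ξ‖ + B * T) := by
    refine (norm_add_le _ _).trans (add_le_add ?_ ?_)
    · rw [norm_mul, norm_real, norm_eq_abs]
      exact (mul_le_of_le_one_left (norm_nonneg _) (Real.abs_cos_le_one _)).trans
        ((norm_sub_le _ _).trans (add_le_add le_rfl h1))
    · rw [norm_mul, norm_real, norm_eq_abs]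
      exact mul_le_mul h3 ((norm_add_le _ _).trans (add_le_add le_rfl h2)) (norm_nonneg _)
        (by positivity)
  rw [kgMajorant, norm_jap_smul, norm_jap_smul, norm_jap_smul]
  calc jap k ξ * ‖kgW m a₀ a₁ s t ξ‖ ≤ jap k ξ * ((‖a₀ ξ‖ + (T + 1) * jap (-1) ξ * B * T) +
      ((T + 1) * jap (-1) ξ) * (‖a₁ ξ‖ + B * T)) := by gcongr
    _ = _ := by
      rw [← jap_sub_one]
      ring

theorem KGData.norm_kgWt_le (hd : KGData k B a₀ a₁ s) {t T : ℝ} (ht : |t| ≤ T) (ξ : ℝ) :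
    ‖(jap (k - 1) ξ : ℂ) • kgWt m a₀ a₁ s t ξ‖ ≤ kgMajorantT m k B a₀ a₁ T ξ := by
  have hT : 0 ≤ T := (abs_nonneg t).trans ht
  have hB := hd.nonneg
  have h1 := hd.norm_sn_integral_le (m := m) ht ξ
  have h2 := hd.norm_cos_integral_le (m := m) ht ξ
  have hj := jap_pos (-1) ξ
  have hj1 := jap_pos 1 ξ
  have hk := jap_pos (k - 1) ξ
  have h3 : |freq m ξ ^ 2 * sn (freq m ξ) t| ≤ (|m| + 2 * π) * jap 1 ξ := by
    rw [sq, mul_assoc, abs_mul, abs_mul, abs_of_nonneg (freq_nonneg m ξ)]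
    exact (mul_le_of_le_one_right (freq_nonneg m ξ) (mul_abs_sn_le (freq_nonneg m ξ) t)).trans
      (freq_le m ξ)
  have hc : 0 ≤ |m| + 2 * π := by positivity
  have h4 : ‖kgWt m a₀ a₁ s t ξ‖ ≤
      ((|m| + 2 * π) * jap 1 ξ) * (‖a₀ ξ‖ + (T + 1) * jap (-1) ξ * B * T) +
      (‖a₁ ξ‖ + B * T) := by
    refine (norm_add_le _ _).trans (add_le_add ?_ ?_)
    · rw [norm_mul, norm_neg, norm_real, norm_eq_abs]
      exact mul_le_mul h3 ((norm_sub_le _ _).trans (add_le_add le_rfl h1)) (norm_nonneg _)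
        (by positivity)
    · rw [norm_mul, norm_real, norm_eq_abs]
      exact (mul_le_of_le_one_left (norm_nonneg _) (Real.abs_cos_le_one _)).trans
        ((norm_add_le _ _).trans (add_le_add le_rfl h2))
  rw [kgMajorantT, norm_jap_smul, norm_jap_smul, norm_jap_smul]
  have e1 : jap (k - 1) ξ * jap 1 ξ = jap k ξ := by rw [jap_mul, sub_add_cancel]
  calc jap (k - 1) ξ * ‖kgWt m a₀ a₁ s t ξ‖ ≤ jap (k - 1) ξ *
      (((|m| + 2 * π) * jap 1 ξ) * (‖a₀ ξ‖ + (T + 1) * jap (-1) ξ * B * T) +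
      (‖a₁ ξ‖ + B * T)) := by gcongr
    _ = (|m| + 2 * π) * ((jap (k - 1) ξ * jap 1 ξ) * ‖a₀ ξ‖ + T * (T + 1) * B *
      ((jap (k - 1) ξ * jap 1 ξ) * jap (-1) ξ)) + (jap (k - 1) ξ * ‖a₁ ξ‖ +
        T * B * jap (k - 1) ξ) := by ring
    _ = _ := by rw [e1, jap_sub_one]

theorem continuous_ofReal_sn_slice (m t : ℝ) : Continuous fun ξ => (sn (freq m ξ) t : ℂ) := by
  have h1 : Continuous fun ξ => sn (freq m ξ) t :=
    Continuous.comp (g := fun p : ℝ × ℝ => sn (freq m p.2) p.1) (f := fun ξ : ℝ => (t, ξ))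
      (continuous_sn_freq m) (by fun_prop)
  fun_prop

theorem continuous_ofReal_cos_slice (m t : ℝ) : Continuous fun ξ => (cos (t * freq m ξ) : ℂ) := by
  have h1 : Continuous fun ξ => cos (t * freq m ξ) :=
    (continuous_cos_freq m).comp (continuous_const.prodMk continuous_id)
  fun_prop

theorem continuous_integral_slice_right {F : ℝ → ℝ → ℂ}
    (hF : Continuous fun p : ℝ × ℝ => F p.1 p.2) (t : ℝ) :
    Continuous fun ξ => ∫ τ in 0..t, F τ ξ :=
  (by fun_prop)

theorem KGData.aestronglyMeasurable_kgW (hd : KGData k B a₀ a₁ s) (m t : ℝ) :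
    AEStronglyMeasurable (kgW m a₀ a₁ s t) volume := by
  have h0 := aestronglyMeasurable_of_jap_smul hd.memLp₀.1
  have h1 := aestronglyMeasurable_of_jap_smul hd.memLp₁.1
  have c1 := (continuous_ofReal_cos_slice m t).aestronglyMeasurable (μ := volume)
  have c2 := (continuous_ofReal_sn_slice m t).aestronglyMeasurable (μ := volume)
  have c3 := (continuous_integral_slice_right (F := fun τ ξ => (sn (freq m ξ) τ : ℂ) * s τ ξ)
    (continuous_sn_source hd.cont) t).aestronglyMeasurable (μ := volume)
  have c4 := (continuous_integral_slice_right (F := fun τ ξ => (cos (τ * freq m ξ) : ℂ) * s τ ξ)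
    (continuous_cos_source hd.cont) t).aestronglyMeasurable (μ := volume)
  exact ((c1.fun_mul (h0.fun_sub c3)).fun_add (c2.fun_mul (h1.fun_add c4)))

theorem KGData.aestronglyMeasurable_kgWt (hd : KGData k B a₀ a₁ s) (m t : ℝ) :
    AEStronglyMeasurable (kgWt m a₀ a₁ s t) volume := by
  have h0 := aestronglyMeasurable_of_jap_smul hd.memLp₀.1
  have h1 := aestronglyMeasurable_of_jap_smul hd.memLp₁.1
  have c1 := (continuous_ofReal_cos_slice m t).aestronglyMeasurable (μ := volume)
  have c2 : AEStronglyMeasurable (fun ξ => -((freq m ξ ^ 2 * sn (freq m ξ) t : ℝ) : ℂ)) volume := by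
    have h2 := ((continuous_ofReal.comp ((continuous_freq m).pow 2)).mul
      (continuous_ofReal_sn_slice m t)).neg.aestronglyMeasurable (μ := volume)
    refine h2.congr (.of_forall fun ξ => ?_)
    simp
  have c3 := (continuous_integral_slice_right (F := fun τ ξ => (sn (freq m ξ) τ : ℂ) * s τ ξ)
    (continuous_sn_source hd.cont) t).aestronglyMeasurable (μ := volume)
  have c4 := (continuous_integral_slice_right (F := fun τ ξ => (cos (τ * freq m ξ) : ℂ) * s τ ξ)
    (continuous_cos_source hd.cont) t).aestronglyMeasurable (μ := volume)
  exact ((c2.fun_mul (h0.fun_sub c3)).fun_add (c1.fun_mul (h1.fun_add c4)))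

theorem aestronglyMeasurable_jap_smul (r : ℝ) {a : ℝ → ℂ} (ha : AEStronglyMeasurable a volume) :
    AEStronglyMeasurable (fun ξ => (jap r ξ : ℂ) • a ξ) volume :=
  (continuous_ofReal.comp (continuous_jap _)).aestronglyMeasurable.smul ha

theorem KGData.memLp_kgW (hd : KGData k B a₀ a₁ s) (m t : ℝ) :
    MemLp (fun ξ => (jap k ξ : ℂ) • kgW m a₀ a₁ s t ξ) 2 volume :=
  (hd.memLp_majorant |t|).mono' (aestronglyMeasurable_jap_smul k (hd.aestronglyMeasurable_kgW m t))
    (.of_forall fun ξ => hd.norm_kgW_le le_rfl ξ)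

theorem KGData.memLp_kgWt (hd : KGData k B a₀ a₁ s) (m t : ℝ) :
    MemLp (fun ξ => (jap (k - 1) ξ : ℂ) • kgWt m a₀ a₁ s t ξ) 2 volume :=
  (hd.memLp_majorantT m |t|).mono'
    (aestronglyMeasurable_jap_smul _ (hd.aestronglyMeasurable_kgWt m t))
    (.of_forall fun ξ => hd.norm_kgWt_le le_rfl ξ)

theorem abs_clip_le {T : ℝ} (hT : 0 ≤ T) (t : ℝ) : |clip T t| ≤ T := by
  rw [abs_of_nonneg (clip_mem hT t).1]
  exact (clip_mem hT t).2

theorem SobolevContinuousOn.of_dominated {r T : ℝ} (hT : 0 ≤ T) {u : ℝ → 𝓢'(ℝ, ℂ)}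
    {w : ℝ → ℝ → ℂ} {Γ : ℝ → ℝ} (hΓ : MemLp Γ 2 volume) (hu : ∀ t, SobRep r (u t) (w t))
    (hw : ∀ t, |t| ≤ T → ∀ ξ, ‖(jap r ξ : ℂ) • w t ξ‖ ≤ Γ ξ)
    (hc : ∀ ξ, Continuous fun t => w t ξ) : SobolevContinuousOn r u (Icc 0 T) := by
  have h1 := continuous_toLp_of_dominated (w := fun t ξ => (jap r ξ : ℂ) • w (clip T t) ξ) hΓ
    (fun t => (hu _).memLp.1) (.of_forall fun ξ =>
      ((hc ξ).comp (continuous_clip T)).const_smul (jap r ξ : ℂ))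
    (fun t => Eventually.of_forall fun ξ => hw _ (abs_clip_le hT t) ξ) (fun t => (hu _).memLp)
  refine ⟨fun t => 𝓕⁻ ((hu (clip T t)).memLp.toLp _ : Lp ℂ 2 vol), (by fun_prop), fun t ht => ?_⟩
  have h2 := (hu (clip T t)).besselPotential_eq
  rw [clip_of_mem ht] at h2
  simp only [clip_of_mem ht, h2]

theorem KGData.sobolevContinuousOn (hd : KGData k B a₀ a₁ s) {T : ℝ} (hT : 0 ≤ T)
    {u : ℝ → 𝓢'(ℝ, ℂ)} (hu : ∀ t, SobRep k (u t) (kgW m a₀ a₁ s t)) :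
    SobolevContinuousOn k u (Icc 0 T) :=
  .of_dominated hT (hd.memLp_majorant T) hu (fun _ ht ξ => hd.norm_kgW_le ht ξ) fun ξ =>
    continuous_iff_continuousAt.2 fun t => (hasDerivAt_kgW hd.cont t ξ).continuousAt

theorem KGData.sobolevContinuousOn_deriv (hd : KGData k B a₀ a₁ s) {T : ℝ} (hT : 0 ≤ T)
    {u : ℝ → 𝓢'(ℝ, ℂ)} (hu : ∀ t, SobRep (k - 1) (u t) (kgWt m a₀ a₁ s t)) :
    SobolevContinuousOn (k - 1) u (Icc 0 T) :=
  .of_dominated hT (hd.memLp_majorantT m T) hu (fun _ ht ξ => hd.norm_kgWt_le ht ξ) fun ξ =>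
    continuous_iff_continuousAt.2 fun t => (hasDerivAt_kgWt hd.cont t ξ).continuousAt

theorem schwartz_smul_norm_eq (r ξ : ℝ) (h : 𝓢(ℝ, ℂ)) (z : ℂ) :
    ‖h ξ • z‖ = ‖japMul (-r) h ξ‖ * ‖(jap r ξ : ℂ) • z‖ := by
  rw [norm_smul, norm_jap_smul, japMul_apply, norm_mul, norm_real, norm_of_nonneg (jap_pos _ _).le]
  have := jap_neg_mul r ξ
  calc ‖h ξ‖ * ‖z‖ = (jap (-r) ξ * jap r ξ) * (‖h ξ‖ * ‖z‖) := by rw [this, one_mul]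
    _ = _ := by ring

theorem integrable_schwartz_mul_majorant (h : 𝓢(ℝ, ℂ)) {Γ : ℝ → ℝ} (hΓ : MemLp Γ 2 volume) :
    Integrable fun ξ => ‖h ξ‖ * Γ ξ :=
  memLp_one_iff_integrable.1 (hΓ.mul (h.memLp 2 volume).norm)

theorem hasDerivAt_pairing_symbol {r : ℝ} {w w' : ℝ → ℝ → ℂ} {t : ℝ} {Γ : ℝ → ℝ} (h : 𝓢(ℝ, ℂ))
    (hΓ : Integrable fun ξ => ‖japMul (-r) h ξ‖ * Γ ξ)
    (hm : ∀ t, AEStronglyMeasurable (w t) volume) (hi : Integrable fun ξ => h ξ • w t ξ)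
    (hm' : AEStronglyMeasurable (w' t) volume)
    (hw' : ∀ τ, |τ| ≤ |t| + 1 → ∀ ξ, ‖(jap r ξ : ℂ) • w' τ ξ‖ ≤ Γ ξ)
    (hd : ∀ τ ξ, HasDerivAt (fun τ => w τ ξ) (w' τ ξ) τ) :
    HasDerivAt (fun τ => ∫ ξ, h ξ • w τ ξ) (∫ ξ, h ξ • w' t ξ) t := by
  refine (hasDerivAt_integral_of_dominated_loc_of_deriv_le (s := Metric.ball t 1)
    (F := fun τ ξ => h ξ • w τ ξ) (F' := fun τ ξ => h ξ • w' τ ξ)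
    (bound := fun ξ => ‖japMul (-r) h ξ‖ * Γ ξ)
    (Metric.ball_mem_nhds t one_pos)
    (.of_forall fun τ => (by fun_prop)) hi
    (by fun_prop) (.of_forall fun ξ τ hτ => ?_) hΓ
    (.of_forall fun ξ τ _ => (hd τ ξ).const_smul (h ξ))).2
  rw [schwartz_smul_norm_eq r]
  refine mul_le_mul_of_nonneg_left (hw' τ ?_ ξ) (norm_nonneg _)
  have h1 := (Metric.mem_ball.1 hτ).le
  rw [dist_eq] at h1
  have h2 := abs_add_le (τ - t) t
  rw [sub_add_cancel] at h2
  linarith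

theorem KGData.hasDerivAt (hd : KGData k B a₀ a₁ s) {u v : ℝ → 𝓢'(ℝ, ℂ)}
    (hu : ∀ t, SobRep k (u t) (kgW m a₀ a₁ s t))
    (hv : ∀ t, SobRep (k - 1) (v t) (kgWt m a₀ a₁ s t)) (h : 𝓢(ℝ, ℂ)) (t : ℝ) :
    HasDerivAt (fun t => u t h) (v t h) t := by
  simp_rw [(hu _).eq, (hv _).eq]
  exact hasDerivAt_pairing_symbol (r := k - 1) (Γ := kgMajorantT m k B a₀ a₁ (|t| + 1)) _
    (integrable_schwartz_mul_majorant _ (hd.memLp_majorantT m _))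
    (fun t => hd.aestronglyMeasurable_kgW m t) ((hu t).integrable _)
    (hd.aestronglyMeasurable_kgWt m t) (fun τ hτ ξ => hd.norm_kgWt_le hτ ξ)
    fun τ ξ => hasDerivAt_kgW hd.cont τ ξ

theorem fourierInv_derivCLM (h : 𝓢(ℝ, ℂ)) (ξ : ℝ) :
    (𝓕⁻ (∂ₛ h)) ξ = -(2 * π * I * ξ) * (𝓕⁻ h) ξ := by
  rw [fourierInv_coe, fourierInv_coe, Real.fourierInv_eq_fourier_neg,
    Real.fourierInv_eq_fourier_neg]
  have h2 : ⇑(∂ₛ h) = deriv h := funext fun x => by simp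
  have h3 : Integrable (deriv h) volume := h2 ▸ (∂ₛ h).integrable
  have h1 := congrFun (Real.fourier_deriv (f := h) h.integrable h.differentiable h3) (-ξ)
  rw [h2, h1]
  simp

theorem fourierInv_derivCLM_derivCLM (m : ℝ) (h : 𝓢(ℝ, ℂ)) (ξ : ℝ) :
    (𝓕⁻ (∂ₛ (∂ₛ h))) ξ - (m : ℂ) ^ 2 * (𝓕⁻ h) ξ = -((freq m ξ ^ 2 : ℝ) : ℂ) * (𝓕⁻ h) ξ := by
  rw [fourierInv_derivCLM, fourierInv_derivCLM, freq_sq]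
  push_cast
  linear_combination (4 * (π : ℂ) ^ 2 * ξ ^ 2 * (𝓕⁻ h) ξ) * I_sq

theorem KGData.hasDerivAt_deriv (hd : KGData k B a₀ a₁ s) {u v : ℝ → 𝓢'(ℝ, ℂ)}
    (hu : ∀ t, SobRep k (u t) (kgW m a₀ a₁ s t))
    (hv : ∀ t, SobRep (k - 1) (v t) (kgWt m a₀ a₁ s t)) (h : 𝓢(ℝ, ℂ)) (t : ℝ) :
    HasDerivAt (fun t => v t h)
      (u t (∂ₛ (∂ₛ h)) - (m : ℂ) ^ 2 * u t h +
        ∫ ξ, (𝓕⁻ h) ξ • s t ξ) t := by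
  have hsl : ∀ t, Continuous fun ξ => s t ξ := fun t =>
    hd.cont.comp (continuous_const.prodMk continuous_id)
  have hi : ∀ g : 𝓢(ℝ, ℂ), Integrable fun ξ => g ξ • s t ξ := fun g =>
    (g.integrable (μ := volume)).smul_bdd B (by fun_prop)
      (.of_forall fun ξ => hd.bound t ξ)
  have e : u t (∂ₛ (∂ₛ h)) - (m : ℂ) ^ 2 * u t h +
        ∫ ξ, (𝓕⁻ h) ξ • s t ξ = ∫ ξ, (𝓕⁻ h) ξ • (-((freq m ξ ^ 2 : ℝ) : ℂ) * kgW m a₀ a₁ s t ξ +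
          s t ξ) := by
    rw [(hu t).eq, (hu t).eq, ← integral_const_mul, ← integral_sub ((hu t).integrable _)
      (((hu t).integrable _).const_mul _), ← integral_add _ (hi _)]
    · refine integral_congr_ae (.of_forall fun ξ => ?_)
      simp only [smul_eq_mul]
      linear_combination (kgW m a₀ a₁ s t ξ) * fourierInv_derivCLM_derivCLM m h ξ
    · exact ((hu t).integrable _).sub (((hu t).integrable _).const_mul _)
  rw [e]
  simp_rw [(hv _).eq]
  refine hasDerivAt_pairing_symbol (r := k - 2)
    (Γ := fun ξ => (|m| + 2 * π) ^ 2 * kgMajorant k B a₀ a₁ (|t| + 1) ξ + jap (k - 2) ξ * B)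
    _ ?_ (fun t => hd.aestronglyMeasurable_kgWt m t) ((hv t).integrable _) ?_
    (fun τ hτ ξ => ?_) fun τ ξ => hasDerivAt_kgWt hd.cont τ ξ
  · refine integrable_schwartz_mul_majorant _ (((hd.memLp_majorant _).const_mul _).add
      (MemLp.mul_const (memLp_jap ?_) B))
    linarith [hd.lt]
  · exact (((continuous_ofReal.comp ((continuous_freq m).pow 2)).neg).aestronglyMeasurable.mul
      (hd.aestronglyMeasurable_kgW m t)).add (by fun_prop)
  · rw [norm_jap_smul]
    have h1 := hd.norm_kgW_le (m := m) hτ ξ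
    rw [norm_jap_smul] at h1
    have h2 : freq m ξ ^ 2 ≤ (|m| + 2 * π) ^ 2 * jap 2 ξ := by
      have h3 := pow_le_pow_left₀ (freq_nonneg m ξ) (freq_le m ξ) 2
      rw [mul_pow, sq (jap 1 ξ), jap_mul] at h3
      norm_num at h3 ⊢
      exact h3
    have e1 : jap (k - 2) ξ * jap 2 ξ = jap k ξ := by rw [jap_mul, sub_add_cancel]
    have hj := jap_pos (k - 2) ξ
    calc jap (k - 2) ξ * ‖-((freq m ξ ^ 2 : ℝ) : ℂ) * kgW m a₀ a₁ s τ ξ + s τ ξ‖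
        ≤ jap (k - 2) ξ * (freq m ξ ^ 2 * ‖kgW m a₀ a₁ s τ ξ‖ + B) := by
          gcongr
          refine (norm_add_le _ _).trans (add_le_add ?_ (hd.bound τ ξ))
          simp
      _ ≤ jap (k - 2) ξ * ((|m| + 2 * π) ^ 2 * jap 2 ξ * ‖kgW m a₀ a₁ s τ ξ‖ + B) := by
          gcongr
      _ = (|m| + 2 * π) ^ 2 * ((jap (k - 2) ξ * jap 2 ξ) * ‖kgW m a₀ a₁ s τ ξ‖) +
          jap (k - 2) ξ * B := by ring
      _ ≤ _ := by
          rw [e1]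
          gcongr

end KleinGordonWeak

section KleinGordonUnique

def freqMul (m : ℝ) (g : 𝓢(ℝ, ℂ)) : 𝓢(ℝ, ℂ) :=
  SchwartzMap.smulLeftCLM ℂ (fun ξ : ℝ => ((-(m ^ 2 + (2 * π * ξ) ^ 2) : ℝ) : ℂ)) g

theorem freqMul_apply (m : ℝ) (g : 𝓢(ℝ, ℂ)) (ξ : ℝ) :
    freqMul m g ξ = -((freq m ξ ^ 2 : ℝ) : ℂ) * g ξ := by
  rw [freqMul, SchwartzMap.smulLeftCLM_apply_apply (by fun_prop), smul_eq_mul, freq_sq,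
    ← ofReal_neg]

theorem fourier_freqMul (m : ℝ) (g : 𝓢(ℝ, ℂ)) : 𝓕 (freqMul m g) = ∂ₛ (∂ₛ (𝓕 g)) -
      (m : ℂ) ^ 2 • 𝓕 g := by
  set R := ∂ₛ (∂ₛ (𝓕 g)) - (m : ℂ) ^ 2 • 𝓕 g with hR
  have h1 : 𝓕⁻ R = 𝓕⁻ (∂ₛ (∂ₛ (𝓕 g))) - (m : ℂ) ^ 2 • 𝓕⁻ (𝓕 g) := by
    change fourierInvCLM ℂ 𝓢(ℝ, ℂ) R = _
    rw [hR, map_sub, map_smul]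
    rfl
  rw [← FourierTransform.fourier_fourierInv_eq (F := 𝓢(ℝ, ℂ)) R, h1]
  congr 1
  ext ξ
  have h2 := fourierInv_derivCLM_derivCLM m (𝓕 g) ξ
  rw [freqMul_apply, _root_.sub_apply, _root_.smul_apply, smul_eq_mul, h2,
    FourierTransform.fourierInv_fourier_eq]

theorem norm_freqMul_toLp_le (m : ℝ) {ρ : ℝ} {g : 𝓢(ℝ, ℂ)} (hg : ∀ ξ, ρ < |ξ| → g ξ = 0) :
    ‖(freqMul m g).toLp 2 volume‖ ≤ (m ^ 2 + (2 * π * ρ) ^ 2) * ‖g.toLp 2 volume‖ := by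
  refine Lp.norm_le_mul_norm_of_ae_le_mul ?_
  filter_upwards [(freqMul m g).coeFn_toLp 2 volume, g.coeFn_toLp 2 volume] with ξ h1 h2
  rw [h1, h2, freqMul_apply, norm_mul, norm_neg, norm_real,
    norm_of_nonneg (sq_nonneg _), freq_sq]
  rcases lt_or_ge ρ |ξ| with h | h
  · rw [hg ξ h]
    simp
  · refine mul_le_mul_of_nonneg_right ?_ (norm_nonneg _)
    have h3 : ξ ^ 2 ≤ ρ ^ 2 := by
      rw [← sq_abs ξ]
      exact pow_le_pow_left₀ (abs_nonneg _) h 2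
    rw [mul_pow, mul_pow]
    have := mul_le_mul_of_nonneg_left h3 (by positivity : (0 : ℝ) ≤ (2 * π) ^ 2)
    rw [mul_pow] at this
    linarith

theorem norm_le_integral_of_hasDerivWithinAt {f f' : ℝ → ℂ} {T K : ℝ} {n : ℕ}
    (h0 : f 0 = 0) (hf : ∀ t ∈ Icc 0 T, HasDerivWithinAt f (f' t) (Icc 0 T) t)
    (hb : ∀ t ∈ Icc 0 T, ‖f' t‖ ≤ K * (t ^ n / n.factorial)) :
    ∀ t ∈ Icc 0 T, ‖f t‖ ≤ K * (t ^ (n + 1) / (n + 1).factorial) := by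
  intro t ht
  refine image_norm_le_of_norm_deriv_right_le_deriv_boundary (f' := f')
    (B := fun t => K * (t ^ (n + 1) / (n + 1).factorial))
    (fun s hs => (hf s hs).continuousWithinAt) (fun s hs => ?_) (by simp [h0])
    (fun s => ?_) (fun s hs => hb s ⟨hs.1, hs.2.le⟩) ht
  · exact (hf s ⟨hs.1, hs.2.le⟩).mono_of_mem_nhdsWithin (Icc_mem_nhdsGE_of_mem hs)
  · have h1 := (((hasDerivAt_pow (n + 1) s).div_const ((n + 1).factorial : ℝ)).const_mul K)
    refine h1.congr_deriv ?_
    rw [Nat.factorial_succ]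
    push_cast
    have h2 : (n.factorial : ℝ) ≠ 0 := by positivity
    have h3 : ((n : ℝ) + 1) ≠ 0 := by positivity
    field_simp

theorem norm_toTemperedDistribution_le (f : Lp ℂ 2 vol) (h : 𝓢(ℝ, ℂ)) :
    ‖toTemperedDistribution f h‖ ≤ ‖h.toLp 2 volume‖ * ‖f‖ := by
  have h5 := L2.inner_def (𝕜 := ℂ) (E := ℂ) (μ := vol)
    (conjCLE.toContinuousLinearMap.compLp (h.toLp 2 volume)) f
  have h6 : ‖conjCLE.toContinuousLinearMap.compLp (h.toLp 2 volume :
      Lp ℂ 2 vol)‖ ≤ ‖h.toLp 2 volume‖ := by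
    refine Lp.norm_le_norm_of_ae_le ?_
    filter_upwards [coeFn_compLp conjCLE.toContinuousLinearMap (h.toLp 2 volume)] with ξ h7
    rw [h7]
    simp
  have h8 : toTemperedDistribution f h = inner ℂ
      (conjCLE.toContinuousLinearMap.compLp (h.toLp 2 volume)) f := by
    rw [h5, toTemperedDistribution_eq_pairL2, pairL2_eq]
    apply integral_congr_ae
    filter_upwards [coeFn_compLp conjCLE.toContinuousLinearMap (h.toLp 2 volume)] with ξ h7
    rw [h7]
    simp [mul_comm]
  rw [h8]
  exact (norm_inner_le_norm _ _).trans (by gcongr)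

theorem norm_toTemperedDistribution_fourier_le (f : Lp ℂ 2 vol) (g : 𝓢(ℝ, ℂ)) :
    ‖toTemperedDistribution f (𝓕 g)‖ ≤ ‖g.toLp 2 volume‖ * ‖f‖ := by
  rw [← TemperedDistribution.fourier_apply, Lp.fourier_toTemperedDistribution_eq,
    ← Lp.norm_fourier_eq f]
  exact norm_toTemperedDistribution_le _ _

theorem klein_gordon_unique {m T : ℝ} {Z : ℝ → Lp ℂ 2 vol}
    {v : ℝ → 𝓢(ℝ, ℂ) → ℂ} (hZ : ContinuousOn Z (Icc 0 T)) (hZ0 : Z 0 = 0) (hv0 : ∀ h, v 0 h = 0)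
    (h1 : ∀ h, ∀ t ∈ Icc 0 T,
      HasDerivWithinAt (fun s => toTemperedDistribution (Z s) h) (v t h) (Icc 0 T) t)
    (h2 : ∀ h, ∀ t ∈ Icc 0 T, HasDerivWithinAt (fun s => v s h)
      (toTemperedDistribution (Z t)
          (∂ₛ (∂ₛ h)) -
        (m : ℂ) ^ 2 * toTemperedDistribution (Z t) h) (Icc 0 T) t) :
    ∀ t ∈ Icc 0 T, Z t = 0 := by
  obtain ⟨C, hC⟩ : ∃ C, ∀ t ∈ Icc 0 T, ‖Z t‖ ≤ C := isCompact_Icc.exists_bound_of_continuousOn hZ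
  have key : ∀ (ρ : ℝ) (n : ℕ) (g : 𝓢(ℝ, ℂ)), (∀ ξ, ρ < |ξ| → g ξ = 0) → ∀ t ∈ Icc 0 T,
      ‖toTemperedDistribution (Z t) (𝓕 g)‖ ≤ (C * (m ^ 2 + (2 * π * ρ) ^ 2) ^ n *
        ‖g.toLp 2 volume‖) * (t ^ (2 * n) / (2 * n).factorial) := by
    intro ρ n
    induction n with
    | zero =>
      intro g _ t ht
      simp only [pow_zero, mul_one, mul_zero, Nat.factorial_zero, Nat.cast_one, div_one]
      refine (norm_toTemperedDistribution_fourier_le (Z t) g).trans ?_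
      rw [mul_comm]
      exact mul_le_mul_of_nonneg_right (hC t ht) (norm_nonneg _)
    | succ n ih =>
      intro g hg t ht
      have hC0 : 0 ≤ C := (norm_nonneg _).trans (hC t ht)
      have hL : ∀ ξ, ρ < |ξ| → freqMul m g ξ = 0 := fun ξ hξ => by
        rw [freqMul_apply, hg ξ hξ, mul_zero]
      have e1 : ∀ t, toTemperedDistribution (Z t) (𝓕 (freqMul m g)) =
          toTemperedDistribution (Z t)
            (∂ₛ (∂ₛ (𝓕 g))) -
          (m : ℂ) ^ 2 * toTemperedDistribution (Z t) (𝓕 g) := fun t => by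
        rw [fourier_freqMul, map_sub, map_smul, smul_eq_mul]
      have e2 : ∀ t ∈ Icc 0 T, ‖toTemperedDistribution (Z t) (𝓕 (freqMul m g))‖ ≤
          (C * (m ^ 2 + (2 * π * ρ) ^ 2) ^ (n + 1) * ‖g.toLp 2 volume‖) *
            (t ^ (2 * n) / (2 * n).factorial) := fun t ht => by
        refine (ih (freqMul m g) hL t ht).trans ?_
        refine mul_le_mul_of_nonneg_right ?_ (div_nonneg (pow_nonneg ht.1 _) (by positivity))
        calc C * (m ^ 2 + (2 * π * ρ) ^ 2) ^ n * ‖(freqMul m g).toLp 2 volume‖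
            ≤ C * (m ^ 2 + (2 * π * ρ) ^ 2) ^ n *
              ((m ^ 2 + (2 * π * ρ) ^ 2) * ‖g.toLp 2 volume‖) :=
              mul_le_mul_of_nonneg_left (norm_freqMul_toLp_le m hg) (by positivity)
          _ = _ := by ring
      have e3 := norm_le_integral_of_hasDerivWithinAt (hv0 (𝓕 g))
        (fun t ht => (h2 (𝓕 g) t ht).congr_deriv (e1 t).symm) e2
      have e4 := norm_le_integral_of_hasDerivWithinAt (f := fun t =>
        toTemperedDistribution (Z t) (𝓕 g)) (by simp [hZ0]) (h1 (𝓕 g)) e3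
      exact e4 t ht
  intro t ht
  have vanish : ∀ (ρ : ℝ) (g : 𝓢(ℝ, ℂ)), (∀ ξ, ρ < |ξ| → g ξ = 0) →
      toTemperedDistribution (Z t) (𝓕 g) = 0 := by
    intro ρ g hg
    rw [← norm_le_zero_iff]
    have hR : 0 ≤ m ^ 2 + (2 * π * ρ) ^ 2 := by positivity
    set c := sqrt (m ^ 2 + (2 * π * ρ) ^ 2) * t
    have h3 : Tendsto (fun n : ℕ => C * ‖g.toLp 2 volume‖ *
        (c ^ (2 * n) / (2 * n).factorial)) atTop (𝓝 (C * ‖g.toLp 2 volume‖ * 0)) :=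
      ((FloorSemiring.tendsto_pow_div_factorial_atTop c).comp
        (tendsto_id.const_mul_atTop' (by norm_num : 0 < 2))).const_mul _
    rw [mul_zero] at h3
    refine ge_of_tendsto' h3 fun n => (key ρ n g hg t ht).trans (le_of_eq ?_)
    have h4 : c ^ (2 * n) = (m ^ 2 + (2 * π * ρ) ^ 2) ^ n * t ^ (2 * n) := by
      rw [mul_pow, pow_mul (sqrt _) 2 n, Real.sq_sqrt hR]
    rw [h4]
    ring
  have hF : (𝓕 (Z t) : Lp ℂ 2 vol) = 0 := by
    rw [Lp.eq_zero_iff_ae_eq_zero]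
    apply ae_eq_zero_of_integral_contDiff_smul_eq_zero
    · exact (memLp _).locallyIntegrable (by norm_num)
    · intro g g_smooth g_cpt
      have hg₁ : HasCompactSupport (ofRealCLM ∘ g) := g_cpt.comp_left rfl
      have hg₂ : ContDiff ℝ ((⊤ : ℕ∞) : WithTop ℕ∞) (ofRealCLM ∘ g) := by fun_prop
      obtain ⟨ρ, hρ⟩ := g_cpt.isCompact.isBounded.subset_closedBall 0
      have h3 := vanish ρ (hg₁.toSchwartzMap hg₂) fun ξ hξ => by
        have : ξ ∉ tsupport g := fun h => by
          have := hρ h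
          rw [mem_closedBall_zero_iff, norm_eq_abs] at this
          linarith
        simp [image_eq_zero_of_notMem_tsupport this]
      rw [← TemperedDistribution.fourier_apply, Lp.fourier_toTemperedDistribution_eq,
        toTemperedDistribution_apply] at h3
      simpa using h3
  have h4 := congrArg (fun f : Lp ℂ 2 vol => 𝓕⁻ f) hF
  simpa [FourierTransform.fourierInv_fourier_eq] using h4

def conjS (h : 𝓢(ℝ, ℂ)) : 𝓢(ℝ, ℂ) :=
  SchwartzMap.postcompCLM (𝕜 := ℝ) conjCLE.toContinuousLinearMap h

theorem conjS_apply (h : 𝓢(ℝ, ℂ)) (x : ℝ) : conjS h x = (starRingEnd ℂ) (h x) := by simp [conjS]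

theorem derivCLM_conjS (h : 𝓢(ℝ, ℂ)) : ∂ₛ (conjS h) = conjS (∂ₛ h) := by
  ext x
  rw [conjS_apply, derivCLM_apply, derivCLM_apply]
  have h1 : ⇑(conjS h) = fun x => (starRingEnd ℂ) (h x) := funext (conjS_apply h)
  rw [h1]
  have h2 := (h.differentiable x).hasDerivAt
  exact (conjCLE.toContinuousLinearMap.hasFDerivAt.comp_hasDerivAt x h2).deriv

theorem IsReal.apply_conjS {u : 𝓢'(ℝ, ℂ)} (hu : IsReal u) (h : 𝓢(ℝ, ℂ)) :
    u (conjS h) = (starRingEnd ℂ) (u h) := by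
  have h1 := hu (h + conjS h) fun x => by simp [conjS_apply]
  have h2 := hu (I • (h - conjS h)) fun x => by simp [conjS_apply]
  rw [map_add] at h1
  rw [map_smul, map_sub, smul_eq_mul] at h2
  apply Complex.ext
  · simp only [mul_im, I_re, I_im, sub_re, sub_im] at h2
    simp only [Complex.conj_re]
    linarith
  · simp only [add_im] at h1
    simp only [conj_im]
    linarith

end KleinGordonUnique

section Density

def density (B : 𝓛) (ψ : SpinorL2) : Lp ℂ 1 vol := (memLp_one_iff_integrable.2
    (L2.integrable_inner (𝕜 := ℂ) (B.compLp ψ) ψ)).toLp _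

theorem density_ae (B : 𝓛) (ψ : SpinorL2) :
    density B ψ =ᵐ[volume] fun x => inner ℂ (B (ψ x)) (ψ x) := by
  filter_upwards [MemLp.coeFn_toLp (memLp_one_iff_integrable.2
    (L2.integrable_inner (𝕜 := ℂ) (B.compLp ψ) ψ)),
    coeFn_compLp B ψ] with x h1 h2
  rw [density, h1, h2]

theorem norm_density_sub_le {B : 𝓛} (hB : ∀ x, ‖B x‖ = ‖x‖) (ψ ψ' : SpinorL2) :
    ‖density B ψ - density B ψ'‖ ≤ ‖ψ - ψ'‖ * (‖ψ‖ + ‖ψ'‖) := by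
  have e1 : ‖density B ψ - density B ψ'‖ₑ ≤ ‖ψ - ψ'‖ₑ * (‖ψ‖ₑ + ‖ψ'‖ₑ) := by
    have e2 : ‖density B ψ - density B ψ'‖ₑ = ∫⁻ x, ‖(density B ψ - density B ψ') x‖ₑ := by
      rw [Lp.enorm_def, eLpNorm_one_eq_lintegral_enorm]
    have e3 : ∀ᵐ x, ‖(density B ψ - density B ψ') x‖ₑ ≤
        ‖(ψ - ψ') x‖ₑ * ‖ψ x‖ₑ + ‖(ψ - ψ') x‖ₑ * ‖ψ' x‖ₑ := by
      filter_upwards [coeFn_sub (density B ψ) (density B ψ'), coeFn_sub ψ ψ',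
        density_ae B ψ, density_ae B ψ'] with x h1 h2 h3 h4
      rw [h1, h2, Pi.sub_apply, Pi.sub_apply, h3, h4]
      have h5 : inner ℂ (B (ψ x)) (ψ x) - inner ℂ (B (ψ' x)) (ψ' x) =
          inner ℂ (B (ψ x - ψ' x)) (ψ x) + inner ℂ (B (ψ' x)) (ψ x - ψ' x) := by simp
      rw [h5]
      have h6 : ∀ y z : Spinor, ‖inner ℂ (B y) z‖ₑ ≤ ‖y‖ₑ * ‖z‖ₑ := fun y z => by
        rw [← ofReal_norm, ← ofReal_norm, ← ofReal_norm, ← ofReal_mul (norm_nonneg _)]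
        refine ofReal_le_ofReal ((norm_inner_le_norm _ _).trans ?_)
        rw [hB]
      refine (enorm_add_le _ _).trans (add_le_add (h6 _ _) ((h6 _ _).trans (le_of_eq ?_)))
      rw [mul_comm]
    have hm : ∀ f : SpinorL2, AEMeasurable (fun x => ‖f x‖ₑ) volume := fun f =>
      (Lp.aestronglyMeasurable f).enorm
    have e4 : ∀ f g : SpinorL2, ∫⁻ x, ‖f x‖ₑ * ‖g x‖ₑ ≤ ‖f‖ₑ * ‖g‖ₑ := fun f g => by
      refine (lintegral_mul_le_sqrt volume (hm f) (hm g)).trans (le_of_eq ?_)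
      rw [← enorm_sq_lp, ← enorm_sq_lp, ← rpow_natCast, ← rpow_natCast, ← rpow_mul, ← rpow_mul]
      norm_num
    rw [e2]
    refine (lintegral_mono_ae e3).trans ?_
    rw [lintegral_add_left' (by fun_prop), mul_add]
    exact add_le_add (e4 _ _) (e4 _ _)
  have h1 := toReal_mono (by finiteness) e1
  rw [ENNReal.toReal_mul, ENNReal.toReal_add (by simp) (by simp)] at h1
  simpa using h1

theorem density_zero (B : 𝓛) : density B 0 = 0 := by
  rw [Lp.eq_zero_iff_ae_eq_zero]
  filter_upwards [density_ae B 0, Lp.coeFn_zero Spinor 2 vol] with x h1 h2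
  rw [h1, h2]
  simp

theorem norm_density_le {B : 𝓛} (hB : ∀ x, ‖B x‖ = ‖x‖) (ψ : SpinorL2) :
    ‖density B ψ‖ ≤ ‖ψ‖ ^ 2 := by
  have := norm_density_sub_le hB ψ 0
  rwa [density_zero, sub_zero, sub_zero, norm_zero, add_zero, ← sq] at this

theorem continuous_density {B : 𝓛} (hB : ∀ x, ‖B x‖ = ‖x‖) : Continuous (density B) := by
  rw [continuous_iff_continuousAt]
  intro ψ
  rw [ContinuousAt, tendsto_iff_norm_sub_tendsto_zero]
  have h1 : Tendsto (fun φ : SpinorL2 => ‖φ - ψ‖ * (‖φ‖ + ‖ψ‖)) (𝓝 ψ)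
      (𝓝 (‖ψ - ψ‖ * (‖ψ‖ + ‖ψ‖))) := (Continuous.tendsto (by fun_prop) ψ)
  rw [sub_self, norm_zero, zero_mul] at h1
  exact squeeze_zero (fun _ => norm_nonneg _) (fun φ => norm_density_sub_le hB φ ψ) h1

theorem norm_fourier_lp_le (S : Lp ℂ 1 vol) (ξ : ℝ) : ‖𝓕 (S : ℝ → ℂ) ξ‖ ≤ ‖S‖ := by
  rw [fourier_real_eq, L1.norm_eq_integral_norm]
  refine (norm_integral_le_integral_norm _).trans (le_of_eq ?_)
  simp

theorem fourier_lp_sub (S S' : Lp ℂ 1 vol) (ξ : ℝ) :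
    𝓕 (S : ℝ → ℂ) ξ - 𝓕 (S' : ℝ → ℂ) ξ = 𝓕 ((S - S' : Lp ℂ 1 vol) : ℝ → ℂ) ξ := by
  have hi : ∀ f : Lp ℂ 1 vol, Integrable fun v : ℝ => 𝐞 (-(v * ξ)) • f v := fun f => by
    have := (Real.fourierIntegral_convergent_iff (μ := vol) (f := f) ξ).2 (L1.integrable_coeFn f)
    simpa [mul_comm] using this
  rw [fourier_real_eq, fourier_real_eq, fourier_real_eq, ← integral_sub (hi S) (hi S')]
  exact integral_congr_ae ((coeFn_sub S S').mono fun x h1 => by simp only [h1, Pi.sub_apply, smul_sub])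

theorem continuous_fourier_lp {S : ℝ → Lp ℂ 1 vol} (hS : Continuous S) :
    Continuous fun p : ℝ × ℝ => 𝓕 (S p.1 : ℝ → ℂ) p.2 := by
  rw [continuous_iff_continuousAt]
  rintro ⟨t, ξ⟩
  rw [ContinuousAt, tendsto_iff_norm_sub_tendsto_zero]
  have c1 : Continuous (𝓕 (S t : ℝ → ℂ)) := VectorFourier.fourierIntegral_continuous (by fun_prop)
      (by fun_prop) (L1.integrable_coeFn (S t))
  have h1 : Tendsto (fun p : ℝ × ℝ => ‖S p.1 - S t‖ + ‖𝓕 (S t : ℝ → ℂ) p.2 -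
      𝓕 (S t : ℝ → ℂ) ξ‖) (𝓝 (t, ξ)) (𝓝 (‖S t - S t‖ + ‖𝓕 (S t : ℝ → ℂ) ξ -
      𝓕 (S t : ℝ → ℂ) ξ‖)) := Continuous.tendsto (by fun_prop) (t, ξ)
  rw [sub_self, sub_self, norm_zero, norm_zero, add_zero] at h1
  refine squeeze_zero (fun _ => norm_nonneg _) (fun p => ?_) h1
  calc ‖𝓕 (S p.1 : ℝ → ℂ) p.2 - 𝓕 (S t : ℝ → ℂ) ξ‖
      = ‖(𝓕 (S p.1 : ℝ → ℂ) p.2 - 𝓕 (S t : ℝ → ℂ) p.2) +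
        (𝓕 (S t : ℝ → ℂ) p.2 - 𝓕 (S t : ℝ → ℂ) ξ)‖ := by rw [sub_add_sub_cancel]
    _ ≤ _ := by
      refine (norm_add_le _ _).trans (add_le_add ?_ le_rfl)
      rw [fourier_lp_sub]
      exact norm_fourier_lp_le _ _

theorem integral_fourierInv_mul_fourier (h : 𝓢(ℝ, ℂ)) (S : Lp ℂ 1 vol) :
    ∫ ξ, (𝓕⁻ h) ξ • 𝓕 (S : ℝ → ℂ) ξ = ∫ x, h x * S x := by
  have h1 := VectorFourier.integral_bilin_fourierIntegral_eq_flip (mul ℂ ℂ)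
    (μ := vol) (ν := vol) (L := innerₗ ℝ)
    (f := (𝓕⁻ h : 𝓢(ℝ, ℂ))) (g := S) continuous_fourierChar continuous_inner
    (𝓕⁻ h).integrable (L1.integrable_coeFn S)
  have h2 : ∀ x, VectorFourier.fourierIntegral 𝐞 volume (innerₗ ℝ)
      (𝓕⁻ h : 𝓢(ℝ, ℂ)) x = h x := fun x => by
    have : 𝓕 (𝓕⁻ h) = h := FourierTransform.fourier_fourierInv_eq h
    exact congrArg (fun f : 𝓢(ℝ, ℂ) => f x) this
  simp only [h2, mul_apply', flip_innerₗ] at h1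
  exact h1.symm

end Density

section RealWave

variable {m k B : ℝ} {a₀ a₁ : ℝ → ℂ} {s : ℝ → ℝ → ℂ}

theorem KGData.mono (hd : KGData k B a₀ a₁ s) {r : ℝ} (hr : r ≤ k) : KGData r B a₀ a₁ s := by
  obtain ⟨u, hu⟩ := exists_sobRep hd.memLp₀
  obtain ⟨v, hv⟩ := exists_sobRep hd.memLp₁
  exact ⟨hr.trans_lt hd.lt, (hu.mono hr).memLp, (hv.mono (by linarith)).memLp, hd.cont, hd.bound⟩

def imC : ℂ →L[ℝ] ℂ := ofRealCLM ∘L Complex.imCLM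

theorem toTemperedDistribution_imC (f : Lp ℂ 2 vol) (h : 𝓢(ℝ, ℂ)) :
    toTemperedDistribution (imC.compLpL 2 volume f) h = (toTemperedDistribution f h -
        (starRingEnd ℂ) (toTemperedDistribution f (conjS h))) / (2 * I) := by
  have hi : ∀ g : 𝓢(ℝ, ℂ), Integrable fun x => g x • f x := fun g =>
    integrable_schwartz_smul (s := 0) (by simpa [jap_zero] using memLp f) g
  have hi' : Integrable fun x => (starRingEnd ℂ) (conjS h x • f x) :=
    conjCLE.toContinuousLinearMap.integrable_comp (hi (conjS h))
  rw [toTemperedDistribution_apply, toTemperedDistribution_apply,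
    toTemperedDistribution_apply, ← integral_conj, ← integral_sub (hi h) hi', eq_div_iff (by simp),
    ← integral_mul_const]
  apply integral_congr_ae
  filter_upwards [coeFn_compLpL (p := 2) (μ := volume) imC f] with x hx
  rw [hx]
  simp only [imC, conjS_apply, smul_eq_mul, map_mul, conj_conj,
    comp_apply, ofRealCLM_apply, Complex.imCLM_apply]
  have h1 := Complex.sub_conj (f x)
  rw [← mul_sub, h1]
  push_cast
  ring

theorem HasDerivAt.conj_apply {f : ℝ → ℂ} {f' : ℂ} {t : ℝ} (hf : HasDerivAt f f' t) :
    HasDerivAt (fun t => (starRingEnd ℂ) (f t)) ((starRingEnd ℂ) f') t :=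
  conjCLE.toContinuousLinearMap.hasFDerivAt.comp_hasDerivAt t hf

structure WaveRep (m k T : ℝ) (a₀ a₁ : ℝ → ℂ) (S : ℝ → Lp ℂ 1 vol)
    (φ : ℝ → RealL2) (φt : ℝ → 𝓢'(ℝ, ℂ)) : Prop where
  cont : Continuous φ
  rep : ∀ t ∈ Icc 0 T, SobRep k (realDist (φ t)) (kgW m a₀ a₁ (ℱ S) t)
  rep_deriv : ∀ t ∈ Icc 0 T, SobRep (k - 1) (φt t) (kgWt m a₀ a₁ (ℱ S) t)

theorem kgData_of_source {φ₀ : RealL2} {φ₁ : 𝓢'(ℝ, ℂ)} {S : ℝ → Lp ℂ 1 vol}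
    (hk : k < 1 / 2) (h₀ : SobRep k (realDist φ₀) a₀) (h₁ : SobRep (k - 1) φ₁ a₁)
    (hS : Continuous S) (hB : ∀ t, ‖S t‖ ≤ B) :
    KGData k B a₀ a₁ (ℱ S) :=
  ⟨hk, h₀.memLp, h₁.memLp, continuous_fourier_lp hS,
    fun t _ => (norm_fourier_lp_le _ _).trans (hB t)⟩

theorem exists_waveRep {φ₀ : RealL2} {φ₁ : 𝓢'(ℝ, ℂ)} {S : ℝ → Lp ℂ 1 vol}
    (m : ℝ) (hk0 : 0 ≤ k) (hk : k < 1 / 2) (h₀ : SobRep k (realDist φ₀) a₀)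
    (h₁ : SobRep (k - 1) φ₁ a₁) (hr : IsReal φ₁) (hS : Continuous S) (hB : ∀ t, ‖S t‖ ≤ B)
    (hSr : ∀ t, ∀ᵐ x, (S t x).im = 0) {T : ℝ} (hT : 0 ≤ T) :
    ∃ (φ : ℝ → RealL2) (φt : ℝ → 𝓢'(ℝ, ℂ)), WaveRep m k T a₀ a₁ S φ φt := by
  have hd := kgData_of_source hk h₀ h₁ hS hB
  set s : ℝ → ℝ → ℂ := fun t => 𝓕 (S t : ℝ → ℂ) with hs
  have hd0 := hd.mono hk0
  have hL : ∀ t, MemLp (kgW m a₀ a₁ s t) 2 volume := fun t => by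
    simpa [jap_zero] using hd0.memLp_kgW m t
  set Φ : ℝ → Lp ℂ 2 vol := fun t => 𝓕⁻ ((hL t).toLp _) with hΦ
  have hΦr : ∀ t, SobRep k (toTemperedDistribution (Φ t)) (kgW m a₀ a₁ s t) := fun t =>
    ⟨hd.memLp_kgW m t, (sobRep_fourierInv (hL t)).eq⟩
  have hc : Continuous fun t => Φ (clip T t) := by
    have h2 := continuous_toLp_of_dominated (w := fun t => kgW m a₀ a₁ s (clip T t))
      (hd0.memLp_majorant T) (fun t => hd.aestronglyMeasurable_kgW m _)
      (.of_forall fun ξ => (continuous_iff_continuousAt.2 fun t =>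
        (hasDerivAt_kgW hd.cont t ξ).continuousAt).comp (continuous_clip T))
      (fun t => Eventually.of_forall fun ξ => by
        have := hd0.norm_kgW_le (m := m) (abs_clip_le hT t) ξ
        rw [norm_jap_smul, jap_zero, one_mul] at this
        exact this) (fun t => hL _)
    exact (Lp.fourierTransformₗᵢ ℝ ℂ).symm.continuous.comp h2
  have hv : ∀ t, ∃ v : 𝓢'(ℝ, ℂ), SobRep (k - 1) v (kgWt m a₀ a₁ s t) := fun t =>
    exists_sobRep (hd.memLp_kgWt m t)
  choose v hv using hv
  have d1 := fun h t => hd.hasDerivAt hΦr hv h t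
  have d2 := fun h t => hd.hasDerivAt_deriv hΦr hv h t
  have e0 : toTemperedDistribution (Φ 0) = realDist φ₀ :=
    (hΦr 0).unique (by rw [kgW_zero]; exact h₀)
  have e1 : v 0 = φ₁ := (hv 0).unique (by rw [kgWt_zero]; exact h₁)
  have hreal0 : Φ 0 = ofRealCLM.compLp φ₀ := toTemperedDistribution_injective e0
  have hsrc : ∀ t (h : 𝓢(ℝ, ℂ)), (starRingEnd ℂ) (∫ ξ, (𝓕⁻ (conjS h)) ξ • s t ξ) =
      ∫ ξ, (𝓕⁻ h) ξ • s t ξ := fun t h => by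
    rw [integral_fourierInv_mul_fourier, integral_fourierInv_mul_fourier, ← integral_conj]
    apply integral_congr_ae
    filter_upwards [hSr t] with x hx
    rw [map_mul, conjS_apply, conj_conj, Complex.conj_eq_iff_im.2 hx]
  have hzero : ∀ t ∈ Icc 0 T, imC.compLpL 2 volume (Φ (clip T t)) = 0 := by
    refine klein_gordon_unique (m := m) (v := fun t h => (v t h -
      (starRingEnd ℂ) (v t (conjS h))) / (2 * I))
      ((imC.compLpL 2 volume).continuous.comp hc).continuousOn ?_ ?_ ?_ ?_
    · rw [clip_of_mem (left_mem_Icc.2 hT), hreal0, Lp.eq_zero_iff_ae_eq_zero]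
      filter_upwards [coeFn_compLpL (p := 2) (μ := volume) imC
        (ofRealCLM.compLp φ₀), coeFn_compLp ofRealCLM φ₀]
        with x hx1 hx2
      rw [hx1, hx2]
      simp [imC]
    · intro h
      simp only [e1, hr.apply_conjS, conj_conj, sub_self, zero_div]
    · intro h t ht
      refine HasDerivWithinAt.congr (((d1 h t).sub
        (HasDerivAt.conj_apply (d1 (conjS h) t))).div_const _).hasDerivWithinAt (fun τ hτ => ?_) ?_
      · rw [toTemperedDistribution_imC, clip_of_mem hτ]
        rfl
      · rw [toTemperedDistribution_imC, clip_of_mem ht]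
        rfl
    · intro h t ht
      refine (((d2 h t).sub (HasDerivAt.conj_apply
        (d2 (conjS h) t))).div_const (2 * I)).hasDerivWithinAt.congr_deriv ?_
      rw [toTemperedDistribution_imC, toTemperedDistribution_imC, clip_of_mem ht, map_add,
        map_sub, map_mul, hsrc, derivCLM_conjS, derivCLM_conjS, map_pow, Complex.conj_ofReal]
      field_simp
      ring
  refine ⟨fun t => reCLM.compLpL 2 volume (Φ (clip T t)), v,
    (reCLM.compLpL 2 volume).continuous.comp hc, fun t ht => ?_, fun t _ => hv t⟩
  have h1 : ofRealCLM.compLp (reCLM.compLpL 2 volume (Φ (clip T t))) = Φ t := by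
    rw [clip_of_mem ht]
    apply Lp.ext
    have h3 := hzero t ht
    rw [clip_of_mem ht, Lp.eq_zero_iff_ae_eq_zero] at h3
    filter_upwards [coeFn_compLp ofRealCLM
      (reCLM.compLpL 2 volume (Φ t)),
      coeFn_compLpL (p := 2) (μ := volume) reCLM (Φ t),
      coeFn_compLpL (p := 2) (μ := volume) imC (Φ t), h3] with x h4 h5 h6 h7
    rw [h4, h5]
    rw [h6] at h7
    simp only [imC, comp_apply, ofRealCLM_apply, Complex.imCLM_apply,
      Pi.zero_apply, Complex.ofReal_eq_zero] at h7
    apply Complex.ext <;> simp [h7]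
  rw [realDist, h1]
  exact hΦr t

variable {T : ℝ} {S : ℝ → Lp ℂ 1 vol} {φ : ℝ → RealL2} {φt : ℝ → 𝓢'(ℝ, ℂ)}

theorem WaveRep.exists_extension (hφ : WaveRep m k T a₀ a₁ S φ φt)
    (hd : KGData k B a₀ a₁ (ℱ S)) :
    ∃ u v : ℝ → 𝓢'(ℝ, ℂ), (∀ t, SobRep k (u t) (kgW m a₀ a₁ (ℱ S) t)) ∧
      (∀ t, SobRep (k - 1) (v t) (kgWt m a₀ a₁ (ℱ S) t)) ∧
      (∀ t ∈ Icc 0 T, u t = realDist (φ t)) ∧ ∀ t ∈ Icc 0 T, v t = φt t := by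
  choose u hu using fun t => exists_sobRep (hd.memLp_kgW m t)
  choose v hv using fun t => exists_sobRep (hd.memLp_kgWt m t)
  exact ⟨u, v, hu, hv, fun t ht => (hu t).unique (hφ.rep t ht),
    fun t ht => (hv t).unique (hφ.rep_deriv t ht)⟩

theorem SobolevContinuousOn.congr {r : ℝ} {u v : ℝ → 𝓢'(ℝ, ℂ)} {I : Set ℝ}
    (hu : SobolevContinuousOn r u I) (h : ∀ t ∈ I, u t = v t) : SobolevContinuousOn r v I := by
  obtain ⟨G, hG, hG'⟩ := hu
  exact ⟨G, hG, fun t ht => by rw [← h t ht, hG' t ht]⟩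

theorem WaveRep.sobolevContinuousOn (hφ : WaveRep m k T a₀ a₁ S φ φt)
    (hd : KGData k B a₀ a₁ (ℱ S)) (hT : 0 ≤ T) :
    SobolevContinuousOn k (fun t => realDist (φ t)) (Icc 0 T) ∧
      SobolevContinuousOn (k - 1) φt (Icc 0 T) := by
  obtain ⟨u, v, hu, hv, hu', hv'⟩ := hφ.exists_extension hd
  exact ⟨(hd.sobolevContinuousOn hT hu).congr hu', (hd.sobolevContinuousOn_deriv hT hv).congr hv'⟩

theorem WaveRep.hasDerivWithinAt (hφ : WaveRep m k T a₀ a₁ S φ φt)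
    (hd : KGData k B a₀ a₁ (ℱ S)) (h : 𝓢(ℝ, ℂ)) {t : ℝ} (ht : t ∈ Icc 0 T) :
    HasDerivWithinAt (fun s => realDist (φ s) h) (φt t h) (Icc 0 T) t := by
  obtain ⟨u, v, hu, hv, hu', hv'⟩ := hφ.exists_extension hd
  rw [← hv' t ht]
  exact (hd.hasDerivAt hu hv h t).hasDerivWithinAt.congr (fun τ hτ => by rw [hu' τ hτ])
    (by rw [hu' t ht])

theorem WaveRep.hasDerivWithinAt_deriv (hφ : WaveRep m k T a₀ a₁ S φ φt)
    (hd : KGData k B a₀ a₁ (ℱ S)) (h : 𝓢(ℝ, ℂ)) {t : ℝ} (ht : t ∈ Icc 0 T) :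
    HasDerivWithinAt (fun s => φt s h) (realDist (φ t) (∂ₛ (∂ₛ h)) -
        (m : ℂ) ^ 2 * realDist (φ t) h + ∫ x, h x * S t x) (Icc 0 T) t := by
  obtain ⟨u, v, hu, hv, hu', hv'⟩ := hφ.exists_extension hd
  rw [← hu' t ht, ← integral_fourierInv_mul_fourier]
  exact (hd.hasDerivAt_deriv hu hv h t).hasDerivWithinAt.congr (fun τ hτ => by rw [hv' τ hτ])
    (by rw [hv' t ht])

theorem WaveRep.initial (hφ : WaveRep m k T a₀ a₁ S φ φt) (hT : 0 ≤ T) {φ₀ : RealL2}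
    {φ₁ : 𝓢'(ℝ, ℂ)} (h₀ : SobRep k (realDist φ₀) a₀) (h₁ : SobRep (k - 1) φ₁ a₁) :
    φ 0 = φ₀ ∧ φt 0 = φ₁ := by
  have h2 := hφ.rep 0 (left_mem_Icc.2 hT)
  have h3 := hφ.rep_deriv 0 (left_mem_Icc.2 hT)
  rw [kgW_zero] at h2
  rw [kgWt_zero] at h3
  refine ⟨?_, h3.unique h₁⟩
  have h4 := toTemperedDistribution_injective (h2.unique h₀)
  apply Lp.ext
  filter_upwards [coeFn_compLp ofRealCLM (φ 0), coeFn_compLp ofRealCLM φ₀] with x h5 h6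
  rw [h4, h6] at h5
  simpa using h5.symm

end RealWave

section PointwiseWave

theorem fourierInv_translate (h : 𝓢(ℝ, ℂ)) (a ξ : ℝ) :
    (𝓕⁻ (h.compSubConstCLM ℂ a)) ξ = (𝐞 (a * ξ) : ℂ) * (𝓕⁻ h) ξ := by
  rw [fourierInv_coe, fourierInv_coe, Real.fourierInv_eq, Real.fourierInv_eq, ← integral_const_mul,
    ← integral_add_right_eq_self (fun v => 𝐞 (inner ℝ v ξ) • (h.compSubConstCLM ℂ a) v) a]
  refine integral_congr_ae (.of_forall fun v => ?_)
  simp only [compSubConstCLM_apply, add_sub_cancel_right, inner_add_left,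
    AddChar.map_add_eq_mul, Circle.smul_def, smul_eq_mul, Circle.coe_mul]
  have : inner ℝ a ξ = a * ξ := by simp [mul_comm]
  rw [this]
  ring

theorem ae_norm_le_of_pairing_le {H : ℝ → ℂ} {K : ℝ} (hH : LocallyIntegrable H volume)
    (h : ∀ g : 𝓢(ℝ, ℂ), ‖∫ x, g x * H x‖ ≤ K * ∫ x, ‖g x‖) : ∀ᵐ x, ‖H x‖ ≤ K := by
  let φ : ℕ → ContDiffBump (0 : ℝ) := fun n =>
    ⟨1 / ((n : ℝ) + 1) / 2, 1 / ((n : ℝ) + 1), by positivity, half_lt_self (by positivity)⟩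
  have h1 : Tendsto (fun n => (φ n).rOut) atTop (𝓝 0) := tendsto_one_div_add_atTop_nhds_zero_nat
  have h2 : ∀ᶠ n in atTop, (φ n).rOut ≤ 2 * (φ n).rIn := Eventually.of_forall fun n => by
    simp only [φ]
    linarith
  filter_upwards [ContDiffBump.ae_convolution_tendsto_right_of_locallyIntegrable
    (μ := vol) h1 h2 hH] with x hx
  refine le_of_tendsto hx.norm (.of_forall fun n => ?_)
  have c1 : HasCompactSupport fun y => ((φ n).normed volume (x - y) : ℂ) :=
    ((φ n).hasCompactSupport_normed.comp_homeomorph (Homeomorph.subLeft x)).comp_left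
      (g := fun r : ℝ => (r : ℂ)) ofReal_zero
  have c2 : ContDiff ℝ ((⊤ : ℕ∞) : WithTop ℕ∞) fun y => ((φ n).normed volume (x - y) : ℂ) :=
    ofRealCLM.contDiff.comp ((φ n).contDiff_normed.comp (by fun_prop))
  have h3 := h (c1.toSchwartzMap c2)
  have h4 : ∀ y, c1.toSchwartzMap c2 y = ((φ n).normed volume (x - y) : ℂ) := fun y => rfl
  simp only [h4] at h3
  have h5 : ∫ y, ‖((φ n).normed volume (x - y) : ℂ)‖ = 1 := by
    simp_rw [norm_real, norm_of_nonneg (ContDiffBump.nonneg_normed _ _)]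
    rw [integral_sub_left_eq_self (fun y => (φ n).normed volume y) volume x]
    exact (φ n).integral_normed
  rw [h5, mul_one] at h3
  rw [convolution_eq_swap]
  simpa using h3

def waveKernel (τ : ℝ) : Lp ℂ 1 vol :=
  indicatorConstLp 1 (measurableSet_Icc (a := -τ) (b := τ)) (by simp) (1 / 2)

theorem fourier_waveKernel {τ : ℝ} (hτ : 0 ≤ τ) (ξ : ℝ) :
    𝓕 (waveKernel τ : ℝ → ℂ) ξ = sn (freq 0 ξ) τ := by
  have h1 : 𝓕 (waveKernel τ : ℝ → ℂ) ξ = ∫ v in (-τ)..τ, (𝐞 (-(v * ξ)) : ℂ) * (1 / 2) := by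
    rw [fourier_real_eq, integral_of_le (by linarith),
      ← integral_Icc_eq_integral_Ioc, ← integral_indicator measurableSet_Icc]
    apply integral_congr_ae
    filter_upwards [indicatorConstLp_coeFn (p := 1) (hs := measurableSet_Icc (a := -τ) (b := τ))
      (hμs := by simp) (c := (1 / 2 : ℂ)) (μ := volume)] with v hv
    rw [waveKernel, hv]
    by_cases hm : v ∈ Icc (-τ) τ
    · rw [indicator_of_mem hm, indicator_of_mem hm, Circle.smul_def, smul_eq_mul]
    · rw [indicator_of_notMem hm, indicator_of_notMem hm, smul_zero]
  have hc : Continuous fun v : ℝ => (𝐞 (-(v * ξ)) : ℂ) * (1 / 2) := by fun_prop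
  have hc' : Continuous fun v : ℝ => (𝐞 (-(-v * ξ)) : ℂ) * (1 / 2) := by fun_prop
  rw [h1, ← intervalIntegral.integral_add_adjacent_intervals (b := 0)
    (hc.intervalIntegrable _ _) (hc.intervalIntegrable _ _)]
  have h2 := intervalIntegral.integral_comp_neg (a := 0) (b := τ)
    (fun v : ℝ => (𝐞 (-(v * ξ)) : ℂ) * (1 / 2))
  rw [neg_zero] at h2
  rw [← h2, ← intervalIntegral.integral_add
    (hc'.intervalIntegrable _ _) (hc.intervalIntegrable _ _), sn,
    ← intervalIntegral.integral_ofReal]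
  refine integral_congr fun v _ => ?_
  simp only [Real.fourierChar_apply]
  have h3 : cos (v * freq 0 ξ) = cos (2 * π * (v * ξ)) := by
    rw [freq_zero_left]
    rcases abs_choice (2 * π * ξ) with h | h <;> rw [h]
    · congr 1; ring
    · rw [← cos_neg]; congr 1; ring
  rw [h3, ofReal_cos, Complex.cos]
  have e1 : ((2 * π * -(-v * ξ) : ℝ) : ℂ) * I = ((2 * π * (v * ξ) : ℝ) : ℂ) * I := by simp
  have e2 : ((2 * π * -(v * ξ) : ℝ) : ℂ) * I = -((2 * π * (v * ξ) : ℝ) : ℂ) * I := by simp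
  rw [e1, e2]
  ring

def kgConst (m T : ℝ) : ℝ := 1 / 2 + 2 * T * (1 + m ^ 2) * ∫ ξ, jap (-2) ξ

theorem integral_jap_nonneg (r : ℝ) : 0 ≤ ∫ ξ, jap r ξ := integral_nonneg fun ξ => (jap_pos r ξ).le

theorem kgConst_nonneg {m T : ℝ} (hT : 0 ≤ T) : 0 ≤ kgConst m T := by
  have := integral_jap_nonneg (-2)
  unfold kgConst
  positivity

theorem norm_fourierInv_schwartz_le (h : 𝓢(ℝ, ℂ)) (ξ : ℝ) : ‖(𝓕⁻ h) ξ‖ ≤ ∫ x, ‖h x‖ := by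
  rw [fourierInv_coe, Real.fourierInv_eq]
  refine (norm_integral_le_integral_norm _).trans (le_of_eq ?_)
  simp

theorem norm_integral_fourierInv_mul_sn_le (m : ℝ) {τ T : ℝ} (hτ : τ ∈ Icc 0 T) (h : 𝓢(ℝ, ℂ)) :
    ‖∫ ξ, (𝓕⁻ h) ξ * (sn (freq m ξ) τ : ℂ)‖ ≤ kgConst m T * ∫ x, ‖h x‖ := by
  have hT : 0 ≤ T := hτ.1.trans hτ.2
  have hN : 0 ≤ ∫ x, ‖h x‖ := by positivity
  have i0 : Integrable fun ξ => (𝓕⁻ h) ξ * (sn (freq 0 ξ) τ : ℂ) :=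
    ((𝓕⁻ h).integrable (μ := volume)).mul_bdd (c := |τ|)
      (continuous_ofReal_sn_slice 0 τ).aestronglyMeasurable
      (.of_forall fun ξ => by rw [norm_real]; exact abs_sn_le _ _)
  have im : Integrable fun ξ => (𝓕⁻ h) ξ * (sn (freq m ξ) τ : ℂ) :=
    ((𝓕⁻ h).integrable (μ := volume)).mul_bdd (c := |τ|)
      (continuous_ofReal_sn_slice m τ).aestronglyMeasurable
      (.of_forall fun ξ => by rw [norm_real]; exact abs_sn_le _ _)
  have e1 : ∫ ξ, (𝓕⁻ h) ξ * (sn (freq m ξ) τ : ℂ) = (∫ x, h x * waveKernel τ x) +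
      ∫ ξ, ((𝓕⁻ h) ξ * (sn (freq m ξ) τ : ℂ) - (𝓕⁻ h) ξ * (sn (freq 0 ξ) τ : ℂ)) := by
    rw [← integral_fourierInv_mul_fourier, integral_sub im i0]
    simp_rw [fourier_waveKernel hτ.1, smul_eq_mul]
    ring
  have e2 : ‖∫ x, h x * waveKernel τ x‖ ≤ 1 / 2 * ∫ x, ‖h x‖ := by
    rw [← integral_const_mul]
    refine norm_integral_le_of_norm_le (h.integrable.norm.const_mul _) ?_
    filter_upwards [indicatorConstLp_coeFn (p := 1) (hs := measurableSet_Icc (a := -τ) (b := τ))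
      (hμs := by simp) (c := (1 / 2 : ℂ)) (μ := volume)] with v hv
    rw [waveKernel, hv, norm_mul, mul_comm]
    refine mul_le_mul_of_nonneg_right ?_ (norm_nonneg _)
    refine (norm_indicator_le_norm_self _ _).trans (by simp)
  have e3 : ‖∫ ξ, ((𝓕⁻ h) ξ * (sn (freq m ξ) τ : ℂ) - (𝓕⁻ h) ξ * (sn (freq 0 ξ) τ : ℂ))‖ ≤
      ((∫ x, ‖h x‖) * (2 * T * (1 + m ^ 2))) * ∫ ξ, jap (-2) ξ := by
    rw [← integral_const_mul]
    refine norm_integral_le_of_norm_le ((integrable_jap (by norm_num)).const_mul _)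
      (.of_forall fun ξ => ?_)
    rw [← mul_sub, ← ofReal_sub, norm_mul, norm_real, norm_eq_abs, mul_assoc]
    refine mul_le_mul (norm_fourierInv_schwartz_le h ξ) ((abs_sn_sub_sn_le m ξ τ).trans ?_)
      (abs_nonneg _) hN
    have hj := (jap_pos (-2) ξ).le
    have : |τ| ≤ T := by rw [abs_of_nonneg hτ.1]; exact hτ.2
    gcongr
  rw [e1]
  refine (norm_add_le _ _).trans ((add_le_add e2 e3).trans (le_of_eq ?_))
  rw [kgConst]
  ring

theorem norm_integral_fourierInv_mul_sn_mul_fourier_le (m : ℝ) {τ T : ℝ} (hτ : τ ∈ Icc 0 T)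
    (h : 𝓢(ℝ, ℂ)) (S : Lp ℂ 1 vol) :
    ‖∫ ξ, (𝓕⁻ h) ξ * (sn (freq m ξ) τ * 𝓕 (S : ℝ → ℂ) ξ)‖ ≤ kgConst m T * ‖S‖ * ∫ x, ‖h x‖ := by
  have im : Integrable fun ξ => (𝓕⁻ h) ξ * (sn (freq m ξ) τ : ℂ) :=
    ((𝓕⁻ h).integrable (μ := volume)).mul_bdd (c := |τ|)
      (continuous_ofReal_sn_slice m τ).aestronglyMeasurable
      (.of_forall fun ξ => by rw [norm_real]; exact abs_sn_le _ _)
  have h1 := VectorFourier.integral_bilin_fourierIntegral_eq_flip (mul ℂ ℂ)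
    (μ := vol) (ν := vol) (L := innerₗ ℝ)
    (f := fun ξ => (𝓕⁻ h) ξ * (sn (freq m ξ) τ : ℂ)) (g := S)
    continuous_fourierChar continuous_inner im (L1.integrable_coeFn S)
  have h2 : ∀ x, ‖VectorFourier.fourierIntegral 𝐞 volume (innerₗ ℝ)
      (fun ξ => (𝓕⁻ h) ξ * (sn (freq m ξ) τ : ℂ)) x‖ ≤ kgConst m T * ∫ x, ‖h x‖ := by
    intro x
    have h3 := norm_integral_fourierInv_mul_sn_le m hτ (h.compSubConstCLM ℂ (-x))
    have h4 : ∫ y, ‖(h.compSubConstCLM ℂ (-x)) y‖ = ∫ y, ‖h y‖ := by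
      simp_rw [compSubConstCLM_apply]
      exact integral_sub_right_eq_self (fun y => ‖h y‖) (-x)
    rw [h4] at h3
    refine le_trans (le_of_eq ?_) h3
    congr 1
    refine integral_congr_ae (.of_forall fun ξ => ?_)
    simp only [fourierInv_translate]
    rw [Circle.smul_def, smul_eq_mul, mul_assoc]
    congr 3
    simp [mul_comm]
  simp only [mul_apply', flip_innerₗ] at h1
  have h5 : ∫ ξ, (𝓕⁻ h) ξ * (sn (freq m ξ) τ * 𝓕 (S : ℝ → ℂ) ξ) =
      ∫ ξ, ((𝓕⁻ h) ξ * (sn (freq m ξ) τ : ℂ)) * 𝓕 (S : ℝ → ℂ) ξ := by simp_rw [mul_assoc]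
  rw [h5]
  refine (congrArg norm h1.symm).le.trans ?_
  rw [mul_right_comm, L1.norm_eq_integral_norm, ← integral_const_mul]
  refine norm_integral_le_of_norm_le ((L1.integrable_coeFn S).norm.const_mul _)
    (.of_forall fun x => ?_)
  rw [norm_mul]
  exact mul_le_mul_of_nonneg_right (h2 x) (norm_nonneg _)

theorem norm_pairing_duhamel_le (m : ℝ) {S : ℝ → Lp ℂ 1 vol} (hS : Continuous S)
    {t T : ℝ} (ht : t ∈ Icc 0 T) (h : 𝓢(ℝ, ℂ)) :
    ‖∫ ξ, (𝓕⁻ h) ξ * ∫ τ in 0..t, sn (freq m ξ) (t - τ) * 𝓕 (S τ : ℝ → ℂ) ξ‖ ≤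
      (kgConst m T * ∫ τ in 0..t, ‖S τ‖) * ∫ x, ‖h x‖ := by
  have hT : 0 ≤ T := ht.1.trans ht.2
  obtain ⟨B, hB⟩ : ∃ B, ∀ τ ∈ Icc 0 t, ‖S τ‖ ≤ B :=
    isCompact_Icc.exists_bound_of_continuousOn hS.continuousOn
  have hcont : Continuous fun p : ℝ × ℝ =>
      (𝓕⁻ h) p.2 * ((sn (freq m p.2) (t - p.1) : ℂ) * 𝓕 (S p.1 : ℝ → ℂ) p.2) := by
    have c1 : Continuous fun p : ℝ × ℝ => sn (freq m p.2) (t - p.1) :=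
      Continuous.comp (g := fun p : ℝ × ℝ => sn (freq m p.2) p.1)
        (f := fun p : ℝ × ℝ => (t - p.1, p.2)) (continuous_sn_freq m) (by fun_prop)
    exact ((𝓕⁻ h).continuous.comp continuous_snd).mul
      ((continuous_ofReal.comp c1).mul (continuous_fourier_lp hS))
  have hint : Integrable (uncurry fun τ ξ => (𝓕⁻ h) ξ * ((sn (freq m ξ) (t - τ) : ℂ) *
      𝓕 (S τ : ℝ → ℂ) ξ)) ((volume.restrict (Set.uIoc 0 t)).prod volume) := by
    have : IsFiniteMeasure ((vol).restrict (Set.uIoc 0 t)) := ⟨by simp⟩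
    have h1 : Integrable (fun p : ℝ × ℝ => (t * B) * ‖(𝓕⁻ h) p.2‖)
        ((volume.restrict (Set.uIoc 0 t)).prod volume) :=
      Integrable.mul_prod (f := fun _ : ℝ => t * B) (g := fun ξ => ‖(𝓕⁻ h) ξ‖)
        (integrable_const _) (𝓕⁻ h).integrable.norm
    refine h1.mono' hcont.aestronglyMeasurable ?_
    have h2 : ∀ᵐ p ∂((volume.restrict (Set.uIoc 0 t)).prod vol), p.1 ∈ Set.uIoc 0 t :=
      Measure.quasiMeasurePreserving_fst.ae (ae_restrict_mem measurableSet_uIoc)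
    filter_upwards [h2] with p hp
    rw [Set.uIoc_of_le ht.1] at hp
    simp only [uncurry]
    rw [norm_mul, norm_mul, norm_real, mul_comm]
    refine mul_le_mul_of_nonneg_right ?_ (norm_nonneg _)
    refine mul_le_mul ((abs_sn_le _ _).trans ?_) ((norm_fourier_lp_le _ _).trans
      (hB _ ⟨hp.1.le, hp.2⟩)) (norm_nonneg _) ht.1
    rw [abs_of_nonneg (by linarith [hp.2])]
    linarith [hp.1]
  have e1 : ∫ ξ, (𝓕⁻ h) ξ * ∫ τ in 0..t, sn (freq m ξ) (t - τ) * 𝓕 (S τ : ℝ → ℂ) ξ =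
      ∫ τ in 0..t, ∫ ξ, (𝓕⁻ h) ξ * ((sn (freq m ξ) (t - τ) : ℂ) * 𝓕 (S τ : ℝ → ℂ) ξ) := by
    rw [intervalIntegral_integral_swap hint]
    simp_rw [intervalIntegral.integral_const_mul]
  rw [e1, mul_right_comm, mul_comm (kgConst m T * _), ← intervalIntegral.integral_mul_const]
  refine intervalIntegral.norm_integral_le_of_norm_le ht.1 (.of_forall fun τ hτ => ?_)
    ((hS.norm.mul continuous_const).intervalIntegrable _ _)
  refine (norm_integral_fourierInv_mul_sn_mul_fourier_le m
    (T := T) ⟨by linarith [hτ.2], by linarith [hτ.1, ht.2]⟩ h (S τ)).trans (le_of_eq ?_)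
  ring

variable {m k T B : ℝ} {a₀ a₁ : ℝ → ℂ} {S S' : ℝ → Lp ℂ 1 vol} {φ φ' : ℝ → RealL2}
  {φt φt' : ℝ → 𝓢'(ℝ, ℂ)}

theorem memLp_ofReal_lp (f : RealL2) : MemLp (fun x => (f x : ℂ)) 2 volume :=
  ofRealCLM.comp_memLp' (memLp f)

theorem locallyIntegrable_ofReal_lp (f : RealL2) : LocallyIntegrable (fun x => (f x : ℂ)) volume :=
  (memLp_ofReal_lp f).locallyIntegrable (by norm_num)

theorem realDist_apply (f : RealL2) (h : 𝓢(ℝ, ℂ)) : realDist f h = ∫ x, h x * (f x : ℂ) := by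
  rw [realDist, toTemperedDistribution_apply]
  apply integral_congr_ae
  filter_upwards [coeFn_compLp ofRealCLM f] with x hx
  rw [hx, smul_eq_mul, ofRealCLM_apply]

theorem WaveRep.ae_abs_sub_le (hφ : WaveRep m k T a₀ a₁ S φ φt)
    (hφ' : WaveRep m k T a₀ a₁ S' φ' φt') (hS : Continuous S) (hS' : Continuous S')
    {t : ℝ} (ht : t ∈ Icc 0 T) :
    ∀ᵐ x, |φ t x - φ' t x| ≤ kgConst m T * ∫ τ in 0..t, ‖S τ - S' τ‖ := by
  have h1 := ae_norm_le_of_pairing_le (K := kgConst m T * ∫ τ in 0..t, ‖S τ - S' τ‖)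
    ((locallyIntegrable_ofReal_lp (φ t)).sub (locallyIntegrable_ofReal_lp (φ' t))) fun h => ?_
  · filter_upwards [h1] with x hx
    rw [Pi.sub_apply, ← ofReal_sub, norm_real] at hx
    exact hx
  · have hi : ∀ f : RealL2, Integrable fun x => h x * (f x : ℂ) := fun f =>
      integrable_schwartz_smul (s := 0) (a := fun x => (f x : ℂ))
        (by simpa [jap_zero] using memLp_ofReal_lp f) h
    have e1 : ∫ x, h x * ((fun x => (φ t x : ℂ)) - fun x => (φ' t x : ℂ)) x =
        ∫ ξ, (𝓕⁻ h) ξ * ∫ τ in 0..t, sn (freq m ξ) (t - τ) *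
          𝓕 ((S τ - S' τ : Lp ℂ 1 vol) : ℝ → ℂ) ξ := by
      simp only [Pi.sub_apply, mul_sub]
      rw [integral_sub (hi _) (hi _), ← realDist_apply, ← realDist_apply, (hφ.rep t ht).eq,
        (hφ'.rep t ht).eq, ← integral_sub ((hφ.rep t ht).integrable _)
        ((hφ'.rep t ht).integrable _)]
      refine integral_congr_ae (.of_forall fun ξ => ?_)
      simp only [smul_eq_mul]
      rw [← mul_sub, kgW_sub_kgW (s := ℱ S) (s' := ℱ S')
        (continuous_fourier_lp hS) (continuous_fourier_lp hS')]
      simp_rw [fourier_lp_sub]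
    rw [e1]
    exact norm_pairing_duhamel_le m (hS.sub hS') ht h

def profHat (a₀ a₁ : ℝ → ℂ) (σ ξ : ℝ) : ℂ :=
  (a₀ ξ - σ * I * (((ξ / (2 * π * (1 + ξ ^ 2)) : ℝ) : ℂ) * a₁ ξ)) / 2

theorem memLp_profHat (h₀ : MemLp (fun ξ => (jap k ξ : ℂ) • a₀ ξ) 2 volume)
    (h₁ : MemLp (fun ξ => (jap (k - 1) ξ : ℂ) • a₁ ξ) 2 volume) (σ : ℝ) :
    MemLp (fun ξ => (jap k ξ : ℂ) • profHat a₀ a₁ σ ξ) 2 volume := by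
  have hc : Continuous fun ξ : ℝ => ((ξ / (2 * π * (1 + ξ ^ 2)) * jap 1 ξ : ℝ) : ℂ) := by
    refine continuous_ofReal.comp (Continuous.mul (Continuous.div continuous_id
      (by fun_prop) fun ξ => by positivity) (continuous_jap 1))
  have h2 : MemLp (fun ξ => ((ξ / (2 * π * (1 + ξ ^ 2)) * jap 1 ξ : ℝ) : ℂ) *
      ((jap (k - 1) ξ : ℂ) • a₁ ξ)) 2 volume := by
    refine h₁.of_le (hc.aestronglyMeasurable.mul h₁.1) (.of_forall fun ξ => ?_)
    rw [norm_mul, norm_real]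
    refine mul_le_of_le_one_left (norm_nonneg _) ?_
    rw [norm_mul, norm_div, norm_eq_abs, norm_of_nonneg (by positivity :
      (0 : ℝ) ≤ 2 * π * (1 + ξ ^ 2)), norm_of_nonneg (jap_pos _ _).le,
      div_mul_eq_mul_div, div_le_one (by positivity)]
    have h3 : |ξ| * jap 1 ξ ≤ 1 + ξ ^ 2 := by
      rw [← jap_two, show (2 : ℝ) = 1 + 1 by norm_num, ← jap_mul]
      exact mul_le_mul_of_nonneg_right (abs_le_jap_one ξ) (jap_pos _ _).le
    nlinarith [pi_gt_three, sq_nonneg ξ]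
  refine ((h₀.sub (h2.const_mul (σ * I))).const_mul (1 / 2)).ae_eq (.of_forall fun ξ => ?_)
  simp only [profHat, Pi.sub_apply, smul_eq_mul]
  have e : jap (k - 1) ξ * jap 1 ξ = jap k ξ := by rw [jap_mul, sub_add_cancel]
  rw [← e]
  push_cast
  ring

def kgRem (m T : ℝ) (a₀ a₁ : ℝ → ℂ) (ξ : ℝ) : ℝ :=
  T * (|m| + m ^ 2) * (jap (-1) ξ * ‖a₀ ξ‖) + (2 * T * (1 + m ^ 2) + T) * (jap (-2) ξ * ‖a₁ ξ‖)

theorem integrable_jap_mul_norm {r l : ℝ} {a : ℝ → ℂ}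
    (ha : MemLp (fun ξ => (jap l ξ : ℂ) • a ξ) 2 volume) (hr : r < l - 1 / 2) :
    Integrable fun ξ => jap r ξ * ‖a ξ‖ := by
  refine (memLp_one_iff_integrable.1 (ha.norm.mul
    (memLp_jap (by linarith : r - l < -(1 / 2))))).congr (.of_forall fun ξ => ?_)
  simp only [Pi.mul_apply, norm_jap_smul]
  rw [← mul_assoc, jap_mul, sub_add_cancel]

theorem integrable_kgRem (hk : 0 ≤ k) (h₀ : MemLp (fun ξ => (jap k ξ : ℂ) • a₀ ξ) 2 volume)
    (h₁ : MemLp (fun ξ => (jap (k - 1) ξ : ℂ) • a₁ ξ) 2 volume) (m T : ℝ) :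
    Integrable (kgRem m T a₀ a₁) :=
  ((integrable_jap_mul_norm h₀ (by linarith)).const_mul _).add
    ((integrable_jap_mul_norm h₁ (by linarith)).const_mul _)

theorem two_pi_mul_sn (ξ t : ℝ) : 2 * π * ξ * sn (freq 0 ξ) t = sin (2 * π * (t * ξ)) := by
  have h1 := mul_sn (freq 0 ξ) t
  rw [freq_zero_left] at h1 ⊢
  rcases abs_choice (2 * π * ξ) with h | h <;> rw [h] at h1 ⊢
  · rw [h1]; congr 1; ring
  · have : sin (2 * π * (t * ξ)) = -sin (t * -(2 * π * ξ)) := by rw [← Real.sin_neg]; congr 1; ring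
    rw [this, ← h1]
    ring

theorem cos_freq_zero (ξ t : ℝ) : cos (t * freq 0 ξ) = cos (2 * π * (t * ξ)) := by
  rw [freq_zero_left]
  rcases abs_choice (2 * π * ξ) with h | h <;> rw [h]
  · congr 1; ring
  · rw [← cos_neg]; congr 1; ring

theorem travelling_add (a₀ a₁ : ℝ → ℂ) (t ξ : ℝ) : (𝐞 (t * ξ) : ℂ) * profHat a₀ a₁ 1 ξ +
      (𝐞 (-t * ξ) : ℂ) * profHat a₀ a₁ (-1) ξ =
    cos (t * freq 0 ξ) * a₀ ξ +
      (sn (freq 0 ξ) t * a₁ ξ - ((sn (freq 0 ξ) t * jap (-2) ξ : ℝ) : ℂ) * a₁ ξ) := by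
  have h1 : jap (-2) ξ = 1 / (1 + ξ ^ 2) := by
    have := jap_neg_mul 2 ξ
    rw [jap_two] at this
    rw [eq_div_iff (by positivity), this]
  have h2 : sn (freq 0 ξ) t - sn (freq 0 ξ) t * jap (-2) ξ =
      sin (2 * π * (t * ξ)) * (ξ / (2 * π * (1 + ξ ^ 2))) := by
    rw [← two_pi_mul_sn, h1]
    have := Real.pi_ne_zero
    have h3 : (1 + ξ ^ 2) ≠ 0 := by positivity
    field_simp
    ring
  rw [← sub_mul, ← ofReal_sub, h2, cos_freq_zero, Real.fourierChar_apply,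
    Real.fourierChar_apply, profHat, profHat]
  have e2 : ((2 * π * (-t * ξ) : ℝ) : ℂ) * I = -((2 * π * (t * ξ) : ℝ) : ℂ) * I := by simp
  rw [e2, Complex.ofReal_mul (sin _), ofReal_cos, Complex.ofReal_sin, Complex.cos, Complex.sin]
  push_cast
  ring

theorem norm_kgW_sub_travelling_le {t : ℝ} (ht : t ∈ Icc 0 T) (ξ : ℝ) :
    ‖kgW m a₀ a₁ (fun _ _ => 0) t ξ - ((𝐞 (t * ξ) : ℂ) * profHat a₀ a₁ 1 ξ +
      (𝐞 (-t * ξ) : ℂ) * profHat a₀ a₁ (-1) ξ)‖ ≤ kgRem m T a₀ a₁ ξ := by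
  have hT : 0 ≤ T := ht.1.trans ht.2
  have htT : |t| ≤ T := by rw [abs_of_nonneg ht.1]; exact ht.2
  have e : kgW m a₀ a₁ (fun _ _ => 0) t ξ - ((𝐞 (t * ξ) : ℂ) * profHat a₀ a₁ 1 ξ +
      (𝐞 (-t * ξ) : ℂ) * profHat a₀ a₁ (-1) ξ) =
      ((cos (t * freq m ξ) - cos (t * freq 0 ξ) : ℝ) : ℂ) * a₀ ξ +
      (((sn (freq m ξ) t - sn (freq 0 ξ) t : ℝ) : ℂ) * a₁ ξ +
        ((sn (freq 0 ξ) t * jap (-2) ξ : ℝ) : ℂ) * a₁ ξ) := by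
    rw [travelling_add, kgW]
    simp only [mul_zero, intervalIntegral.integral_zero, sub_zero, add_zero]
    push_cast
    ring
  rw [e, kgRem]
  have j1 := (jap_pos (-1) ξ).le
  have j2 := (jap_pos (-2) ξ).le
  refine (norm_add_le _ _).trans (add_le_add ?_ ((norm_add_le _ _).trans ?_))
  · rw [norm_mul, norm_real, norm_eq_abs, ← mul_assoc]
    refine mul_le_mul_of_nonneg_right ((abs_cos_sub_cos_le m ξ t).trans ?_) (norm_nonneg _)
    gcongr
  · rw [add_mul]
    refine add_le_add ?_ ?_
    · rw [norm_mul, norm_real, norm_eq_abs, ← mul_assoc]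
      refine mul_le_mul_of_nonneg_right ((abs_sn_sub_sn_le m ξ t).trans ?_) (norm_nonneg _)
      gcongr
    · rw [norm_mul, norm_real, norm_eq_abs, abs_mul, abs_of_nonneg j2, ← mul_assoc]
      gcongr
      exact (abs_sn_le _ _).trans htT

theorem toTemperedDistribution_shift_eq {F : Lp ℂ 2 vol} {a : ℝ → ℂ} {r : ℝ}
    (hF : SobRep r (toTemperedDistribution F) a) (c : ℝ) (h : 𝓢(ℝ, ℂ)) :
    toTemperedDistribution (shift c F) h = ∫ ξ, (𝓕⁻ h) ξ * ((𝐞 (c * ξ) : ℂ) * a ξ) := by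
  rw [← toTemperedDistribution_translate, hF.eq]
  refine integral_congr_ae (.of_forall fun ξ => ?_)
  simp only [fourierInv_translate, smul_eq_mul]
  ring

theorem WaveRep.ae_abs_le (hφ : WaveRep m k T a₀ a₁ S φ φt) (hk : 0 ≤ k)
    (hd : KGData k B a₀ a₁ (ℱ S)) (hS : Continuous S)
    {F : ℝ → Lp ℂ 2 vol}
    (hF : ∀ σ, SobRep k (toTemperedDistribution (F σ)) (profHat a₀ a₁ σ))
    {t : ℝ} (ht : t ∈ Icc 0 T) :
    ∀ᵐ x, |φ t x| ≤ ‖F 1 (x + t)‖ + ‖F (-1) (x - t)‖ + ((∫ ξ, kgRem m T a₀ a₁ ξ) +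
      kgConst m T * ∫ τ in 0..t, ‖S τ‖) := by
  set K := (∫ ξ, kgRem m T a₀ a₁ ξ) + kgConst m T * ∫ τ in 0..t, ‖S τ‖ with hK
  set L : Lp ℂ 2 vol := ofRealCLM.compLp (φ t) - (shift t (F 1) + shift (-t) (F (-1))) with hL
  have h1 : ∀ᵐ x, ‖L x‖ ≤ K := by
    refine ae_norm_le_of_pairing_le ((memLp L).locallyIntegrable (by norm_num)) fun h => ?_
    have i1 : Integrable fun ξ => (𝓕⁻ h) ξ * kgW m a₀ a₁ (ℱ S) t ξ :=
      (hφ.rep t ht).integrable _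
    have i2 : ∀ σ c, Integrable fun ξ => (𝓕⁻ h) ξ *
        ((𝐞 (c * ξ) : ℂ) * profHat a₀ a₁ σ ξ) := fun σ c => by
      refine ((hF σ).integrable (𝓕⁻ (h.compSubConstCLM ℂ c))).congr (.of_forall fun ξ => ?_)
      simp only [fourierInv_translate, smul_eq_mul]
      ring
    have hd0 : KGData k 0 a₀ a₁ (fun _ _ => 0) := ⟨hd.lt, hd.memLp₀, hd.memLp₁, continuous_const,
      by simp⟩
    have i3 : Integrable fun ξ => (𝓕⁻ h) ξ * kgW m a₀ a₁ (fun _ _ => 0) t ξ :=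
      integrable_schwartz_smul (hd0.memLp_kgW m t) _
    have e1 : ∫ x, h x * L x = (∫ ξ, (𝓕⁻ h) ξ * (kgW m a₀ a₁ (fun _ _ => 0) t ξ -
        ((𝐞 (t * ξ) : ℂ) * profHat a₀ a₁ 1 ξ + (𝐞 (-t * ξ) : ℂ) * profHat a₀ a₁ (-1) ξ))) +
        ∫ ξ, (𝓕⁻ h) ξ * ∫ τ in 0..t, sn (freq m ξ) (t - τ) * 𝓕 (S τ : ℝ → ℂ) ξ := by
      have e2 : ∫ x, h x * L x = realDist (φ t) h - (toTemperedDistribution (shift t (F 1)) h +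
          toTemperedDistribution (shift (-t) (F (-1))) h) := by
        have e3 : ∫ x, h x * L x = toTemperedDistribution L h := by simp
        rw [e3, realDist]
        change Lp.toTemperedDistributionCLM ℂ volume 2 L h = _
        rw [hL, map_sub, map_add]
        rfl
      have e4 : ∀ ξ, (∫ τ in 0..t, (sn (freq m ξ) (t - τ) : ℂ) * 𝓕 (S τ : ℝ → ℂ) ξ) =
          kgW m a₀ a₁ (ℱ S) t ξ - kgW m a₀ a₁ (fun _ _ => 0) t ξ := fun ξ => by
        rw [kgW_sub_kgW (s := ℱ S) (s' := fun _ _ => 0)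
          (continuous_fourier_lp hS) continuous_const]
        simp
      have i4 : Integrable fun ξ => (𝓕⁻ h) ξ * ((𝐞 (t * ξ) : ℂ) *
          profHat a₀ a₁ 1 ξ) + (𝓕⁻ h) ξ * ((𝐞 (-t * ξ) : ℂ) *
          profHat a₀ a₁ (-1) ξ) := (i2 1 t).add (i2 (-1) (-t))
      simp_rw [e4, mul_sub, mul_add]
      rw [e2, (hφ.rep t ht).eq, toTemperedDistribution_shift_eq (hF 1),
        toTemperedDistribution_shift_eq (hF (-1)), integral_sub i1 i3,
        integral_sub i3 i4, integral_add (i2 1 t) (i2 (-1) (-t))]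
      simp only [smul_eq_mul]
      ring
    rw [e1, hK, add_mul]
    refine (norm_add_le _ _).trans (add_le_add ?_ (norm_pairing_duhamel_le m hS ht h))
    rw [mul_comm, ← integral_const_mul]
    refine norm_integral_le_of_norm_le ((integrable_kgRem hk hd.memLp₀ hd.memLp₁ m T).const_mul _)
      (.of_forall fun ξ => ?_)
    rw [norm_mul]
    exact mul_le_mul (norm_fourierInv_schwartz_le h ξ) (norm_kgW_sub_travelling_le ht ξ)
      (norm_nonneg _) (by positivity)
  filter_upwards [h1, coeFn_sub (ofRealCLM.compLp (φ t)) (shift t (F 1) +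
    shift (-t) (F (-1))), coeFn_add (shift t (F 1)) (shift (-t) (F (-1))), shift_ae t (F 1),
    shift_ae (-t) (F (-1)), coeFn_compLp ofRealCLM (φ t)]
    with x h2 h3 h4 h5 h6 h7
  rw [hL, h3, Pi.sub_apply, h4, Pi.add_apply, h5, h6, h7, ofRealCLM_apply] at h2
  have h8 : |φ t x| = ‖(φ t x : ℂ)‖ := by simp
  have h9 := norm_sub_norm_le (φ t x : ℂ) (F 1 (x + t) + F (-1) (x + -t))
  have h10 := norm_add_le (F 1 (x + t)) (F (-1) (x + -t))
  rw [h8, sub_eq_add_neg x t]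
  linarith

end PointwiseWave

section DiracIntegral

variable {A B : 𝓛} {M T : ℝ} {q : ℝ → RealL2} {ψ : ℝ → SpinorL2}

def diracRHS (A B : 𝓛) (M : ℝ) (q : ℝ → RealL2) (ψ : ℝ → SpinorL2) (h : 𝓢(ℝ, ℂ)) (t : ℝ) : Spinor :=
  A (spinorDist (ψ t) (∂ₛ h)) - (I * M) • B (spinorDist (ψ t) h) -
    I • B (toTemperedDistribution (smulL1 (q t) (ψ t)) h)

theorem continuous_diracRHS (A B : 𝓛) (M : ℝ) (hq : Continuous q)
    (hψ : Continuous ψ) (h : 𝓢(ℝ, ℂ)) : Continuous (diracRHS A B M q ψ h) := by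
  have c1 : Continuous fun t => A (spinorDist (ψ t) (∂ₛ h)) :=
    A.continuous.comp (continuous_toTemperedDistribution hψ _)
  have c2 : Continuous fun t => B (spinorDist (ψ t) h) :=
    B.continuous.comp (continuous_toTemperedDistribution hψ h)
  have c3 : Continuous fun t => B (toTemperedDistribution (smulL1 (q t) (ψ t)) h) :=
    B.continuous.comp (continuous_toTemperedDistribution (continuous_smulL1 hq hψ) h)
  have c4 : Continuous fun t => (I * M) • B (spinorDist (ψ t) h) := c2.fun_const_smul _
  have c5 : Continuous fun t =>
      I • B (toTemperedDistribution (smulL1 (q t) (ψ t)) h) := c3.fun_const_smul _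
  unfold diracRHS
  exact (c1.fun_sub c4).fun_sub c5

theorem WeakDirac.integral_eq (hw : WeakDirac A B M T q ψ) (h : 𝓢(ℝ, ℂ)) {t : ℝ}
    (ht : t ∈ Icc 0 T) :
    spinorDist (ψ t) h = spinorDist (ψ 0) h + ∫ s in 0..t, diracRHS A B M q ψ h s := by
  have h1 := intervalIntegral.integral_eq_sub_of_hasDeriv_right_of_le ht.1
    (f := fun s => spinorDist (ψ s) h) (f' := diracRHS A B M q ψ h)
    (continuous_toTemperedDistribution hw.cont h).continuousOn (fun s hs => ?_)
    ((continuous_diracRHS A B M hw.cont_pot hw.cont h).intervalIntegrable _ _)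
  · rw [h1, add_sub_cancel]
  · have hs' : s ∈ Ico 0 T := ⟨hs.1.le, hs.2.trans_le ht.2⟩
    exact ((hw.eq h s ⟨hs'.1, hs'.2.le⟩).mono_of_mem_nhdsWithin
      (Icc_mem_nhdsGE_of_mem hs')).mono Ioi_subset_Ici_self

theorem WeakDirac.of_integral_eq (hψ : Continuous ψ) (hq : Continuous q)
    (h : ∀ h : 𝓢(ℝ, ℂ), ∀ t ∈ Icc 0 T,
      spinorDist (ψ t) h = spinorDist (ψ 0) h + ∫ s in 0..t, diracRHS A B M q ψ h s) :
    WeakDirac A B M T q ψ := by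
  refine ⟨hψ, hq, fun g t ht => ?_⟩
  have hc := continuous_diracRHS A B M hq hψ g
  have h1 := (integral_hasDerivAt_right (hc.intervalIntegrable 0 t)
    (hc.stronglyMeasurableAtFilter _ _) hc.continuousAt).const_add (spinorDist (ψ 0) g)
  exact h1.hasDerivWithinAt.congr (fun s hs => h g s hs) (h g t ht)

theorem WeakDirac.comp_clip (hw : WeakDirac A B M T q ψ) (hT : 0 ≤ T) :
    WeakDirac A B M T q fun t => ψ (clip T t) := by
  refine .of_integral_eq (hw.cont.comp (continuous_clip T)) hw.cont_pot fun h t ht => ?_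
  rw [clip_of_mem ht, clip_of_mem (left_mem_Icc.2 hT), hw.integral_eq h ht]
  congr 1
  refine integral_congr fun s hs => ?_
  rw [uIcc_of_le ht.1] at hs
  simp only [diracRHS, clip_of_mem (⟨hs.1, hs.2.trans ht.2⟩ : s ∈ Icc 0 T)]

theorem smulL1_sub_left (p q : RealL2) (f : SpinorL2) :
    smulL1 (p - q) f = smulL1 p f - smulL1 q f := by
  simp [smulL1, map_sub]

theorem smulL1_sub_right (q : RealL2) (f f' : SpinorL2) :
    smulL1 q (f - f') = smulL1 q f - smulL1 q f' := by
  simp [smulL1, map_sub]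

theorem enorm_eq_sqrt_lintegral {F : Type*} [NormedAddCommGroup F]
    (f : Lp F 2 vol) : ‖f‖ₑ = (∫⁻ x, ‖f x‖ₑ ^ 2) ^ (1 / 2 : ℝ) := by
  rw [← enorm_sq_lp, ← rpow_natCast, ← rpow_mul]
  norm_num

theorem enorm_pairing_smulL1_le {q : RealL2} {f : SpinorL2} {P : ℝ → ℝ → ℝ≥0∞} {η : ℝ≥0∞} {t : ℝ}
    (hP : ∀ σ, Measurable (P σ))
    (hq : ∀ᵐ x, ‖q x‖ₑ ≤ P 1 (x - t) + P (-1) (x + t) + η) (h : 𝓢(ℝ, ℂ)) {H : ℝ}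
    (hH : ∀ x, ‖h x‖ ≤ H) :
    ‖toTemperedDistribution (smulL1 q f) h‖ₑ ≤
      (ofReal H * profileNorm P + η * ‖h.toLp 2 volume‖ₑ) * ‖f‖ₑ := by
  have mf : AEMeasurable (fun x => ‖f x‖ₑ) volume := by fun_prop
  have mh : AEMeasurable (fun x => ‖h x‖ₑ) volume := by fun_prop
  have m1 : Measurable fun x => P 1 (x - t) := by fun_prop
  have m2 : Measurable fun x => P (-1) (x + t) := by fun_prop
  have hH' : ∀ x, ‖h x‖ₑ ≤ ofReal H := fun x => by
    rw [← ofReal_norm]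
    exact ofReal_le_ofReal (hH x)
  have h1 : ‖toTemperedDistribution (smulL1 q f) h‖ₑ ≤ ∫⁻ x, (ofReal H * (P 1 (x - t) * ‖f x‖ₑ) +
        ofReal H * (P (-1) (x + t) * ‖f x‖ₑ)) + η * (‖h x‖ₑ * ‖f x‖ₑ) := by
    rw [toTemperedDistribution_apply]
    refine (enorm_integral_le_lintegral_enorm _).trans (lintegral_mono_ae ?_)
    filter_upwards [smulL1_ae q f, hq] with x h2 h3
    rw [h2, enorm_smul, enorm_smul]
    have h4 : ‖(q x : ℂ)‖ₑ = ‖q x‖ₑ := by rw [← ofReal_norm, ← ofReal_norm, norm_real]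
    rw [h4]
    calc ‖h x‖ₑ * (‖q x‖ₑ * ‖f x‖ₑ) ≤
        ‖h x‖ₑ * ((P 1 (x - t) + P (-1) (x + t) + η) * ‖f x‖ₑ) := by gcongr
      _ = (‖h x‖ₑ * (P 1 (x - t) * ‖f x‖ₑ) + ‖h x‖ₑ * (P (-1) (x + t) * ‖f x‖ₑ)) +
          η * (‖h x‖ₑ * ‖f x‖ₑ) := by ring
      _ ≤ _ := by gcongr <;> exact hH' x
  have h2 : ∀ (u : ℝ → ℝ≥0∞), AEMeasurable u volume →
      ∫⁻ x, u x * ‖f x‖ₑ ≤ (∫⁻ x, u x ^ 2) ^ (1 / 2 : ℝ) * ‖f‖ₑ := fun u hu => by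
    rw [enorm_eq_sqrt_lintegral f]
    exact lintegral_mul_le_sqrt volume hu mf
  have e1 : ∫⁻ x, P 1 (x - t) ^ 2 = ∫⁻ x, P 1 x ^ 2 :=
    lintegral_sub_right_eq_self (fun x => P 1 x ^ 2) t
  have e2 : ∫⁻ x, P (-1) (x + t) ^ 2 = ∫⁻ x, P (-1) x ^ 2 :=
    lintegral_add_right_eq_self (fun x => P (-1) x ^ 2) t
  have e3 : ∫⁻ x, ‖h x‖ₑ ^ 2 = ∫⁻ x, ‖(h.toLp 2 volume : Lp ℂ 2 vol) x‖ₑ ^ 2 := by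
    exact lintegral_congr_ae ((h.coeFn_toLp 2 volume).mono fun x hx => by simp only [hx])
  have i1 := h2 _ m1.aemeasurable
  have i2 := h2 _ m2.aemeasurable
  have i3 := h2 _ mh
  rw [e1] at i1
  rw [e2] at i2
  rw [e3, ← enorm_eq_sqrt_lintegral] at i3
  refine h1.trans ?_
  rw [lintegral_add_left' (by fun_prop), lintegral_add_left' (by fun_prop),
    lintegral_const_mul'' _ (by fun_prop), lintegral_const_mul'' _ (by fun_prop),
    lintegral_const_mul'' _ (by fun_prop)]
  calc _ ≤ ofReal H * ((∫⁻ x, P 1 x ^ 2) ^ (1 / 2 : ℝ) * ‖f‖ₑ) +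
      ofReal H * ((∫⁻ x, P (-1) x ^ 2) ^ (1 / 2 : ℝ) * ‖f‖ₑ) +
      η * (‖h.toLp 2 volume‖ₑ * ‖f‖ₑ) := by gcongr
    _ = _ := by rw [profileNorm]; ring

theorem WeakDirac.bounded (hw : WeakDirac A B M T q ψ) (hD : DiracPair A B)
    {Φ : ℝ → ℝ → ℝ≥0∞} {c N : ℝ≥0∞} (hb : TravelBound T (fun t x => M + q t x) Φ fun _ => c)
    (hN : N < ∞) (hc : c ≤ N) (hΦ : ∀ σ, ∫⁻ x, Φ σ x ^ 2 ≤ N) (hTN : ofReal T ≤ N)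
    (h0 : ‖ψ 0‖ₑ ^ 2 ≤ N) (h0T : ofReal T * ‖ψ 0‖ₑ ^ 2 ≤ N) :
    BoundedDirac A B M T N c Φ q ψ ∧ ∀ t ∈ Icc 0 T, ‖ψ t‖ ≤ ‖ψ 0‖ := by
  have fin : ∫⁻ t in Ioc 0 T, ‖ψ t‖ₑ ^ 2 < ∞ := by
    obtain ⟨K, hK⟩ : ∃ K, ∀ t ∈ Icc 0 T, ‖ψ t‖ ≤ K :=
      isCompact_Icc.exists_bound_of_continuousOn hw.cont.continuousOn
    calc ∫⁻ t in Ioc 0 T, ‖ψ t‖ₑ ^ 2 ≤ ∫⁻ t in Ioc 0 T, ofReal K ^ 2 := by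
          refine setLIntegral_mono measurable_const fun t ht => ?_
          gcongr
          rw [← ofReal_norm]
          exact ofReal_le_ofReal (hK t ⟨ht.1.le, ht.2⟩)
      _ < ∞ := by
          rw [setLIntegral_const]
          exact mul_lt_top (by finiteness) (by simp)
  set N' := N + ∫⁻ t in Ioc 0 T, ‖ψ t‖ₑ ^ 2
  have hN' : N ≤ N' := le_self_add
  have h1 : BoundedDirac A B M T N' c Φ q ψ := ⟨hw, hb, hTN.trans hN', hc.trans hN',
    fun σ => (hΦ σ).trans hN', h0.trans hN', le_add_self⟩
  have h2 : ∀ t ∈ Icc 0 T, ‖ψ t‖ ≤ ‖ψ 0‖ := fun t ht => h1.norm_le hD (by finiteness) ht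
  refine ⟨⟨hw, hb, hTN, hc, hΦ, h0, ?_⟩, h2⟩
  calc ∫⁻ t in Ioc 0 T, ‖ψ t‖ₑ ^ 2 ≤ ∫⁻ t in Ioc 0 T, ‖ψ 0‖ₑ ^ 2 := by
        refine setLIntegral_mono measurable_const fun t ht => ?_
        gcongr
        exact enorm_le_iff_norm_le.2 (h2 t ⟨ht.1.le, ht.2⟩)
    _ = ofReal T * ‖ψ 0‖ₑ ^ 2 := by rw [setLIntegral_const, volume_Ioc, sub_zero, mul_comm]
    _ ≤ N := h0T

def tail (p : ℝ → ℝ → ℝ≥0∞) (l : ℕ) (σ x : ℝ) : ℝ≥0∞ := p σ x - l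

theorem measurable_tail {p : ℝ → ℝ → ℝ≥0∞} (hp : ∀ σ, Measurable (p σ)) (l : ℕ) (σ : ℝ) :
    Measurable (tail p l σ) := (hp σ).sub measurable_const

theorem tail_anti (p : ℝ → ℝ → ℝ≥0∞) {l l' : ℕ} (h : l ≤ l') (σ x : ℝ) :
    tail p l' σ x ≤ tail p l σ x := by
  unfold tail
  gcongr

theorem tendsto_profileNorm_tail {p : ℝ → ℝ → ℝ≥0∞} (hp : ∀ σ, Measurable (p σ))
    (hfin : ∀ σ, ∫⁻ x, p σ x ^ 2 < ∞) :
    Tendsto (fun l => profileNorm (tail p l)) atTop (𝓝 0) := by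
  have h1 : ∀ σ, Tendsto (fun l => ∫⁻ x, tail p l σ x ^ 2) atTop (𝓝 0) := fun σ => by
    have h2 : ∀ᵐ x, p σ x ^ 2 < ∞ := ae_lt_top (by fun_prop) (hfin σ).ne
    have h3 := tendsto_lintegral_of_dominated_convergence (μ := vol)
      (F := fun l x => tail p l σ x ^ 2) (f := fun _ => 0) (fun x => p σ x ^ 2)
      (fun l => (measurable_tail hp l σ).pow_const 2)
      (fun l => Eventually.of_forall fun x => by
        simp only [tail]
        gcongr
        simp) (hfin σ).ne ?_
    · simpa using h3
    · filter_upwards [h2] with x hx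
      have hx' : p σ x ≠ ∞ := fun h => by simp [h] at hx
      obtain ⟨n, hn⟩ := ENNReal.exists_nat_gt hx'
      refine tendsto_const_nhds.congr' ?_
      filter_upwards [eventually_ge_atTop n] with l hl
      rw [tail, tsub_eq_zero_of_le (hn.le.trans (by exact_mod_cast hl))]
      simp
  have h2 : ∀ σ, Tendsto (fun l => (∫⁻ x, tail p l σ x ^ 2) ^ (1 / 2 : ℝ)) atTop (𝓝 0) :=
    fun σ => by
      have := (h1 σ).ennrpow_const (1 / 2 : ℝ)
      simpa using this
  have h3 := (h2 1).add (h2 (-1))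
  simpa [profileNorm] using h3

theorem profileNorm_const_mul (c : ℝ≥0∞) {p : ℝ → ℝ → ℝ≥0∞} (hp : ∀ σ, Measurable (p σ)) :
    profileNorm (fun σ x => c * p σ x) = c * profileNorm p := by
  have h1 : ∀ σ, (∫⁻ x, (c * p σ x) ^ 2) ^ (1 / 2 : ℝ) = c * (∫⁻ x, p σ x ^ 2) ^ (1 / 2 : ℝ) :=
    fun σ => by
      simp_rw [mul_pow]
      rw [lintegral_const_mul _ ((hp σ).pow_const 2), ENNReal.mul_rpow_of_nonneg _ _ (by norm_num),
        ← rpow_natCast, ← rpow_mul]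
      norm_num
  rw [profileNorm, h1, h1, ← mul_add, profileNorm]

theorem enorm_clamp_sub_le {a K : ℝ} {l : ℕ} {x y : ℝ≥0∞} (hK : 0 ≤ K)
    (h : ‖a‖ₑ ≤ x + y + ofReal K) :
    ‖clamp (K + 2 * l) a - a‖ₑ ≤ (x - l) + (y - l) := by
  by_cases h1 : |a| ≤ K + 2 * l
  · rw [clamp_of_abs_le h1, sub_self, enorm_zero]
    exact zero_le
  · have h2 : |clamp (K + 2 * l) a - a| = |a| - (K + 2 * l) := by
      have hl : (0 : ℝ) ≤ l := Nat.cast_nonneg l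
      push Not at h1
      unfold clamp
      rcases abs_cases a with ⟨e, h3⟩ | ⟨e, h3⟩
      · rw [e] at h1 ⊢
        rw [min_eq_right h1.le, max_eq_left (by linarith), abs_of_nonpos (by linarith)]
        ring
      · rw [e] at h1 ⊢
        rw [min_eq_left (by linarith), max_eq_right (by linarith), abs_of_nonneg (by linarith)]
        ring
    have h3 : ‖clamp (K + 2 * l) a - a‖ₑ = ‖a‖ₑ - (ofReal K + 2 * l) := by
      rw [← ofReal_norm, ← ofReal_norm, norm_eq_abs, norm_eq_abs, h2,
        ENNReal.ofReal_sub _ (by positivity), ofReal_add hK (by positivity),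
        ofReal_mul (by norm_num)]
      simp
    rw [h3, tsub_le_iff_right]
    refine h.trans ?_
    calc x + y + ofReal K ≤ ((x - l) + l) + ((y - l) + l) + ofReal K := by
          gcongr <;> exact le_tsub_add
      _ = _ := by ring

theorem memLp_clamp {K : ℝ} (hK : 0 ≤ K) (q : RealL2) : MemLp (fun x => clamp K (q x)) 2 volume :=
  (memLp q).of_le ((continuous_clamp K).comp_aestronglyMeasurable (by fun_prop))
    (.of_forall fun x => by
      have := abs_clamp_sub_le K (q x) 0
      rwa [clamp_zero hK, sub_zero, sub_zero] at this)

def clampLp {K : ℝ} (hK : 0 ≤ K) (q : RealL2) : RealL2 := (memLp_clamp hK q).toLp _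

theorem clampLp_ae {K : ℝ} (hK : 0 ≤ K) (q : RealL2) :
    clampLp hK q =ᵐ[volume] fun x => clamp K (q x) := (memLp_clamp hK q).coeFn_toLp

theorem continuous_clampLp {K : ℝ} (hK : 0 ≤ K) : Continuous (clampLp hK) := by
  refine (LipschitzWith.of_dist_le_mul (K := 1) fun p q => ?_).continuous
  rw [NNReal.coe_one, one_mul, dist_eq_norm, dist_eq_norm]
  refine Lp.norm_le_norm_of_ae_le ?_
  filter_upwards [coeFn_sub (clampLp hK p) (clampLp hK q), coeFn_sub p q, clampLp_ae hK p,
    clampLp_ae hK q] with x h1 h2 h3 h4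
  rw [h1, h2, Pi.sub_apply, Pi.sub_apply, h3, h4]
  exact abs_clamp_sub_le K _ _

end DiracIntegral

section FixedPoint

variable {A B : 𝓛} {M T R K C : ℝ} {p : ℝ → ℝ → ℝ≥0∞} {N₀ : ℝ≥0∞}
  {Q : (ℝ → SpinorL2) → ℝ → RealL2}

structure FieldMap (T R : ℝ) (p : ℝ → ℝ → ℝ≥0∞) (N₀ : ℝ≥0∞) (K C : ℝ)
    (Q : (ℝ → SpinorL2) → ℝ → RealL2) : Prop where
  time_nonneg : 0 ≤ T
  radius_nonneg : 0 ≤ R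
  const_nonneg : 0 ≤ K
  lip_nonneg : 0 ≤ C
  meas : ∀ σ, Measurable (p σ)
  lt_top : N₀ < ∞
  profile_le : ∀ σ, ∫⁻ x, p σ x ^ 2 ≤ N₀
  cont : ∀ ψ, Continuous ψ → (∀ t, ‖ψ t‖ ≤ R) → Continuous (Q ψ)
  le : ∀ ψ, Continuous ψ → (∀ t, ‖ψ t‖ ≤ R) → ∀ t ∈ Icc 0 T, ∀ᵐ x,
    ‖Q ψ t x‖ₑ ≤ p 1 (x - t) + p (-1) (x + t) + ofReal K
  lip : ∀ ψ ψ', Continuous ψ → (∀ t, ‖ψ t‖ ≤ R) → Continuous ψ' → (∀ t, ‖ψ' t‖ ≤ R) →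
    ∀ t ∈ Icc 0 T, ∀ᵐ x, |Q ψ t x - Q ψ' t x| ≤ C * ∫ s in 0..t, ‖ψ s - ψ' s‖

def aprioriConst (M T R K : ℝ) (N₀ : ℝ≥0∞) : ℝ≥0∞ :=
  ofReal T + ofReal (|M| + K) + N₀ + ofReal R ^ 2 + ofReal T * ofReal R ^ 2

theorem aprioriConst_lt_top (h : N₀ < ∞) : aprioriConst M T R K N₀ < ∞ := by
  unfold aprioriConst
  finiteness

theorem travelBound_add_const (hK : 0 ≤ K) (hp : ∀ σ, Measurable (p σ)) {q : ℝ → RealL2}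
    (hq : ∀ t ∈ Icc 0 T, ∀ᵐ x, ‖q t x‖ₑ ≤ p 1 (x - t) + p (-1) (x + t) + ofReal K) :
    TravelBound T (fun t x => M + q t x) p fun _ => ofReal (|M| + K) where
  meas := hp
  meas_time := measurable_const
  le t ht := by
    filter_upwards [hq t ht] with x hx
    refine (enorm_add_le _ _).trans ?_
    rw [ofReal_add (abs_nonneg _) hK, ← norm_eq_abs, ofReal_norm]
    calc ‖M‖ₑ + ‖q t x‖ₑ ≤ ‖M‖ₑ + (p 1 (x - t) + p (-1) (x + t) + ofReal K) := by gcongr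
      _ = _ := by ring

theorem WeakDirac.bounded_of_le {q : ℝ → RealL2} {ψ : ℝ → SpinorL2}
    (hw : WeakDirac A B M T q ψ) (hD : DiracPair A B) (hK : 0 ≤ K) (hp : ∀ σ, Measurable (p σ))
    (hN : N₀ < ∞) (hpN : ∀ σ, ∫⁻ x, p σ x ^ 2 ≤ N₀)
    (hq : ∀ t ∈ Icc 0 T, ∀ᵐ x, ‖q t x‖ₑ ≤ p 1 (x - t) + p (-1) (x + t) + ofReal K)
    (h0 : ‖ψ 0‖ ≤ R) :
    BoundedDirac A B M T (aprioriConst M T R K N₀) (ofReal (|M| + K)) p q ψ ∧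
      ∀ t ∈ Icc 0 T, ‖ψ t‖ ≤ ‖ψ 0‖ := by
  have h1 : ‖ψ 0‖ₑ ≤ ofReal R := by
    rw [← ofReal_norm]
    exact ofReal_le_ofReal h0
  have h2 : ‖ψ 0‖ₑ ^ 2 ≤ ofReal R ^ 2 := by gcongr
  refine hw.bounded hD (travelBound_add_const hK hp hq) (aprioriConst_lt_top hN) ?_
    (fun σ => (hpN σ).trans ?_) ?_ (h2.trans ?_)
    ((mul_le_mul_right h2 (ofReal T)).trans ?_)
  all_goals unfold aprioriConst
  · exact (((le_add_self.trans le_self_add).trans le_self_add).trans le_self_add)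
  · exact ((le_add_self.trans le_self_add).trans le_self_add)
  · exact (((le_self_add.trans le_self_add).trans le_self_add).trans le_self_add)
  · exact le_add_self.trans le_self_add
  simp

def fieldBall (R : ℝ) : Set (ℝ → SpinorL2) := {ψ | Continuous ψ ∧ ∀ t, ‖ψ t‖ ≤ R}

def truncated (hK : 0 ≤ K) (Q : (ℝ → SpinorL2) → ℝ → RealL2) (l : ℕ) (ψ : ℝ → SpinorL2) (t : ℝ) :
    RealL2 :=
  clampLp (K := K + 2 * l) (by positivity) (Q ψ t)

theorem FieldMap.truncated_le (hQ : FieldMap T R p N₀ K C Q) {ψ : ℝ → SpinorL2}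
    (hψ : ψ ∈ fieldBall R) (l : ℕ) {t : ℝ} (ht : t ∈ Icc 0 T) : ∀ᵐ x,
      ‖truncated hQ.const_nonneg Q l ψ t x‖ₑ ≤ p 1 (x - t) + p (-1) (x + t) + ofReal K := by
  have h0 : 0 ≤ K + 2 * l := add_nonneg hQ.const_nonneg (by positivity)
  filter_upwards [hQ.le ψ hψ.1 hψ.2 t ht, clampLp_ae h0 (Q ψ t)] with x h1 h2
  refine le_trans ?_ h1
  rw [truncated, h2, enorm_le_iff_norm_le]
  have := abs_clamp_sub_le (K + 2 * l) (Q ψ t x) 0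
  rwa [clamp_zero h0, sub_zero, sub_zero] at this

theorem FieldMap.truncated_sub_le (hQ : FieldMap T R p N₀ K C Q) {ψ : ℝ → SpinorL2}
    (hψ : ψ ∈ fieldBall R) (l : ℕ) {t : ℝ} (ht : t ∈ Icc 0 T) : ∀ᵐ x,
      ‖truncated hQ.const_nonneg Q l ψ t x - Q ψ t x‖ₑ ≤
        tail p l 1 (x - t) + tail p l (-1) (x + t) := by
  have h0 : 0 ≤ K + 2 * l := add_nonneg hQ.const_nonneg (by positivity)
  filter_upwards [hQ.le ψ hψ.1 hψ.2 t ht, clampLp_ae h0 (Q ψ t)] with x h1 h2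
  rw [truncated, h2]
  exact enorm_clamp_sub_le hQ.const_nonneg h1

theorem enorm_le_ofReal_of_abs_le {x y : ℝ} (h : |x| ≤ y) : ‖x‖ₑ ≤ ofReal y := by
  rw [← ofReal_norm]
  exact ofReal_le_ofReal h

theorem FieldMap.travelBound_truncated_sub (hQ : FieldMap T R p N₀ K C Q) {ψ ψ' : ℝ → SpinorL2}
    (hψ : ψ ∈ fieldBall R) (hψ' : ψ' ∈ fieldBall R) {l l' : ℕ} (hl : l' ≤ l) :
    TravelBound T (fun t x => truncated hQ.const_nonneg Q l ψ t x -
        truncated hQ.const_nonneg Q l' ψ' t x) (fun σ x => 2 * tail p l' σ x)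
      (fun t => ofReal (C * |∫ s in 0..t, ‖ψ s - ψ' s‖|)) where
  meas σ := (measurable_tail hQ.meas l' σ).const_mul 2
  meas_time := ENNReal.measurable_ofReal.comp (Continuous.measurable
    (((continuous_primitive (fun a b =>
      (hψ.1.sub hψ'.1).norm.intervalIntegrable a b) 0).abs).const_mul C))
  le t ht := by
    have h0 : 0 ≤ K + 2 * l := add_nonneg hQ.const_nonneg (by positivity)
    filter_upwards [hQ.lip ψ ψ' hψ.1 hψ.2 hψ'.1 hψ'.2 t ht, hQ.le ψ' hψ'.1 hψ'.2 t ht,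
      hQ.truncated_sub_le hψ' l' ht, clampLp_ae h0 (Q ψ t)] with x h1 h2 h3 h4
    have e1 : truncated hQ.const_nonneg Q l ψ t x - truncated hQ.const_nonneg Q l' ψ' t x =
        (clamp (K + 2 * l) (Q ψ t x) - clamp (K + 2 * l) (Q ψ' t x)) +
        (clamp (K + 2 * l) (Q ψ' t x) - Q ψ' t x) -
        (truncated hQ.const_nonneg Q l' ψ' t x - Q ψ' t x) := by
      rw [truncated, h4]; ring
    rw [e1]
    refine enorm_sub_le.trans ((add_le_add_left (enorm_add_le _ _) _).trans ?_)
    have b1 : ‖clamp (K + 2 * l) (Q ψ t x) - clamp (K + 2 * l) (Q ψ' t x)‖ₑ ≤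
        ofReal (C * |∫ s in 0..t, ‖ψ s - ψ' s‖|) := by
      refine enorm_le_ofReal_of_abs_le ((abs_clamp_sub_le _ _ _).trans (h1.trans ?_))
      exact mul_le_mul_of_nonneg_left (le_abs_self _) hQ.lip_nonneg
    have b2 : ‖clamp (K + 2 * l) (Q ψ' t x) - Q ψ' t x‖ₑ ≤
        tail p l' 1 (x - t) + tail p l' (-1) (x + t) :=
      (enorm_clamp_sub_le hQ.const_nonneg h2).trans
        (add_le_add (tail_anti p hl 1 _) (tail_anti p hl (-1) _))
    calc _ ≤ ofReal (C * |∫ s in 0..t, ‖ψ s - ψ' s‖|) +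
          (tail p l' 1 (x - t) + tail p l' (-1) (x + t)) +
          (tail p l' 1 (x - t) + tail p l' (-1) (x + t)) := by gcongr
      _ = _ := by ring

theorem FieldMap.exists_step (hQ : FieldMap T R p N₀ K C Q) (hD : DiracPair A B) (M : ℝ)
    {ψ₀ : SpinorL2} (h0 : ‖ψ₀‖ ≤ R) (l : ℕ) (ψ : fieldBall R) :
    ∃ ψ' : fieldBall R, BoundedDirac A B M T (aprioriConst M T R K N₀) (ofReal (|M| + K)) p
      (truncated hQ.const_nonneg Q l ψ) ψ' ∧ ψ'.1 0 = ψ₀ ∧ ∀ t, ψ'.1 (clip T t) = ψ'.1 t := by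
  have hl : 0 ≤ K + 2 * l := add_nonneg hQ.const_nonneg (by positivity)
  obtain ⟨ψ', hw, hi⟩ := exists_weakDirac hD M (q := truncated hQ.const_nonneg Q l ψ) (K := K + 2 * l)
    ((continuous_clampLp hl).comp (hQ.cont ψ ψ.2.1 ψ.2.2)) (fun t => by
      filter_upwards [clampLp_ae hl (Q ψ t)] with x hx
      rw [truncated, hx]
      exact (abs_clamp_le _ _).trans (abs_of_nonneg hl).le) ψ₀ hQ.time_nonneg
  have h1 := hw.comp_clip hQ.time_nonneg
  have e0 : clip T 0 = 0 := clip_of_mem (left_mem_Icc.2 hQ.time_nonneg)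
  obtain ⟨h2, h3⟩ := h1.bounded_of_le hD hQ.const_nonneg hQ.meas hQ.lt_top hQ.profile_le (R := R)
    (fun t ht => hQ.truncated_le ψ.2 l ht) (by rw [e0, hi]; exact h0)
  have hcc : ∀ t, clip T (clip T t) = clip T t := fun t => clip_of_mem (clip_mem hQ.time_nonneg t)
  refine ⟨⟨fun t => ψ' (clip T t), h1.cont, fun t => ?_⟩, h2, by simp only [e0, hi], fun t => by
    simp only [hcc]⟩
  have h4 := h3 (clip T t) (clip_mem hQ.time_nonneg t)
  simp only [hcc, e0, hi] at h4
  exact h4.trans h0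

theorem FieldMap.step_sub_le (hQ : FieldMap T R p N₀ K C Q) (hD : DiracPair A B)
    {ψ ψ' χ χ' : ℝ → SpinorL2} {l l' : ℕ} (hl : l' ≤ l) {N c : ℝ≥0∞} (hN : N < ∞)
    (hψ : ψ ∈ fieldBall R) (hψ' : ψ' ∈ fieldBall R) (hχ' : χ' ∈ fieldBall R)
    (h : BoundedDirac A B M T N c p (truncated hQ.const_nonneg Q l ψ) χ)
    (h' : BoundedDirac A B M T N c p (truncated hQ.const_nonneg Q l' ψ') χ') (h0 : χ 0 = χ' 0)
    {δ D r : ℝ} (hδ0 : 0 ≤ δ) (hD0 : 0 ≤ D) (hr : 0 < r)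
    (hδ : 2 * profileNorm (tail p l') * stabConst N ≤ ofReal (δ ^ 2))
    (hd : ∀ t ∈ Icc 0 T, ‖ψ t - ψ' t‖ ≤ D * exp (r * t)) :
    ∀ t ∈ Icc 0 T, ‖χ t - χ' t‖ ≤
      (δ + 4 * R * (C * (D / r)) / (2 * r)) * exp (r * t) := by
  have hR := hQ.radius_nonneg
  have hC := hQ.lip_nonneg
  have hc : Continuous fun s => ‖ψ s - ψ' s‖ := (hψ.1.sub hψ'.1).norm
  have he : Continuous fun t => C * |∫ s in 0..t, ‖ψ s - ψ' s‖| :=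
    ((continuous_primitive (fun a b => hc.intervalIntegrable a b) 0).abs).const_mul C
  refine le_exp_of_sq_le_integral (h.cont.sub h'.cont).norm he (fun t => norm_nonneg _) hr hδ0
    (by positivity) (by positivity) (fun t ht => ?_) (fun s hs => ?_)
  · refine h.norm_sub_sq_le h' hD hN he (fun s => by positivity)
      (hQ.travelBound_truncated_sub hψ hψ' hl) ?_ hR (fun s _ => hχ'.2 s) h0 ht
    rwa [profileNorm_const_mul 2 (measurable_tail hQ.meas l')]
  · have h1 := integral_le_exp hc hr hD0 hd hs
    have h2 : 0 ≤ ∫ s in 0..s, ‖ψ s - ψ' s‖ :=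
      intervalIntegral.integral_nonneg hs.1 fun s _ => norm_nonneg _
    rw [abs_of_nonneg h2, mul_assoc]
    gcongr

theorem enorm_toTemperedDistribution_smulL1_sub_le {q q' : RealL2} {f f' : SpinorL2}
    (h : 𝓢(ℝ, ℂ)) : ‖toTemperedDistribution (smulL1 q f) h -
      toTemperedDistribution (smulL1 q' f') h‖ₑ ≤
    ‖toTemperedDistribution (smulL1 q (f - f')) h‖ₑ +
      ‖toTemperedDistribution (smulL1 (q - q') f') h‖ₑ := by
  have h1 : toTemperedDistribution (smulL1 q f) h - toTemperedDistribution (smulL1 q' f') h =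
      toTemperedDistribution (smulL1 q (f - f')) h +
      toTemperedDistribution (smulL1 (q - q') f') h := by
    rw [smulL1_sub_right, smulL1_sub_left]
    simp only [← Lp.toTemperedDistributionCLM_apply, map_sub, _root_.sub_apply]
    abel
  rw [h1]
  exact enorm_add_le _ _

end FixedPoint

section FixedPoint

variable {A B : 𝓛} {M T R K C : ℝ} {p : ℝ → ℝ → ℝ≥0∞} {N₀ : ℝ≥0∞}
  {Q : (ℝ → SpinorL2) → ℝ → RealL2}

theorem enorm_spinorDist_sub_le (f f' : SpinorL2) (h : 𝓢(ℝ, ℂ)) :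
    ‖spinorDist f h - spinorDist f' h‖ₑ ≤
      ‖pairL2 (F := Spinor) (h.toLp 2 volume)‖ₑ * ‖f - f'‖ₑ := by
  rw [spinorDist, spinorDist, toTemperedDistribution_eq_pairL2, toTemperedDistribution_eq_pairL2,
    ← map_sub]
  exact le_opENorm _ _

theorem enorm_diracRHS_sub_le (A B : 𝓛) (M : ℝ) (h : 𝓢(ℝ, ℂ)) :
    ∃ c : ℝ≥0∞, c < ∞ ∧ ∀ (q q' : ℝ → RealL2) (ψ ψ' : ℝ → SpinorL2) (t : ℝ),
      ‖diracRHS A B M q ψ h t - diracRHS A B M q' ψ' h t‖ₑ ≤ c * (‖ψ t - ψ' t‖ₑ +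
        ‖toTemperedDistribution (smulL1 (q t) (ψ t)) h -
          toTemperedDistribution (smulL1 (q' t) (ψ' t)) h‖ₑ) := by
  set c₁ := ‖A‖ₑ * ‖pairL2 (F := Spinor) ((∂ₛ h).toLp 2 volume)‖ₑ
  set c₂ := ‖I * (M : ℂ)‖ₑ * (‖B‖ₑ * ‖pairL2 (F := Spinor) (h.toLp 2 volume)‖ₑ)
  refine ⟨c₁ + c₂ + ‖B‖ₑ, ?_, fun q q' ψ ψ' t => ?_⟩
  · finiteness
  set w := toTemperedDistribution (smulL1 (q t) (ψ t)) h -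
          toTemperedDistribution (smulL1 (q' t) (ψ' t)) h
  have e1 : diracRHS A B M q ψ h t - diracRHS A B M q' ψ' h t = A (spinorDist (ψ t) (∂ₛ h) -
        spinorDist (ψ' t) (∂ₛ h)) -
      (I * M) • B (spinorDist (ψ t) h - spinorDist (ψ' t) h) -
      I • B w := by
    simp only [w, diracRHS, map_sub, smul_sub]
    abel
  have b1 : ‖A (spinorDist (ψ t) (∂ₛ h) - spinorDist (ψ' t) (∂ₛ h))‖ₑ ≤ c₁ * ‖ψ t - ψ' t‖ₑ := by
    refine (le_opENorm _ _).trans ?_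
    rw [mul_assoc]
    gcongr
    exact enorm_spinorDist_sub_le _ _ _
  have b2 : ‖(I * (M : ℂ)) • B (spinorDist (ψ t) h - spinorDist (ψ' t) h)‖ₑ ≤
      c₂ * ‖ψ t - ψ' t‖ₑ := by
    rw [enorm_smul, mul_assoc, mul_assoc]
    gcongr
    refine (le_opENorm _ _).trans ?_
    gcongr
    exact enorm_spinorDist_sub_le _ _ _
  have b3 : ‖I • B w‖ₑ ≤ ‖B‖ₑ * ‖w‖ₑ := by
    have : ‖I‖ₑ = 1 := by rw [← ofReal_norm, norm_I, ENNReal.ofReal_one]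
    rw [enorm_smul, this, one_mul]
    exact le_opENorm _ _
  rw [e1]
  calc _ ≤ c₁ * ‖ψ t - ψ' t‖ₑ + c₂ * ‖ψ t - ψ' t‖ₑ + ‖B‖ₑ * ‖w‖ₑ :=
        (enorm_sub_le.trans (add_le_add_left enorm_sub_le _)).trans (by gcongr)
    _ = (c₁ + c₂) * ‖ψ t - ψ' t‖ₑ + ‖B‖ₑ * ‖w‖ₑ := by ring
    _ ≤ (c₁ + c₂ + ‖B‖ₑ) * ‖ψ t - ψ' t‖ₑ + (c₁ + c₂ + ‖B‖ₑ) * ‖w‖ₑ := by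
        exact add_le_add (mul_le_mul_left le_self_add _) (mul_le_mul_left le_add_self _)
    _ = _ := by ring

theorem FieldMap.weakDirac_of_tendsto (hQ : FieldMap T R p N₀ K C Q) {u : ℕ → ℝ → SpinorL2}
    (hu : ∀ n, u n ∈ fieldBall R) {ψ : ℝ → SpinorL2} (hψ : ψ ∈ fieldBall R) {e : ℕ → ℝ}
    (he : Tendsto e atTop (𝓝 0)) (hd : ∀ n t, ‖u n t - ψ t‖ ≤ e n) {l : ℕ → ℕ}
    (hl : Tendsto l atTop atTop)
    (hw : ∀ n, WeakDirac A B M T (truncated hQ.const_nonneg Q (l n) (u n)) (u (n + 1))) :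
    WeakDirac A B M T (Q ψ) ψ := by
  have hQc := hQ.cont ψ hψ.1 hψ.2
  have he0 : ∀ n, 0 ≤ e n := fun n => (norm_nonneg _).trans (hd n 0)
  have hE : Tendsto (fun n => ofReal (e n)) atTop (𝓝 0) := by
    simpa using ENNReal.tendsto_ofReal he
  have hE' := hE.comp (tendsto_add_atTop_nat 1)
  have hd' : ∀ n t, ‖u n t - ψ t‖ₑ ≤ ofReal (e n) := fun n t => by
    rw [← ofReal_norm]
    exact ofReal_le_ofReal (hd n t)
  have hlim : ∀ (h : 𝓢(ℝ, ℂ)) t, Tendsto (fun n => spinorDist (u (n + 1) t) h) atTop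
      (𝓝 (spinorDist (ψ t) h)) := fun h t => by
    rw [tendsto_iff_edist_tendsto_0]
    have h1 : Tendsto (fun n => ‖pairL2 (F := Spinor) (h.toLp 2 volume)‖ₑ *
        ofReal (e (n + 1))) atTop (𝓝 0) := by
      simpa using ENNReal.Tendsto.const_mul hE' (Or.inr enorm_ne_top)
    refine tendsto_of_tendsto_of_tendsto_of_le_of_le tendsto_const_nhds h1 (fun n => zero_le)
      fun n => ?_
    rw [edist_eq_enorm_sub]
    exact (enorm_spinorDist_sub_le _ _ _).trans (by gcongr; exact hd' _ _)
  refine .of_integral_eq hψ.1 hQc fun h t ht => ?_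
  obtain ⟨c, hc, hcb⟩ := enorm_diracRHS_sub_le A B M h
  obtain ⟨H, hH⟩ : ∃ H, ∀ x, ‖h x‖ ≤ H := by
    obtain ⟨H, hH⟩ := h.decay 0 0
    exact ⟨H, fun x => by simpa using hH.2 x⟩
  set hn := ‖h.toLp 2 vol‖ₑ
  have hfinp : ∀ σ, ∫⁻ x, p σ x ^ 2 < ∞ := fun σ => (hQ.profile_le σ).trans_lt hQ.lt_top
  have hpn : profileNorm p < ∞ := by
    unfold profileNorm
    have := hfinp 1
    have := hfinp (-1)
    finiteness
  set b : ℕ → ℝ≥0∞ := fun n => c * (ofReal (e (n + 1)) +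
    ((ofReal H * profileNorm p + ofReal K * hn) * ofReal (e (n + 1)) +
    (ofReal H * profileNorm (tail p (l n)) + ofReal (C * T) *
      ofReal (e n) * hn) * ofReal R))
  set G := fun n => diracRHS A B M (truncated hQ.const_nonneg Q (l n) (u n)) (u (n + 1)) h
  have hb0 : Tendsto b atTop (𝓝 0) := by
    have t1 : Tendsto (fun n => (ofReal H * profileNorm p + ofReal K * hn) *
        ofReal (e (n + 1))) atTop (𝓝 0) := by
      simpa using ENNReal.Tendsto.const_mul hE' (Or.inr (by finiteness))
    have t2 : Tendsto (fun n => ofReal H * profileNorm (tail p (l n))) atTop (𝓝 0) := by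
      simpa using ENNReal.Tendsto.const_mul
        ((tendsto_profileNorm_tail hQ.meas hfinp).comp hl) (Or.inr ofReal_ne_top)
    have t3 : Tendsto (fun n => ofReal (C * T) * ofReal (e n)) atTop (𝓝 0) := by
      simpa using ENNReal.Tendsto.const_mul hE (Or.inr ofReal_ne_top)
    have t4 : Tendsto (fun n => ofReal (C * T) * ofReal (e n) * hn) atTop (𝓝 0) := by
      simpa using ENNReal.Tendsto.mul_const t3 (Or.inr enorm_ne_top)
    have t5 : Tendsto (fun n => (ofReal H * profileNorm (tail p (l n)) +
        ofReal (C * T) * ofReal (e n) * hn) * ofReal R) atTop (𝓝 0) := by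
      simpa using ENNReal.Tendsto.mul_const (t2.add t4) (Or.inr ofReal_ne_top)
    simpa using ENNReal.Tendsto.const_mul (hE'.add (t1.add t5)) (Or.inr hc.ne)
  have hbound : ∀ n, ∀ s ∈ Icc 0 T,
      ‖G n s - diracRHS A B M (Q ψ) ψ h s‖ₑ ≤ b n := fun n s hs => by
    refine (hcb _ _ _ _ s).trans ?_
    simp only [b]
    gcongr
    · exact hd' _ _
    refine (enorm_toTemperedDistribution_smulL1_sub_le h).trans (add_le_add ?_ ?_)
    · refine (enorm_pairing_smulL1_le hQ.meas (hQ.truncated_le (hu n) (l n) hs) h hH).trans ?_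
      gcongr
      exact hd' _ _
    · refine (enorm_pairing_smulL1_le (P := tail p (l n))
        (η := ofReal (C * T) * ofReal (e n)) (t := s)
        (measurable_tail hQ.meas _) ?_ h hH).trans ?_
      · filter_upwards [hQ.truncated_sub_le (hu n) (l n) hs, coeFn_sub
          (truncated hQ.const_nonneg Q (l n) (u n) s) (Q ψ s),
          hQ.lip (u n) ψ (hu n).1 (hu n).2 hψ.1 hψ.2 s hs] with x h1 h2 h3
        have e1 : (truncated hQ.const_nonneg Q (l n) (u n) s - Q ψ s) x =
            (truncated hQ.const_nonneg Q (l n) (u n) s x - Q (u n) s x) +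
              (Q (u n) s x - Q ψ s x) := by
          rw [h2, Pi.sub_apply]; ring
        rw [e1]
        refine (enorm_add_le _ _).trans (add_le_add h1 ?_)
        have hC := hQ.lip_nonneg
        rw [← ofReal_mul (mul_nonneg hC hQ.time_nonneg)]
        refine enorm_le_ofReal_of_abs_le (h3.trans ?_)
        rw [mul_assoc]
        gcongr
        calc ∫ r in 0..s, ‖u n r - ψ r‖ ≤ ∫ r in 0..s, e n :=
              integral_mono_on hs.1
                (((hu n).1.sub hψ.1).norm.intervalIntegrable _ _) (by simp) fun r _ => hd n r
          _ = s * e n := by simp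
          _ ≤ T * e n := by
              have := he0 n
              gcongr
              exact hs.2
      · gcongr
        rw [← ofReal_norm]
        exact ofReal_le_ofReal (hψ.2 s)
  have hcont : ∀ n, Continuous (G n) := fun n =>
    continuous_diracRHS A B M (hw n).cont_pot (hw n).cont h
  have huni : TendstoUniformlyOn G (diracRHS A B M (Q ψ) ψ h) atTop (Icc 0 T) := by
    rw [Metric.tendstoUniformlyOn_iff]
    intro ε hε
    filter_upwards [(tendsto_order.1 hb0).2 (ofReal ε) (by simpa using hε)] with n hn s hs
    have h1 := (hbound n s hs).trans_lt hn
    rw [dist_comm, dist_eq_norm]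
    rw [← ofReal_norm] at h1
    exact (ENNReal.ofReal_lt_ofReal_iff hε).1 h1
  have hint : Tendsto (fun n => ∫ s in 0..t, G n s) atTop
      (𝓝 (∫ s in 0..t, diracRHS A B M (Q ψ) ψ h s)) := by
    refine (huni.mono ?_).tendsto_intervalIntegral_of_continuousOn
      (.of_forall fun n => (by fun_prop))
    rw [uIcc_of_le ht.1]
    exact Icc_subset_Icc_right ht.2
  refine tendsto_nhds_unique (hlim h t) ?_
  refine ((hlim h 0).add hint).congr fun n => ?_
  exact ((hw n).integral_eq h ht).symm

theorem FieldMap.exists_fixedPoint (hQ : FieldMap T R p N₀ K C Q) (hD : DiracPair A B) (M : ℝ)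
    {ψ₀ : SpinorL2} (h0 : ‖ψ₀‖ ≤ R) :
    ∃ ψ ∈ fieldBall R, WeakDirac A B M T (Q ψ) ψ ∧ ψ 0 = ψ₀ ∧ ∀ t, ψ (clip T t) = ψ t := by
  have hR := hQ.radius_nonneg
  have hC := hQ.lip_nonneg
  set N := aprioriConst M T R K N₀
  have hN : N < ∞ := aprioriConst_lt_top hQ.lt_top
  have hS : stabConst N < ∞ := stabConst_lt_top hN
  set D := 2 * R + 1 with hDdef
  have hD0 : 0 < D := by positivity
  set r := 8 * (R * C) + 1 with hrdef
  have hr : 1 ≤ r := by have : 0 ≤ R * C := by positivity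
                        linarith
  have hr0 : 0 < r := by linarith
  set δ : ℕ → ℝ := fun n => D * (1 / 2) ^ n / 4
  have hδ0 : ∀ n, 0 < δ n := fun n => by positivity
  obtain ⟨l, hlm, hl⟩ := extraction_forall_of_eventually
    (P := fun n l => 2 * profileNorm (tail p l) * stabConst N ≤ ofReal (δ n ^ 2))
    fun n => by
      have h1 := tendsto_profileNorm_tail hQ.meas fun σ => (hQ.profile_le σ).trans_lt hQ.lt_top
      have h2 : Tendsto (fun l => 2 * profileNorm (tail p l) * stabConst N) atTop (𝓝 0) := by
        have := ENNReal.Tendsto.mul_const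
          (ENNReal.Tendsto.const_mul h1 (Or.inr (ofNat_ne_top (n := 2)))) (Or.inr hS.ne)
        simpa using this
      have h3 : 0 < ofReal (δ n ^ 2) := by
        rw [ENNReal.ofReal_pos]
        exact pow_pos (hδ0 n) 2
      exact h2.eventually_le_const h3
  choose step hs1 hs2 hs3 using fun n => hQ.exists_step hD M h0 (l n)
  set u : ℕ → fieldBall R := fun n => Nat.rec ⟨fun _ => ψ₀, continuous_const, fun _ => h0⟩
    (fun n ψ => step n ψ) n
  have hu : ∀ n, u (n + 1) = step n (u n) := fun n => rfl
  have hd : ∀ n, ∀ t ∈ Icc 0 T, ‖(u (n + 1)).1 t - (u n).1 t‖ ≤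
      D * (1 / 2) ^ n * exp (r * t) := by
    intro n
    induction n with
    | zero =>
      intro t ht
      have h1 : 1 ≤ exp (r * t) := Real.one_le_exp (mul_nonneg hr0.le ht.1)
      calc _ ≤ ‖(u 1).1 t‖ + ‖(u 0).1 t‖ := norm_sub_le _ _
        _ ≤ R + R := add_le_add ((u 1).2.2 t) ((u 0).2.2 t)
        _ ≤ D * 1 := by linarith
        _ ≤ _ := by simp only [pow_zero, mul_one]; nlinarith
    | succ n ih =>
      have h1 := hQ.step_sub_le hD (hlm.monotone (Nat.le_succ n)) hN (u (n + 1)).2 (u n).2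
        (u (n + 1)).2 (hs1 (n + 1) (u (n + 1))) (hs1 n (u n))
        ((hs2 (n + 1) (u (n + 1))).trans (hs2 n (u n)).symm) (hδ0 n).le (by positivity) hr0 (hl n) ih
      intro t ht
      refine (h1 t ht).trans ?_
      gcongr
      have h2 : 4 * R * (C * (D * (1 / 2) ^ n / r)) / (2 * r) =
          D * (1 / 2) ^ n * (2 * (R * C) / r ^ 2) := by
        field_simp; ring
      have h3 : 2 * (R * C) / r ^ 2 ≤ 1 / 4 := by
        rw [div_le_iff₀ (by positivity)]
        nlinarith
      calc _ ≤ δ n + D * (1 / 2) ^ n * (1 / 4) := by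
            rw [h2]
            gcongr
        _ = _ := by simp only [δ]; rw [pow_succ]; ring
  have hclip : ∀ n t, (u n).1 (clip T t) = (u n).1 t := fun n => by
    cases n with
    | zero => exact fun t => rfl
    | succ n => exact hs3 n (u n)
  set D' := D * exp (r * T)
  have hdist : ∀ t n, dist ((u n).1 t) ((u (n + 1)).1 t) ≤ D' * (1 / 2) ^ n := fun t n => by
    rw [dist_comm, dist_eq_norm, ← hclip (n + 1), ← hclip n]
    have hm := clip_mem hQ.time_nonneg t
    refine (hd n _ hm).trans ?_
    calc D * (1 / 2) ^ n * exp (r * clip T t) ≤ D * (1 / 2) ^ n * exp (r * T) := by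
          gcongr; exact hm.2
      _ = _ := by simp only [D']; ring
  choose ψ hψ using fun t => cauchySeq_tendsto_of_complete
    (cauchySeq_of_le_geometric _ _ (by norm_num) (hdist t))
  set e : ℕ → ℝ := fun n => D' * (1 / 2) ^ n / (1 - 1 / 2)
  have he : Tendsto e atTop (𝓝 0) := by
    have := ((tendsto_pow_atTop_nhds_zero_of_lt_one (r := (1 / 2 : ℝ)) (by norm_num)
      (by norm_num)).const_mul D').div_const (1 - 1 / 2)
    rwa [mul_zero, zero_div] at this
  have hue : ∀ n t, ‖(u n).1 t - ψ t‖ ≤ e n := fun n t => by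
    rw [← dist_eq_norm]
    exact dist_le_of_le_geometric_of_tendsto _ _ (by norm_num) (hdist t) (hψ t) n
  have hunif : TendstoUniformly (fun n => (u n).1) ψ atTop := by
    rw [Metric.tendstoUniformly_iff]
    intro ε hε
    filter_upwards [(tendsto_order.1 he).2 ε hε] with n hn t
    rw [dist_comm, dist_eq_norm]
    exact (hue n t).trans_lt hn
  have hmem : ψ ∈ fieldBall R := ⟨hunif.continuous (Frequently.of_forall fun n => (u n).2.1),
    fun t => le_of_tendsto (hψ t).norm (.of_forall fun n => (u n).2.2 t)⟩
  refine ⟨ψ, hmem, hQ.weakDirac_of_tendsto (fun n => (u n).2) hmem he hue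
    hlm.tendsto_atTop fun n => (hs1 n (u n)).toWeakDirac, ?_, fun t =>
      tendsto_nhds_unique (hψ _) ((hψ t).congr fun n => (hclip n t).symm)⟩
  refine tendsto_nhds_unique (hψ 0) (tendsto_const_nhds.congr fun n => ?_)
  cases n with
  | zero => rfl
  | succ n => exact (hs2 n (u n)).symm

theorem FieldMap.unique (hQ : FieldMap T R p N₀ K C Q) (hD : DiracPair A B) {ψ ψ' : ℝ → SpinorL2}
    (hψ : ψ ∈ fieldBall R) (hψ' : ψ' ∈ fieldBall R) (hw : WeakDirac A B M T (Q ψ) ψ)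
    (hw' : WeakDirac A B M T (Q ψ') ψ') (h0 : ψ 0 = ψ' 0) : ∀ t ∈ Icc 0 T, ψ t = ψ' t := by
  have hR := hQ.radius_nonneg
  have hC := hQ.lip_nonneg
  have hN : aprioriConst M T R K N₀ < ∞ := aprioriConst_lt_top hQ.lt_top
  obtain ⟨b1, -⟩ := hw.bounded_of_le hD hQ.const_nonneg hQ.meas hQ.lt_top hQ.profile_le
    (hQ.le ψ hψ.1 hψ.2) (hψ.2 0)
  obtain ⟨b2, -⟩ := hw'.bounded_of_le hD hQ.const_nonneg hQ.meas hQ.lt_top hQ.profile_le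
    (hQ.le ψ' hψ'.1 hψ'.2) (hψ'.2 0)
  have hc : Continuous fun s => ‖ψ s - ψ' s‖ := (hψ.1.sub hψ'.1).norm
  have he : Continuous fun t => C * |∫ s in 0..t, ‖ψ s - ψ' s‖| :=
    ((continuous_primitive (fun a b => hc.intervalIntegrable a b) 0).abs).const_mul C
  have hδ : TravelBound T (fun t x => Q ψ t x - Q ψ' t x) (fun _ _ => 0)
      fun t => ofReal (C * |∫ s in 0..t, ‖ψ s - ψ' s‖|) :=
    ⟨fun _ => measurable_const, ENNReal.measurable_ofReal.comp he.measurable, fun t ht => by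
      filter_upwards [hQ.lip ψ ψ' hψ.1 hψ.2 hψ'.1 hψ'.2 t ht] with x hx
      rw [zero_add, zero_add]
      refine enorm_le_ofReal_of_abs_le (hx.trans ?_)
      gcongr
      exact le_abs_self _⟩
  have hsq : ∀ t ∈ Icc 0 T, ‖ψ t - ψ' t‖ ^ 2 ≤ (0 : ℝ) ^ 2 + 4 * R *
      ∫ s in 0..t, (C * |∫ s in 0..s, ‖ψ s - ψ' s‖|) * ‖ψ s - ψ' s‖ := fun t ht =>
    b1.norm_sub_sq_le b2 hD hN he (fun s => by positivity) hδ (by simp [profileNorm]) hR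
      (fun s _ => hψ'.2 s) h0 ht
  set r := 8 * (R * C) + 1 with hrdef
  have hr : 1 ≤ r := by have : 0 ≤ R * C := by positivity
                        linarith
  have hr0 : 0 < r := by linarith
  have hd : ∀ n : ℕ, ∀ t ∈ Icc 0 T, ‖ψ t - ψ' t‖ ≤ 2 * R * (1 / 2) ^ n * exp (r * t) := by
    intro n
    induction n with
    | zero =>
      intro t ht
      have h1 : 1 ≤ exp (r * t) := Real.one_le_exp (mul_nonneg hr0.le ht.1)
      calc _ ≤ ‖ψ t‖ + ‖ψ' t‖ := norm_sub_le _ _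
        _ ≤ R + R := add_le_add (hψ.2 t) (hψ'.2 t)
        _ = 2 * R * 1 := by ring
        _ ≤ _ := by
          rw [pow_zero, mul_one]
          exact le_mul_of_one_le_right (by positivity) h1
    | succ n ih =>
      set D := 2 * R * (1 / 2 : ℝ) ^ n
      have hD0 : 0 ≤ D := by positivity
      have h1 := le_exp_of_sq_le_integral hc he (fun _ => norm_nonneg _) hr0 le_rfl
        (by positivity) (E := C * (D / r)) (by positivity) hsq fun s hs => by
          have h1 := integral_le_exp hc hr0 hD0 ih hs
          have h2 : 0 ≤ ∫ s in 0..s, ‖ψ s - ψ' s‖ :=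
            intervalIntegral.integral_nonneg hs.1 fun s _ => norm_nonneg _
          rw [abs_of_nonneg h2, mul_assoc]
          gcongr
      intro t ht
      refine (h1 t ht).trans ?_
      gcongr
      have h2 : 4 * R * (C * (D / r)) / (2 * r) = D * (2 * (R * C) / r ^ 2) := by
        field_simp; ring
      have h3 : 2 * (R * C) / r ^ 2 ≤ 1 / 2 := by
        rw [div_le_iff₀ (by positivity)]
        nlinarith
      calc _ = D * (2 * (R * C) / r ^ 2) := by rw [zero_add, h2]
        _ ≤ D * (1 / 2) := by gcongr
        _ = _ := by simp only [D]; rw [pow_succ]; ring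
  intro t ht
  have h1 : Tendsto (fun n : ℕ => 2 * R * (1 / 2) ^ n * exp (r * t)) atTop (𝓝 0) := by
    have := ((tendsto_pow_atTop_nhds_zero_of_lt_one (r := (1 / 2 : ℝ)) (by norm_num)
      (by norm_num)).const_mul (2 * R)).mul_const (exp (r * t))
    rwa [mul_zero, zero_mul] at this
  have h2 := ge_of_tendsto' h1 fun n => hd n t ht
  exact sub_eq_zero.1 (norm_le_zero_iff.1 h2)

end FixedPoint

theorem SobRep.exists_lintegral_Icc_le {f : Lp ℂ 2 vol} {a : ℝ → ℂ} {k : ℝ}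
    (hf : SobRep k (toTemperedDistribution f) a) (hk0 : 0 ≤ k) (hk : k ≤ 1 / 2) :
    ∃ C, 0 ≤ C ∧ ∀ z h, 0 < h → ∫⁻ x in Icc z (z + h), ‖f x‖ₑ ^ 2 ≤ ofReal (C * h ^ k) := by
  have ha : MemLp a 2 volume := by simpa [jap_zero] using (hf.mono hk0).memLp
  set E := ∫⁻ ξ, ‖(jap k ξ : ℂ) • a ξ‖ₑ ^ 2
  have hE : E ≠ ∞ := by
    have := hf.memLp.2
    rw [eLpNorm_lt_top_iff_lintegral_rpow_enorm_lt_top two_ne_zero ofNat_ne_top] at this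
    simpa [E] using this.ne
  have hn : ∀ r : ℝ, 0 ≤ r → ∀ ξ, r ≤ jap k ξ → ofReal r * ‖a ξ‖ₑ ≤
      ‖(jap k ξ : ℂ) • a ξ‖ₑ := fun r hr ξ h => by
    rw [enorm_smul, ← ofReal_norm (jap k ξ : ℂ), norm_real,
      norm_of_nonneg (jap_pos _ _).le]
    gcongr
  refine ⟨12 * E.toReal + ‖f‖ ^ 2, by positivity, fun z h hh => ?_⟩
  rcases lt_or_ge 1 h with h1 | h1
  · calc _ ≤ ∫⁻ x, ‖f x‖ₑ ^ 2 := setLIntegral_le_lintegral _ _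
      _ = ofReal (‖f‖ ^ 2 * 1) := by
        rw [← enorm_sq_lp, mul_one, ofReal_pow (norm_nonneg _), ofReal_norm]
      _ ≤ _ := by
        gcongr
        · simp
        · exact Real.one_le_rpow h1.le hk0
  set N := h ^ (-(1 / 2) : ℝ) with hN
  have hN0 : 0 < N := by positivity
  have iL : IntegrableOn a (Icc (-N) N) := (ha.restrict _).integrable (by norm_num)
  set K := ∫ ξ in Icc (-N) N, ‖a ξ‖ with hK
  have hK2 : ofReal K ^ 2 ≤ ofReal (2 * N) * E := by
    have h2 : ofReal K ≤ (ofReal (2 * N)) ^ (1 / 2 : ℝ) * E ^ (1 / 2 : ℝ) := by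
      rw [hK, ofReal_integral_norm_eq_lintegral_enorm iL]
      calc _ = ∫⁻ ξ in Icc (-N) N, 1 * ‖a ξ‖ₑ := by simp
        _ ≤ _ := lintegral_mul_le_sqrt _ aemeasurable_const iL.1.enorm
        _ ≤ _ := by
          gcongr
          · simp [two_mul]
          · refine (setLIntegral_le_lintegral _ _).trans (lintegral_mono fun ξ => ?_)
            gcongr
            simpa using hn 1 zero_le_one ξ (one_le_jap hk0 ξ)
    calc _ ≤ ((ofReal (2 * N)) ^ (1 / 2 : ℝ) * E ^ (1 / 2 : ℝ)) ^ 2 := by gcongr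
      _ = _ := by
        rw [mul_pow, ← rpow_natCast, ← rpow_natCast, ← rpow_mul,
          ← rpow_mul]
        norm_num
  have mH : MemLp ((Icc (-N) N)ᶜ.indicator a) 2 volume := ha.indicator measurableSet_Icc.compl
  set w : Lp ℂ 2 vol := 𝓕⁻ (mH.toLp _)
  have hw : ‖w‖ₑ ^ 2 ≤ ofReal (h ^ k) * E := by
    have e1 : ‖w‖ₑ = ‖mH.toLp _‖ₑ := by
      rw [← ofReal_norm, ← ofReal_norm]
      congr 1
      exact (Lp.fourierTransformₗᵢ ℝ ℂ).symm.norm_map _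
    rw [e1, enorm_sq_lp, ← lintegral_const_mul' _ _ ofReal_ne_top]
    refine lintegral_mono_ae ?_
    filter_upwards [mH.coeFn_toLp] with ξ hξ
    rw [hξ]
    by_cases hm : ξ ∈ Icc (-N) N
    · simp [hm]
    rw [indicator_of_mem (mem_compl hm)]
    have h3 : N ^ k ≤ jap k ξ := by
      rw [jap, Real.rpow_div_two_eq_sqrt _ (by positivity)]
      gcongr
      refine Real.le_sqrt_of_sq_le ?_
      rw [mem_Icc, ← abs_le, not_le] at hm
      nlinarith [sq_abs ξ]
    calc ‖a ξ‖ₑ ^ 2 = ofReal (h ^ k) * (ofReal (N ^ k) * ‖a ξ‖ₑ) ^ 2 := by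
          rw [mul_pow, ← mul_assoc, ← ofReal_pow (by positivity),
            ← ofReal_mul (by positivity)]
          have : h ^ k * (N ^ k) ^ 2 = 1 := by
            rw [← Real.rpow_natCast, hN, ← Real.rpow_mul hh.le, ← Real.rpow_mul hh.le,
              ← rpow_add hh, show k + -(1 / 2) * k * (2 : ℕ) = 0 by push_cast; ring,
              Real.rpow_zero]
          rw [this, ENNReal.ofReal_one, one_mul]
      _ ≤ _ := by gcongr; exact hn _ (by positivity) ξ h3
  have hL : ∀ᵐ x, ‖(f - w) x‖ ≤ K := by
    refine ae_norm_le_of_pairing_le (locallyIntegrable_lp _) fun g => ?_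
    have e1 : ∫ x, g x * (f - w) x = ∫ ξ in Icc (-N) N, (𝓕⁻ g) ξ • a ξ := by
      rw [show ∫ x, g x * (f - w) x = toTemperedDistribution (f - w) g by
          simp, ← Lp.toTemperedDistributionCLM_apply, map_sub,
        sub_apply, Lp.toTemperedDistributionCLM_apply, Lp.toTemperedDistributionCLM_apply,
        hf.eq, (sobRep_fourierInv mH).eq, ← integral_sub (hf.integrable _)
          ((sobRep_fourierInv mH).integrable _), ← integral_indicator measurableSet_Icc]
      refine integral_congr_ae (.of_forall fun ξ => ?_)
      by_cases hm : ξ ∈ Icc (-N) N <;> simp [hm]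
    rw [e1, hK, mul_comm, ← integral_const_mul]
    refine norm_integral_le_of_norm_le (iL.norm.const_mul _) (.of_forall fun ξ => ?_)
    rw [norm_smul]
    gcongr
    exact norm_fourierInv_schwartz_le g ξ
  calc ∫⁻ x in Icc z (z + h), ‖f x‖ₑ ^ 2
      ≤ ∫⁻ x in Icc z (z + h), 4 * (ofReal K ^ 2 + ‖w x‖ₑ ^ 2) := by
        refine lintegral_mono_ae (ae_restrict_of_ae ?_)
        filter_upwards [hL, coeFn_sub f w] with x h4 h5
        refine le_trans ?_ (add_sq_le_four _ _)
        gcongr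
        calc ‖f x‖ₑ = ‖(f - w) x + w x‖ₑ := by rw [h5, Pi.sub_apply, sub_add_cancel]
          _ ≤ _ := (enorm_add_le _ _).trans (by
            gcongr
            rw [← ofReal_norm]
            exact ofReal_le_ofReal h4)
    _ ≤ 4 * (ofReal h * (ofReal (2 * N) * E) + ofReal (h ^ k) * E) := by
        rw [lintegral_const_mul' _ _ (by simp), lintegral_add_left measurable_const,
          setLIntegral_const, volume_Icc, add_sub_cancel_left, mul_comm (_ ^ 2)]
        gcongr
        refine (setLIntegral_le_lintegral _ _).trans ?_
        rwa [← enorm_sq_lp]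
    _ ≤ ofReal (12 * E.toReal * h ^ k) := by
        have h5 : h * (2 * N) ≤ 2 * h ^ k := by
          have : h * N = h ^ (1 / 2 : ℝ) := by
            nth_rw 1 [hN, ← Real.rpow_one h]
            rw [← rpow_add hh]
            norm_num
          linarith [Real.rpow_le_rpow_of_exponent_ge hh h1 hk]
        rw [← ofReal_toReal hE, ← mul_assoc, ← ofReal_mul hh.le,
          ← ofReal_mul (by positivity), ← ofReal_mul (by positivity),
          ← ofReal_add (by positivity) (by positivity),
          show (4 : ℝ≥0∞) = ofReal 4 by simp, ← ofReal_mul (by norm_num),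
          ENNReal.toReal_ofReal toReal_nonneg]
        apply ofReal_le_ofReal
        nlinarith [toReal_nonneg (a := E), mul_le_mul_of_nonneg_right h5 (by positivity)]
    _ ≤ _ := by
        gcongr
        simp

section Coupled

variable {A B : 𝓛} {M m g k T R : ℝ} {a₀ a₁ : ℝ → ℂ}

theorem kgW_congr {s s' : ℝ → ℝ → ℂ} {t : ℝ} (ht : 0 ≤ t) (h : ∀ τ ∈ Icc 0 t, s τ = s' τ) :
    kgW m a₀ a₁ s t = kgW m a₀ a₁ s' t ∧ kgWt m a₀ a₁ s t = kgWt m a₀ a₁ s' t := by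
  have e1 : ∀ ξ (c : ℝ → ℂ), ∫ τ in 0..t, c τ * s τ ξ = ∫ τ in 0..t, c τ * s' τ ξ :=
    fun ξ c => integral_congr fun τ hτ => by
      rw [uIcc_of_le ht] at hτ
      simp only [h τ hτ]
  constructor <;> funext ξ
  · simp only [kgW, e1]
  · simp only [kgWt, e1]

theorem WaveRep.congr_source {S S' : ℝ → Lp ℂ 1 vol} {φ : ℝ → RealL2}
    {φt : ℝ → 𝓢'(ℝ, ℂ)} {T' : ℝ} (h : WaveRep m k T' a₀ a₁ S φ φt) (hT : T ≤ T')
    (hS : ∀ t ∈ Icc 0 T, S t = S' t) : WaveRep m k T a₀ a₁ S' φ φt := by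
  have e : ∀ t ∈ Icc 0 T, ∀ τ ∈ Icc 0 t, (ℱ S) τ =
      (ℱ S') τ := fun t ht τ hτ => by
    simp only [hS τ ⟨hτ.1, hτ.2.trans ht.2⟩]
  refine ⟨h.cont, fun t ht => ?_, fun t ht => ?_⟩
  · rw [← (kgW_congr ht.1 (e t ht)).1]
    exact h.rep t ⟨ht.1, ht.2.trans hT⟩
  · rw [← (kgW_congr ht.1 (e t ht)).2]
    exact h.rep_deriv t ⟨ht.1, ht.2.trans hT⟩

theorem WaveRep.unique {S : ℝ → Lp ℂ 1 vol} {φ φ' : ℝ → RealL2}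
    {φt φt' : ℝ → 𝓢'(ℝ, ℂ)} (h : WaveRep m k T a₀ a₁ S φ φt) (h' : WaveRep m k T a₀ a₁ S φ' φt')
    (hS : Continuous S) {t : ℝ} (ht : t ∈ Icc 0 T) : φ t = φ' t ∧ φt t = φt' t := by
  refine ⟨?_, (h.rep_deriv t ht).unique (h'.rep_deriv t ht)⟩
  apply Lp.ext
  filter_upwards [h.ae_abs_sub_le h' hS hS ht] with x hx
  simp only [sub_self, norm_zero, intervalIntegral.integral_zero, mul_zero] at hx
  exact sub_eq_zero.1 (abs_nonpos_iff.1 hx)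

theorem norm_density_le_sq (hD : DiracPair A B) {ψ : ℝ → SpinorL2} (hψ : ψ ∈ fieldBall R) (t : ℝ) :
    ‖density B (ψ t)‖ ≤ R ^ 2 :=
  (norm_density_le hD.norm_right (ψ t)).trans (by gcongr; exact hψ.2 t)

theorem exists_fieldMap (hD : DiracPair A B) (hk0 : 0 ≤ k) (hk : k < 1 / 2) (hT : 0 ≤ T)
    (hR : 0 ≤ R) (h₀ : MemLp (fun ξ => (jap k ξ : ℂ) • a₀ ξ) 2 volume)
    (h₁ : MemLp (fun ξ => (jap (k - 1) ξ : ℂ) • a₁ ξ) 2 volume)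
    {Φ : (ℝ → SpinorL2) → ℝ → RealL2} {Φt : (ℝ → SpinorL2) → ℝ → 𝓢'(ℝ, ℂ)}
    (hΦ : ∀ ψ ∈ fieldBall R, WaveRep m k T a₀ a₁ (fun t => density B (ψ t)) (Φ ψ) (Φt ψ)) (g : ℝ) :
    ∃ p N₀ K C, (FieldMap T R p N₀ K C fun ψ t => (-g) • Φ ψ t) ∧ ∃ C', 0 ≤ C' ∧ ∀ σ z h, 0 < h →
      ∫⁻ x in Icc z (z + h), p σ x ^ 2 ≤ ofReal (C' * h ^ k) := by
  have hL : ∀ σ, MemLp (profHat a₀ a₁ σ) 2 volume := fun σ => by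
    obtain ⟨u, hu⟩ := exists_sobRep (memLp_profHat h₀ h₁ σ)
    simpa [jap_zero] using (hu.mono hk0).memLp
  set F : ℝ → Lp ℂ 2 vol := fun σ => 𝓕⁻ ((hL σ).toLp _)
  have hF : ∀ σ, SobRep k (toTemperedDistribution (F σ)) (profHat a₀ a₁ σ) := fun σ =>
    ⟨memLp_profHat h₀ h₁ σ, (sobRep_fourierInv (hL σ)).eq⟩
  have hkg := kgConst_nonneg (m := m) hT
  set G : ℝ → Lp ℂ 2 vol := fun σ => if σ = 1 then F (-1) else F 1 with hG
  set K := |g| * (|∫ ξ, kgRem m T a₀ a₁ ξ| + kgConst m T * (T * R ^ 2))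
  set N₀ : ℝ≥0∞ := ‖g‖ₑ ^ 2 * (‖F 1‖ₑ ^ 2 + ‖F (-1)‖ₑ ^ 2)
  have hdc : ∀ {ψ : ℝ → SpinorL2}, ψ ∈ fieldBall R → Continuous fun t => density B (ψ t) :=
    fun hψ => (continuous_density hD.norm_right).comp hψ.1
  obtain ⟨C₁, hC₁, hm₁⟩ := (hF 1).exists_lintegral_Icc_le hk0 hk.le
  obtain ⟨C₂, hC₂, hm₂⟩ := (hF (-1)).exists_lintegral_Icc_le hk0 hk.le
  refine ⟨fun σ x => ‖g‖ₑ * ‖G σ x‖ₑ, N₀, K, |g| * (kgConst m T * (2 * R)), ⟨hT, hR, by positivity,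
    by positivity, fun σ => (by fun_prop), by
      finiteness, fun σ => ?_, fun ψ h1 h2 => (hΦ ψ ⟨h1, h2⟩).cont.const_smul (-g),
    fun ψ h1 h2 t ht => ?_, fun ψ ψ' h1 h2 h1' h2' t ht => ?_⟩, ‖g‖ ^ 2 * (C₁ + C₂), by positivity,
    fun σ z h hh => ?_⟩
  · simp_rw [mul_pow]
    rw [lintegral_const_mul _ (by fun_prop), ← enorm_sq_lp]
    simp only [N₀, hG]
    split_ifs
    · gcongr; simp
    · gcongr; simp
  · have hψ : ψ ∈ fieldBall R := ⟨h1, h2⟩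
    filter_upwards [(hΦ ψ hψ).ae_abs_le hk0 (B := R ^ 2) ⟨hk, h₀, h₁,
      continuous_fourier_lp (hdc hψ), fun t _ => (norm_fourier_lp_le _ _).trans
        (norm_density_le_sq hD hψ t)⟩ (hdc hψ) hF ht, coeFn_smul (-g) (Φ ψ t)] with x hx hx2
    have e1 : G 1 = F (-1) := if_pos rfl
    have e2 : G (-1) = F 1 := if_neg (by norm_num)
    have e3 : ∫ τ in 0..t, ‖density B (ψ τ)‖ ≤ T * R ^ 2 := by
      calc ∫ τ in 0..t, ‖density B (ψ τ)‖ ≤ ∫ τ in 0..t, R ^ 2 :=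
            integral_mono_on ht.1 ((hdc hψ).norm.intervalIntegrable _ _) (by simp)
              fun s _ => norm_density_le_sq hD hψ s
        _ = t * R ^ 2 := by simp
        _ ≤ T * R ^ 2 := by gcongr; exact ht.2
    have e4 : |Φ ψ t x| ≤ ‖F 1 (x + t)‖ + ‖F (-1) (x - t)‖ +
        (|∫ ξ, kgRem m T a₀ a₁ ξ| + kgConst m T * (T * R ^ 2)) := by
      refine hx.trans ?_
      gcongr
      exact le_abs_self _
    simp only [e1, e2, ← ofReal_norm, ← ofReal_mul (norm_nonneg g)]
    rw [← ofReal_add (by positivity) (by positivity),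
      ← ofReal_add (by positivity) (by positivity)]
    apply ofReal_le_ofReal
    rw [hx2, Pi.smul_apply, smul_eq_mul, norm_mul, norm_neg, norm_eq_abs, norm_eq_abs]
    calc |g| * |Φ ψ t x| ≤ |g| * (‖F 1 (x + t)‖ + ‖F (-1) (x - t)‖ +
        (|∫ ξ, kgRem m T a₀ a₁ ξ| + kgConst m T * (T * R ^ 2))) := by gcongr
      _ = _ := by simp only [K]; ring
  · have hψ : ψ ∈ fieldBall R := ⟨h1, h2⟩
    have hψ' : ψ' ∈ fieldBall R := ⟨h1', h2'⟩
    filter_upwards [(hΦ ψ hψ).ae_abs_sub_le (hΦ ψ' hψ') (hdc hψ) (hdc hψ') ht,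
      coeFn_smul (-g) (Φ ψ t), coeFn_smul (-g) (Φ ψ' t)] with x hx hx2 hx3
    rw [hx2, hx3, Pi.smul_apply, Pi.smul_apply, ← smul_sub, smul_eq_mul, abs_mul, abs_neg, mul_assoc]
    gcongr
    refine hx.trans ?_
    rw [mul_assoc]
    gcongr
    rw [← intervalIntegral.integral_const_mul]
    refine integral_mono_on ht.1
      (((hdc hψ).sub (hdc hψ')).norm.intervalIntegrable _ _)
      (((h1.sub h1').norm.const_mul _).intervalIntegrable _ _) fun s hs => ?_
    refine (norm_density_sub_le hD.norm_right _ _).trans ?_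
    rw [mul_comm]
    gcongr
    linarith [h2 s, h2' s]
  · simp_rw [mul_pow]
    rw [lintegral_const_mul' _ _ (by finiteness), mul_assoc, ofReal_mul (by positivity),
      ofReal_pow (norm_nonneg g), ofReal_norm]
    gcongr
    simp only [hG]
    split_ifs
    · exact (hm₂ z h hh).trans (by gcongr; linarith)
    · exact (hm₁ z h hh).trans (by gcongr; linarith)

theorem WeakDirac.congr_pot {q q' : ℝ → RealL2} {ψ : ℝ → SpinorL2} (h : WeakDirac A B M T q ψ)
    (hq' : Continuous q') (hq : ∀ t ∈ Icc 0 T, q t = q' t) : WeakDirac A B M T q' ψ :=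
  ⟨h.cont, hq', fun f t ht => by
    rw [← hq t ht]
    exact h.eq f t ht⟩

theorem WeakDirac.mono {q : ℝ → RealL2} {ψ : ℝ → SpinorL2} {T' : ℝ}
    (h : WeakDirac A B M T' q ψ) (hT : T ≤ T') : WeakDirac A B M T q ψ :=
  ⟨h.cont, h.cont_pot, fun f t ht =>
    (h.eq f t ⟨ht.1, ht.2.trans hT⟩).mono (Icc_subset_Icc_right hT)⟩

structure WeakDKG (A B : 𝓛) (M m g k T : ℝ) (a₀ a₁ : ℝ → ℂ)
    (ψ : ℝ → SpinorL2) (φ : ℝ → RealL2) (φt : ℝ → 𝓢'(ℝ, ℂ)) : Prop where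
  dirac : WeakDirac A B M T (fun t => (-g) • φ t) ψ
  wave : WaveRep m k T a₀ a₁ (fun t => density B (ψ t)) φ φt
  clip : ∀ t, ψ (clip T t) = ψ t

section

variable {ψ ψ' : ℝ → SpinorL2} {φ φ' : ℝ → RealL2} {φt φt' : ℝ → 𝓢'(ℝ, ℂ)}

theorem WeakDKG.restrict {T' : ℝ} (h : WeakDKG A B M m g k T' a₀ a₁ ψ φ φt) (hT : 0 ≤ T)
    (hT' : T ≤ T') : WeakDKG A B M m g k T a₀ a₁ (fun t => ψ (DKG.clip T t)) φ φt where
  dirac := (h.dirac.mono hT').comp_clip hT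
  wave := h.wave.congr_source hT' fun t ht => by rw [clip_of_mem ht]
  clip t := by rw [clip_of_mem (clip_mem hT t)]

theorem WeakDKG.exists_mem_fieldBall (h : WeakDKG A B M m g k T a₀ a₁ ψ φ φt) (hT : 0 ≤ T) :
    ∃ R, ∀ t, ‖ψ t‖ ≤ R := by
  obtain ⟨R, hR⟩ := isCompact_Icc.exists_bound_of_continuousOn
    (h.dirac.cont.continuousOn (s := Icc 0 T))
  exact ⟨R, fun t => by
    rw [← h.clip]
    exact hR _ (clip_mem hT t)⟩

variable {φ₀ : RealL2} {φ₁ : 𝓢'(ℝ, ℂ)}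

theorem density_im (hD : DiracPair A B) (f : SpinorL2) : ∀ᵐ x, (density B f x).im = 0 := by
  filter_upwards [density_ae B f] with x hx
  rw [hx, ← inner_conj_symm, conj_im, hD.inner_right_im, neg_zero]

theorem exists_potentials (hD : DiracPair A B) (m : ℝ) (hk0 : 0 ≤ k) (hk : k < 1 / 2) (hT : 0 ≤ T)
    (R : ℝ) (h₀ : SobRep k (realDist φ₀) a₀) (h₁ : SobRep (k - 1) φ₁ a₁) (hr : IsReal φ₁) :
    ∃ (Φ : (ℝ → SpinorL2) → ℝ → RealL2) (Φt : (ℝ → SpinorL2) → ℝ → 𝓢'(ℝ, ℂ)),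
      ∀ ψ ∈ fieldBall R, WaveRep m k T a₀ a₁ (fun t => density B (ψ t)) (Φ ψ) (Φt ψ) := by
  have h2 : ∀ ψ : ℝ → SpinorL2, ∃ (φ : ℝ → RealL2) (φt : ℝ → 𝓢'(ℝ, ℂ)), ψ ∈ fieldBall R →
      WaveRep m k T a₀ a₁ (fun t => density B (ψ t)) φ φt := fun ψ => by
    by_cases hψ : ψ ∈ fieldBall R
    · obtain ⟨φ, φt, h⟩ := exists_waveRep m hk0 hk h₀ h₁ hr
        ((continuous_density hD.norm_right).comp hψ.1) (norm_density_le_sq hD hψ)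
        (fun t => density_im hD (ψ t)) hT
      exact ⟨φ, φt, fun _ => h⟩
    · exact ⟨0, 0, fun h => absurd h hψ⟩
  choose Φ Φt h using h2
  exact ⟨Φ, Φt, h⟩

theorem exists_weakDKG (hD : DiracPair A B) (M m g : ℝ) (hk0 : 0 ≤ k) (hk : k < 1 / 2) (hT : 0 ≤ T)
    (ψ₀ : SpinorL2) (h₀ : SobRep k (realDist φ₀) a₀) (h₁ : SobRep (k - 1) φ₁ a₁) (hr : IsReal φ₁) :
    ∃ ψ φ φt, WeakDKG A B M m g k T a₀ a₁ ψ φ φt ∧ ψ 0 = ψ₀ := by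
  obtain ⟨Φ, Φt, hΦ⟩ := exists_potentials hD m hk0 hk hT ‖ψ₀‖ h₀ h₁ hr
  obtain ⟨p, N₀, K, C, hQ, -⟩ := exists_fieldMap hD hk0 hk hT (norm_nonneg ψ₀) h₀.memLp h₁.memLp hΦ g
  obtain ⟨ψ, hψ, hw, h0, hc⟩ := hQ.exists_fixedPoint hD M le_rfl
  exact ⟨ψ, Φ ψ, Φt ψ, ⟨hw, hΦ ψ hψ, hc⟩, h0⟩

theorem WeakDKG.exists_boundedDirac (h : WeakDKG A B M m g k T a₀ a₁ ψ φ φt)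
    (hD : DiracPair A B) (hk0 : 0 ≤ k) (hk : k < 1 / 2) (hT : 0 ≤ T)
    (h₀ : SobRep k (realDist φ₀) a₀) (h₁ : SobRep (k - 1) φ₁ a₁) (hr : IsReal φ₁) :
    ∃ p N c C, N < ∞ ∧ BoundedDirac A B M T N c p (fun t => (-g) • φ t) ψ ∧ 0 ≤ C ∧
      ∀ σ z h, 0 < h → ∫⁻ x in Icc z (z + h), p σ x ^ 2 ≤ ofReal (C * h ^ k) := by
  obtain ⟨R, hR⟩ := h.exists_mem_fieldBall hT
  obtain ⟨Φ, Φt, hΦ⟩ := exists_potentials hD m hk0 hk hT R h₀ h₁ hr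
  obtain ⟨p, N₀, K, C, hQ, C', hC', hm⟩ := exists_fieldMap hD hk0 hk hT
    ((norm_nonneg _).trans (hR 0)) h₀.memLp h₁.memLp hΦ g
  refine ⟨p, _, _, C', aprioriConst_lt_top hQ.lt_top, (h.dirac.bounded_of_le hD hQ.const_nonneg
    hQ.meas hQ.lt_top hQ.profile_le (fun t ht => ?_) (hR 0)).1, hC', hm⟩
  rw [(h.wave.unique (hΦ ψ ⟨h.dirac.cont, hR⟩)
    ((continuous_density hD.norm_right).comp h.dirac.cont) ht).1]
  exact hQ.le ψ h.dirac.cont hR t ht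

theorem WeakDKG.unique (h : WeakDKG A B M m g k T a₀ a₁ ψ φ φt)
    (h' : WeakDKG A B M m g k T a₀ a₁ ψ' φ' φt') (hD : DiracPair A B) (hk0 : 0 ≤ k)
    (hk : k < 1 / 2) (hT : 0 ≤ T) (h₀ : SobRep k (realDist φ₀) a₀) (h₁ : SobRep (k - 1) φ₁ a₁)
    (hr : IsReal φ₁) (h0 : ψ 0 = ψ' 0) :
    ψ = ψ' ∧ ∀ t ∈ Icc 0 T, φ t = φ' t ∧ φt t = φt' t := by
  obtain ⟨R₁, hR₁⟩ := h.exists_mem_fieldBall hT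
  obtain ⟨R₂, hR₂⟩ := h'.exists_mem_fieldBall hT
  have hψ : ψ ∈ fieldBall (max R₁ R₂) := ⟨h.dirac.cont, fun t => (hR₁ t).trans (le_max_left _ _)⟩
  have hψ' : ψ' ∈ fieldBall (max R₁ R₂) :=
    ⟨h'.dirac.cont, fun t => (hR₂ t).trans (le_max_right _ _)⟩
  obtain ⟨Φ, Φt, hΦ⟩ := exists_potentials hD m hk0 hk hT (max R₁ R₂) h₀ h₁ hr
  obtain ⟨p, N₀, K, C, hQ, -⟩ := exists_fieldMap hD hk0 hk hT
    ((norm_nonneg _).trans (hψ.2 0)) h₀.memLp h₁.memLp hΦ g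
  have hc : ∀ {ψ : ℝ → SpinorL2}, Continuous ψ → Continuous fun t => density B (ψ t) :=
    fun hψ => (continuous_density hD.norm_right).comp hψ
  have key := hQ.unique hD hψ hψ' (h.dirac.congr_pot ((hΦ ψ hψ).cont.const_smul (-g)) fun t ht => by
      rw [(h.wave.unique (hΦ ψ hψ) (hc hψ.1) ht).1])
    (h'.dirac.congr_pot ((hΦ ψ' hψ').cont.const_smul (-g)) fun t ht => by
      rw [(h'.wave.unique (hΦ ψ' hψ') (hc hψ'.1) ht).1]) h0
  have e : ψ = ψ' := by
    funext t
    rw [← h.clip, ← h'.clip]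
    exact key _ (clip_mem hT t)
  subst e
  exact ⟨rfl, fun t ht => h.wave.unique h'.wave (hc hψ.1) ht⟩

end

end Coupled

section TimeRegularity

variable {F : Type*} [NormedAddCommGroup F] [InnerProductSpace ℂ F] [CompleteSpace F]

theorem lintegral_enorm_fourier_sq {w : ℝ → F} (h1 : Integrable w) (h2 : MemLp w 2 volume) :
    ∫⁻ τ, ‖𝓕 w τ‖ₑ ^ 2 = ∫⁻ t, ‖w t‖ₑ ^ 2 := by
  set f : Lp F 2 vol := h2.toLp w
  have hc : Continuous (𝓕 w) :=
    VectorFourier.fourierIntegral_continuous (by fun_prop) continuous_inner h1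
  have key : ∀ᵐ τ, 𝓕 w τ = (𝓕 f : Lp F 2 vol) τ := by
    refine ae_eq_of_integral_contDiff_smul_eq hc.locallyIntegrable
      (locallyIntegrable_lp _) fun g hg hgs => ?_
    have hgs' : HasCompactSupport fun x => (g x : ℂ) := hgs.comp_left ofReal_zero
    set G : 𝓢(ℝ, ℂ) := hgs'.toSchwartzMap (ofRealCLM.contDiff.comp hg)
    have hG : ∀ (u : ℝ → F), ∫ x, g x • u x = ∫ x, G x • u x := fun u =>
      integral_congr_ae (.of_forall fun x => (coe_smul (g x) (u x)).symm)
    rw [hG, hG, ← toTemperedDistribution_apply, ← Lp.fourier_toTemperedDistribution_eq,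
      TemperedDistribution.fourier_apply, toTemperedDistribution_apply]
    have h3 := VectorFourier.integral_fourierIntegral_smul_eq_flip (L := innerₗ ℝ)
      (μ := vol) (ν := vol) continuous_fourierChar
      continuous_inner (G.integrable (μ := volume)) h1
    rw [flip_innerₗ] at h3
    refine h3.symm.trans (integral_congr_ae ?_)
    filter_upwards [h2.coeFn_toLp] with x hx
    rw [hx]
    rfl
  calc ∫⁻ τ, ‖𝓕 w τ‖ₑ ^ 2 = ∫⁻ τ, ‖(𝓕 f : Lp F 2 vol) τ‖ₑ ^ 2 := by
        exact lintegral_congr_ae (key.mono fun τ hτ => by simp only [hτ])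
    _ = ‖f‖ₑ ^ 2 := by rw [← enorm_sq_lp, ← ofReal_norm, ← ofReal_norm, Lp.norm_fourier_eq]
    _ = _ := by
        rw [enorm_sq_lp]
        exact lintegral_congr_ae (h2.coeFn_toLp.mono fun x hx => by simp only [f, hx])

theorem lintegral_enorm_fourier_diff_sq {w : ℝ → F} (h1 : Integrable w) (h2 : MemLp w 2 volume)
    (h : ℝ) : ∫⁻ τ, ‖(𝐞 (h * τ) : ℂ) - 1‖ₑ ^ 2 * ‖𝓕 w τ‖ₑ ^ 2 = ∫⁻ t, ‖w (t + h) - w t‖ₑ ^ 2 := by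
  refine Eq.trans ?_ (lintegral_enorm_fourier_sq ((h1.comp_add_right h).sub h1)
    ((h2.comp_measurePreserving (measurePreserving_add_right volume h)).sub h2))
  refine lintegral_congr fun τ => ?_
  rw [← mul_pow, ← enorm_smul]
  congr 2
  have e1 := congrFun (VectorFourier.fourierIntegral_comp_add_right (e := 𝐞)
    (μ := vol) (L := innerₗ ℝ) w h) τ
  have i1 := fun w (hw : Integrable w volume) => (Real.fourierIntegral_convergent_iff (E := F)
    (μ := vol) (f := w) τ).2 hw
  have e2 : 𝓕 (fun t => w (t + h) - w t) τ = 𝓕 (fun t => w (t + h)) τ - 𝓕 w τ := by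
    simp only [Real.fourier_eq, smul_sub]
    exact integral_sub (i1 _ (h1.comp_add_right h)) (i1 _ h1)
  refine Eq.trans ?_ e2.symm
  rw [sub_smul, one_smul]
  congr 1
  refine Eq.trans ?_ e1.symm
  simp [Circle.smul_def, mul_comm]
  rfl

theorem two_le_norm_fourierChar_sub_one_sq {x : ℝ} (h1 : 1 / 4 ≤ |x|) (h2 : |x| ≤ 1 / 2) :
    2 ≤ ‖(𝐞 x : ℂ) - 1‖ ^ 2 := by
  have e : ‖(𝐞 x : ℂ) - 1‖ ^ 2 = 2 - 2 * cos (2 * π * |x|) := by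
    have : cos (2 * π * |x|) = cos (2 * π * x) := by
      rcases abs_choice x with h | h <;> rw [h]
      simp
    rw [this, Real.fourierChar_apply, ← Complex.normSq_eq_norm_sq, Complex.exp_mul_I,
      ← ofReal_cos, ← Complex.ofReal_sin, Complex.normSq_apply]
    simp only [sub_re, sub_im, add_re, add_im, Complex.mul_re,
      mul_im, I_re, I_im, Complex.ofReal_re, Complex.ofReal_im,
      Complex.one_re, Complex.one_im]
    nlinarith [Real.sin_sq_add_cos_sq (2 * π * x)]
  rw [e]
  have := Real.cos_nonpos_of_pi_div_two_le_of_le (x := 2 * π * |x|)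
    (by nlinarith [pi_pos]) (by nlinarith [pi_pos])
  linarith

theorem jap_sq_le_lintegral {b : ℝ} (hb : 0 < b) (τ : ℝ) :
    ofReal (jap b (2 * π * τ)) ^ 2 ≤ ofReal ((1 + (2 * π) ^ 2) ^ b) *
      (1 + ∫⁻ h in Ioc (0 : ℝ) 1, ofReal (h ^ (-1 - 2 * b)) *
        ‖(𝐞 (h * τ) : ℂ) - 1‖ₑ ^ 2) := by
  have e : jap b (2 * π * τ) ^ 2 = (1 + (2 * π * τ) ^ 2) ^ b := by
    rw [jap, ← Real.rpow_natCast, ← Real.rpow_mul (by positivity)]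
    norm_num
  rw [← ofReal_pow (jap_pos _ _).le, e]
  rcases le_total |τ| 1 with h | h
  · calc ofReal ((1 + (2 * π * τ) ^ 2) ^ b) ≤
        ofReal ((1 + (2 * π) ^ 2) ^ b) * 1 := by
          have : (2 * π * τ) ^ 2 ≤ (2 * π) ^ 2 := by
            rw [mul_pow, ← sq_abs τ]
            exact mul_le_of_le_one_right (by positivity) (pow_le_one₀ (abs_nonneg _) h)
          rw [mul_one]
          exact ofReal_le_ofReal (Real.rpow_le_rpow (by positivity) (by linarith) hb.le)
      _ ≤ _ := by gcongr; simp
  · have hτ : 0 < |τ| := by linarith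
    have h1 : (1 + (2 * π * τ) ^ 2) ^ b ≤ (1 + (2 * π) ^ 2) ^ b * |τ| ^ (2 * b) := by
      rw [Real.rpow_mul hτ.le, ← mul_rpow (by positivity) (by positivity)]
      gcongr
      rw [Real.rpow_two, mul_pow, ← sq_abs τ]
      nlinarith [one_le_pow₀ h (n := 2)]
    refine (ofReal_le_ofReal h1).trans ?_
    rw [ofReal_mul (by positivity)]
    gcongr
    refine le_trans ?_ le_add_self
    have hsub : Icc (1 / (4 * |τ|)) (1 / (2 * |τ|)) ⊆ Ioc (0 : ℝ) 1 := fun x hx =>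
      ⟨lt_of_lt_of_le (by positivity) hx.1, hx.2.trans (by rw [div_le_one (by positivity)]; linarith)⟩
    calc ofReal (|τ| ^ (2 * b)) ≤
          ∫⁻ h in Icc (1 / (4 * |τ|)) (1 / (2 * |τ|)), ofReal ((2 * |τ|) ^ (1 + 2 * b) * 2) := by
          rw [setLIntegral_const, volume_Icc, ← ofReal_mul (by positivity)]
          apply ofReal_le_ofReal
          have e1 : 1 / (2 * |τ|) - 1 / (4 * |τ|) = 1 / (4 * |τ|) := by field_simp; ring
          rw [e1, rpow_add (by positivity), Real.rpow_one, mul_rpow (by norm_num) hτ.le]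
          have h2 : (1 : ℝ) ≤ 2 ^ (2 * b) := Real.one_le_rpow (by norm_num) (by positivity)
          have h3 : 2 * |τ| * (2 ^ (2 * b) * |τ| ^ (2 * b)) * 2 * (1 / (4 * |τ|)) =
              2 ^ (2 * b) * |τ| ^ (2 * b) := by field_simp; norm_num
          rw [h3]
          exact le_mul_of_one_le_left (by positivity) h2
      _ ≤ ∫⁻ h in Icc (1 / (4 * |τ|)) (1 / (2 * |τ|)), ofReal (h ^ (-1 - 2 * b)) *
          ‖(𝐞 (h * τ) : ℂ) - 1‖ₑ ^ 2 := by
          refine setLIntegral_mono' measurableSet_Icc fun x hx => ?_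
          have hx0 : 0 < x := (hsub hx).1
          have hxa : |x * τ| = x * |τ| := by rw [abs_mul, abs_of_pos hx0]
          rw [← ofReal_norm, ← ofReal_pow (norm_nonneg _), ← ofReal_mul (by positivity)]
          apply ofReal_le_ofReal
          gcongr
          · have h4 : 2 * |τ| ≤ x⁻¹ := by
              rw [le_inv_comm₀ (by positivity) hx0, inv_eq_one_div]
              exact hx.2
            calc (2 * |τ|) ^ (1 + 2 * b) ≤ (x⁻¹) ^ (1 + 2 * b) := by gcongr
              _ = _ := by
                  rw [Real.inv_rpow hx0.le, ← Real.rpow_neg hx0.le]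
                  congr 1; ring
          · refine two_le_norm_fourierChar_sub_one_sq ?_ ?_ <;> rw [hxa]
            · have := mul_le_mul_of_nonneg_right hx.1 hτ.le
              refine le_trans (le_of_eq ?_) this
              field_simp
            · have := mul_le_mul_of_nonneg_right hx.2 hτ.le
              refine this.trans (le_of_eq ?_)
              field_simp
      _ ≤ _ := lintegral_mono_set hsub

variable {Y : ℝ → Lp F 2 vol} {a c : ℝ}

theorem rep_eq_zero {t : ℝ} (h : Y t = 0) (x : ℝ) : rep Y t x = 0 := by
  have h1 : ∀ y, ∫ z in 0..y, (Y t) z = 0 := fun y => by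
    rw [h, intervalIntegral.integral_congr_ae (g := fun _ => 0)]
    · simp
    · filter_upwards [Lp.coeFn_zero F 2 vol] with z hz _
      exact hz
  simp only [rep, h1, deriv_const]

theorem lintegral_rep_add_sub_sq (hY : Continuous Y) (h : ℝ) :
    ∫⁻ ξ, ∫⁻ t, ‖rep Y (t + h) ξ - rep Y t ξ‖ₑ ^ 2 = ∫⁻ t, ‖Y (t + h) - Y t‖ₑ ^ 2 := by
  have hm := stronglyMeasurable_rep hY
  have m1 : Measurable fun z : ℝ × ℝ => ‖rep Y (z.2 + h) z.1 - rep Y z.2 z.1‖ₑ ^ 2 :=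
    ((hm.comp_measurable (g := fun z : ℝ × ℝ => (z.2 + h, z.1)) (by fun_prop)).sub
      (hm.comp_measurable (g := fun z : ℝ × ℝ => (z.2, z.1)) (by fun_prop))).enorm.pow_const 2
  rw [lintegral_lintegral_swap m1.aemeasurable]
  refine lintegral_congr fun t => ?_
  rw [enorm_sq_lp]
  apply lintegral_congr_ae
  filter_upwards [rep_ae Y (t + h), rep_ae Y t, coeFn_sub (Y (t + h)) (Y t)] with x h1 h2 h3
  rw [h3, Pi.sub_apply, h1, h2]

theorem lintegral_rep_sq (hY : Continuous Y) : ∫⁻ ξ, ∫⁻ t, ‖rep Y t ξ‖ₑ ^ 2 = ∫⁻ t, ‖Y t‖ₑ ^ 2 := by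
  have m1 : Measurable fun z : ℝ × ℝ => ‖rep Y z.2 z.1‖ₑ ^ 2 :=
    ((stronglyMeasurable_rep hY).comp_measurable
      (g := fun z : ℝ × ℝ => (z.2, z.1)) (by fun_prop)).enorm.pow_const 2
  rw [lintegral_lintegral_swap m1.aemeasurable]
  refine lintegral_congr fun t => ?_
  rw [enorm_sq_lp]
  exact lintegral_congr_ae ((rep_ae Y t).mono fun x h1 => by simp only [h1])

theorem lintegral_curve_sq_lt_top (hY : Continuous Y) (hs : ∀ t ∉ Icc a c, Y t = 0) :
    ∫⁻ t, ‖Y t‖ₑ ^ 2 < ∞ := by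
  obtain ⟨K, hK⟩ := isCompact_Icc.exists_bound_of_continuousOn (s := Icc a c) hY.continuousOn
  calc ∫⁻ t, ‖Y t‖ₑ ^ 2 ≤ ∫⁻ t, (Icc a c).indicator (fun _ => ofReal K ^ 2) t := by
        refine lintegral_mono fun t => ?_
        by_cases ht : t ∈ Icc a c
        · rw [indicator_of_mem ht]
          gcongr
          rw [← ofReal_norm]
          exact ofReal_le_ofReal (hK t ht)
        · simp [hs t ht]
    _ < ∞ := by
        rw [lintegral_indicator measurableSet_Icc, setLIntegral_const]
        exact mul_lt_top (by finiteness) (by simp)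

theorem ae_memLp_slice (hY : Continuous Y) (hs : ∀ t ∉ Icc a c, Y t = 0) :
    ∀ᵐ ξ, Integrable (fun t => rep Y t ξ) ∧ MemLp (fun t => rep Y t ξ) 2 volume := by
  have hm := (stronglyMeasurable_rep hY).comp_measurable
    (g := fun z : ℝ × ℝ => (z.2, z.1)) (by fun_prop)
  have h1 : ∫⁻ ξ, ∫⁻ t, ‖rep Y t ξ‖ₑ ^ 2 ≠ ∞ := by
    rw [lintegral_rep_sq hY]
    exact (lintegral_curve_sq_lt_top hY hs).ne
  filter_upwards [ae_lt_top (by fun_prop) h1] with ξ hξ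
  have hmξ : StronglyMeasurable fun t => rep Y t ξ :=
    hm.comp_measurable (g := fun t : ℝ => (ξ, t)) (by fun_prop)
  have h2 : MemLp (fun t => rep Y t ξ) 2 volume := ⟨(by fun_prop), by
      rw [eLpNorm_lt_top_iff_lintegral_rpow_enorm_lt_top two_ne_zero ofNat_ne_top]
      simpa using hξ⟩
  refine ⟨?_, h2⟩
  refine IntegrableOn.integrable_of_forall_notMem_eq_zero (s := Icc a c)
    ((h2.restrict _).integrable (by norm_num)) fun t ht => rep_eq_zero (hs t ht) ξ

theorem stronglyMeasurable_fourier_rep (hY : Continuous Y) :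
    StronglyMeasurable fun z : ℝ × ℝ => 𝓕 (fun t => rep Y t z.1) z.2 := by
  simp only [fourier_real_eq]
  refine StronglyMeasurable.integral_prod_right'
    (f := fun q : (ℝ × ℝ) × ℝ => 𝐞 (-(q.2 * q.1.2)) • rep Y q.2 q.1.1) ?_
  have h1 : Continuous fun q : (ℝ × ℝ) × ℝ => (𝐞 (-(q.2 * q.1.2)) : ℂ) := (by fun_prop)
  exact h1.stronglyMeasurable.smul ((stronglyMeasurable_rep hY).comp_measurable
    (g := fun q : (ℝ × ℝ) × ℝ => (q.2, q.1.1)) (by fun_prop))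

theorem lintegral_jap_fourier_le {w : ℝ → F} (h1 : Integrable w) (h2 : MemLp w 2 volume) {b : ℝ}
    (hb : 0 < b) :
    ∫⁻ τ, ofReal (jap b (2 * π * τ)) ^ 2 * ‖𝓕 w τ‖ₑ ^ 2 ≤
      ofReal ((1 + (2 * π) ^ 2) ^ b) * ((∫⁻ t, ‖w t‖ₑ ^ 2) +
        ∫⁻ h in Ioc (0 : ℝ) 1, ofReal (h ^ (-1 - 2 * b)) * ∫⁻ t, ‖w (t + h) - w t‖ₑ ^ 2) := by
  have hJ : Measurable fun τ => ‖𝓕 w τ‖ₑ ^ 2 :=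
    (VectorFourier.fourierIntegral_continuous (L := innerₗ ℝ) (by fun_prop)
      continuous_inner h1).enorm.measurable.pow_const 2
  have hω : Measurable fun h : ℝ => ofReal (h ^ (-1 - 2 * b)) := (by fun_prop)
  have m0 : Measurable fun z : ℝ × ℝ => ofReal (z.1 ^ (-1 - 2 * b)) *
      ‖(𝐞 (z.1 * z.2) : ℂ) - 1‖ₑ ^ 2 := by fun_prop
  have m1 : Measurable fun τ => ∫⁻ h in Ioc (0 : ℝ) 1, ofReal (h ^ (-1 - 2 * b)) *
      ‖(𝐞 (h * τ) : ℂ) - 1‖ₑ ^ 2 := by fun_prop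
  have m2 : Measurable fun z : ℝ × ℝ => ofReal (z.2 ^ (-1 - 2 * b)) *
      ‖(𝐞 (z.2 * z.1) : ℂ) - 1‖ₑ ^ 2 * ‖𝓕 w z.1‖ₑ ^ 2 :=
    (m0.comp measurable_swap).mul (hJ.comp measurable_fst)
  refine (lintegral_mono fun τ => mul_le_mul_left (jap_sq_le_lintegral hb τ) _).trans (le_of_eq ?_)
  simp only [mul_assoc, add_mul, one_mul]
  rw [lintegral_const_mul _ (by fun_prop), lintegral_add_left hJ, lintegral_enorm_fourier_sq h1 h2]
  congr 2
  calc _ = ∫⁻ τ, ∫⁻ h in Ioc (0 : ℝ) 1, ofReal (h ^ (-1 - 2 * b)) *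
        ‖(𝐞 (h * τ) : ℂ) - 1‖ₑ ^ 2 * ‖𝓕 w τ‖ₑ ^ 2 :=
        lintegral_congr fun τ => (lintegral_mul_const _ (by fun_prop)).symm
    _ = ∫⁻ h in Ioc (0 : ℝ) 1, ∫⁻ τ, ofReal (h ^ (-1 - 2 * b)) *
        ‖(𝐞 (h * τ) : ℂ) - 1‖ₑ ^ 2 * ‖𝓕 w τ‖ₑ ^ 2 :=
        lintegral_lintegral_swap m2.aemeasurable
    _ = _ := lintegral_congr fun h => by
        simp only [mul_assoc]
        rw [lintegral_const_mul' _ _ ofReal_ne_top, lintegral_enorm_fourier_diff_sq h1 h2 h]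

theorem lintegral_jap_fourier_lt_top (hY : Continuous Y) (hs : ∀ t ∉ Icc a c, Y t = 0)
    {b b' C : ℝ} (hb : 0 < b) (hb' : b < b')
    (hd : ∀ h ∈ Ioc (0 : ℝ) 1, ∫⁻ t, ‖Y (t + h) - Y t‖ₑ ^ 2 ≤ ofReal (C * h ^ (2 * b'))) :
    ∫⁻ ξ, ∫⁻ τ, ofReal (jap b (2 * π * τ)) ^ 2 * ‖𝓕 (fun t => rep Y t ξ) τ‖ₑ ^ 2 < ∞ := by
  have hm := stronglyMeasurable_rep hY
  have hω : Measurable fun h : ℝ => ofReal (h ^ (-1 - 2 * b)) := (by fun_prop)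
  have hE : Measurable fun z : ℝ × ℝ => ∫⁻ t, ‖rep Y (t + z.2) z.1 - rep Y t z.1‖ₑ ^ 2 :=
    (by fun_prop)
  have m3 : Measurable fun z : ℝ × ℝ => ofReal (z.2 ^ (-1 - 2 * b)) *
      ∫⁻ t, ‖rep Y (t + z.2) z.1 - rep Y t z.1‖ₑ ^ 2 := by fun_prop
  have m4 : Measurable fun ξ => ∫⁻ t, ‖rep Y t ξ‖ₑ ^ 2 := (by fun_prop)
  refine (lintegral_mono_ae ((ae_memLp_slice hY hs).mono fun ξ hξ =>
    lintegral_jap_fourier_le hξ.1 hξ.2 hb)).trans_lt ?_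
  rw [lintegral_const_mul _ (m4.fun_add m3.lintegral_prod_right'), lintegral_add_left m4,
    lintegral_rep_sq hY, lintegral_lintegral_swap m3.aemeasurable]
  refine mul_lt_top ENNReal.ofReal_lt_top (add_lt_top.2 ⟨lintegral_curve_sq_lt_top hY hs, ?_⟩)
  have hr : -1 < -1 - 2 * b + 2 * b' := by linarith
  have hint : IntegrableOn (fun h : ℝ => C * h ^ (-1 - 2 * b + 2 * b')) (Ioc 0 1) volume :=
    (intervalIntegrable_iff_integrableOn_Ioc_of_le zero_le_one).1
      ((intervalIntegral.intervalIntegrable_rpow' hr).const_mul C)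
  calc _ ≤ ∫⁻ h in Ioc (0 : ℝ) 1, ofReal (C * h ^ (-1 - 2 * b + 2 * b')) := by
        refine setLIntegral_mono' measurableSet_Ioc fun h hh => ?_
        dsimp only
        rw [lintegral_const_mul' _ _ ofReal_ne_top, lintegral_rep_add_sub_sq hY h]
        refine (mul_le_mul_right (hd h hh) _).trans (le_of_eq ?_)
        rw [← ofReal_mul (rpow_nonneg hh.1.le _), rpow_add hh.1]
        congr 1; ring
    _ ≤ ∫⁻ h in Ioc (0 : ℝ) 1, ‖C * h ^ (-1 - 2 * b + 2 * b')‖ₑ := by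
        refine lintegral_mono fun h => ?_
        rw [← ofReal_norm]
        exact ofReal_le_ofReal (le_abs_self _)
    _ < ∞ := hint.2

end TimeRegularity

section SpaceTimeFourier

def coords : SpaceTime ≃ᵐ ℝ × ℝ :=
  (MeasurableEquiv.toLp 2 (Fin 2 → ℝ)).symm.trans MeasurableEquiv.finTwoArrow

theorem coords_apply (p : SpaceTime) : coords p = (p 0, p 1) := rfl

theorem coords_symm_apply (z : ℝ × ℝ) : coords.symm z = !₂[z.1, z.2] := by
  rw [MeasurableEquiv.symm_apply_eq]; rfl

theorem measurePreserving_coords : MeasurePreserving coords :=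
  (volume_preserving_finTwoArrow ℝ).comp
    (EuclideanSpace.volume_preserving_symm_measurableEquiv_toLp (Fin 2))

theorem integral_spaceTime {E : Type*} [NormedAddCommGroup E] [NormedSpace ℝ E]
    (f : SpaceTime → E) : ∫ p, f p = ∫ z : ℝ × ℝ, f !₂[z.1, z.2] := by
  rw [← measurePreserving_coords.symm.integral_comp' f]
  simp only [coords_symm_apply]

theorem exists_schwartz_prod_bound (H : 𝓢(SpaceTime, ℂ)) :
    ∃ C, 0 ≤ C ∧ ∀ ξ τ : ℝ, ‖H !₂[ξ, τ]‖ ≤ C * (jap (-2) ξ * jap (-2) τ) := by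
  have h1 := fun p => SchwartzMap.one_add_le_sup_seminorm_apply (𝕜 := ℂ) (m := (4, 0)) (k := 4)
    (n := 0) le_rfl le_rfl H p
  set C := 2 ^ (4, 0).1 * ((Finset.Iic (4, 0)).sup fun m : ℕ × ℕ => SchwartzMap.seminorm ℂ m.1 m.2) H
  refine ⟨C, by positivity, fun ξ τ => ?_⟩
  have h2 := h1 !₂[ξ, τ]
  rw [norm_iteratedFDeriv_zero] at h2
  set p : SpaceTime := !₂[ξ, τ]
  have h3 : |ξ| ≤ ‖p‖ := PiLp.norm_apply_le p 0
  have h4 : |τ| ≤ ‖p‖ := PiLp.norm_apply_le p 1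
  have h5 : ∀ x : ℝ, |x| ≤ ‖p‖ → jap 2 x ≤ (1 + ‖p‖) ^ 2 := fun x hx => by
    rw [jap_two, ← sq_abs]
    nlinarith [abs_nonneg x]
  have h6 : jap 2 ξ * jap 2 τ * ‖H p‖ ≤ C := by
    refine le_trans ?_ h2
    calc jap 2 ξ * jap 2 τ * ‖H p‖ ≤ (1 + ‖p‖) ^ 2 * (1 + ‖p‖) ^ 2 * ‖H p‖ := by
          gcongr
          · exact (jap_pos 2 τ).le
          · exact h5 ξ h3
          · exact h5 τ h4
      _ = _ := by ring
  calc ‖H p‖ = (jap (-2) ξ * jap 2 ξ) * (jap (-2) τ * jap 2 τ) * ‖H p‖ := by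
        rw [jap_neg_mul, jap_neg_mul]; ring
    _ = (jap 2 ξ * jap 2 τ * ‖H p‖) * (jap (-2) ξ * jap (-2) τ) := by ring
    _ ≤ _ := by
        gcongr
        exact mul_nonneg (jap_pos _ _).le (jap_pos _ _).le

theorem continuous_slice (H : 𝓢(SpaceTime, ℂ)) : Continuous fun z : ℝ × ℝ => H !₂[z.1, z.2] :=
  (by fun_prop)

theorem fourierInv_slice (h : 𝓢(SpaceTime, ℂ)) (g : 𝓢(ℝ, ℂ)) (t : ℝ) (hg : ∀ x, g x = h !₂[x, t])
    (ξ : ℝ) : (𝓕⁻ g) ξ = ∫ τ, (𝐞 (-(t * τ)) : ℂ) * (𝓕⁻ h) !₂[ξ, τ] := by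
  set H : 𝓢(SpaceTime, ℂ) := 𝓕⁻ h
  obtain ⟨C, hC, hb⟩ := exists_schwartz_prod_bound H
  set k : ℝ → ℂ := fun ξ => ∫ τ, (𝐞 (-(t * τ)) : ℂ) * H !₂[ξ, τ]
  have i2 : Integrable (jap (-2)) := integrable_jap (by norm_num)
  have nb : ∀ x ξ τ : ℝ, ‖(𝐞 x : ℂ) * H !₂[ξ, τ]‖ ≤ C * (jap (-2) ξ * jap (-2) τ) :=
    fun x ξ τ => by rw [norm_mul, Circle.norm_coe, one_mul]; exact hb ξ τ
  have cH : Continuous fun z : ℝ × ℝ => (𝐞 (-(t * z.2)) : ℂ) * H !₂[z.1, z.2] :=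
    (by fun_prop)
  have hkc : Continuous k := by
    refine continuous_of_dominated (bound := fun τ => C * jap (-2) τ)
      (fun ξ => (by fun_prop))
      (fun ξ => Eventually.of_forall fun τ => (nb _ ξ τ).trans ?_) (i2.const_mul C)
      (.of_forall fun τ => (by fun_prop))
    gcongr
    refine mul_le_of_le_one_left (jap_pos _ _).le ?_
    exact (jap_mono (by norm_num : (-2 : ℝ) ≤ 0) ξ).trans (jap_zero ξ).le
  have i3 : Integrable fun z : ℝ × ℝ => C * (jap (-2) z.1 * jap (-2) z.2) :=
    (i2.mul_prod i2).const_mul C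
  have iH : Integrable fun z : ℝ × ℝ => (𝐞 (-(t * z.2)) : ℂ) * H !₂[z.1, z.2] :=
    i3.mono' (by fun_prop) (.of_forall fun z => nb _ z.1 z.2)
  have hki : Integrable k := iH.integral_prod_left
  have hF : 𝓕 k = g := by
    funext x
    have e1 : h = 𝓕 H := (FourierTransform.fourier_fourierInv_eq h).symm
    rw [hg, e1, SchwartzMap.fourier_coe, fourier_real_eq, Real.fourier_eq, integral_spaceTime]
    have iH' : Integrable fun z : ℝ × ℝ => 𝐞 (-(z.1 * x)) •
        ((𝐞 (-(t * z.2)) : ℂ) * H !₂[z.1, z.2]) := by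
      refine i3.mono' (by fun_prop)
        (.of_forall fun z => ?_)
      rw [Circle.norm_smul]
      exact nb _ z.1 z.2
    rw [Measure.volume_eq_prod, integral_prod]
    · refine integral_congr_ae (.of_forall fun ξ => ?_)
      dsimp only
      rw [Circle.smul_def, ← integral_smul]
      refine integral_congr_ae (.of_forall fun τ => ?_)
      simp only [Circle.smul_def, smul_eq_mul, ← mul_assoc, ← Circle.coe_mul,
        ← AddChar.map_add_eq_mul]
      congr 3
      simp [PiLp.inner_apply, Fin.sum_univ_two]
      ring
    · refine iH'.congr (.of_forall fun z => ?_)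
      simp only [Circle.smul_def, smul_eq_mul, ← mul_assoc, ← Circle.coe_mul,
        ← AddChar.map_add_eq_mul]
      congr 3
      simp [PiLp.inner_apply, Fin.sum_univ_two]
      ring
  have := hkc.fourierInv_fourier_eq hki (by rw [hF]; exact g.integrable)
  rw [fourierInv_coe, ← hF, this]

end SpaceTimeFourier

section Bourgain

variable {F : Type*} [NormedAddCommGroup F] [InnerProductSpace ℂ F] [CompleteSpace F]

theorem exists_memBourgain {s b σ : ℝ} (hs : 0 ≤ s) (hb : 0 ≤ b) {J : ℝ → ℝ → F}
    (hJ : StronglyMeasurable fun z : ℝ × ℝ => J z.1 z.2)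
    (hfin : ∫⁻ ξ, ∫⁻ τ, ofReal (jap b (2 * π * τ)) ^ 2 * ‖J ξ τ‖ₑ ^ 2 < ∞) :
    ∃ u : 𝓢'(SpaceTime, F), MemBourgain s b σ u ∧ ∀ h : 𝓢(SpaceTime, ℂ), u h =
      ∫ z : ℝ × ℝ, (𝓕⁻ h) !₂[z.1, z.2] •
        (jap (-s) (2 * π * z.1) : ℂ) • J z.1 (z.2 + σ * |z.1|) := by
  set G : SpaceTime → F := fun p =>
    (jap (-s) (2 * π * p 0) : ℂ) • J (p 0) (p 1 + σ * |p 0|) with hG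
  have m0 : Measurable fun p : SpaceTime => (p 0, p 1) := coords.measurable
  have mJ : StronglyMeasurable fun p : SpaceTime => J (p 0) (p 1 + σ * |p 0|) :=
    (by fun_prop)
  have mG : StronglyMeasurable G := StronglyMeasurable.smul (continuous_ofReal.comp
    ((continuous_jap _).comp (by fun_prop))).stronglyMeasurable mJ
  have hw : ∀ p, bourgainWeight s b σ p =
      jap s (2 * π * p 0) * jap b (2 * π * (p 1 + σ * |p 0|)) := fun p => by
    have : 2 * π * p 1 + σ * |2 * π * p 0| = 2 * π * (p 1 + σ * |p 0|) := by
      rw [abs_mul, abs_of_pos (by positivity : 0 < 2 * π)]; ring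
    rw [bourgainWeight, this, jap, jap]
  have hwc : Continuous (bourgainWeight s b σ) := by
    have : bourgainWeight s b σ = _ := funext hw
    rw [this]
    exact ((continuous_jap s).comp (by fun_prop)).mul ((continuous_jap b).comp (by fun_prop))
  have hwG : ∀ p, ‖bourgainWeight s b σ p • G p‖ =
      jap b (2 * π * (p 1 + σ * |p 0|)) * ‖J (p 0) (p 1 + σ * |p 0|)‖ := fun p => by
    rw [norm_smul, hG, norm_smul, norm_real, hw, norm_of_nonneg (jap_pos _ _).le,
      norm_of_nonneg (mul_pos (jap_pos _ _) (jap_pos _ _)).le]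
    have := jap_neg_mul s (2 * π * p 0)
    linear_combination (jap b (2 * π * (p 1 + σ * |p 0|)) * ‖J (p 0) (p 1 + σ * |p 0|)‖) * this
  have hmem : MemLp (fun p => bourgainWeight s b σ p • G p) 2 volume := by
    refine ⟨(hwc.stronglyMeasurable.smul mG).aestronglyMeasurable, ?_⟩
    rw [eLpNorm_lt_top_iff_lintegral_rpow_enorm_lt_top two_ne_zero ofNat_ne_top]
    have mf : Measurable fun z : ℝ × ℝ =>
        ofReal (jap b (2 * π * z.2)) ^ 2 * ‖J z.1 z.2‖ₑ ^ 2 :=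
      ((((continuous_jap b).comp (by fun_prop : Continuous fun z : ℝ × ℝ =>
        2 * π * z.2)).measurable.ennreal_ofReal).pow_const 2).mul (by fun_prop)
    have mf' := mf.comp (g := _) (by fun_prop : Measurable fun z : ℝ × ℝ => (z.1, z.2 + σ * |z.1|))
    calc _ = ∫⁻ p : SpaceTime, ofReal (jap b (2 * π * ((coords p).2 +
          σ * |(coords p).1|))) ^ 2 * ‖J (coords p).1 ((coords p).2 + σ * |(coords p).1|)‖ₑ ^ 2 := by
          refine lintegral_congr fun p => ?_
          rw [← ofReal_norm, hwG, ofReal_mul (jap_pos _ _).le, ofReal_norm, coords_apply]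
          simp [mul_pow]
      _ = ∫⁻ ξ, ∫⁻ τ, ofReal (jap b (2 * π * (τ + σ * |ξ|))) ^ 2 *
          ‖J ξ (τ + σ * |ξ|)‖ₑ ^ 2 := by
          rw [measurePreserving_coords.lintegral_comp_emb coords.measurableEmbedding fun z : ℝ × ℝ =>
            ofReal (jap b (2 * π * (z.2 + σ * |z.1|))) ^ 2 *
              ‖J z.1 (z.2 + σ * |z.1|)‖ₑ ^ 2]
          exact lintegral_prod _ mf'.aemeasurable
      _ < ∞ := by
          refine lt_of_eq_of_lt (lintegral_congr fun ξ => ?_) hfin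
          exact lintegral_add_right_eq_self (fun τ => ofReal (jap b (2 * π * τ)) ^ 2 *
            ‖J ξ τ‖ₑ ^ 2) (σ * |ξ|)
  have hG2 : MemLp G 2 volume := hmem.of_le mG.aestronglyMeasurable (.of_forall fun p => by
    rw [norm_smul (bourgainWeight s b σ p) (G p), hw, norm_of_nonneg (mul_pos (jap_pos _ _) (jap_pos _ _)).le]
    exact le_mul_of_one_le_left (norm_nonneg _)
      (one_le_mul_of_one_le_of_one_le (one_le_jap hs _) (one_le_jap hb _)))
  have hu : ∀ h : 𝓢(SpaceTime, ℂ), toTemperedDistribution (hG2.toLp G) h = ∫ p, h p • G p :=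
    fun h => by
      rw [toTemperedDistribution_apply]
      exact integral_congr_ae (hG2.coeFn_toLp.mono fun p hp => by simp only [hp])
  refine ⟨𝓕⁻ (toTemperedDistribution (hG2.toLp G)), ⟨G, hmem, fun h => ?_⟩, fun h => ?_⟩
  · rw [FourierTransform.fourier_fourierInv_eq, hu]
  · rw [TemperedDistribution.fourierInv_apply, hu, integral_spaceTime]
    rfl

def cutoff (T t : ℝ) : ℝ := max 0 (1 - Metric.infDist t (Icc 0 T))

theorem continuous_cutoff (T : ℝ) : Continuous (cutoff T) := by
  have := Metric.continuous_infDist_pt (Icc 0 T)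
  unfold cutoff
  fun_prop

theorem abs_cutoff_sub_le (T r t : ℝ) : |cutoff T r - cutoff T t| ≤ |r - t| := by
  refine (abs_max_sub_max_le_max _ _ _ _).trans ?_
  have := (Metric.lipschitz_infDist_pt (Icc 0 T)).dist_le_mul t r
  rw [NNReal.coe_one, one_mul, dist_eq, dist_eq, abs_sub_comm t r] at this
  rw [sub_self, abs_zero, sub_sub_sub_cancel_left]
  exact max_le (abs_nonneg _) this

theorem cutoff_of_mem {T t : ℝ} (ht : t ∈ Icc 0 T) : cutoff T t = 1 := by
  rw [cutoff, Metric.infDist_zero_of_mem ht]; norm_num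

theorem cutoff_of_notMem {T t : ℝ} (hT : 0 ≤ T) (ht : t ∉ Icc (-1) (T + 1)) : cutoff T t = 0 := by
  rw [cutoff, max_eq_left]
  rw [sub_nonpos, Metric.le_infDist (nonempty_Icc.2 hT)]
  intro y hy
  rw [dist_eq, le_abs]
  by_contra! h
  exact ht ⟨by linarith [hy.1], by linarith [hy.2]⟩

theorem cutoff_mem (T t : ℝ) : |cutoff T t| ≤ 1 := by
  rw [abs_of_nonneg (le_max_left _ _)]
  exact max_le zero_le_one (by linarith [Metric.infDist_nonneg (x := t) (s := Icc 0 T)])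

variable {Z : ℝ → Lp F 2 vol} {T b' C : ℝ}

theorem lintegral_cutoff_sub_sq_le (hZ : Continuous Z) (hT : 0 ≤ T) (hb' : b' ≤ 1) (hC : 0 ≤ C)
    (hd : ∀ h ∈ Ioc (0 : ℝ) 1, ∫⁻ t, ‖Z (clip T (t + h)) - Z (clip T t)‖ₑ ^ 2 ≤
      ofReal (C * h ^ (2 * b'))) :
    ∃ C', ∀ h ∈ Ioc (0 : ℝ) 1, ∫⁻ t, ‖(cutoff T (t + h) : ℂ) • Z (clip T (t + h)) -
      (cutoff T t : ℂ) • Z (clip T t)‖ₑ ^ 2 ≤ ofReal (C' * h ^ (2 * b')) := by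
  obtain ⟨K, hK⟩ := isCompact_Icc.exists_bound_of_continuousOn (s := Icc 0 T) hZ.continuousOn
  have hK0 : 0 ≤ K := (norm_nonneg _).trans (hK 0 (left_mem_Icc.2 hT))
  refine ⟨4 * (K ^ 2 * (T + 3) + C), fun h hh => ?_⟩
  have hpt : ∀ t, ‖(cutoff T (t + h) : ℂ) • Z (clip T (t + h)) -
      (cutoff T t : ℂ) • Z (clip T t)‖ₑ ^ 2 ≤
      4 * ((Icc (-2) (T + 1)).indicator (fun _ => ofReal (h * K) ^ 2) t +
        ‖Z (clip T (t + h)) - Z (clip T t)‖ₑ ^ 2) := fun t => by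
    have e : (cutoff T (t + h) : ℂ) • Z (clip T (t + h)) -
        (cutoff T t : ℂ) • Z (clip T t) =
        ((cutoff T (t + h) - cutoff T t : ℝ) : ℂ) • Z (clip T (t + h)) +
        (cutoff T t : ℂ) • (Z (clip T (t + h)) - Z (clip T t)) := by
      push_cast
      module
    have b1 : ‖((cutoff T (t + h) - cutoff T t : ℝ) : ℂ) • Z (clip T (t + h))‖ₑ ^ 2 ≤
        (Icc (-2) (T + 1)).indicator (fun _ => ofReal (h * K) ^ 2) t := by
      by_cases ht : t ∈ Icc (-2) (T + 1)
      · rw [indicator_of_mem ht]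
        gcongr
        rw [← ofReal_norm, norm_smul, norm_real]
        apply ofReal_le_ofReal
        have h1 := abs_cutoff_sub_le T (t + h) t
        rw [add_sub_cancel_left, abs_of_pos hh.1] at h1
        exact mul_le_mul h1 (hK _ (clip_mem hT _)) (norm_nonneg _) hh.1.le
      · have h1 : t ∉ Icc (-1) (T + 1) := fun h' => ht ⟨by linarith [h'.1], h'.2⟩
        have h2 : t + h ∉ Icc (-1) (T + 1) := fun h' =>
          ht ⟨by linarith [h'.1, hh.2], by linarith [h'.2, hh.1]⟩
        simp [cutoff_of_notMem hT h1, cutoff_of_notMem hT h2]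
    have b2 : ‖(cutoff T t : ℂ) • (Z (clip T (t + h)) - Z (clip T t))‖ₑ ≤
        ‖Z (clip T (t + h)) - Z (clip T t)‖ₑ := by
      rw [enorm_le_iff_norm_le, norm_smul, norm_real]
      exact mul_le_of_le_one_left (norm_nonneg _) (cutoff_mem T t)
    rw [e]
    refine (pow_le_pow_left' (enorm_add_le _ _) 2).trans ((add_sq_le_four _ _).trans ?_)
    gcongr
  refine (lintegral_mono hpt).trans ?_
  rw [lintegral_const_mul' _ _ (by norm_num), lintegral_add_left (by
    exact measurable_const.indicator measurableSet_Icc), lintegral_indicator measurableSet_Icc,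
    setLIntegral_const, volume_Icc]
  have h1 : h ^ (2 : ℝ) ≤ h ^ (2 * b') :=
    Real.rpow_le_rpow_of_exponent_ge hh.1 hh.2 (by linarith)
  rw [Real.rpow_two] at h1
  have hp : 0 ≤ h ^ (2 * b') := rpow_nonneg hh.1.le _
  have hhK : 0 ≤ h * K := mul_nonneg hh.1.le hK0
  calc _ ≤ 4 * (ofReal (h * K) ^ 2 * ofReal (T + 1 - -2) +
        ofReal (C * h ^ (2 * b'))) := by gcongr; exact hd h hh
    _ = ofReal (4 * ((h * K) ^ 2 * (T + 1 - -2) + C * h ^ (2 * b'))) := by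
        rw [← ofReal_pow hhK, ← ofReal_mul (by positivity),
          ← ofReal_add (mul_nonneg (by positivity) (by linarith)) (by positivity),
          ofReal_mul (by norm_num), ofReal_ofNat]
    _ ≤ _ := by
        apply ofReal_le_ofReal
        have h3 : 0 ≤ K ^ 2 * (T + 3) := by positivity
        nlinarith [mul_le_mul_of_nonneg_left h1 h3]

theorem memBourgainOn_of_curve (hZ : Continuous Z) (hT : 0 ≤ T) {s b σ : ℝ} (hs : 0 ≤ s)
    (hb : 0 < b) (hbb : b < b') (hb' : b' ≤ 1) (hC : 0 ≤ C)
    (hd : ∀ h ∈ Ioc (0 : ℝ) 1, ∫⁻ t, ‖Z (clip T (t + h)) - Z (clip T t)‖ₑ ^ 2 ≤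
      ofReal (C * h ^ (2 * b'))) {f : ℝ → 𝓢'(ℝ, F)}
    (hf : ∀ t ∈ Icc 0 T, ∀ h : 𝓢(ℝ, ℂ), f t h = ∫ ξ, (𝓕⁻ h) ξ •
      ((jap (-s) (2 * π * ξ) : ℂ) * 𝐞 (-(t * (σ * |ξ|)))) • Z t ξ) :
    MemBourgainOn s b σ T f := by
  set Y : ℝ → Lp F 2 vol := fun t => (cutoff T t : ℂ) • Z (clip T t)
  have hY : Continuous Y := (continuous_ofReal.comp (continuous_cutoff T)).smul
    (hZ.comp (continuous_clip T))
  have hYs : ∀ t ∉ Icc (-1) (T + 1), Y t = 0 := fun t ht => by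
    simp only [Y, cutoff_of_notMem hT ht, ofReal_zero]
    simp
  obtain ⟨C', hC'⟩ := lintegral_cutoff_sub_sq_le hZ hT hb' hC hd
  obtain ⟨u, hu, hu'⟩ := exists_memBourgain (σ := σ) hs hb.le (stronglyMeasurable_fourier_rep hY)
    (lintegral_jap_fourier_lt_top hY hYs hb hbb hC')
  refine ⟨u, hu, fun h g hg hsupp => ?_⟩
  obtain ⟨D, hD, hDb⟩ := exists_schwartz_prod_bound (𝓕⁻ h)
  have i2 : Integrable (jap (-2)) := integrable_jap (by norm_num)
  have hm := stronglyMeasurable_rep hY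
  set Ψ : (ℝ × ℝ) × ℝ → F := fun q => ((𝓕⁻ h) !₂[q.1.1, q.1.2] *
    ((jap (-s) (2 * π * q.1.1) : ℂ) *
      𝐞 (-(q.2 * (q.1.2 + σ * |q.1.1|))))) • rep Y q.2 q.1.1 with hΨ
  have mΨ : StronglyMeasurable Ψ := by
    refine StronglyMeasurable.smul (Continuous.stronglyMeasurable ?_)
      (by fun_prop)
    exact ((continuous_slice _).comp continuous_fst).mul ((continuous_ofReal.comp
      ((continuous_jap _).comp (by fun_prop))).mul
        (by fun_prop))
  have nΨ : ∀ q, ‖Ψ q‖ₑ ≤ ofReal D * (‖jap (-2) q.1.1‖ₑ * ‖rep Y q.2 q.1.1‖ₑ) *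
      ‖jap (-2) q.1.2‖ₑ := fun q => by
    have h1 : ‖(𝓕⁻ h) !₂[q.1.1, q.1.2]‖ₑ ≤ ofReal D * (‖jap (-2) q.1.1‖ₑ *
        ‖jap (-2) q.1.2‖ₑ) := by
      rw [← ofReal_norm, ← ofReal_norm, ← ofReal_norm, norm_of_nonneg (jap_pos _ _).le,
        norm_of_nonneg (jap_pos _ _).le, ← ofReal_mul (jap_pos _ _).le,
        ← ofReal_mul hD]
      exact ofReal_le_ofReal (hDb _ _)
    have h2 : ‖(jap (-s) (2 * π * q.1.1) : ℂ) *
        𝐞 (-(q.2 * (q.1.2 + σ * |q.1.1|)))‖ₑ ≤ 1 := by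
      rw [← ofReal_norm, norm_mul, Circle.norm_coe, mul_one, norm_real,
        norm_of_nonneg (jap_pos _ _).le, ENNReal.ofReal_le_one, ← jap_zero (2 * π * q.1.1)]
      exact jap_mono (by linarith) _
    rw [hΨ, enorm_smul, enorm_mul]
    calc _ ≤ ofReal D * (‖jap (-2) q.1.1‖ₑ * ‖jap (-2) q.1.2‖ₑ) * 1 *
          ‖rep Y q.2 q.1.1‖ₑ := by gcongr
      _ = _ := by ring
  have iΨ : Integrable Ψ ((volume.prod volume).prod volume) := by
    refine ⟨(by fun_prop), ?_⟩
    have mr : ∀ t, Measurable fun ξ => ‖jap (-2) ξ‖ₑ * ‖rep Y t ξ‖ₑ := fun t =>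
      (continuous_jap _).enorm.measurable.mul
        (by fun_prop)
    have hI : ∫⁻ τ, ‖jap (-2) τ‖ₑ < ∞ := i2.2
    have hJ : ∀ t, ∫⁻ ξ, ‖jap (-2) ξ‖ₑ * ‖rep Y t ξ‖ₑ ≤
        (∫⁻ ξ, ‖jap (-2) ξ‖ₑ ^ 2) ^ (1 / 2 : ℝ) * ‖Y t‖ₑ := fun t => by
      refine (lintegral_mul_le_sqrt volume (by fun_prop)
        (hm.comp_measurable (g := fun ξ : ℝ => (t, ξ)) (by fun_prop)).enorm.aemeasurable).trans ?_
      rw [enorm_eq_sqrt_lintegral (Y t)]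
      refine mul_le_mul_right (ENNReal.rpow_le_rpow (lintegral_mono_ae ?_) (by norm_num)) _
      filter_upwards [rep_ae Y t] with x hx
      simp only [Function.comp_apply, hx, le_refl]
    have hYi : Integrable Y := hY.integrable_of_hasCompactSupport
      (HasCompactSupport.intro isCompact_Icc hYs)
    have hj : (∫⁻ ξ, ‖jap (-2) ξ‖ₑ ^ 2) ^ (1 / 2 : ℝ) < ∞ := by
      have := (memLp_jap (by norm_num : (-2 : ℝ) < -(1 / 2))).2
      rw [eLpNorm_lt_top_iff_lintegral_rpow_enorm_lt_top two_ne_zero ofNat_ne_top] at this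
      exact ENNReal.rpow_lt_top_of_nonneg (by norm_num) (by simpa using this.ne)
    rw [HasFiniteIntegral, lintegral_prod_symm _ (by fun_prop)]
    calc _ ≤ ∫⁻ t, ofReal D * ((∫⁻ ξ, ‖jap (-2) ξ‖ₑ ^ 2) ^ (1 / 2 : ℝ) *
          ∫⁻ τ, ‖jap (-2) τ‖ₑ) * ‖Y t‖ₑ := by
          refine lintegral_mono fun t => ?_
          have mt : Measurable fun z : ℝ × ℝ => ‖Ψ (z, t)‖ₑ :=
            (by fun_prop)
          rw [lintegral_prod _ mt.aemeasurable]
          refine (lintegral_mono fun ξ => lintegral_mono fun τ => nΨ ((ξ, τ), t)).trans ?_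
          simp only [lintegral_const_mul _ (continuous_jap (-2)).enorm.measurable]
          rw [lintegral_mul_const _ ((mr t).const_mul _), lintegral_const_mul _ (mr t)]
          calc _ ≤ ofReal D * ((∫⁻ ξ, ‖jap (-2) ξ‖ₑ ^ 2) ^ (1 / 2 : ℝ) * ‖Y t‖ₑ) *
                ∫⁻ τ, ‖jap (-2) τ‖ₑ := by gcongr; exact hJ t
            _ = _ := by ring
      _ < ∞ := by
          have hfin : ofReal D * ((∫⁻ ξ, ‖jap (-2) ξ‖ₑ ^ 2) ^ (1 / 2 : ℝ) *
              ∫⁻ τ, ‖jap (-2) τ‖ₑ) < ∞ :=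
            (by finiteness)
          rw [lintegral_const_mul' _ _ hfin.ne]
          exact mul_lt_top hfin hYi.2
  have e1 : ∀ z : ℝ × ℝ, (𝓕⁻ h) !₂[z.1, z.2] • (jap (-s) (2 * π * z.1) : ℂ) •
      𝓕 (fun t => rep Y t z.1) (z.2 + σ * |z.1|) = ∫ t, Ψ (z, t) := fun z => by
    rw [fourier_real_eq, smul_smul, ← integral_smul]
    refine integral_congr_ae (.of_forall fun t => ?_)
    simp only [hΨ, Circle.smul_def, smul_smul, mul_assoc]
  have e2 : ∀ᵐ t, ∫ z : ℝ × ℝ, Ψ (z, t) = (Ioc 0 T).indicator (fun t => f t (g t)) t := by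
    filter_upwards [iΨ.prod_left_ae] with t ht
    rw [Measure.volume_eq_prod, integral_prod _ ht]
    have e3 : ∀ ξ, ∫ τ, Ψ ((ξ, τ), t) = ((𝓕⁻ (g t)) ξ *
        ((jap (-s) (2 * π * ξ) : ℂ) * 𝐞 (-(t * (σ * |ξ|))))) •
        rep Y t ξ := fun ξ => by
      refine (integral_smul_const (fun τ => (𝓕⁻ h) !₂[ξ, τ] *
        ((jap (-s) (2 * π * ξ) : ℂ) *
          𝐞 (-(t * (τ + σ * |ξ|))))) (rep Y t ξ)).trans ?_
      rw [fourierInv_slice h (g t) t (hg t), ← integral_mul_const]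
      congr 1
      refine integral_congr_ae (.of_forall fun τ => ?_)
      dsimp only
      rw [mul_add, neg_add, AddChar.map_add_eq_mul, Circle.coe_mul]
      ring
    simp only [e3]
    by_cases ht' : t ∈ Ioc 0 T
    · have hI : t ∈ Icc 0 T := ⟨ht'.1.le, ht'.2⟩
      have hYt : Y t = Z t := by
        simp only [Y, cutoff_of_mem hI, clip_of_mem hI, ofReal_one]
        exact one_smul ℂ _
      rw [indicator_of_mem ht', hf t hI]
      exact integral_congr_ae ((rep_ae Y t).mono fun ξ hξ => by simp only [hξ, hYt, mul_smul])
    · have hg0 : g t = 0 := by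
        ext x
        rw [hg, zero_apply]
        exact image_eq_zero_of_notMem_tsupport fun h' => ht' (Ioo_subset_Ioc_self (hsupp h'))
      have h0 : ∀ ξ, (𝓕⁻ (g t)) ξ = 0 := fun ξ => by
        rw [hg0, fourierInv_coe, Real.fourierInv_eq]
        simp
      simp [indicator_of_notMem ht', h0]
  rw [hu', integral_of_le hT, ← integral_indicator measurableSet_Ioc]
  simp only [e1]
  rw [Measure.volume_eq_prod, integral_integral_swap iΨ]
  exact integral_congr_ae e2

end Bourgain

section Increments

theorem sq_lintegral_mul_le {X : Type*} [MeasurableSpace X] (μ : Measure X) {f g : X → ℝ≥0∞}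
    (hf : AEMeasurable f μ) (hg : AEMeasurable g μ) :
    (∫⁻ x, f x * g x ∂μ) ^ 2 ≤ (∫⁻ x, f x ^ 2 ∂μ) * ∫⁻ x, g x ^ 2 ∂μ := by
  calc _ ≤ ((∫⁻ x, f x ^ 2 ∂μ) ^ (1 / 2 : ℝ) * (∫⁻ x, g x ^ 2 ∂μ) ^ (1 / 2 : ℝ)) ^ 2 := by
        gcongr
        exact lintegral_mul_le_sqrt μ hf hg
    _ = _ := by
        rw [mul_pow, ← rpow_natCast, ← rpow_natCast, ← rpow_mul, ← rpow_mul]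
        norm_num

theorem lintegral_window {F : ℝ → ℝ≥0∞} (hF : Measurable F) (h : ℝ) :
    ∫⁻ t, ∫⁻ s in Ioc t (t + h), F s = ofReal h * ∫⁻ s, F s := by
  have m : MeasurableSet {z : ℝ × ℝ | z.2 ∈ Ioc z.1 (z.1 + h)} :=
    (measurableSet_lt measurable_fst measurable_snd).inter
      (measurableSet_le measurable_snd (measurable_fst.add_const h))
  simp_rw [← lintegral_indicator measurableSet_Ioc]
  rw [lintegral_lintegral_swap, ← lintegral_const_mul _ hF]
  · congr 1
    funext s
    have : ∀ t, (Ioc t (t + h)).indicator F s = (Ico (s - h) s).indicator (fun _ => F s) t :=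
      fun t => by
        simp only [indicator, mem_Ioc, mem_Ico]
        congr 1
        rw [and_comm, sub_le_iff_le_add]
    simp_rw [this]
    rw [lintegral_indicator measurableSet_Ico, setLIntegral_const, Real.volume_Ico,
      sub_sub_cancel, mul_comm]
  · exact ((hF.comp measurable_snd).indicator m).aemeasurable

theorem Ioc_clip_subset {T : ℝ} (t h : ℝ) :
    Ioc (clip T t) (clip T (t + h)) ⊆ Ioc t (t + h) ∩ Ioc 0 T := fun s hs => by
  simp only [mem_Ioc, clip, max_lt_iff, min_lt_iff, le_max_iff, le_min_iff, mem_inter_iff] at hs ⊢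
  obtain ⟨⟨h1, h2⟩, h3⟩ := hs
  rcases h3 with h3 | h3
  · linarith
  · rcases h2 with h2 | h2
    · exact ⟨⟨h2, h3.1⟩, h1, h3.2⟩
    · linarith

theorem lintegral_sq_window_le {T : ℝ} {α : ℝ → ℝ≥0∞} {β v : ℝ → ℝ → ℝ≥0∞}
    (hα : Measurable α) (hβ : Measurable fun z : ℝ × ℝ => β z.1 z.2)
    (hv : Measurable fun z : ℝ × ℝ => v z.1 z.2) {h : ℝ} {L : ℝ≥0∞}
    (hL : ∀ t y, ∫⁻ s in Ioc t (t + h), β s y ^ 2 ≤ L) :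
    ∫⁻ t, ∫⁻ y, (∫⁻ s in Ioc (clip T t) (clip T (t + h)), (α y + β s y) * v s y) ^ 2 ≤
      4 * ofReal h * (ofReal h * (∫⁻ s in Ioc 0 T, ∫⁻ y, α y ^ 2 * v s y ^ 2) +
        L * ∫⁻ s in Ioc 0 T, ∫⁻ y, v s y ^ 2) := by
  set W : ℝ → ℝ → ℝ≥0∞ := fun s y => (Ioc 0 T).indicator
    (fun s => ofReal h * (α y ^ 2 * v s y ^ 2) + L * v s y ^ 2) s
  have mW : Measurable fun z : ℝ × ℝ => W z.1 z.2 :=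
    Measurable.indicator (s := {z : ℝ × ℝ | z.1 ∈ Ioc 0 T}) (by fun_prop)
      (measurable_fst measurableSet_Ioc)
  have h1 : ∀ t y, (∫⁻ s in Ioc (clip T t) (clip T (t + h)), (α y + β s y) * v s y) ^ 2 ≤
      4 * ∫⁻ s in Ioc t (t + h), W s y := fun t y => by
    set I := Ioc (clip T t) (clip T (t + h))
    have hI := Ioc_clip_subset (T := T) t h
    have k1 : ∫⁻ s in I, α y ^ 2 * 1 ≤ ofReal h * α y ^ 2 := by
      rw [mul_one, setLIntegral_const, mul_comm]
      gcongr
      refine (measure_mono (hI.trans inter_subset_left)).trans ?_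
      simp
    calc _ = ((∫⁻ s in I, α y * v s y) + ∫⁻ s in I, β s y * v s y) ^ 2 := by
          simp_rw [add_mul]
          rw [lintegral_add_left (by fun_prop)]
      _ ≤ 4 * ((∫⁻ s in I, α y * v s y) ^ 2 + (∫⁻ s in I, β s y * v s y) ^ 2) := add_sq_le_four _ _
      _ ≤ 4 * ((∫⁻ s in I, α y ^ 2) * (∫⁻ s in I, v s y ^ 2) +
            (∫⁻ s in I, β s y ^ 2) * ∫⁻ s in I, v s y ^ 2) := by
          gcongr
          all_goals exact sq_lintegral_mul_le _ (by fun_prop) (by fun_prop)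
      _ ≤ 4 * (ofReal h * α y ^ 2 * (∫⁻ s in I, v s y ^ 2) + L * ∫⁻ s in I, v s y ^ 2) := by
          gcongr
          · simpa using k1
          · exact (lintegral_mono_set (hI.trans inter_subset_left)).trans (hL t y)
      _ = 4 * ∫⁻ s in I, (ofReal h * (α y ^ 2 * v s y ^ 2) + L * v s y ^ 2) := by
          simp_rw [← mul_assoc]
          rw [lintegral_add_left (by fun_prop), lintegral_const_mul _ (by fun_prop),
            lintegral_const_mul _ (by fun_prop)]
      _ ≤ 4 * ∫⁻ s in Ioc t (t + h), W s y := by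
          refine mul_le_mul_right ?_ 4
          rw [show (fun s => W s y) = (Ioc 0 T).indicator fun s => ofReal h *
            (α y ^ 2 * v s y ^ 2) + L * v s y ^ 2 from rfl, lintegral_indicator measurableSet_Ioc, Measure.restrict_restrict measurableSet_Ioc,
            inter_comm]
          exact lintegral_mono_set hI
  calc _ ≤ ∫⁻ t, 4 * ∫⁻ s in Ioc t (t + h), ∫⁻ y, W s y := by
        refine lintegral_mono fun t => (lintegral_mono fun y => h1 t y).trans (le_of_eq ?_)
        rw [lintegral_const_mul' _ _ (by simp), lintegral_lintegral_swap (by fun_prop)]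
    _ = 4 * (ofReal h * ∫⁻ s, ∫⁻ y, W s y) := by
        rw [lintegral_const_mul' _ _ (by simp), lintegral_window (by fun_prop)]
    _ = _ := by
        rw [mul_assoc]
        congr 2
        have : ∀ s, ∫⁻ y, W s y = (Ioc 0 T).indicator (fun s => ofReal h *
            (∫⁻ y, α y ^ 2 * v s y ^ 2) + L * ∫⁻ y, v s y ^ 2) s := fun s => by
          by_cases hs : s ∈ Ioc 0 T
          · simp only [W, indicator_of_mem hs]
            rw [lintegral_add_left (by fun_prop), lintegral_const_mul _ (by fun_prop),
              lintegral_const_mul _ (by fun_prop)]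
          · simp [W, indicator_of_notMem hs]
        simp_rw [this]
        rw [lintegral_indicator measurableSet_Ioc, lintegral_add_left (by fun_prop),
          lintegral_const_mul _ (by fun_prop), lintegral_const_mul _ (by fun_prop)]

variable {A B : 𝓛} {M T : ℝ} {q : ℝ → RealL2} {ψ : ℝ → SpinorL2}
  {N c : ℝ≥0∞} {Φ : ℝ → ℝ → ℝ≥0∞}

def moving (A : 𝓛) (ψ : ℝ → SpinorL2) (σ t : ℝ) : SpinorL2 :=
  shift (σ * t) ((half A σ).compLpL 2 volume (ψ t))

theorem moving_ae (A : 𝓛) (ψ : ℝ → SpinorL2) (σ t : ℝ) :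
    moving A ψ σ t =ᵐ[volume] fun y => comp A ψ σ t (y + σ * t) := by
  filter_upwards [shift_ae (σ * t) ((half A σ).compLpL 2 volume (ψ t)),
    ae_comp_add (compLpL_rep_ae (half A σ) ψ t) (σ * t)] with y h1 h2
  rw [moving, h1, ← h2]
  rfl

theorem continuous_moving (A : 𝓛) (hψ : Continuous ψ) (σ : ℝ) : Continuous (moving A ψ σ) :=
  continuous_shift ofNat_ne_top (by fun_prop) (by fun_prop)

theorem WeakDirac.ae_enorm_moving_sub_le (h : WeakDirac A B M T q ψ) (hD : DiracPair A B)
    (hb : TravelBound T (fun t x => M + q t x) Φ fun _ => c) {σ : ℝ} (hσ : σ = 1 ∨ σ = -1)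
    {t t' : ℝ} (ht : t ∈ Icc 0 T) (ht' : t' ∈ Icc 0 T) (htt : t ≤ t') : ∀ᵐ y,
    ‖(moving A ψ σ t' - moving A ψ σ t) y‖ₑ ≤ ∫⁻ s in Ioc t t',
      (Φ σ y + c + Φ (-σ) (y + 2 * σ * s)) * ‖comp A ψ (-σ) s (y + σ * s)‖ₑ := by
  filter_upwards [h.ae_pot_le hb hσ, h.integrableOn_source σ, h.duhamel hD hσ ht,
    h.duhamel hD hσ ht', moving_ae A ψ σ t, moving_ae A ψ σ t',
    coeFn_sub (moving A ψ σ t') (moving A ψ σ t)] with y h1 h2 h3 h4 h5 h6 h7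
  have e : Ioc 0 t' = Ioc 0 t ∪ Ioc t t' := (Ioc_union_Ioc_eq_Ioc ht.1 htt).symm
  have hs : Ioc t t' ⊆ Ioc 0 T := Ioc_subset_Ioc ht.1 ht'.2
  rw [h7, Pi.sub_apply, h5, h6, h3, h4, e, setIntegral_union (Ioc_disjoint_Ioc_of_le le_rfl)
    measurableSet_Ioc (h2.mono_set (Ioc_subset_Ioc_right ht.2)) (h2.mono_set hs),
    add_sub_add_left_eq_sub, add_sub_cancel_left]
  refine (enorm_integral_le_lintegral_enorm _).trans (lintegral_mono_ae ?_)
  filter_upwards [ae_restrict_of_ae_restrict_of_subset hs h1] with s h8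
  rw [enorm_source hD]
  gcongr
  rwa [add_right_comm]

theorem lintegral_Ioc_affine_le {f : ℝ → ℝ≥0∞} (hf : Measurable f) {σ : ℝ}
    (hσ : σ = 1 ∨ σ = -1) {h : ℝ} {L : ℝ≥0∞} (hL : ∀ z, ∫⁻ x in Icc z (z + 2 * h), f x ≤ L)
    (t y : ℝ) : ∫⁻ s in Ioc t (t + h), f (y + 2 * σ * s) ≤ L := by
  obtain ⟨z, hz⟩ : ∃ z, ∀ s ∈ Ioc t (t + h), y + 2 * σ * s ∈ Icc z (z + 2 * h) := by
    rcases hσ with rfl | rfl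
    · exact ⟨y + 2 * t, fun s hs => ⟨by linarith [hs.1], by linarith [hs.2]⟩⟩
    · exact ⟨y - 2 * (t + h), fun s hs => ⟨by linarith [hs.2], by linarith [hs.1]⟩⟩
  refine le_trans ?_ ((lintegral_comp_affine ((Icc z (z + 2 * h)).indicator f)
    (hf.indicator measurableSet_Icc) y hσ (Ioc t (t + h))).trans ?_)
  · exact setLIntegral_mono' measurableSet_Ioc fun s hs => by rw [indicator_of_mem (hz s hs)]
  · rw [lintegral_indicator measurableSet_Icc]
    exact hL z

theorem BoundedDirac.exists_lintegral_moving_sub_le (hb : BoundedDirac A B M T N c Φ q ψ)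
    (hD : DiracPair A B) (hN : N < ∞) (hT : 0 ≤ T) {C k : ℝ} (hC : 0 ≤ C) (hk : k ≤ 1)
    (hm : ∀ σ z h, 0 < h → ∫⁻ x in Icc z (z + h), Φ σ x ^ 2 ≤ ofReal (C * h ^ k))
    {σ : ℝ} (hσ : σ = 1 ∨ σ = -1) : ∃ C', 0 ≤ C' ∧ ∀ h ∈ Ioc (0 : ℝ) 1,
      ∫⁻ t, ‖moving A ψ σ (clip T (t + h)) - moving A ψ σ (clip T t)‖ₑ ^ 2 ≤
        ofReal (C' * h ^ (1 + k)) := by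
  have hc := hb.char hD
  set v : ℝ → ℝ → ℝ≥0∞ := fun s y => ‖comp A ψ (-σ) s (y + σ * s)‖ₑ with hv
  have mv : Measurable fun z : ℝ × ℝ => v z.1 z.2 :=
    (stronglyMeasurable_shear σ (stronglyMeasurable_comp A hb.cont (-σ))).enorm
  have mΦ := hc.meas_pot
  have tr : ∀ (f : ℝ → ℝ → ℝ≥0∞), (∫⁻ s in Ioc 0 T, ∫⁻ y, f s (y + σ * s)) =
      ∫⁻ s in Ioc 0 T, ∫⁻ x, f s x := fun f => by
    simp_rw [lintegral_add_right_eq_self]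
  set K₁ := ∫⁻ s in Ioc 0 T, ∫⁻ y, (Φ σ y + c) ^ 2 * v s y ^ 2
  set K₂ := ∫⁻ s in Ioc 0 T, ∫⁻ y, v s y ^ 2
  have hK₂ : K₂ < ∞ := by
    simp only [K₂, v]
    rw [tr fun s x => ‖comp A ψ (-σ) s x‖ₑ ^ 2]
    exact (hc.le _ (sign_neg hσ)).trans_lt hN
  have hK₁ : K₁ < ∞ := by
    have h1 := hc.lintegral_profile_mul_le (sign_neg hσ) (mΦ σ) (hb.pot_le σ)
    rw [← tr fun s x => Φ σ (x + -σ * s) ^ 2 * ‖comp A ψ (-σ) s x‖ₑ ^ 2] at h1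
    have h3 := profileConst_lt_top hN
    have h4 := hb.const_le.trans_lt hN
    calc K₁ ≤ ∫⁻ s in Ioc 0 T, ∫⁻ y, (4 * (Φ σ y ^ 2 * v s y ^ 2) + 4 * c ^ 2 * v s y ^ 2) := by
          refine lintegral_mono fun s => lintegral_mono fun y => ?_
          refine (mul_le_mul_left (add_sq_le_four _ _) _).trans_eq (by ring)
      _ = 4 * (∫⁻ s in Ioc 0 T, ∫⁻ y, Φ σ y ^ 2 * v s y ^ 2) + 4 * c ^ 2 * K₂ := by
          simp (discharger := fun_prop) only [lintegral_const_mul, lintegral_add_left]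
          rw [lintegral_add_left (by fun_prop), lintegral_const_mul _ (by fun_prop),
            lintegral_const_mul _ (by fun_prop)]
      _ < ∞ := by
          have h2 : (∫⁻ s in Ioc 0 T, ∫⁻ y, Φ σ y ^ 2 * v s y ^ 2) < ∞ := by
            convert h1.trans_lt (by finiteness) using 6
            ring_nf
          finiteness
  refine ⟨4 * (K₁.toReal + C * 2 ^ k * K₂.toReal), by positivity, fun h hh => ?_⟩
  have key := lintegral_sq_window_le (T := T) (α := fun y => Φ σ y + c)
    (β := fun s y => Φ (-σ) (y + 2 * σ * s)) (v := v)
    (by fun_prop) (by fun_prop) mv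
    (lintegral_Ioc_affine_le (by fun_prop) hσ fun z => hm (-σ) z (2 * h) (by linarith [hh.1]))
  refine (lintegral_mono fun t => ?_).trans (key.trans ?_)
  · rw [enorm_sq_lp]
    refine lintegral_mono_ae ?_
    have hcl : clip T t ≤ clip T (t + h) := by
      have := hh.1
      unfold clip
      gcongr
      linarith
    filter_upwards [hb.toWeakDirac.ae_enorm_moving_sub_le hD hb.bound hσ (clip_mem hT t)
      (clip_mem hT (t + h)) hcl] with y hy
    gcongr
  · have h0 := hh.1.le
    have hp := rpow_nonneg (mul_nonneg zero_le_two h0) k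
    have t1 := toReal_nonneg (a := K₁)
    have t2 := toReal_nonneg (a := K₂)
    have e : 4 * ofReal h * (ofReal h * K₁ + ofReal (C * (2 * h) ^ k) * K₂) =
        ofReal (4 * h * (h * K₁.toReal + C * (2 * h) ^ k * K₂.toReal)) := by
      rw [ofReal_mul (p := 4 * h) (by positivity), ofReal_mul (p := 4) (by norm_num),
        ofReal_add (by positivity) (by positivity), ofReal_mul h0,
        ofReal_mul (p := C * _) (by positivity), ofReal_toReal hK₁.ne,
        ofReal_toReal hK₂.ne, ofReal_ofNat]
    refine e.le.trans (ofReal_le_ofReal ?_)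
    have hk' : h ≤ h ^ k := by
      simpa using Real.rpow_le_rpow_of_exponent_ge hh.1 hh.2 hk
    rw [rpow_add hh.1, Real.rpow_one, mul_rpow zero_le_two h0]
    calc 4 * h * (h * K₁.toReal + C * (2 ^ k * h ^ k) * K₂.toReal)
        ≤ 4 * h * (h ^ k * K₁.toReal + C * (2 ^ k * h ^ k) * K₂.toReal) := by gcongr
      _ = _ := by ring

end Increments

section SpinorBourgain

variable {A B : 𝓛} {M m g k T : ℝ} {a₀ a₁ : ℝ → ℂ} {ψ : ℝ → SpinorL2}
  {φ : ℝ → RealL2} {φt : ℝ → 𝓢'(ℝ, ℂ)} {α β : Matrix (Fin 2) (Fin 2) ℂ} {σ : ℝ}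

theorem fourier_shift_compLpL_ae (L : 𝓛) (c : ℝ) (f : SpinorL2) :
    (𝓕 (shift c (L.compLpL 2 volume f)) : SpinorL2) =ᵐ[volume]
      fun ξ => (𝐞 (c * ξ) : ℂ) • L ((𝓕 f : SpinorL2) ξ) := by
  refine (sobRep_toTemperedDistribution _).ae_eq ⟨?_, fun h => ?_⟩
  · simp only [jap_zero, ofReal_one, one_smul]
    refine (L.comp_memLp' (memLp (𝓕 f : SpinorL2))).of_le (by fun_prop)
      (.of_forall fun ξ => ?_)
    rw [norm_smul, Circle.norm_coe, one_mul]
    rfl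
  · rw [← toTemperedDistribution_translate, toTemperedDistribution_compLp,
      (sobRep_toTemperedDistribution f).eq, ← L.integral_comp_comm
        ((sobRep_toTemperedDistribution f).integrable _)]
    refine integral_congr_ae (.of_forall fun ξ => ?_)
    simp only [fourierInv_translate, map_smul, smul_smul]
    rw [mul_comm]

theorem DiracPair.half_half_neg (hD : DiracPair A B) (hσ : σ = 1 ∨ σ = -1) (x : Spinor) :
    half A σ (half A (-σ) x) = 0 := by
  rw [half_apply A σ, hD.left_half (sign_neg hσ)]
  rcases hσ with rfl | rfl <;> simp

theorem projSymbol_eq_half (α : Matrix (Fin 2) (Fin 2) ℂ) (σ : ℝ) (f : ℝ → Spinor) (ξ : ℝ) :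
    projSymbol α σ f ξ = half (op α) (σ * SignType.sign ξ) (f ξ) := rfl

theorem norm_projMul_sub_le (hD : DiracPair (op α) B) (hσ : σ = 1 ∨ σ = -1) (f f' : SpinorL2) :
    ‖projMul α σ f - projMul α σ f'‖ ≤ ‖f - f'‖ := by
  refine Lp.norm_le_norm_of_ae_le ?_
  filter_upwards [coeFn_sub (projMul α σ f) (projMul α σ f'), coeFn_sub f f',
    (memLp_projSymbol α σ f).coeFn_toLp, (memLp_projSymbol α σ f').coeFn_toLp,
    Measure.ae_ne volume 0] with ξ h1 h2 h3 h4 h5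
  rw [h1, h2, Pi.sub_apply, Pi.sub_apply, projMul, projMul, h3, h4, projSymbol_eq_half,
    projSymbol_eq_half, ← map_sub]
  refine hD.norm_half_le ?_ _
  rcases hσ with rfl | rfl <;> rcases h5.lt_or_gt with h | h <;> simp [h]

def spinorCurve (α : Matrix (Fin 2) (Fin 2) ℂ) (σ : ℝ) (ψ : ℝ → SpinorL2) (t : ℝ) : SpinorL2 :=
  projMul α σ (𝓕 (moving (op α) ψ 1 t + moving (op α) ψ (-1) t))

theorem norm_spinorCurve_sub_le (hD : DiracPair (op α) B) (hσ : σ = 1 ∨ σ = -1) (t t' : ℝ) :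
    ‖spinorCurve α σ ψ t - spinorCurve α σ ψ t'‖ ≤ ‖moving (op α) ψ 1 t - moving (op α) ψ 1 t'‖ +
      ‖moving (op α) ψ (-1) t - moving (op α) ψ (-1) t'‖ := by
  refine (norm_projMul_sub_le hD hσ _ _).trans ?_
  refine le_trans (le_of_eq ?_) (norm_add_le _ _)
  have : ∀ f f' : SpinorL2, ‖(𝓕 f : SpinorL2) - 𝓕 f'‖ = ‖f - f'‖ := fun f f' => by
    have := (Lp.fourierTransformₗᵢ ℝ Spinor).norm_map (f - f')
    rwa [map_sub] at this
  rw [this, add_sub_add_comm]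

theorem spinorCurve_ae (hD : DiracPair (op α) B) (hσ : σ = 1 ∨ σ = -1) (t : ℝ) :
    spinorCurve α σ ψ t =ᵐ[volume] fun ξ => (𝐞 (t * (σ * |ξ|)) : ℂ) •
      projSymbol α σ (𝓕 (ψ t) : SpinorL2) ξ := by
  have e : (𝓕 (moving (op α) ψ 1 t + moving (op α) ψ (-1) t) : SpinorL2) =
      𝓕 (moving (op α) ψ 1 t) + 𝓕 (moving (op α) ψ (-1) t) :=
    (Lp.fourierTransformₗᵢ ℝ Spinor).map_add _ _
  filter_upwards [(memLp_projSymbol α σ (𝓕 (moving (op α) ψ 1 t +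
    moving (op α) ψ (-1) t))).coeFn_toLp, coeFn_add (𝓕 (moving (op α) ψ 1 t) : SpinorL2)
    (𝓕 (moving (op α) ψ (-1) t)), fourier_shift_compLpL_ae (half (op α) 1) (1 * t) (ψ t),
    fourier_shift_compLpL_ae (half (op α) (-1)) (-1 * t) (ψ t), Measure.ae_ne volume 0]
    with ξ h1 h2 h3 h4 h5
  rw [spinorCurve, projMul, h1, projSymbol_eq_half, projSymbol_eq_half, e, h2, Pi.add_apply,
    moving, moving, h3, h4, map_add, map_smul, map_smul]
  have k1 := hD.half_half (Or.inl rfl) ((𝓕 (ψ t) : SpinorL2) ξ)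
  have k2 := hD.half_half (Or.inr rfl) ((𝓕 (ψ t) : SpinorL2) ξ)
  have k3 := hD.half_half_neg (Or.inl rfl) ((𝓕 (ψ t) : SpinorL2) ξ)
  have k4 := hD.half_half_neg (Or.inr rfl) ((𝓕 (ψ t) : SpinorL2) ξ)
  rw [neg_neg] at k4
  rcases hσ with rfl | rfl <;> rcases h5.lt_or_gt with h | h <;>
    simp [h, abs_of_neg, abs_of_pos, k1, k2, k3, k4]

theorem WeakDKG.memBourgainOn_spinor (h : WeakDKG (op α) B M m g k T a₀ a₁ ψ φ φt)
    (hD : DiracPair (op α) B) (hk0 : 0 ≤ k) (hk : k < 1 / 2) (hT : 0 ≤ T) {φ₀ : RealL2}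
    {φ₁ : 𝓢'(ℝ, ℂ)} (h₀ : SobRep k (realDist φ₀) a₀) (h₁ : SobRep (k - 1) φ₁ a₁)
    (hr : IsReal φ₁) (hσ : σ = 1 ∨ σ = -1) {ε : ℝ} (hε : 0 < ε) (hεk : ε < k / 2) :
    MemBourgainOn 0 (1 / 2 + ε) σ T fun t => spinorDist (proj α σ (ψ t)) := by
  obtain ⟨p, N, c, C, hN, hb, hC, hm⟩ := h.exists_boundedDirac hD hk0 hk hT h₀ h₁ hr
  obtain ⟨C₁, hC₁, i₁⟩ := hb.exists_lintegral_moving_sub_le hD hN hT hC (by linarith) hm (Or.inl rfl)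
  obtain ⟨C₂, hC₂, i₂⟩ := hb.exists_lintegral_moving_sub_le hD hN hT hC (by linarith) hm (Or.inr rfl)
  have cm := continuous_moving (op α) h.dirac.cont
  refine memBourgainOn_of_curve (Z := spinorCurve α σ ψ) (b' := 1 / 2 + k / 2)
    (C := 4 * (C₁ + C₂)) (continuous_iff_continuousAt.2 fun t => ?_) hT le_rfl (by linarith)
    (by linarith) (by linarith) (by positivity) (fun r hr => ?_) fun t ht h => ?_
  · refine tendsto_iff_norm_sub_tendsto_zero.2 (squeeze_zero (fun _ => norm_nonneg _)
      (fun s => norm_spinorCurve_sub_le hD hσ s t) ?_)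
    have := (((cm 1).sub continuous_const).norm.add ((cm (-1)).sub continuous_const).norm).tendsto'
      (f := fun s => ‖moving (op α) ψ 1 s - moving (op α) ψ 1 t‖ +
      ‖moving (op α) ψ (-1) s - moving (op α) ψ (-1) t‖) t 0 (by simp)
    exact this
  · have hm1 : Measurable fun t => ‖moving (op α) ψ 1 (DKG.clip T (t + r)) -
        moving (op α) ψ 1 (DKG.clip T t)‖ₑ ^ 2 := by
      have := DKG.continuous_clip T
      have := cm 1
      exact (Continuous.enorm (by fun_prop)).measurable.pow_const 2
    calc _ ≤ ∫⁻ t, 4 * (‖moving (op α) ψ 1 (DKG.clip T (t + r)) - moving (op α) ψ 1 (DKG.clip T t)‖ₑ ^ 2 +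
          ‖moving (op α) ψ (-1) (DKG.clip T (t + r)) - moving (op α) ψ (-1) (DKG.clip T t)‖ₑ ^ 2) := by
          refine lintegral_mono fun t => le_trans ?_ (add_sq_le_four _ _)
          gcongr
          simp only [← ofReal_norm]
          rw [← ofReal_add (norm_nonneg _) (norm_nonneg _)]
          exact ofReal_le_ofReal (norm_spinorCurve_sub_le hD hσ _ _)
      _ ≤ 4 * (ofReal (C₁ * r ^ (1 + k)) + ofReal (C₂ * r ^ (1 + k))) := by
          rw [lintegral_const_mul' _ _ (by simp), lintegral_add_left hm1]
          gcongr
          · exact i₁ r hr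
          · exact i₂ r hr
      _ = _ := by
          have := rpow_nonneg hr.1.le (1 + k)
          rw [← ofReal_add (by positivity) (by positivity), ← ofReal_ofNat,
            ← ofReal_mul (by norm_num)]
          congr 1
          rw [show 2 * (1 / 2 + k / 2) = 1 + k by ring]
          ring
  · have e := (sobRep_fourierInv (memLp_projSymbol α σ (𝓕 (ψ t)))).eq h
    refine e.trans (integral_congr_ae ?_)
    filter_upwards [spinorCurve_ae (ψ := ψ) hD hσ t] with ξ hξ
    have e2 : (𝐞 (-(t * (σ * |ξ|))) : ℂ) * 𝐞 (t * (σ * |ξ|)) = 1 := by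
      rw [← Circle.coe_mul, ← AddChar.map_add_eq_mul]
      simp
    rw [hξ, neg_zero, jap_zero, ofReal_one, one_mul, smul_smul _ _ (projSymbol _ _ _ _), e2,
      one_smul]

end SpinorBourgain

section WaveBourgain

variable {m k T B σ : ℝ} {a₀ a₁ : ℝ → ℂ} {s : ℝ → ℝ → ℂ}

def waveCurve (m k σ : ℝ) (a₀ a₁ : ℝ → ℂ) (s : ℝ → ℝ → ℂ) (t ξ : ℝ) : ℂ :=
  (jap k (2 * π * ξ) : ℂ) * ((𝐞 (t * (σ * |ξ|)) : ℂ) * (kgW m a₀ a₁ s t ξ +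
      σ * I * ((jap (-1) (2 * π * ξ) : ℂ) * kgWt m a₀ a₁ s t ξ)))

def waveMajorant (m k B : ℝ) (a₀ a₁ : ℝ → ℂ) (T ξ : ℝ) : ℝ :=
  (1 + m ^ 2) * kgMajorant k B a₀ a₁ T ξ + kgMajorantT m k B a₀ a₁ T ξ + jap (k - 1) ξ * B

theorem KGData.memLp_waveMajorant (hd : KGData k B a₀ a₁ s) (m T : ℝ) :
    MemLp (waveMajorant m k B a₀ a₁ T) 2 volume :=
  (((hd.memLp_majorant T).const_mul _).add (hd.memLp_majorantT m T)).add
    ((memLp_jap (by linarith [hd.lt])).mul_const B)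

theorem sq_le_two_pi_mul_sq (ξ : ℝ) : ξ ^ 2 ≤ (2 * π * ξ) ^ 2 := by
  rw [mul_pow]
  exact le_mul_of_one_le_left (sq_nonneg ξ) (by nlinarith [pi_gt_three])

theorem jap_two_pi_le {r : ℝ} (hr : r ≤ 0) (ξ : ℝ) : jap r (2 * π * ξ) ≤ jap r ξ :=
  Real.rpow_le_rpow_of_nonpos (by positivity) (by linarith [sq_le_two_pi_mul_sq ξ]) (by linarith)

theorem jap_two_pi_le_mul {r : ℝ} (hr : 0 ≤ r) (ξ : ℝ) :
    jap r (2 * π * ξ) ≤ 49 ^ (r / 2) * jap r ξ := by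
  rw [jap, jap, ← mul_rpow (by norm_num) (by positivity)]
  gcongr
  nlinarith [Real.pi_lt_d2, pi_gt_three, sq_nonneg ξ, mul_le_mul_of_nonneg_right
    (by nlinarith [Real.pi_lt_d2, pi_gt_three] : (2 * π) ^ 2 ≤ 49) (sq_nonneg ξ)]

theorem KGData.exists_hasDerivAt_waveCurve (hd : KGData k B a₀ a₁ s) (hσ : σ = 1 ∨ σ = -1) {t : ℝ}
    (ht : |t| ≤ T) (ξ : ℝ) : ∃ d, HasDerivAt (fun t => waveCurve m k σ a₀ a₁ s t ξ) d t ∧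
      ‖d‖ ≤ waveMajorant m k B a₀ a₁ T ξ := by
  have h1 : HasDerivAt (fun t : ℝ => (𝐞 (t * (σ * |ξ|)) : ℂ))
      (2 * π * I * 𝐞 (t * (σ * |ξ|)) * ((σ * |ξ| : ℝ) : ℂ)) t := by
    have h2 := HasDerivAt.scomp (g₁ := fun x : ℝ => (𝐞 x : ℂ)) t
      (Real.hasDerivAt_fourierChar (t * (σ * |ξ|))) ((hasDerivAt_id t).mul_const (σ * |ξ|))
    refine h2.congr_deriv ?_
    rw [Complex.real_smul, one_mul, mul_comm]
  refine ⟨_, (h1.fun_mul ((hasDerivAt_kgW hd.cont t ξ).fun_add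
    (((hasDerivAt_kgWt hd.cont t ξ).const_mul _).const_mul _))).const_mul _, ?_⟩
  set W := kgW m a₀ a₁ s t ξ
  set V := kgWt m a₀ a₁ s t ξ
  set η := 2 * π * ξ with hη
  set r := jap (-1) η
  have hr : 0 < r := jap_pos _ _
  have hr2 : r ^ 2 * (1 + η ^ 2) = 1 := by
    rw [← jap_two, sq, jap_mul, jap_mul]
    norm_num [jap_zero]
  have hηr : |η| * r ≤ 1 := by
    rw [← sq_le_one_iff₀ (by positivity), mul_pow, sq_abs]
    nlinarith
  have e : (2 * π * |ξ| : ℝ) = |η| := by rw [hη, abs_mul, abs_of_pos (by positivity : 0 < 2 * π)]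
  have hσ2 : (σ : ℂ) * σ = 1 := by rcases hσ with rfl | rfl <;> simp
  have ed : ∀ (J E : ℂ), J * (2 * π * I * E * ((σ * |ξ| : ℝ) : ℂ) *
      (W + σ * I * ((r : ℂ) * V)) + E * (V + σ * I * ((r : ℂ) *
        (-((freq m ξ ^ 2 : ℝ) : ℂ) * W + s t ξ)))) =
      J * (E * (I * σ * ((|η| - (m ^ 2 + η ^ 2) * r : ℝ) : ℂ) * W +
        ((1 - |η| * r : ℝ) : ℂ) * V + σ * I * ((r : ℂ) * s t ξ))) := fun J E => by
    rw [freq_sq, ← hη, ← e]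
    push_cast
    linear_combination J * E * (2 * π * ((|ξ| : ℝ) : ℂ) * r * V) * (I ^ 2 * hσ2 + I_sq)
  rw [ed, norm_mul, norm_mul, Circle.norm_coe, one_mul, norm_real, norm_of_nonneg (jap_pos _ _).le]
  have hσn : ‖(σ : ℂ)‖ = 1 := by rcases hσ with rfl | rfl <;> simp
  have ha : |(|η| - (m ^ 2 + η ^ 2) * r)| ≤ (1 + m ^ 2) * r := by
    have h5 : η ^ 2 * r ≤ |η| := by
      rw [← sq_abs]
      nlinarith [abs_nonneg η]
    have h6 : |η| ≤ r * (1 + η ^ 2) := by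
      by_contra! h7
      nlinarith [mul_lt_mul_of_pos_right h7 hr]
    rw [abs_le]
    constructor <;> nlinarith [sq_nonneg m]
  have hb : |1 - |η| * r| ≤ r := by
    have h0 : 0 ≤ |η| * r := by positivity
    have hr1 : r ≤ 1 := by rw [← jap_zero η]; exact jap_mono (by norm_num) η
    rw [abs_of_nonneg (by linarith)]
    nlinarith [sq_abs η]
  have hn : ‖I * σ * ((|η| - (m ^ 2 + η ^ 2) * r : ℝ) : ℂ) * W +
        ((1 - |η| * r : ℝ) : ℂ) * V + σ * I * ((r : ℂ) * s t ξ)‖ ≤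
      (1 + m ^ 2) * r * ‖W‖ + r * ‖V‖ + r * B := by
    refine (norm_add₃_le).trans ?_
    simp only [norm_mul, norm_I, hσn, one_mul, norm_real, norm_eq_abs, abs_of_pos hr]
    gcongr
    exact hd.bound t ξ
  have hJ : jap k η * r ≤ jap (k - 1) ξ := by
    rw [jap_sub_one]
    exact jap_two_pi_le (by linarith [hd.lt]) ξ
  have hW := hd.norm_kgW_le (m := m) ht ξ
  have hV := hd.norm_kgWt_le (m := m) ht ξ
  rw [norm_jap_smul] at hW hV
  have hk1 := jap_mono (by linarith : k - 1 ≤ k) ξ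
  have hB := hd.nonneg
  calc _ ≤ jap k η * ((1 + m ^ 2) * r * ‖W‖ + r * ‖V‖ + r * B) := by
        gcongr
        exact (jap_pos _ _).le
    _ = (1 + m ^ 2) * ((jap k η * r) * ‖W‖) + (jap k η * r) * ‖V‖ + (jap k η * r) * B := by ring
    _ ≤ (1 + m ^ 2) * (jap k ξ * ‖W‖) + jap (k - 1) ξ * ‖V‖ + jap (k - 1) ξ * B := by
        gcongr
        exact hJ.trans hk1
    _ ≤ _ := by
        unfold waveMajorant
        gcongr

theorem KGData.norm_waveCurve_sub_le (hd : KGData k B a₀ a₁ s) (hσ : σ = 1 ∨ σ = -1) {t t' : ℝ}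
    (ht : t ∈ Icc 0 T) (ht' : t' ∈ Icc 0 T) (ξ : ℝ) :
    ‖waveCurve m k σ a₀ a₁ s t' ξ - waveCurve m k σ a₀ a₁ s t ξ‖ ≤
      waveMajorant m k B a₀ a₁ T ξ * |t' - t| := by
  have h1 : ∀ t, ∃ d, t ∈ Icc 0 T → HasDerivAt (fun t => waveCurve m k σ a₀ a₁ s t ξ) d t ∧
      ‖d‖ ≤ waveMajorant m k B a₀ a₁ T ξ := fun t => by
    by_cases ht : t ∈ Icc 0 T
    · obtain ⟨d, hd⟩ := hd.exists_hasDerivAt_waveCurve (m := m) hσ (T := T)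
        (by rw [abs_of_nonneg ht.1]; exact ht.2) ξ
      exact ⟨d, fun _ => hd⟩
    · exact ⟨0, fun h => absurd h ht⟩
  choose d hd' using h1
  exact (convex_Icc 0 T).norm_image_sub_le_of_norm_hasDerivWithin_le
    (fun t ht => (hd' t ht).1.hasDerivWithinAt) (fun t ht => (hd' t ht).2) ht ht'

theorem KGData.memLp_waveCurve (hd : KGData k B a₀ a₁ s) (hk : 0 ≤ k) (m : ℝ)
    (hσ : σ = 1 ∨ σ = -1) (t : ℝ) : MemLp (waveCurve m k σ a₀ a₁ s t) 2 volume := by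
  have c : ∀ r, Continuous fun ξ : ℝ => (jap r (2 * π * ξ) : ℂ) := fun r =>
    continuous_ofReal.comp ((continuous_jap r).comp (by fun_prop))
  have cE : Continuous fun ξ : ℝ => (𝐞 (t * (σ * |ξ|)) : ℂ) :=
    (by fun_prop)
  refine ((((hd.memLp_kgW m t).norm.const_mul (49 ^ (k / 2))).add (hd.memLp_kgWt m t).norm).mono'
    ((c k).aestronglyMeasurable.mul (cE.aestronglyMeasurable.mul
      ((hd.aestronglyMeasurable_kgW m t).add (((c (-1)).aestronglyMeasurable.mul
        (hd.aestronglyMeasurable_kgWt m t)).const_mul _)))) (.of_forall fun ξ => ?_))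
  have hσn : ‖(σ : ℂ)‖ = 1 := by rcases hσ with rfl | rfl <;> simp
  have hj := jap_pos k (2 * π * ξ)
  simp only [waveCurve, norm_mul, Circle.norm_coe, one_mul, norm_real, Pi.add_apply,
    norm_of_nonneg (jap_pos _ _).le, norm_jap_smul]
  calc _ ≤ jap k (2 * π * ξ) * (‖kgW m a₀ a₁ s t ξ‖ +
        jap (-1) (2 * π * ξ) * ‖kgWt m a₀ a₁ s t ξ‖) := by
        gcongr
        refine (norm_add_le _ _).trans (le_of_eq ?_)
        rw [norm_mul, norm_mul, norm_mul, hσn, norm_I, norm_real,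
          norm_of_nonneg (jap_pos _ _).le, one_mul, one_mul]
    _ = jap k (2 * π * ξ) * ‖kgW m a₀ a₁ s t ξ‖ +
        jap (k - 1) (2 * π * ξ) * ‖kgWt m a₀ a₁ s t ξ‖ := by
        rw [← jap_sub_one]
        ring
    _ ≤ 49 ^ (k / 2) * jap k ξ * ‖kgW m a₀ a₁ s t ξ‖ + jap (k - 1) ξ * ‖kgWt m a₀ a₁ s t ξ‖ := by
        gcongr
        · exact jap_two_pi_le_mul hk ξ
        · exact jap_two_pi_le (by linarith [hd.lt]) ξ
    _ = _ := by ring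

theorem sobRep_invSqrtA {u : 𝓢'(ℝ, ℂ)} {a : ℝ → ℂ} {r : ℝ} (hu : SobRep r u a) (h : 𝓢(ℝ, ℂ)) :
    invSqrtA u h = ∫ ξ, (𝓕⁻ h) ξ * ((jap (-1) (2 * π * ξ) : ℂ) * a ξ) := by
  have hg : (fun ξ : ℝ => (((1 + (2 * π * ξ) ^ 2) ^ (-(1 / 2) : ℝ) : ℝ) : ℂ)) =
      (fun ξ => (jap (-1) ξ : ℂ)) ∘ fun ξ => 2 * π * ξ := by
    funext ξ
    simp only [jap, Function.comp_apply]
    norm_num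
  have hg' : (fun ξ : ℝ => (((1 + (2 * π * ξ) ^ 2) ^ (-(1 / 2) : ℝ) : ℝ) : ℂ)).HasTemperateGrowth := by
    rw [hg]
    exact (hasTemperateGrowth_jap (-1)).comp (by fun_prop)
  rw [invSqrtA, fourierMultiplierCLM_apply_apply, hu.eq, FourierTransform.fourierInv_fourier_eq]
  refine integral_congr_ae (.of_forall fun ξ => ?_)
  simp only [SchwartzMap.smulLeftCLM_apply_apply hg', congrFun hg ξ, Function.comp_apply, smul_eq_mul]
  ring

theorem WaveRep.memBourgainOn {S : ℝ → Lp ℂ 1 vol} {φ : ℝ → RealL2}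
    {φt : ℝ → 𝓢'(ℝ, ℂ)} (hφ : WaveRep m k T a₀ a₁ S φ φt)
    (hd : KGData k B a₀ a₁ (ℱ S)) (hk : 0 ≤ k) (hT : 0 ≤ T)
    (hσ : σ = 1 ∨ σ = -1) {b : ℝ} (hb : 0 < b) (hb1 : b < 1) :
    MemBourgainOn k b σ T fun t => halfWave σ (φ t) (φt t) := by
  have hL := hd.memLp_waveCurve hk m hσ
  set Z : ℝ → Lp ℂ 2 vol := fun t => (hL (clip T t)).toLp _
  set L := ‖(hd.memLp_waveMajorant m T).toLp _‖
  have hcl : ∀ r t, |clip T r - clip T t| ≤ |r - t| := fun r t => by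
    unfold clip
    exact (abs_max_sub_max_le_max _ _ _ _).trans (by
      rw [sub_self, abs_zero]
      exact max_le (abs_nonneg _) ((abs_min_sub_min_le_max _ _ _ _).trans (by simp)))
  have hlip : ∀ r t, ‖Z r - Z t‖ ≤ L * |clip T r - clip T t| := fun r t => by
    rw [mul_comm]
    refine Lp.norm_le_mul_norm_of_ae_le_mul ?_
    filter_upwards [coeFn_sub (Z r) (Z t), (hL (clip T r)).coeFn_toLp,
      (hL (clip T t)).coeFn_toLp, (hd.memLp_waveMajorant m T).coeFn_toLp] with ξ h1 h2 h3 h4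
    rw [h1, Pi.sub_apply, h2, h3, h4, mul_comm]
    refine (hd.norm_waveCurve_sub_le hσ (clip_mem hT t) (clip_mem hT r) ξ).trans ?_
    gcongr
    exact le_abs_self _
  have hZ : Continuous Z := (LipschitzWith.of_dist_le_mul (K := ⟨L, norm_nonneg _⟩) fun r t => by
    rw [dist_eq_norm, dist_eq]
    exact (hlip r t).trans (mul_le_mul_of_nonneg_left (hcl r t) (norm_nonneg _))).continuous
  refine memBourgainOn_of_curve (Z := Z) (b' := 1) (C := L ^ 2 * (T + 1)) hZ hT hk hb hb1 le_rfl
    (by positivity) (fun r hr => ?_) fun t ht h => ?_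
  · have h1 : ∀ t, ‖Z (clip T (t + r)) - Z (clip T t)‖ₑ ^ 2 ≤
        (Icc (-1) T).indicator (fun _ => ofReal (L ^ 2 * r ^ 2)) t := fun t => by
      have e : ∀ t, Z (clip T t) = Z t := fun t => by simp only [Z, clip_of_mem (clip_mem hT t)]
      rw [e, e]
      by_cases h2 : t ∈ Icc (-1) T
      · rw [indicator_of_mem h2, ← mul_pow, ofReal_pow (mul_nonneg (norm_nonneg _) hr.1.le),
          ← ofReal_norm]
        gcongr
        refine (hlip _ _).trans ?_
        gcongr
        refine (hcl _ _).trans ?_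
        rw [add_sub_cancel_left, abs_of_pos hr.1]
      · have h3 : clip T (t + r) = clip T t := by
          simp only [mem_Icc, not_and_or, not_le] at h2
          unfold clip
          rcases h2 with h2 | h2
          · rw [min_eq_left, min_eq_left, max_eq_left, max_eq_left] <;> linarith [hr.1, hr.2]
          · rw [min_eq_right, min_eq_right] <;> linarith [hr.1, hr.2]
        simp only [Z, h3, sub_self]
        simp
    refine (lintegral_mono h1).trans (le_of_eq ?_)
    rw [lintegral_indicator measurableSet_Icc, setLIntegral_const, volume_Icc,
      ← ofReal_mul (by positivity)]
    congr 1
    norm_num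
    ring
  · have i1 := (hφ.rep t ht).integrable (𝓕⁻ h)
    have i2 : Integrable fun ξ => (𝓕⁻ h) ξ * ((jap (-1) (2 * π * ξ) : ℂ) *
        kgWt m a₀ a₁ (ℱ S) t ξ) := by
      refine ((hφ.rep_deriv t ht).integrable (𝓕⁻ h)).mono ?_ (.of_forall fun ξ => ?_)
      · exact (𝓕⁻ h).continuous.aestronglyMeasurable.mul ((continuous_ofReal.comp
          ((continuous_jap _).comp (by fun_prop))).aestronglyMeasurable.mul
            (hd.aestronglyMeasurable_kgWt m t))
      · rw [smul_eq_mul, norm_mul, norm_mul, norm_mul, norm_real, norm_of_nonneg (jap_pos _ _).le]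
        gcongr
        exact mul_le_of_le_one_left (norm_nonneg _)
          ((jap_mono (by norm_num) _).trans_eq (jap_zero _))
    rw [halfWave, add_apply, smul_apply, (hφ.rep t ht).eq,
      sobRep_invSqrtA (hφ.rep_deriv t ht), smul_eq_mul, ← integral_const_mul,
      ← integral_add i1 (i2.const_mul _)]
    apply integral_congr_ae
    have hZt := (hL (clip T t)).coeFn_toLp
    rw [clip_of_mem ht] at hZt
    filter_upwards [hZt] with ξ hξ
    have e1 : Z t ξ = waveCurve m k σ a₀ a₁ (ℱ S) t ξ := by
      simp only [Z, clip_of_mem ht]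
      exact hξ
    have e2 : (𝐞 (-(t * (σ * |ξ|))) : ℂ) * 𝐞 (t * (σ * |ξ|)) = 1 := by
      rw [← Circle.coe_mul, ← AddChar.map_add_eq_mul]
      simp
    have e3 : (jap (-k) (2 * π * ξ) : ℂ) * (jap k (2 * π * ξ) : ℂ) = 1 := by
      rw [← Complex.ofReal_mul, jap_neg_mul, ofReal_one]
    rw [e1, waveCurve, smul_eq_mul, smul_eq_mul, smul_eq_mul]
    set X := kgW m a₀ a₁ (ℱ S) t ξ
    set Y := kgWt m a₀ a₁ (ℱ S) t ξ
    linear_combination (-(𝓕⁻ h) ξ * (X + σ * I *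
      ((jap (-1) (2 * π * ξ) : ℂ) * Y))) * ((jap (-k) (2 * π * ξ) : ℂ) * (jap k (2 * π * ξ) : ℂ) * e2 + e3)

end WaveBourgain

section Solutions

variable {α β : Matrix (Fin 2) (Fin 2) ℂ} {M m g k T ε : ℝ} {a₀ a₁ : ℝ → ℂ} {ψ₀ : SpinorL2}
  {φ₀ : RealL2} {φ₁ : 𝓢'(ℝ, ℂ)} {ψ ψ' : ℝ → SpinorL2} {φ φ' : ℝ → RealL2} {φt φt' : ℝ → 𝓢'(ℝ, ℂ)}

theorem op_mul_apply (α β : Matrix (Fin 2) (Fin 2) ℂ) (x : Spinor) :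
    op (α * β) x = op α (op β x) := by
  rw [op, op, op, map_mul]
  rfl

theorem toTemperedDistribution_smulL1_smul (g : ℝ) (q : RealL2) (f : SpinorL2) (h : 𝓢(ℝ, ℂ)) :
    toTemperedDistribution (smulL1 ((-g) • q) f) h = -((g : ℂ) • ∫ x, h x • ((q x : ℂ) • f x)) := by
  rw [toTemperedDistribution_apply, ← integral_smul, ← integral_neg]
  apply integral_congr_ae
  filter_upwards [smulL1_ae ((-g) • q) f, coeFn_smul (-g) q] with x h1 h2
  rw [h1, h2, Pi.smul_apply, smul_eq_mul]
  push_cast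
  module

theorem integral_mul_density (B : 𝓛) (f : SpinorL2) (h : 𝓢(ℝ, ℂ)) :
    ∫ x, h x * density B f x = ∫ x, h x * inner ℂ (B (f x)) (f x) := by
  exact integral_congr_ae ((density_ae B f).mono fun x hx => by simp only [hx])

theorem dirac_iff (hD : DiracPair (op α) (op β)) (d x y z : Spinor) :
    -I • op β d + I • op (α * β) (-x) + (M : ℂ) • y = z ↔
      d = op α x - (I * M) • op β y - I • op β (-z) := by
  have h1 : op β (op α (op β x)) = -op α x := by
    rw [hD.anticomm, map_neg, hD.sq_right]
  have h2 : op β (op α x) = -op α (op β x) := by rw [hD.anticomm, neg_neg]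
  rw [op_mul_apply]
  constructor
  · rintro rfl
    simp only [map_add, map_smul, map_neg, hD.sq_right, h1]
    linear_combination (norm := module) I_mul_I • (d - op α x)
  · rintro rfl
    simp only [map_sub, map_smul, map_neg, hD.sq_right, h2]
    linear_combination (norm := module) I_mul_I • ((M : ℂ) • y - z)

theorem WeakDKG.isSolution (h : WeakDKG (op α) (op β) M m g k T a₀ a₁ ψ φ φt)
    (hD : DiracPair (op α) (op β)) (hk0 : 0 ≤ k) (hk : k < 1 / 2) (hT : 0 ≤ T)
    (h₀ : SobRep k (realDist φ₀) a₀) (h₁ : SobRep (k - 1) φ₁ a₁) (hr : IsReal φ₁) (hε : 0 < ε)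
    (hεk : ε < k / 2) : IsSolution α β M m g k ε (ψ 0) φ₀ φ₁ T ψ φ φt := by
  obtain ⟨R, hR⟩ := h.exists_mem_fieldBall hT
  have hd := kgData_of_source hk h₀ h₁ ((continuous_density hD.norm_right).comp h.dirac.cont)
    (norm_density_le_sq hD ⟨h.dirac.cont, hR⟩)
  have hS := fun σ => h.memBourgainOn_spinor (σ := σ) hD hk0 hk hT h₀ h₁ hr
  have hW := fun σ => h.wave.memBourgainOn (σ := σ) hd hk0 hT
  refine ⟨h.dirac.cont.continuousOn, (h.wave.sobolevContinuousOn hd hT).1,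
    (h.wave.sobolevContinuousOn hd hT).2, rfl, (h.wave.initial hT h₀ h₁).1,
    (h.wave.initial hT h₀ h₁).2, fun f t ht => ?_,
    fun f t ht => h.wave.hasDerivWithinAt hd f ht,
    fun f t ht => ⟨_, h.wave.hasDerivWithinAt_deriv hd f ht, ?_⟩, hS _ (.inl rfl) hε hεk,
    hS _ (.inr rfl) hε hεk, hW _ (.inl rfl) (by linarith) (by linarith),
    hW _ (.inr rfl) (by linarith) (by linarith)⟩
  · have e := h.dirac.eq f t ht
    rw [toTemperedDistribution_smulL1_smul] at e
    refine ⟨_, e, ?_⟩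
    rw [TemperedDistribution.derivCLM_apply_apply, map_neg (spinorDist (ψ t))]
    exact (dirac_iff hD _ _ _ _).2 rfl
  · simp only [TemperedDistribution.derivCLM_apply_apply, map_neg, neg_neg, integral_mul_density]
    ring

theorem SobolevContinuousOn.continuousOn (hk : 0 ≤ k) {S : Set ℝ}
    (h : SobolevContinuousOn k (fun t => realDist (φ t)) S) :
    ContinuousOn (fun t => ofRealCLM.compLp (φ t)) S := by
  obtain ⟨G, hG, hGφ⟩ := h
  set c : ℝ → Lp ℂ 2 vol := fun t => ofRealCLM.compLp (φ t)
  have e : ∀ f f' : Lp ℂ 2 vol, ‖(𝓕 f : Lp ℂ 2 vol) - 𝓕 f'‖ = ‖f - f'‖ := fun f f' => by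
    have := (Lp.fourierTransformₗᵢ ℝ ℂ).norm_map (f - f')
    rwa [map_sub] at this
  have h1 : ∀ t ∈ S, (𝓕 (G t) : Lp ℂ 2 vol) =ᵐ[volume]
      fun ξ => (jap k ξ : ℂ) • (𝓕 (c t) : Lp ℂ 2 vol) ξ := fun t ht => by
    have h2 := (sobRep_toTemperedDistribution (c t)).besselPotential k
    rw [show besselPotential ℝ ℂ k (toTemperedDistribution (c t)) = _ from hGφ t ht] at h2
    exact ((sobRep_toTemperedDistribution (G t)).mono (by linarith)).ae_eq h2
  have h2 : ∀ t ∈ S, ∀ t' ∈ S, ‖c t - c t'‖ ≤ ‖G t - G t'‖ := fun t ht t' ht' => by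
    rw [← e, ← e (G t)]
    refine Lp.norm_le_norm_of_ae_le ?_
    filter_upwards [coeFn_sub (𝓕 (c t) : Lp ℂ 2 vol) (𝓕 (c t')),
      coeFn_sub (𝓕 (G t) : Lp ℂ 2 vol) (𝓕 (G t')), h1 t ht, h1 t' ht']
      with ξ h3 h4 h5 h6
    rw [h3, h4, Pi.sub_apply, Pi.sub_apply, h5, h6, ← smul_sub, norm_jap_smul]
    exact le_mul_of_one_le_left (norm_nonneg _) (one_le_jap hk ξ)
  refine fun t ht => tendsto_iff_norm_sub_tendsto_zero.2 (squeeze_zero'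
    (.of_forall fun _ => norm_nonneg _) ?_ (tendsto_iff_norm_sub_tendsto_zero.1 (hG t ht)))
  filter_upwards [self_mem_nhdsWithin] with s hs using h2 s hs t ht

theorem IsSolution.exists_weakDKG (h : IsSolution α β M m g k ε ψ₀ φ₀ φ₁ T ψ φ φt)
    (hD : DiracPair (op α) (op β)) (hk0 : 0 ≤ k) (hk : k < 1 / 2) (hT : 0 < T)
    (h₀ : SobRep k (realDist φ₀) a₀) (h₁ : SobRep (k - 1) φ₁ a₁) (hr : IsReal φ₁) :
    ∃ Φ Φt, WeakDKG (op α) (op β) M m g k T a₀ a₁ (fun t => ψ (DKG.clip T t)) Φ Φt ∧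
      ∀ t ∈ Icc 0 T, φ t = Φ t ∧ φt t = Φt t := by
  have hψ : Continuous fun t => ψ (clip T t) :=
    h.continuousOn_spinor.comp_continuous (continuous_clip T) (clip_mem hT.le)
  obtain ⟨R, hR⟩ := isCompact_Icc.exists_bound_of_continuousOn h.continuousOn_spinor
  have hb : (fun t => ψ (clip T t)) ∈ fieldBall R := ⟨hψ, fun t => hR _ (clip_mem hT.le t)⟩
  have hS := (continuous_density hD.norm_right).comp hψ
  have hd := kgData_of_source hk h₀ h₁ hS (norm_density_le_sq hD hb)
  obtain ⟨Φ, Φt, hw⟩ := exists_waveRep m hk0 hk h₀ h₁ hr hS (norm_density_le_sq hD hb)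
    (fun t => density_im hD _) hT.le
  have hi := hw.initial hT.le h₀ h₁
  have hsub : ∀ t f, toTemperedDistribution
      (ofRealCLM.compLp (φ t) - ofRealCLM.compLp (Φ t)) f =
      realDist (φ t) f - realDist (Φ t) f := fun t f => by
    rw [← Lp.toTemperedDistributionCLM_apply, map_sub]
    rfl
  have hZ := klein_gordon_unique (m := m) (T := T)
    (Z := fun t => ofRealCLM.compLp (φ t) - ofRealCLM.compLp (Φ t))
    (v := fun t f => φt t f - Φt t f)
    ((h.continuousOn_wave.continuousOn hk0).sub
      ((hw.sobolevContinuousOn hd hT.le).1.continuousOn hk0))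
    (by simp only [h.initial_wave, hi.1, sub_self])
    (fun f => by simp only [h.initial_wave_deriv, hi.2, sub_self])
    (fun f t ht => by
      simp only [hsub]
      exact (h.wave_deriv f t ht).sub (hw.hasDerivWithinAt hd f ht))
    (fun f t ht => by
      obtain ⟨d, hd1, hd2⟩ := h.klein_gordon f t ht
      refine (hd1.sub (hw.hasDerivWithinAt_deriv hd f ht)).congr_deriv ?_
      simp only [TemperedDistribution.derivCLM_apply_apply, map_neg, neg_neg,
        ← integral_mul_density] at hd2
      simp only [hsub, clip_of_mem ht, Function.comp_apply]
      linear_combination hd2)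
  have e1 : ∀ t ∈ Icc 0 T, φ t = Φ t := fun t ht => by
    have h2 := sub_eq_zero.1 (hZ t ht)
    apply Lp.ext
    filter_upwards [ofRealCLM.coeFn_compLp (φ t), ofRealCLM.coeFn_compLp (Φ t)]
      with x h3 h4
    rw [h2, h4] at h3
    exact (Complex.ofReal_injective h3).symm
  refine ⟨Φ, Φt, ⟨⟨hψ, hw.cont.const_smul (-g), fun f t ht => ?_⟩, hw, fun t => by
    rw [clip_of_mem (clip_mem hT.le t)]⟩, fun t ht => ⟨e1 t ht, ?_⟩⟩
  · obtain ⟨d, hd1, hd2⟩ := h.dirac f t ht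
    rw [TemperedDistribution.derivCLM_apply_apply, map_neg, dirac_iff hD, e1 t ht] at hd2
    rw [toTemperedDistribution_smulL1_smul, clip_of_mem ht, ← hd2]
    exact hd1.congr (fun s hs => by rw [clip_of_mem hs]) (by rw [clip_of_mem ht])
  · ext f
    exact (uniqueDiffOn_Icc hT t ht).eq_deriv _ (h.wave_deriv f t ht)
      ((hw.hasDerivWithinAt hd f ht).congr (fun s hs => by rw [e1 s hs]) (by rw [e1 t ht]))

theorem IsSolution.unique (h : IsSolution α β M m g k ε ψ₀ φ₀ φ₁ T ψ φ φt)
    (h' : IsSolution α β M m g k ε ψ₀ φ₀ φ₁ T ψ' φ' φt')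
    (hD : DiracPair (op α) (op β)) (hk0 : 0 ≤ k) (hk : k < 1 / 2) (hT : 0 < T)
    (h₀ : SobRep k (realDist φ₀) a₀) (h₁ : SobRep (k - 1) φ₁ a₁) (hr : IsReal φ₁) {t : ℝ}
    (ht : t ∈ Icc 0 T) : ψ t = ψ' t ∧ φ t = φ' t ∧ φt t = φt' t := by
  obtain ⟨Φ, Φt, hw, he⟩ := h.exists_weakDKG hD hk0 hk hT h₀ h₁ hr
  obtain ⟨Φ', Φt', hw', he'⟩ := h'.exists_weakDKG hD hk0 hk hT h₀ h₁ hr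
  have hu := hw.unique hw' hD hk0 hk hT.le h₀ h₁ hr (by
    simp only [clip_of_mem (left_mem_Icc.2 hT.le), h.initial_spinor, h'.initial_spinor])
  have h1 := congrFun hu.1 t
  simp only [clip_of_mem ht] at h1
  rw [(he t ht).1, (he t ht).2, (he' t ht).1, (he' t ht).2]
  exact ⟨h1, hu.2 t ht⟩

theorem MemBourgainOn.congr {F : Type*} [NormedAddCommGroup F] [InnerProductSpace ℂ F]
    [CompleteSpace F] {s b σ : ℝ} {f f' : ℝ → 𝓢'(ℝ, F)} (h : MemBourgainOn s b σ T f)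
    (hT : 0 ≤ T) (hf : ∀ t ∈ Icc 0 T, f' t = f t) : MemBourgainOn s b σ T f' := by
  obtain ⟨u, hu, hu'⟩ := h
  refine ⟨u, hu, fun g gs h1 h2 => (hu' g gs h1 h2).trans ?_⟩
  refine integral_congr fun t ht => ?_
  rw [uIcc_of_le hT] at ht
  simp only [hf t ht]

theorem IsSolution.congr (h : IsSolution α β M m g k ε ψ₀ φ₀ φ₁ T ψ φ φt) (hT : 0 ≤ T)
    (he : ∀ t ∈ Icc 0 T, ψ' t = ψ t ∧ φ' t = φ t ∧ φt' t = φt t) :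
    IsSolution α β M m g k ε ψ₀ φ₀ φ₁ T ψ' φ' φt' := by
  have h0 := he 0 (left_mem_Icc.2 hT)
  refine ⟨h.continuousOn_spinor.congr fun t ht => (he t ht).1,
    h.continuousOn_wave.congr fun t ht => by rw [(he t ht).2.1],
    h.continuousOn_wave_deriv.congr fun t ht => (he t ht).2.2.symm, h0.1.trans h.initial_spinor,
    h0.2.1.trans h.initial_wave, h0.2.2.trans h.initial_wave_deriv, fun f t ht => ?_,
    fun f t ht => ?_, fun f t ht => ?_, h.bourgain_spinor_pos.congr hT fun t ht => ?_,
    h.bourgain_spinor_neg.congr hT fun t ht => ?_, h.bourgain_wave_pos.congr hT fun t ht => ?_,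
    h.bourgain_wave_neg.congr hT fun t ht => ?_⟩
  · obtain ⟨d, hd, hd'⟩ := h.dirac f t ht
    rw [(he t ht).1, (he t ht).2.1]
    exact ⟨d, hd.congr (fun s hs => by rw [(he s hs).1]) (by rw [(he t ht).1]), hd'⟩
  · rw [(he t ht).2.2]
    exact (h.wave_deriv f t ht).congr (fun s hs => by rw [(he s hs).2.1]) (by rw [(he t ht).2.1])
  · obtain ⟨d, hd, hd'⟩ := h.klein_gordon f t ht
    rw [(he t ht).1, (he t ht).2.1]
    exact ⟨d, hd.congr (fun s hs => by rw [(he s hs).2.2]) (by rw [(he t ht).2.2]), hd'⟩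
  all_goals simp only [he t ht]

theorem exists_global_solution (hD : DiracPair (op α) (op β)) (hk0 : 0 ≤ k) (hk : k < 1 / 2)
    (M m g : ℝ) (ψ₀ : SpinorL2) (h₀ : SobRep k (realDist φ₀) a₀) (h₁ : SobRep (k - 1) φ₁ a₁)
    (hr : IsReal φ₁) (hε : 0 < ε) (hεk : ε < k / 2) :
    ∃ ψ φ φt, ∀ T, 0 < T → IsSolution α β M m g k ε ψ₀ φ₀ φ₁ T ψ φ φt := by
  have h1 := fun n : ℕ => DKG.exists_weakDKG hD M m g hk0 hk (T := n + 1) (by positivity) ψ₀ h₀ h₁ hr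
  choose Ψ Φ Φt hw hw0 using h1
  have h2 : ∀ (n : ℕ) (T : ℝ), 0 < T → T ≤ n + 1 →
      IsSolution α β M m g k ε ψ₀ φ₀ φ₁ T (Ψ n) (Φ n) (Φt n) := fun n T hT hTn => by
    have := ((hw n).restrict hT.le hTn).isSolution hD hk0 hk hT.le h₀ h₁ hr hε hεk
    simp only [clip_of_mem (left_mem_Icc.2 hT.le), hw0] at this
    exact this.congr hT.le fun t ht => ⟨by rw [clip_of_mem ht], rfl, rfl⟩
  refine ⟨fun t => Ψ ⌈t⌉₊ t, fun t => Φ ⌈t⌉₊ t, fun t => Φt ⌈t⌉₊ t, fun T hT => ?_⟩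
  have h3 : T ≤ ⌈T⌉₊ + 1 := (Nat.le_ceil T).trans (by linarith)
  refine (h2 ⌈T⌉₊ T hT h3).congr hT.le fun t ht => ?_
  have h4 : (⌈t⌉₊ : ℝ) + 1 ≤ ⌈T⌉₊ + 1 := by gcongr; exact ht.2
  exact (h2 ⌈t⌉₊ _ (by positivity) le_rfl).unique (h2 ⌈T⌉₊ _ (by positivity) h4) hD hk0 hk
    (by positivity) h₀ h₁ hr ⟨ht.1, (Nat.le_ceil t).trans (by linarith)⟩

end Solutions

end DKG

end

theorem theorem2 (k : ℝ) (hk0 : 0 < k) (hk : k < 1 / 2) :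
    ∃ ε₀ : ℝ, 0 < ε₀ ∧ ∀ ε : ℝ, 0 < ε → ε < ε₀ →
      ∀ α β : Matrix (Fin 2) (Fin 2) ℂ, α.IsHermitian → β.IsHermitian →
        α * α = 1 → β * β = 1 → α * β + β * α = 0 →
      ∀ (M m g : ℝ) (ψ₀ : DKG.SpinorL2) (φ₀ : DKG.RealL2) (φ₁ : 𝓢'(ℝ, ℂ)),
        MemSobolev k 2 (DKG.realDist φ₀) → MemSobolev (k - 1) 2 φ₁ → DKG.IsReal φ₁ →
      ∃ (ψ : ℝ → DKG.SpinorL2) (φ : ℝ → DKG.RealL2) (φt : ℝ → 𝓢'(ℝ, ℂ)),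
        ∀ T : ℝ, 0 < T →
          DKG.IsSolution α β M m g k ε ψ₀ φ₀ φ₁ T ψ φ φt ∧
          ∀ (ψ' : ℝ → DKG.SpinorL2) (φ' : ℝ → DKG.RealL2) (φt' : ℝ → 𝓢'(ℝ, ℂ)),
            DKG.IsSolution α β M m g k ε ψ₀ φ₀ φ₁ T ψ' φ' φt' →
            ∀ t ∈ Set.Icc 0 T, ψ' t = ψ t ∧ φ' t = φ t ∧ φt' t = φt t := by
  refine ⟨k / 2, by positivity, fun ε hε hεk α β hα hβ hαα hββ hαβ M m g ψ₀ φ₀ φ₁ h₀ h₁ hr => ?_⟩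
  have hD := DKG.diracPair_op hα hβ hαα hββ hαβ
  obtain ⟨a₀, ha₀⟩ := DKG.exists_sobRep_of_memSobolev h₀
  obtain ⟨a₁, ha₁⟩ := DKG.exists_sobRep_of_memSobolev h₁
  obtain ⟨ψ, φ, φt, hs⟩ :=
    DKG.exists_global_solution hD hk0.le hk M m g ψ₀ ha₀ ha₁ hr hε hεk
  exact ⟨ψ, φ, φt, fun T hT => ⟨hs T hT, fun ψ' φ' φt' h' t ht =>
    h'.unique (hs T hT) hD hk0.le hk hT ha₀ ha₁ hr ht⟩⟩
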